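/- Notation. Fix $z>0$. * $\mathfrak S=\varprojlim S_n$ is the set of sequences $\mathfrak u=(u_n)_n$, $u_n\in S_n$, such that $u_{n-1}$ is obtained from $u_n$ by removing $n$ from its decomposition into disjoint cycles. The group $S_\infty\times S_\infty$ ($S_\infty=\bigcup S_n$) acts on $\mathfrak S$ by $\mathfrak u\mapsto h_1^{-1}\mathfrak u h_2$, where $(h_1^{-1}\mathfrak u h_2)_N=h_1^{-1}u_Nh_2$ for large $N$. The measure $\mu^z$ on $\mathfrak S$ is the inverse limit of the Ewens measures $\mu^z_n(g)=z^{[g]}/\bigl(z(z+1)\cdots(z+n-1)\bigr)$ on $S_n$, where $[g]$ is the number of cycles of $g$. * $\mathfrak T^z$ is the space of (empty) restaurants, i.e. of unordered collections $\{\ell_\nu\}$ of positive numbers (lengths of tables) with $\sum\ell_\nu=1$, equipped with the Poisson–Dirichlet distribution: the law of $\{s_\nu/\sum_\kappa s_\kappa\}$, where $\{s_\nu\}$ is a Poisson point process on $\mathbb R_{>0}$ with intensity measure $z\,x^{-1}e^{-x}dx$. The map $\pi:\mathfrak S\to\mathfrak T^z$ (forgetting the guests) sends $\mathfrak u$ to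 the collection of the asymptotic frequencies $\lim_N\frac1N\#\{\text{cycle of }i\text{ in }u_N\}$, one for each class of $i\in\mathbb N$ lying on a common cycle. * A polymorphism $(M,\mu)\to(N,\nu)$ is a measure $\mathfrak p$ on $M\times N\times\mathbb R^\circ$, $\mathbb R^\circ=(\mathbb R_{>0},\cdot)$ with coordinate $t$, whose projection to $M$ is $\mu$ and such that the projection of $t\cdot\mathfrak p$ to $N$ is $\nu$. The spreaded image of a point $m\in M$ is the conditional measure of $\mathfrak p$ on $\{m\}\times N\times\mathbb R^\circ$; it is defined for $\mu$-almost all $m$. The product of polymorphisms spreads $m$ to points $(n,t)$ by the first one, then $n$ to points $(k,s)$ by the second one, and gives the points $(k,ts)$. A transformation $\varphi$ leaving $\mu$ quasiinvariant gives the image of $\mu$ under $m\mapsto(m,\varphi(m),\varphi'(m))$, where $\mu(\varphi(A))=\int_A\varphi'\,d\mu$. The adjoint $\mathfrak p^\star$ is the image of $t\cdot\mathfrak p$ under $(m,n,t)\mapsto(n,m,t^{-1})$. Let $\mathfrak x$ be the image of $\mu^z$ under $\mathfrak u\mapsto(\mathfrak u,\pi(\mathfrak u),1)$. * An element of $\mathcal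 S(0,0)$ is a finite collection of cycles $\{\bigcirc[k_j]\}_j$, $k_j\ge2$. It corresponds to the double coset, with respect to the diagonal subgroup of $S_\infty\times S_\infty$, of the pairs $(h_1,h_2)$ for which the lengths $\ge 2$ of the cycles of $h_1^{-1}h_2$ are $\{k_j\}$. The polymorphism $\Xi_{0,0}(\{\bigcirc[k_j]\}):\mathfrak T^z\to\mathfrak T^z$ is the product of, in this order, $\mathfrak x^\star$ (a random arrangement of guests), the transformation $\mathfrak u\mapsto h_1^{-1}\mathfrak uh_2$ and $\mathfrak x$, where $(h_1,h_2)$ is any representative of the double coset. * A checker surface is an oriented closed (possibly disconnected) surface glued from $n$ white and $n$ black triangles with sides of colors $a,b,c$ (clockwise on white triangles, anticlockwise on black ones), sides being glued in pairs white–black of the same color, considered up to isomorphism. $A$-, $B$-, $C$-vertices are the vertices opposite to sides of color $a$, $b$, $c$ respectively. The order $\mathrm{ord}(v)$ of a vertex is half of its valence. $\Gamma[\{k_j\}]$ is the set of checker surfaces with $n=\sum_jk_j$ whose $A$-vertices have orders $\{k_j\}$. For a checker surface $\Sigma$ with $B$-vertices $B_\beta$ and $C$-vertices $C_\gamma$,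 let $m_{\beta\gamma}$ be the number of edges connecting $B_\beta$ and $C_\gamma$. A framing of $\Sigma$ is an injective map $\omega$ from the set of $B$-vertices to the set of tables of $\{\ell_\nu\}$. $\mathrm{Aut}_B(\Sigma)$ is the group of automorphisms of $\Sigma$ fixing all $B$-vertices. * For $m_1,\dots,m_q\ge0$, not all zero, $\Theta_q[m_1,\dots,m_q;\ell]$ is the Dirichlet distribution on the simplex $x_i\ge 0$, $x_1+\dots+x_q=\ell$: coordinates with $m_i=0$ vanish, and if $m_1,\dots,m_p$ are the positive parameters, the density with respect to $dx_1\cdots dx_{p-1}$ is $$\frac{\Gamma(\sum_i m_i)\,\ell^{\,1-\sum_i m_i}}{\prod_{i\le p}\Gamma(m_i)}\prod_{i\le p}x_i^{m_i-1}$$ (for $p=1$ it is the delta-measure at $x_1=\ell$). * $\mathrm{Replace}[\{\ell_{\omega_j}\}\to\Lambda]\{\ell_\nu\}$ is the distribution of the collection obtained from $\{\ell_\nu\}$ by replacing the finite subcollection $\{\ell_{\omega_j}\}$ by a random finite collection with distribution $\Lambda$. $\iota_m[\{k_j\}]$ is the number of entries of $m$ in the list $\{k_j\}$. Theorem. Let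 $\{\bigcirc[k_j]\}_j\in\mathcal S(0,0)$. Then $\Xi_{0,0}(\{\bigcirc[k_j]\})$ is a polymorphism of $\mathfrak T^z$ to itself, and for almost every $\{\ell_\nu\}\in\mathfrak T^z$ the spreaded image of the point $\{\ell_\nu\}$ is the following measure on $\mathbb R^\circ\times\mathfrak T^z$: $$\prod_jk_j\prod_{m}\iota_m[\{k_j\}]!\;\sum_{(\Sigma,\omega)}\frac1{\#\mathrm{Aut}_B(\Sigma)}\prod_{B_\beta}\frac{\ell_{\omega(B_\beta)}^{\mathrm{ord}(B_\beta)}}{(\mathrm{ord}(B_\beta)-1)!}\;\Bigl(\delta_{z^{\#\{C_\gamma\}-\#\{B_\beta\}}}\times\mathrm{Replace}\Bigl[\{\ell_{\omega(B_\beta)}\}_\beta\to\mathop{\ast}_\beta\Theta_{\#\{C_\gamma\}}\bigl[\{m_{\beta\gamma}\}_\gamma;\ell_{\omega(B_\beta)}\bigr]\Bigr]\{\ell_\nu\}\Bigr),$$ where the sum is over all isomorphism classes of pairs consisting of $\Sigma\in\Gamma[\{k_j\}]$ and a framing $\omega$ of $\Sigma$ by tables of $\{\ell_\nu\}$, and $\ast_\beta$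 denotes the convolution of measures on $\mathbb R^{\#\{C_\gamma\}}$. -/

import Mathlib

open MeasureTheory ProbabilityTheory

namespace Restaurants

noncomputable section

/-! ### Virtual permutations

Guests are numbered `0, 1, 2, …`. An element of `S_n` is a permutation of `ℕ` fixing all `i ≥ n`. -/

/-- The removal of the point `n` from the decomposition of `σ` into disjoint cycles: if `σ n = α` and
`σ β = n`, the new permutation sends `β` to `α` and fixes `n`. -/
def removePoint (n : ℕ) (σ : Equiv.Perm ℕ) : Equiv.Perm ℕ :=
  Equiv.swap n (σ n) * σ

/-- The inverse limit of the sets `S_n` along the maps removing the last point. -/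
@[ext] structure VirtualPerm where
  seq : ℕ → Equiv.Perm ℕ
  fix : ∀ n i, n ≤ i → seq n i = i
  compat : ∀ n, removePoint n (seq (n + 1)) = seq n

/-- The σ-algebra generated by the (finitely many valued) maps to the finite sets `S_n`. -/
instance : MeasurableSpace VirtualPerm :=
  MeasurableSpace.comap (fun u n i => u.seq n i : VirtualPerm → ℕ → ℕ → ℕ) inferInstance

theorem measurable_seq_apply (n i : ℕ) : Measurable fun u : VirtualPerm => u.seq n i := by
  have h1 : Measurable (fun u n i => u.seq n i : VirtualPerm → ℕ → ℕ → ℕ) := comap_measurable _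
  have h2 : Measurable fun f : ℕ → ℕ → ℕ => f n i :=
    (measurable_pi_apply i).comp (measurable_pi_apply n)
  exact h2.comp h1

theorem perm_apply_inv (σ : Equiv.Perm ℕ) (n : ℕ) : σ (σ⁻¹ n) = n := σ.apply_symm_apply n

theorem removePoint_apply_of_ne {n : ℕ} {σ : Equiv.Perm ℕ} {i : ℕ} (hi : i ≠ n) :
    removePoint n σ i = if σ i = n then σ n else σ i := by
  unfold removePoint
  rw [Equiv.Perm.mul_apply, Equiv.swap_apply_def]
  have : σ i ≠ σ n := fun h => hi (σ.injective h)
  simp [this]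

theorem removePoint_self (n : ℕ) (σ : Equiv.Perm ℕ) : removePoint n σ n = n := by
  simp [removePoint]

theorem removePoint_fix {n : ℕ} {σ : Equiv.Perm ℕ} (h : ∀ i, n + 1 ≤ i → σ i = i) :
    ∀ i, n ≤ i → removePoint n σ i = i := by
  intro i hi
  rcases eq_or_lt_of_le hi with rfl | hi'
  · exact removePoint_self _ _
  · rw [removePoint_apply_of_ne (by omega), h i hi']
    simp [show i ≠ n by omega]

theorem standardBorelSpace_of_equiv {α β : Type*} [MeasurableSpace α] [MeasurableSpace β]
    [StandardBorelSpace β] (e : α ≃ᵐ β) : StandardBorelSpace α := by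
  let _ := upgradeStandardBorel β
  let _ : TopologicalSpace α := TopologicalSpace.induced e inferInstance
  have hp : PolishSpace α :=
    (e.toEquiv.toHomeomorphOfIsInducing ⟨rfl⟩).isClosedEmbedding.polishSpace
  have hb : BorelSpace α := by
    refine ⟨?_⟩
    rw [← e.measurableEmbedding.comap_eq, borel_comap]
    exact congrArg _ BorelSpace.measurable_eq
  infer_instance

/-- The space of virtual permutations is a standard Borel space. -/
instance : StandardBorelSpace VirtualPerm := by
  let F : VirtualPerm → ℕ → ℕ → ℕ := fun u n i => u.seq n i
  let S : Set (ℕ → ℕ → ℕ) :=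
    {f | (∀ n i, n ≤ i → f n i = i) ∧ (∀ n i j, i ≠ j → f n i ≠ f n j) ∧
      ∀ n i, f n i = if i = n then n else if f (n + 1) i = n then f (n + 1) n else f (n + 1) i}
  have hF : Function.Injective F := by
    intro u v h
    ext n i
    exact congrFun (congrFun h n) i
  have hev : ∀ n i, Measurable (fun f : ℕ → ℕ → ℕ => f n i) := fun n i =>
    (measurable_pi_apply i).comp (measurable_pi_apply n)
  have hS : MeasurableSet S := by
    have h1 : MeasurableSet {f : ℕ → ℕ → ℕ | ∀ n i, n ≤ i → f n i = i} := by
      simp only [Set.ofPred_forall]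
      exact .iInter fun n => .iInter fun i => .iInter fun _ =>
        measurableSet_eq_fun (hev n i) measurable_const
    have h2 : MeasurableSet {f : ℕ → ℕ → ℕ | ∀ n i j, i ≠ j → f n i ≠ f n j} := by
      simp only [Set.ofPred_forall]
      exact .iInter fun n => .iInter fun i => .iInter fun j => .iInter fun _ =>
        (measurableSet_eq_fun (hev n i) (hev n j)).compl
    have h3 : MeasurableSet {f : ℕ → ℕ → ℕ | ∀ n i, f n i =
        if i = n then n else if f (n + 1) i = n then f (n + 1) n else f (n + 1) i} := by
      simp only [Set.ofPred_forall]
      refine .iInter fun n => .iInter fun i => measurableSet_eq_fun (hev n i) ?_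
      refine Measurable.ite (by simp) measurable_const ?_
      exact Measurable.ite (measurableSet_eq_fun (hev _ _) measurable_const) (hev _ _) (hev _ _)
    exact h1.inter (h2.inter h3)
  have hrange : Set.range F = S := by
    ext f
    constructor
    · rintro ⟨u, rfl⟩
      refine ⟨u.fix, fun n i j hij h => hij ((u.seq n).injective h), fun n i => ?_⟩
      change u.seq n i = _
      rw [← u.compat n]
      split_ifs with h1 h2
      · rw [h1, removePoint_self]
      · rw [removePoint_apply_of_ne h1, if_pos h2]
      · rw [removePoint_apply_of_ne h1, if_neg h2]
    · rintro ⟨h1, h2, h3⟩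
      have hinj : ∀ n, Function.Injective (f n) := fun n i j h => by
        by_contra hij
        exact h2 n i j hij h
      have hbij : ∀ n, Function.Bijective (f n) := by
        intro n
        refine ⟨hinj n, fun j => ?_⟩
        by_cases hj : n ≤ j
        · exact ⟨j, h1 n j hj⟩
        · have hlt : ∀ i, i < n → f n i < n := by
            intro i hi
            by_contra hc
            have := hinj n (h1 n (f n i) (by omega))
            omega
          let e : Fin n → Fin n := fun i => ⟨f n i, hlt i i.2⟩
          have he : Function.Injective e := fun a b hab => by
            apply Fin.ext
            apply hinj n
            simpa [e] using hab
          obtain ⟨i, hi⟩ := (Finite.injective_iff_surjective.1 he) ⟨j, by omega⟩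
          exact ⟨i, by simpa [e] using hi⟩
      refine ⟨⟨fun n => Equiv.ofBijective (f n) (hbij n), h1, fun n => ?_⟩, rfl⟩
      ext i
      change removePoint n (Equiv.ofBijective (f (n + 1)) (hbij (n + 1))) i = f n i
      rw [h3 n i]
      by_cases hi : i = n
      · rw [hi, removePoint_self, if_pos rfl]
      · rw [removePoint_apply_of_ne hi, if_neg hi]
        rfl
  have hemb : MeasurableEmbedding F := by
    refine ⟨hF, comap_measurable _, ?_⟩
    rintro _ ⟨t, ht, rfl⟩
    rw [Set.image_preimage_eq_inter_range, hrange]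
    exact ht.inter hS
  have : StandardBorelSpace S := hS.standardBorel
  have : StandardBorelSpace (Set.range F) := by rw [hrange]; infer_instance
  exact standardBorelSpace_of_equiv hemb.equivRange

instance : Nonempty VirtualPerm :=
  ⟨⟨fun _ => 1, fun _ _ _ => rfl, fun n => by
    rw [removePoint, Equiv.Perm.one_apply, Equiv.swap_self, mul_one]; rfl⟩⟩

/-- The multiplicative group of positive reals. -/
abbrev PosReal := {t : ℝ // 0 < t}

instance : StandardBorelSpace PosReal :=
  MeasurableSet.standardBorel (measurableSet_Ioi : MeasurableSet (Set.Ioi (0 : ℝ)))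

/-! ### The measure on virtual permutations -/

/-- The guest `n` starts a new cycle with probability `z / (z + n)`, and is put right after the guest
`j < n` with probability `1 / (z + n)`. -/
def seatWeight (z : PosReal) (n : ℕ) (j : Fin (n + 1)) : ℝ :=
  (if j = Fin.last n then (z : ℝ) else 1) / (z + n)

def seatLaw (z : PosReal) (n : ℕ) : Measure (Fin (n + 1)) :=
  ∑ j, ENNReal.ofReal (seatWeight z n j) • Measure.dirac j

theorem seatWeight_nonneg (z : PosReal) (n : ℕ) (j : Fin (n + 1)) : 0 ≤ seatWeight z n j := by
  have := z.2
  unfold seatWeight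
  split_ifs <;> positivity

instance (z : PosReal) (n : ℕ) : IsProbabilityMeasure (seatLaw z n) := by
  refine ⟨?_⟩
  have hz := z.2
  simp only [seatLaw, Measure.coe_finsetSum, Finset.sum_apply, Measure.smul_apply, measure_univ,
    smul_eq_mul, mul_one]
  rw [← ENNReal.ofReal_sum_of_nonneg fun j _ => seatWeight_nonneg z n j]
  have : ∑ j, seatWeight z n j = 1 := by
    rw [Fin.sum_univ_castSucc]
    have h : ∀ j : Fin n, (Fin.castSucc j = Fin.last n) ↔ False := fun j => by
      simp [(Fin.castSucc_lt_last j).ne]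
    simp only [seatWeight, h, if_false, if_true, Finset.sum_const, Finset.card_univ,
      Fintype.card_fin, nsmul_eq_mul]
    have : (z : ℝ) + n ≠ 0 := by positivity
    field_simp
    ring
  rw [this, ENNReal.ofReal_one]

theorem seatLaw_singleton (z : PosReal) (n : ℕ) (j : Fin (n + 1)) :
    seatLaw z n {j} = ENNReal.ofReal (seatWeight z n j) := by
  simp only [seatLaw, Measure.coe_finsetSum, Finset.sum_apply, Measure.smul_apply, smul_eq_mul]
  rw [Finset.sum_eq_single j]
  · simp
  · intro b _ hb
    simp [hb]
  · simp

/-- The permutations obtained by seating the guests one after another. -/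
def seatingSeq (c : (n : ℕ) → Fin (n + 1)) : ℕ → Equiv.Perm ℕ
  | 0 => 1
  | n + 1 => seatingSeq c n * Equiv.swap n (c n)

theorem seatingSeq_fix (c : (n : ℕ) → Fin (n + 1)) : ∀ n i, n ≤ i → seatingSeq c n i = i := by
  intro n
  induction n with
  | zero => intro i _; rfl
  | succ n ih =>
    intro i hi
    have h1 : i ≠ n := by omega
    have h2 : i ≠ (c n : ℕ) := by have := (c n).2; omega
    rw [seatingSeq, Equiv.Perm.mul_apply, Equiv.swap_apply_of_ne_of_ne h1 h2, ih i (by omega)]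

def seating (c : (n : ℕ) → Fin (n + 1)) : VirtualPerm where
  seq := seatingSeq c
  fix := seatingSeq_fix c
  compat n := by
    unfold removePoint
    rw [seatingSeq, Equiv.Perm.mul_apply, Equiv.swap_apply_left, ← mul_assoc]
    nth_rewrite 1 [← seatingSeq_fix c n n le_rfl]
    rw [← Equiv.mul_swap_eq_swap_mul, mul_assoc, Equiv.swap_mul_self, mul_one]

/-- The measure on virtual permutations: the guests are seated independently. By
`virtualMeasure_cylinder` its images in the groups `S_n` are the Ewens distributions, so this is the
inverse limit of the Ewens distributions. -/
def virtualMeasure (z : PosReal) : Measure VirtualPerm :=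
  (Measure.infinitePi (seatLaw z)).map seating

theorem measurable_seating : Measurable seating := by
  rw [measurable_comap_iff]
  refine measurable_pi_lambda _ fun n => measurable_pi_lambda _ fun i => ?_
  change Measurable fun c => seatingSeq c n i
  induction n generalizing i with
  | zero => exact measurable_const
  | succ n ih =>
    have hg : Measurable fun p : Fin (n + 1) × (ℕ → ℕ) => p.2 (Equiv.swap n (p.1 : ℕ) i) :=
      measurable_from_prod_countable_right fun j =>
        measurable_pi_apply (X := fun _ : ℕ => ℕ) (Equiv.swap n (j : ℕ) i)
    have hp : Measurable fun c : (n : ℕ) → Fin (n + 1) =>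
        ((c n, fun i => seatingSeq c n i) : Fin (n + 1) × (ℕ → ℕ)) :=
      (measurable_pi_apply n).prodMk (measurable_pi_lambda _ ih)
    exact hg.comp hp

instance (z : PosReal) : IsProbabilityMeasure (virtualMeasure z) :=
  Measure.isProbabilityMeasure_map measurable_seating.aemeasurable

open Classical in
/-- The number of disjoint cycles of `σ ∈ S_n` (fixed points included); each cycle is counted at its
least element. -/
def cycleCount (n : ℕ) (σ : Equiv.Perm ℕ) : ℕ :=
  ((Finset.range n).filter fun i => ∀ j < i, ¬ σ.SameCycle i j).card

theorem sameCycle_removePoint {n : ℕ} {σ : Equiv.Perm ℕ} {i j : ℕ} (hi : i ≠ n) (hj : j ≠ n) :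
    (removePoint n σ).SameCycle i j ↔ σ.SameCycle i j := by
  have step : ∀ x, σ.SameCycle x (removePoint n σ x) ∨ x = n := by
    intro x
    by_cases hx : x = n
    · exact Or.inr hx
    · left
      rw [removePoint_apply_of_ne hx]
      split_ifs with h
      · refine ⟨2, ?_⟩
        rw [show (2 : ℤ) = 1 + 1 from rfl, zpow_add, zpow_one, Equiv.Perm.mul_apply, h]
      · exact ⟨1, by simp⟩
  have ne : ∀ (k : ℕ) x, x ≠ n → (removePoint n σ ^ k) x ≠ n := by
    intro k x hx h
    apply hx
    have h' : (removePoint n σ ^ k) n = n := by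
      rw [← Equiv.Perm.smul_def]
      induction k with
      | zero => simp
      | succ k ih =>
        have : removePoint n σ n = n := removePoint_self n σ
        exact Function.IsFixedPt.perm_pow this (k + 1)
    exact (removePoint n σ ^ k).injective (h.trans h'.symm)
  have fwd : ∀ (k : ℕ) x, x ≠ n → σ.SameCycle x ((removePoint n σ ^ k) x) := by
    intro k x hx
    induction k with
    | zero => exact Equiv.Perm.SameCycle.refl _ _
    | succ k ih =>
      rw [pow_succ', Equiv.Perm.mul_apply]
      exact ih.trans ((step _).resolve_right (ne k x hx))
  have bwd : ∀ (k : ℕ) x, x ≠ n → (σ ^ k) x ≠ n → (removePoint n σ).SameCycle x ((σ ^ k) x) := by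
    intro k
    induction k using Nat.strong_induction_on with
    | _ k ih =>
      intro x hx hk
      match k with
      | 0 => exact Equiv.Perm.SameCycle.refl _ _
      | k + 1 =>
        rw [pow_succ', Equiv.Perm.mul_apply] at hk ⊢
        by_cases hy : (σ ^ k) x = n
        · match k with
          | 0 => exact absurd hy hx
          | k + 1 =>
            rw [pow_succ', Equiv.Perm.mul_apply] at hy
            have hy' : (σ ^ k) x ≠ n := by
              intro h
              apply hk
              rw [pow_succ', Equiv.Perm.mul_apply, hy]
              rw [h] at hy
              exact hy
            refine (ih k (by omega) x hx hy').trans ⟨1, ?_⟩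
            rw [zpow_one, removePoint_apply_of_ne hy', if_pos hy, pow_succ',
              Equiv.Perm.mul_apply, hy]
        · refine (ih k (by omega) x hx hy).trans ⟨1, ?_⟩
          rw [zpow_one, removePoint_apply_of_ne hy, if_neg hk]
  constructor
  · rintro ⟨k, rfl⟩
    obtain ⟨m, rfl | rfl⟩ := k.eq_nat_or_neg
    · exact fwd m i hi
    · have h := fwd m _ hj
      rw [← zpow_natCast, ← Equiv.Perm.mul_apply, ← zpow_add] at h
      simpa using h.symm
  · rintro ⟨k, rfl⟩
    obtain ⟨m, rfl | rfl⟩ := k.eq_nat_or_neg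
    · exact bwd m i hi hj
    · have h := bwd m _ hj
      rw [← zpow_natCast, ← Equiv.Perm.mul_apply, ← zpow_add] at h
      simpa using (h (by simpa using hi)).symm

theorem cycleCount_succ {n : ℕ} {σ : Equiv.Perm ℕ} (h : ∀ i, n + 1 ≤ i → σ i = i) :
    cycleCount (n + 1) σ = cycleCount n (removePoint n σ) + if σ n = n then 1 else 0 := by
  classical
  have h1 : ((Finset.range n).filter fun i => ∀ j < i, ¬ σ.SameCycle i j)
      = (Finset.range n).filter fun i => ∀ j < i, ¬ (removePoint n σ).SameCycle i j := by
    refine Finset.filter_congr fun i hi => ?_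
    have hi' := Finset.mem_range.1 hi
    refine forall_congr' fun j => forall_congr' fun hj => not_congr ?_
    exact (sameCycle_removePoint (by omega) (by omega)).symm
  have h2 : (∀ j < n, ¬ σ.SameCycle n j) ↔ σ n = n := by
    constructor
    · intro hc
      by_contra hn
      refine hc (σ n) ?_ ⟨1, by simp⟩
      by_contra hlt
      have := σ.injective (h (σ n) (by omega))
      exact hn this
    · rintro hn j hj ⟨k, hk⟩
      have : (σ ^ k) n = n := Function.IsFixedPt.perm_zpow hn k
      omega
  unfold cycleCount
  rw [Finset.range_add_one, Finset.filter_insert]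
  by_cases hn : σ n = n
  · rw [if_pos (by convert h2.2 hn), if_pos hn, Finset.card_insert_of_notMem (by simp)]
    congr 1
    convert congrArg Finset.card h1
  · rw [if_neg (by convert fun hc => hn (h2.1 hc)), if_neg hn, add_zero]
    convert congrArg Finset.card h1

theorem exists_seating_code (z : PosReal) (n : ℕ) : ∀ σ : Equiv.Perm ℕ, (∀ i, n ≤ i → σ i = i) →
    ∃ d : (i : ℕ) → Fin (i + 1), (∀ c, seatingSeq c n = σ ↔ ∀ i < n, c i = d i) ∧
      ∏ i ∈ Finset.range n, seatWeight z i (d i)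
        = (z : ℝ) ^ cycleCount n σ / ∏ i ∈ Finset.range n, ((z : ℝ) + i) := by
  induction n with
  | zero =>
    intro σ h
    have : σ = 1 := by ext i; simp [h i (Nat.zero_le i)]
    exact ⟨fun i => 0, by simp [this, seatingSeq], by simp [cycleCount]⟩
  | succ n ih =>
    intro σ h
    obtain ⟨d, hd, hw⟩ := ih (removePoint n σ) (removePoint_fix h)
    have hlt : σ⁻¹ n < n + 1 := by
      by_contra hc
      have h1 := h (σ⁻¹ n) (by omega)
      rw [perm_apply_inv] at h1
      omega
    refine ⟨Function.update d n ⟨σ⁻¹ n, hlt⟩, fun c => ?_, ?_⟩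
    · have key : seatingSeq c (n + 1) = σ ↔ seatingSeq c n = removePoint n σ ∧
          c n = ⟨σ⁻¹ n, hlt⟩ := by
        constructor
        · intro hc
          refine ⟨by rw [← hc]; exact ((seating c).compat n).symm, Fin.ext ?_⟩
          change (c n : ℕ) = σ⁻¹ n
          rw [Equiv.Perm.eq_inv_iff_eq, ← hc, seatingSeq, Equiv.Perm.mul_apply,
            Equiv.swap_apply_right, seatingSeq_fix c n n le_rfl]
        · rintro ⟨h1, h2⟩
          rw [seatingSeq, h1, h2, removePoint, mul_assoc, Equiv.mul_swap_eq_swap_mul,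
            perm_apply_inv, ← mul_assoc, Equiv.swap_comm (σ n) n, Equiv.swap_mul_self,
            one_mul]
      rw [key, hd]
      constructor
      · rintro ⟨h1, h2⟩ i hi
        rcases Nat.lt_succ_iff_lt_or_eq.1 hi with hi | rfl
        · rw [Function.update_of_ne hi.ne, h1 i hi]
        · rw [Function.update_self, h2]
      · intro hc
        refine ⟨fun i hi => ?_, ?_⟩
        · rw [hc i (by omega), Function.update_of_ne hi.ne]
        · rw [hc n (by omega), Function.update_self]
    · rw [Finset.prod_range_succ, Finset.prod_range_succ, Function.update_self,
        cycleCount_succ h]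
      have : ∏ i ∈ Finset.range n, seatWeight z i (Function.update d n ⟨σ⁻¹ n, hlt⟩ i)
          = ∏ i ∈ Finset.range n, seatWeight z i (d i) :=
        Finset.prod_congr rfl fun i hi => by
          rw [Function.update_of_ne (Finset.mem_range.1 hi).ne]
      rw [this, hw, seatWeight, pow_add]
      have hiff : ((⟨σ⁻¹ n, hlt⟩ : Fin (n + 1)) = Fin.last n) ↔ σ n = n := by
        rw [Fin.ext_iff, Fin.val_last]
        change σ⁻¹ n = n ↔ _
        rw [Equiv.Perm.inv_eq_iff_eq, eq_comm]
      by_cases hn : σ n = n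
      · rw [if_pos (hiff.2 hn), if_pos hn, pow_one, div_mul_div_comm]
      · rw [if_neg (fun hc => hn (hiff.1 hc)), if_neg hn, pow_zero, div_mul_div_comm]

/-- The image of `virtualMeasure z` in `S_n` is the Ewens distribution. -/
theorem virtualMeasure_cylinder (z : PosReal) (n : ℕ) (σ : Equiv.Perm ℕ)
    (h : ∀ i, n ≤ i → σ i = i) :
    virtualMeasure z {u | u.seq n = σ}
      = ENNReal.ofReal ((z : ℝ) ^ cycleCount n σ / ∏ i ∈ Finset.range n, ((z : ℝ) + i)) := by
  obtain ⟨d, hd, hw⟩ := exists_seating_code z n σ h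
  have hm : MeasurableSet {u : VirtualPerm | u.seq n = σ} := by
    have : {u : VirtualPerm | u.seq n = σ}
        = ⋂ i, {u : VirtualPerm | u.seq n i = σ i} := by
      ext u
      simp [Equiv.ext_iff]
    rw [this]
    refine .iInter fun i => ?_
    exact measurableSet_eq_fun (measurable_seq_apply n i) measurable_const
  rw [virtualMeasure, Measure.map_apply measurable_seating hm, ← hw]
  have hs : seating ⁻¹' {u | u.seq n = σ}
      = Set.pi (Finset.range n : Finset ℕ) (fun i => ({d i} : Set (Fin (i + 1)))) := by
    ext c
    have : seating c ∈ {u : VirtualPerm | u.seq n = σ} ↔ seatingSeq c n = σ := Iff.rfl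
    rw [Set.mem_preimage, this, hd c]
    simp [Set.mem_pi]
  rw [hs, Measure.infinitePi_pi _ (fun i _ => measurableSet_singleton _),
    ENNReal.ofReal_prod_of_nonneg fun i _ => seatWeight_nonneg z i (d i)]
  exact Finset.prod_congr rfl fun i _ => seatLaw_singleton z i (d i)

/-! ### The action of `S_∞ × S_∞` on virtual permutations -/

/-- The embedding of the symmetric group of `{0, …, n - 1}` into the group of permutations of `ℕ`. -/
def extendPerm {n : ℕ} (h : Equiv.Perm (Fin n)) : Equiv.Perm ℕ :=
  h.viaFintypeEmbedding Fin.valEmbedding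

theorem extendPerm_fix {n : ℕ} (h : Equiv.Perm (Fin n)) (i : ℕ) (hi : n ≤ i) :
    extendPerm h i = i := by
  unfold extendPerm
  refine Equiv.Perm.viaFintypeEmbedding_apply_notMem_range _ _ ?_
  rintro ⟨j, hj⟩
  have := j.2
  simp only [Fin.valEmbedding_apply] at hj
  omega

theorem extendPerm_inv_fix {n : ℕ} (h : Equiv.Perm (Fin n)) (i : ℕ) (hi : n ≤ i) :
    (extendPerm h)⁻¹ i = i :=
  Equiv.Perm.inv_eq_iff_eq.2 (extendPerm_fix h i hi).symm

/-- The projection `S_{N + k} → S_N`. -/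
def removeFrom (N : ℕ) : ℕ → Equiv.Perm ℕ → Equiv.Perm ℕ
  | 0, σ => σ
  | k + 1, σ => removeFrom N k (removePoint (N + k) σ)

theorem removeFrom_fix (N : ℕ) : ∀ k σ, (∀ i, N + k ≤ i → σ i = i) →
    ∀ i, N ≤ i → removeFrom N k σ i = i := by
  intro k
  induction k with
  | zero => intro σ h; exact h
  | succ k ih => intro σ h; exact ih _ (removePoint_fix h)

theorem removePoint_removeFrom (N : ℕ) : ∀ k σ,
    removePoint N (removeFrom (N + 1) k σ) = removeFrom N (k + 1) σ := by
  intro k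
  induction k with
  | zero => intro σ; rfl
  | succ k ih =>
    intro σ
    rw [removeFrom, ih, removeFrom, removeFrom, removeFrom,
      show N + 1 + k = N + (k + 1) by omega]

theorem removePoint_mul {M : ℕ} {g h : Equiv.Perm ℕ} (hg : g M = M) (hh : h M = M)
    (σ : Equiv.Perm ℕ) : removePoint M (g * σ * h) = g * removePoint M σ * h := by
  unfold removePoint
  rw [Equiv.Perm.mul_apply, Equiv.Perm.mul_apply, hh]
  nth_rewrite 1 [← hg]
  rw [← mul_assoc, ← mul_assoc, ← Equiv.mul_swap_eq_swap_mul, ← mul_assoc]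

/-- The virtual permutation `h₁⁻¹ u h₂`. Its component in `S_N` is `h₁⁻¹ u_N h₂` for `N ≥ n`
(see `act_seq`), and the projection of `h₁⁻¹ u_{N + n} h₂` in general. -/
def act {n : ℕ} (h₁ h₂ : Equiv.Perm (Fin n)) (u : VirtualPerm) : VirtualPerm where
  seq N := removeFrom N n ((extendPerm h₁)⁻¹ * u.seq (N + n) * extendPerm h₂)
  fix N := by
    refine removeFrom_fix N n _ fun i hi => ?_
    rw [Equiv.Perm.mul_apply, Equiv.Perm.mul_apply, extendPerm_fix _ _ (by omega), u.fix _ _ hi,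
      extendPerm_inv_fix _ _ (by omega)]
  compat N := by
    rw [removePoint_removeFrom, removeFrom,
      removePoint_mul (extendPerm_inv_fix _ _ (by omega)) (extendPerm_fix _ _ (by omega)),
      show N + 1 + n = N + n + 1 by omega, u.compat]

theorem act_seq {n : ℕ} (h₁ h₂ : Equiv.Perm (Fin n)) (u : VirtualPerm) {N : ℕ} (hN : n ≤ N) :
    (act h₁ h₂ u).seq N = (extendPerm h₁)⁻¹ * u.seq N * extendPerm h₂ := by
  have key : ∀ k, removeFrom N k ((extendPerm h₁)⁻¹ * u.seq (N + k) * extendPerm h₂)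
      = (extendPerm h₁)⁻¹ * u.seq N * extendPerm h₂ := by
    intro k
    induction k with
    | zero => rfl
    | succ k ih =>
      rw [removeFrom,
        removePoint_mul (extendPerm_inv_fix _ _ (by omega)) (extendPerm_fix _ _ (by omega)),
        ← add_assoc, u.compat, ih]
  exact key n

/-- The chip in `𝒮(0,0)` of the pair `(h₁, h₂)`: the multiset of the lengths `≥ 2` of the cycles of
`h₁⁻¹ h₂`. Two pairs lie in the same double coset of the diagonal subgroup if and only if they have
the same chip. -/
def chip {n : ℕ} (h₁ h₂ : Equiv.Perm (Fin n)) : Multiset ℕ :=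
  (h₁⁻¹ * h₂).cycleType

/-! ### Restaurants -/

/-- A restaurant is an unordered collection of table lengths; it is recorded by listing the lengths in
decreasing order (absent tables have length `0`). -/
abbrev Restaurant := ℕ → ℝ

/-- The decreasing rearrangement of a family of nonnegative numbers. -/
def rank {ι : Type*} (a : ι → ℝ) : Restaurant :=
  fun k => sInf {t : ℝ | 0 ≤ t ∧ {i | t < a i}.encard ≤ k}

/-- The length of the table of the guest `i`: the asymptotic frequency of the cycle of `i`. -/
def tableLength (u : VirtualPerm) (i : ℕ) : ℝ :=
  Filter.limsup (fun N : ℕ => ({j | (u.seq N).SameCycle i j}.ncard : ℝ) / N) Filter.atTop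

open Classical in
/-- The restaurant of a virtual permutation (all guests are forgotten). Each table is counted at its
guest with the least number. -/
def tableLengths (u : VirtualPerm) : Restaurant :=
  rank fun i : ℕ => if ∀ j < i, ¬ (u.seq (i + 1)).SameCycle i j then tableLength u i else 0

/-! ### The Poisson–Dirichlet distribution -/

/-- The measure `z x⁻¹ e⁻ˣ dx` on `x > 0`. -/
def intensity (z : PosReal) : Measure ℝ :=
  (volume.restrict (Set.Ioi 0)).withDensity
    fun x => ENNReal.ofReal ((z : ℝ) * x⁻¹ * Real.exp (-x))

/-- A partition of the half-line `x > 0` into `(1, ∞)` and `(1/(k+1), 1/k]` for `k ≥ 1`. -/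
def block (k : ℕ) : Set ℝ :=
  if k = 0 then Set.Ioi 1 else Set.Ioc (1 / ((k : ℝ) + 1)) (1 / (k : ℝ))

/-- The Poisson point process on a block: a Poisson number of points and a sequence of independent
points with the normalized distribution; only the first points of the sequence are used. -/
def blockLaw (z : PosReal) (k : ℕ) : Measure (ℕ × (ℕ → ℝ)) :=
  (poissonMeasure (intensity z (block k)).toNNReal).prod
    (Measure.infinitePi fun _ : ℕ => cond (intensity z) (block k))

/-- The Poisson point process on the half-line `x > 0` with intensity measure `intensity z`, as the
superposition of independent Poisson point processes on the blocks. -/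
def poissonProcess (z : PosReal) : Measure (ℕ → ℕ × (ℕ → ℝ)) :=
  Measure.infinitePi (blockLaw z)

/-- The points of the configuration (and zeros, which stand for no point). -/
def configPoints (w : ℕ → ℕ × (ℕ → ℝ)) (p : ℕ × ℕ) : ℝ :=
  if p.2 < (w p.1).1 then (w p.1).2 p.2 else 0

/-- The Poisson–Dirichlet distribution on restaurants. -/
def poissonDirichlet (z : PosReal) : Measure Restaurant :=
  (poissonProcess z).map fun w =>
    rank fun p => configPoints w p / ∑' q, configPoints w q

theorem measurableSet_block (k : ℕ) : MeasurableSet (block k) := by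
  unfold block
  split_ifs
  · exact measurableSet_Ioi
  · exact measurableSet_Ioc

theorem block_subset (k : ℕ) : ∃ a : ℝ, 0 < a ∧ block k ⊆ Set.Ioi a := by
  unfold block
  split_ifs
  · exact ⟨1, one_pos, le_rfl⟩
  · exact ⟨1 / ((k : ℝ) + 1), by positivity, Set.Ioc_subset_Ioi_self⟩

theorem intensity_block_ne_top (z : PosReal) (k : ℕ) : intensity z (block k) ≠ ⊤ := by
  obtain ⟨a, ha, hsub⟩ := block_subset k
  have hz := z.2
  refine ne_top_of_le_ne_top ?_ (measure_mono hsub)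
  rw [intensity, withDensity_apply _ measurableSet_Ioi, Measure.restrict_restrict measurableSet_Ioi]
  have h1 : ∫⁻ x in Set.Ioi a ∩ Set.Ioi 0, ENNReal.ofReal ((z : ℝ) * x⁻¹ * Real.exp (-x))
      ≤ ∫⁻ x in Set.Ioi a, ENNReal.ofReal ((z : ℝ) * a⁻¹ * Real.exp (-x)) := by
    rw [Set.inter_eq_left.2 (Set.Ioi_subset_Ioi ha.le)]
    refine setLIntegral_mono' measurableSet_Ioi fun x hx => ENNReal.ofReal_le_ofReal ?_
    have hx' : a < x := hx
    gcongr
  refine ne_top_of_le_ne_top ?_ h1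
  have h2 := ((integrableOn_exp_neg_Ioi a).const_mul ((z : ℝ) * a⁻¹)).lintegral_lt_top
  exact h2.ne

theorem intensity_block_ne_zero (z : PosReal) (k : ℕ) : intensity z (block k) ≠ 0 := by
  obtain ⟨a, ha, hsub⟩ := block_subset k
  have hz := z.2
  have hpos : block k ⊆ Set.Ioi 0 := hsub.trans (Set.Ioi_subset_Ioi ha.le)
  have hm : Measurable fun x : ℝ => ENNReal.ofReal ((z : ℝ) * x⁻¹ * Real.exp (-x)) := by fun_prop
  rw [intensity, Ne, withDensity_apply_eq_zero hm]
  have hset : {x : ℝ | ENNReal.ofReal ((z : ℝ) * x⁻¹ * Real.exp (-x)) ≠ 0} ∩ block k = block k := by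
    refine Set.inter_eq_right.2 fun x hx => ?_
    have hx' : 0 < x := hpos hx
    have : 0 < (z : ℝ) * x⁻¹ * Real.exp (-x) := by positivity
    simpa using this
  rw [hset, Measure.restrict_apply (measurableSet_block k), Set.inter_eq_left.2 hpos]
  unfold block
  split_ifs with h
  · simp
  · have hk : (0 : ℝ) < k := by exact_mod_cast Nat.pos_of_ne_zero h
    rw [Real.volume_Ioc]
    have : 1 / ((k : ℝ) + 1) < 1 / k := one_div_lt_one_div_of_lt hk (by linarith)
    simpa using this

instance (z : PosReal) (k : ℕ) : IsProbabilityMeasure (cond (intensity z) (block k)) :=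
  cond_isProbabilityMeasure_of_finite (intensity_block_ne_zero z k) (intensity_block_ne_top z k)

instance (z : PosReal) (k : ℕ) : IsProbabilityMeasure (blockLaw z k) := by
  unfold blockLaw
  infer_instance

instance (z : PosReal) : IsProbabilityMeasure (poissonProcess z) := by
  unfold poissonProcess
  infer_instance

/-! ### Polymorphisms -/

section Polymorphisms

variable {M N K : Type*} [MeasurableSpace M] [MeasurableSpace N] [MeasurableSpace K]

/-- Polymorphisms `(M, μ) → (N, ν)`. -/
structure IsPolymorphism (μ : Measure M) (ν : Measure N) (p : Measure (M × N × PosReal)) :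
    Prop where
  fst : p.map (fun x => x.1) = μ
  snd : (p.withDensity fun x => ENNReal.ofReal x.2.2).map (fun x => x.2.1) = ν

/-- The positive real number `x` (the value `1` in the degenerate cases `x = 0, ∞`). -/
def toPosReal (x : ENNReal) : PosReal :=
  if h : 0 < x.toReal then ⟨x.toReal, h⟩ else 1

/-- The Radon–Nikodym derivative of a bijection `φ`, i.e. the density `φ'` for which
`μ (φ A) = ∫_A φ' dμ`. -/
def radonNikodym (μ : Measure M) (φ : M → M) (m : M) : PosReal :=
  toPosReal ((μ.comap φ).rnDeriv μ m)

/-- The image of `μ` under `m ↦ (m, φ m, D m)`. -/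
def ofMap (μ : Measure M) (φ : M → N) (D : M → PosReal) : Measure (M × N × PosReal) :=
  μ.map fun m => (m, φ m, D m)

instance (μ : Measure M) [IsFiniteMeasure μ] (φ : M → N) (D : M → PosReal) :
    IsFiniteMeasure (ofMap μ φ D) := by
  unfold ofMap
  infer_instance

/-- The involution: the image of the measure `t · p` under `(m, n, t) ↦ (n, m, t⁻¹)`. -/
def star (p : Measure (M × N × PosReal)) : Measure (N × M × PosReal) :=
  (p.withDensity fun x => ENNReal.ofReal x.2.2).map fun x => (x.2.1, x.1, x.2.2⁻¹)

/-- The product of polymorphisms, first `p` and then `q`: a point `m` is spread to points `(n, t)` by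
`p`, then `n` is spread to points `(k, s)` by `q`, and this gives points `(k, t s)`. -/
def comp [StandardBorelSpace K] [Nonempty K] (p : Measure (M × N × PosReal))
    (q : Measure (N × K × PosReal)) [IsFiniteMeasure q] : Measure (M × K × PosReal) :=
  (p ⊗ₘ (q.condKernel.comap (fun x : M × N × PosReal => x.2.1)
    (measurable_fst.comp measurable_snd))).map
    fun x => (x.1.1, x.2.1, x.1.2.2 * x.2.2)

/-- The measures `F m` are the conditional measures of `p` on the fibers over the points `m`, i.e. the
spreaded images of the points `m`. -/
def IsSpreadedImage (μ : Measure M) (p : Measure (M × N × PosReal))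
    (F : M → Measure (N × PosReal)) : Prop :=
  ∃ κ : Kernel M (N × PosReal), IsMarkovKernel κ ∧ p = μ ⊗ₘ κ ∧ ∀ᵐ m ∂μ, F m = κ m

end Polymorphisms

/-- The polymorphism from virtual permutations to restaurants which forgets the guests. -/
def forget (z : PosReal) : Measure (VirtualPerm × Restaurant × PosReal) :=
  ofMap (virtualMeasure z) tableLengths fun _ => 1

/-- The polymorphism of the transformation `u ↦ h₁⁻¹ u h₂`. -/
def actPolymorphism (z : PosReal) {n : ℕ} (h₁ h₂ : Equiv.Perm (Fin n)) :
    Measure (VirtualPerm × VirtualPerm × PosReal) :=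
  ofMap (virtualMeasure z) (act h₁ h₂) (radonNikodym (virtualMeasure z) (act h₁ h₂))

instance (z : PosReal) : IsFiniteMeasure (forget z) := by
  unfold forget
  infer_instance

instance (z : PosReal) {n : ℕ} (h₁ h₂ : Equiv.Perm (Fin n)) :
    IsFiniteMeasure (actPolymorphism z h₁ h₂) := by
  unfold actPolymorphism
  infer_instance

/-- The polymorphism `Ξ` of the space of restaurants: arrange the guests at random, apply the
transformation `u ↦ h₁⁻¹ u h₂`, forget the guests. -/
def chipPolymorphism (z : PosReal) {n : ℕ} (h₁ h₂ : Equiv.Perm (Fin n)) :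
    Measure (Restaurant × Restaurant × PosReal) :=
  comp (comp (star (forget z)) (actPolymorphism z h₁ h₂)) (forget z)

/-! ### Checker surfaces -/

/-- A labeled checker surface with `n` white and `n` black triangles: the edge of color `a` of the
white triangle `w` is glued to the edge of color `a` of the black triangle `a w`; likewise for the
colors `b` and `c`. -/
structure LabeledSurface (n : ℕ) where
  a : Equiv.Perm (Fin n)
  b : Equiv.Perm (Fin n)
  c : Equiv.Perm (Fin n)

/-- The vertices adjacent to edges of the two colors whose gluings are `p` and `q`. Each white triangle
has one corner of this type; turning around this corner, one passes from the white triangle `w` through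
its second edge to the black triangle `q w`, and then to the white triangle `p⁻¹ (q w)`. So the vertices
are the cycles of `p⁻¹ q` on the set of white triangles. -/
def Vertex {n : ℕ} (p q : Equiv.Perm (Fin n)) : Type :=
  Quotient (Equiv.Perm.SameCycle.setoid (p⁻¹ * q))

/-- The vertex of the white triangle `w`. -/
def Vertex.mk {n : ℕ} (p q : Equiv.Perm (Fin n)) (w : Fin n) : Vertex p q :=
  Quotient.mk (Equiv.Perm.SameCycle.setoid (p⁻¹ * q)) w

instance {n : ℕ} (p q : Equiv.Perm (Fin n)) : Finite (Vertex p q) :=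
  Quotient.finite _

instance {n : ℕ} (p q : Equiv.Perm (Fin n)) : Fintype (Vertex p q) :=
  Fintype.ofFinite _

/-- The order of a vertex: half of its valence, i.e. the number of white triangles around it. -/
def Vertex.order {n : ℕ} {p q : Equiv.Perm (Fin n)} (v : Vertex p q) : ℕ :=
  Nat.card {w : Fin n // Vertex.mk p q w = v}

namespace LabeledSurface

variable {n : ℕ} (S : LabeledSurface n)

/-- Vertices of type `A` are opposite to the edges of color `a`, and so on. -/
abbrev VertexA : Type := Vertex S.b S.c
abbrev VertexB : Type := Vertex S.a S.c
abbrev VertexC : Type := Vertex S.a S.b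

/-- The number of edges connecting `β` and `γ`; such edges have color `a`, and each of them belongs to
one white triangle. -/
def edges (β : S.VertexB) (γ : S.VertexC) : ℕ :=
  Nat.card {w : Fin n // Vertex.mk S.a S.c w = β ∧ Vertex.mk S.a S.b w = γ}

/-- The automorphisms of the checker surface (pairs of permutations of white and of black triangles
compatible with the gluings) fixing all `B`-vertices. -/
def AutB : Type :=
  {s : Equiv.Perm (Fin n) × Equiv.Perm (Fin n) //
    s.2 * S.a = S.a * s.1 ∧ s.2 * S.b = S.b * s.1 ∧ s.2 * S.c = S.c * s.1 ∧
      ∀ w, Vertex.mk S.a S.c (s.1 w) = Vertex.mk S.a S.c w}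

end LabeledSurface

/-- The tables of a restaurant. -/
abbrev Table (ℓ : Restaurant) : Type := {ν : ℕ // 0 < ℓ ν}

/-- A labeled checker surface whose `A`-vertices have the orders `k`, with a framing `ω`, i.e. an
injective map from the set of `B`-vertices to the set of tables. -/
structure FramedSurface (k : Multiset ℕ) (ℓ : Restaurant) where
  S : LabeledSurface k.sum
  order_eq : (Finset.univ.val.map fun α : S.VertexA => α.order) = k
  ω : S.VertexB ↪ Table ℓ

/-- Two framed labeled surfaces are equivalent if they differ by a relabeling of the white and of the
black triangles, so that the classes are the isomorphism classes of framed checker surfaces without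
labels. -/
instance FramedSurface.setoid (k : Multiset ℕ) (ℓ : Restaurant) : Setoid (FramedSurface k ℓ) where
  r F G := ∃ s t : Equiv.Perm (Fin k.sum),
    t * F.S.a = G.S.a * s ∧ t * F.S.b = G.S.b * s ∧ t * F.S.c = G.S.c * s ∧
      ∀ w, G.ω (Vertex.mk G.S.a G.S.c (s w)) = F.ω (Vertex.mk F.S.a F.S.c w)
  iseqv := by
    refine ⟨fun F => ⟨1, 1, by simp, by simp, by simp, fun w => rfl⟩, ?_, ?_⟩
    · rintro F G ⟨s, t, ha, hb, hc, hω⟩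
      refine ⟨s⁻¹, t⁻¹, ?_, ?_, ?_, fun w => ?_⟩
      · rw [inv_mul_eq_iff_eq_mul, ← mul_assoc, ha, mul_assoc, mul_inv_cancel, mul_one]
      · rw [inv_mul_eq_iff_eq_mul, ← mul_assoc, hb, mul_assoc, mul_inv_cancel, mul_one]
      · rw [inv_mul_eq_iff_eq_mul, ← mul_assoc, hc, mul_assoc, mul_inv_cancel, mul_one]
      · rw [← hω (s⁻¹ w)]
        congr 2
        exact s.apply_symm_apply w
    · rintro F G H ⟨s, t, ha, hb, hc, hω⟩ ⟨s', t', ha', hb', hc', hω'⟩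
      refine ⟨s' * s, t' * t, ?_, ?_, ?_, fun w => ?_⟩
      · rw [mul_assoc, ha, ← mul_assoc, ha', mul_assoc]
      · rw [mul_assoc, hb, ← mul_assoc, hb', mul_assoc]
      · rw [mul_assoc, hc, ← mul_assoc, hc', mul_assoc]
      · rw [Equiv.Perm.mul_apply, hω', hω]

/-! ### Dirichlet distributions -/

open Classical in
/-- The Dirichlet distribution with parameters `m` on the simplex `x ≥ 0`, `∑ x = ℓ`, in the space
`ι → ℝ`; the coordinates with `m i = 0` vanish. One index `i₀` with `m i₀ > 0` is chosen, and the
remaining coordinates with `m i > 0` serve as coordinates on the simplex (the measure does not depend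
on the choice of `i₀`). -/
def dirichlet {ι : Type*} [Fintype ι] (m : ι → ℝ) (ℓ : ℝ) : Measure (ι → ℝ) :=
  if h : ∃ i, 0 < m i then
    (((volume : Measure ({i : ι // 0 < m i ∧ i ≠ h.choose} → ℝ)).restrict
      {y | (∀ j, 0 < y j) ∧ ∑ j, y j < ℓ}).withDensity fun y =>
        ENNReal.ofReal (Real.Gamma (∑ i, m i) / (∏ i with 0 < m i, Real.Gamma (m i))
          * ℓ ^ (1 - ∑ i, m i) * (∏ j, y j ^ (m j - 1))
          * (ℓ - ∑ j, y j) ^ (m h.choose - 1))).map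
      fun y i => if i = h.choose then ℓ - ∑ j, y j
        else if hi : 0 < m i ∧ i ≠ h.choose then y ⟨i, hi⟩ else 0
  else 0

/-- The convolution of a finite family of measures on `ι → ℝ`. -/
def convolution {κ ι : Type*} [Fintype κ] (Λ : κ → Measure (ι → ℝ)) : Measure (ι → ℝ) :=
  (Measure.pi Λ).map fun y => ∑ β, y β

open Classical in
/-- The restaurant obtained from `ℓ` by replacing the lengths of the tables in the set `B` by the
lengths `y`. -/
def replaceTables {ι : Type*} (ℓ : Restaurant) (B : Set (Table ℓ)) (y : ι → ℝ) : Restaurant :=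
  rank (Sum.elim (fun ν : {ν : Table ℓ // ν ∉ B} => ℓ ν.1) y)

/-! ### The formula -/

/-- The summand of a framed surface. -/
def summand (z : PosReal) {k : Multiset ℕ} {ℓ : Restaurant} (F : FramedSurface k ℓ) :
    Measure (Restaurant × PosReal) :=
  (ENNReal.ofReal ((1 / (Nat.card F.S.AutB : ℝ)) *
      ∏ β : F.S.VertexB, (ℓ (F.ω β) ^ β.order / ((β.order - 1).factorial : ℝ)))) •
    ((convolution fun β : F.S.VertexB =>
        dirichlet (fun γ : F.S.VertexC => (F.S.edges β γ : ℝ)) (ℓ (F.ω β))).map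
      (replaceTables ℓ (Set.range F.ω))).prod
    (Measure.dirac (z ^ ((Nat.card F.S.VertexC : ℤ) - (Nat.card F.S.VertexB : ℤ))))

/-- The sum over the isomorphism classes of framed checker surfaces. -/
def spreadedImage (z : PosReal) (k : Multiset ℕ) (ℓ : Restaurant) :
    Measure (Restaurant × PosReal) :=
  ((k.prod * ∏ m ∈ k.toFinset, (k.count m).factorial : ℕ) : ENNReal) •
    Measure.sum fun F : Quotient (FramedSurface.setoid k ℓ) => summand z F.out

end

end Restaurants

namespace Restaurants

/-! ### Decreasing rearrangements -/

section Rank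

variable {ι κ : Type*}

/-! The measure on virtual permutations can be disintegrated explicitly over restaurants. Draw a
Poisson–Dirichlet restaurant `ℓ`, regard each table as a circle, and let independent guests choose a
table `ν` with probability `ℓ ν` and a uniform point of its circle; the `N`-th permutation sends
each of the first `N` guests to the next one on the same circle. By `map_arrange` the result has the
law `virtualMeasure z`, and almost surely its restaurant is again `ℓ` (`ae_tableLengths_arrange`, by
the strong law of large numbers). Hence the spreaded image of `ℓ` is the joint law, under the random
guests `guests ℓ`, of the restaurant of the transformed permutation and of the Radon–Nikodym
derivative. On Ewens cylinders this derivative is `z` to the increment of the number of cycles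
(`comap_act`).

To identify the law of the arranged guests, cylinders are compared. The probability that the first
`n` guests form `σ` is a sum of products of powers of the lengths over distinct tables
(`guests_seq_eq`). Its mean for the Poisson–Dirichlet distribution follows from the Mecke formula:
an exponential weight of the total length factors over points, the Laplace transform of the total
length is `(1 + t) ^ (-z)` (`laplace_eq`), and integration over `t` undoes the normalization
(`lintegral_distinctSum_poissonDirichlet`). The outcome is the Ewens weight.

For the spreaded image one may replace the pair `(h₁, h₂)` by `(g⁻¹, 1)`, where `g` has cycle type
`k` on exactly `k.sum` points (`chipPolymorphism_reduce`); the transformation becomes `u ↦ g u`.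
Suppose that the first `k.sum` guests form `σ` with its cycles at the tables `ω`. They cut these
circles into arcs, and after multiplication by `g` the arc following `p` belongs to the cycle of `p`
under `g σ`, while other tables are untouched (`IsTypical.tableLengths_act`). On this event the arcs
of each circle have the flat Dirichlet law up to the mass `1 / (ord - 1)!` (`lintegral_arcs`).
Summing the arcs that fall into each new cycle turns flat Dirichlet laws into Dirichlet laws with
the parameters `m_βγ`, and the contributions of different old tables are convolved
(`lintegral_cutLengths`). This gives one term for each pair `(σ, ω)` (`map_regroup_guests`).

Finally `(σ, ω)` is a labeling of a framed checker surface with gluings `1, g σ, σ`. The labelings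
of a given surface compatible with `g` form a torsor over the centralizer of `g`, whose order is the
combinatorial prefactor, and `AutB` acts on them freely (`card_seatings`). Grouping the pairs by
isomorphism classes gives the stated sum. -/

theorem rank_congr {a : ι → ℝ} {b : κ → ℝ}
    (h : ∀ t, 0 ≤ t → {i | t < a i}.encard = {i | t < b i}.encard) : rank a = rank b := by
  funext k
  unfold rank
  congr 1
  ext t
  simp only [Set.mem_ofPred_eq]
  refine and_congr_right fun ht => ?_
  rw [h t ht]

theorem rank_comp_equiv (e : ι ≃ κ) (b : κ → ℝ) : rank (fun i => b (e i)) = rank b := by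
  refine rank_congr fun t _ => ?_
  have : {i | t < b (e i)} = e ⁻¹' {i | t < b i} := rfl
  rw [this, Set.encard_preimage_of_bijective e.bijective]

/-- Nonnegative thresholds see only the positive entries, so families over different index types may
be compared regardless of their zeros. -/
theorem encard_lt_eq_of_equiv {a : ι → ℝ} {b : κ → ℝ} (e : {i // 0 < a i} ≃ {j // 0 < b j})
    (he : ∀ i, b (e i) = a i) {t : ℝ} (ht : 0 ≤ t) :
    {i | t < a i}.encard = {i | t < b i}.encard := by
  have h1 : {i | t < a i} = Subtype.val '' {i : {i // 0 < a i} | t < a i} := by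
    ext i
    simp only [Set.mem_ofPred_eq, Set.mem_image, Subtype.exists, exists_and_left, exists_prop,
      exists_eq_right_right]
    exact ⟨fun h => ⟨h, ht.trans_lt h⟩, fun h => h.1⟩
  have h2 : {i | t < b i} = Subtype.val '' {i : {i // 0 < b i} | t < b i} := by
    ext i
    simp only [Set.mem_ofPred_eq, Set.mem_image, Subtype.exists, exists_and_left, exists_prop,
      exists_eq_right_right]
    exact ⟨fun h => ⟨h, ht.trans_lt h⟩, fun h => h.1⟩
  rw [h1, h2, Subtype.val_injective.encard_image, Subtype.val_injective.encard_image]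
  have : {i : {i // 0 < a i} | t < a i} = e ⁻¹' {i : {i // 0 < b i} | t < b i} := by
    ext i
    simp [he]
  rw [this, Set.encard_preimage_of_bijective e.bijective]

theorem rank_eq_of_equiv {a : ι → ℝ} {b : κ → ℝ} (e : {i // 0 < a i} ≃ {j // 0 < b j})
    (he : ∀ i, b (e i) = a i) : rank a = rank b :=
  rank_congr fun _ ht => encard_lt_eq_of_equiv e he ht

theorem rank_nonneg (a : ι → ℝ) (k : ℕ) : 0 ≤ rank a k :=
  Real.sInf_nonneg fun _ ht => ht.1

theorem bddBelow_levels (a : ι → ℝ) (k : ℕ) :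
    BddBelow {t : ℝ | 0 ≤ t ∧ {i | t < a i}.encard ≤ k} := ⟨0, fun _ ht => ht.1⟩

/-- If more than `k` entries of `a` are greater than `t`, this remains true for some `s > t`. -/
theorem exists_gt_of_lt_encard {a : ι → ℝ} {t : ℝ} {k : ℕ} (h : (k : ℕ∞) < {i | t < a i}.encard) :
    ∃ s, t < s ∧ ∀ r < s, (k : ℕ∞) < {i | r < a i}.encard := by
  have h' : ((k + 1 : ℕ) : ℕ∞) ≤ {i | t < a i}.encard := by
    rw [Nat.cast_add, Nat.cast_one]
    exact Order.add_one_le_of_lt h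
  obtain ⟨T, hT, hc⟩ := Set.exists_subset_encard_eq h'
  have hfin : T.Finite := Set.finite_of_encard_eq_coe hc
  have hne : T.Nonempty := by
    rw [← Set.encard_ne_zero, hc]
    simp
  obtain ⟨i₀, hi₀, hmin⟩ := Set.exists_min_image T a hfin hne
  refine ⟨a i₀, hT hi₀, fun r hr => ?_⟩
  have : T ⊆ {i | r < a i} := fun i hi => hr.trans_le (hmin i hi)
  refine lt_of_lt_of_le ?_ (Set.encard_le_encard this)
  rw [hc]
  exact_mod_cast Nat.lt_succ_self k

/-- If too many entries exceed `t`, then a whole interval to the right of `t` is inadmissible as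
well, so the infimum lies strictly above `t`. Nonemptiness excludes the convention `sInf ∅ = 0`. -/
theorem lt_rank_iff_of_nonempty {a : ι → ℝ} {k : ℕ}
    (hne : {t : ℝ | 0 ≤ t ∧ {i | t < a i}.encard ≤ k}.Nonempty) {t : ℝ} (ht : 0 ≤ t) :
    t < rank a k ↔ (k : ℕ∞) < {i | t < a i}.encard := by
  constructor
  · intro h
    by_contra hc
    exact absurd (csInf_le (bddBelow_levels a k) ⟨ht, not_lt.1 hc⟩) (not_le.2 h)
  · intro h
    obtain ⟨s, hs, hr⟩ := exists_gt_of_lt_encard h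
    refine hs.trans_le (le_csInf hne fun r hr' => ?_)
    by_contra hlt
    exact absurd hr'.2 (not_le.2 (hr r (not_le.1 hlt)))

/-- Only finitely many entries are greater than a given positive number. -/
def FiniteLevels (a : ι → ℝ) : Prop := ∀ t, 0 < t → {i | t < a i}.Finite

theorem FiniteLevels.of_hasSum {a : ι → ℝ} (h : Summable a) : FiniteLevels a := by
  intro t ht
  have := h.tendsto_cofinite_zero.eventually (gt_mem_nhds ht)
  rw [Filter.eventually_cofinite] at this
  refine this.subset fun i hi => ?_
  simp only [Set.mem_ofPred_eq, not_lt] at hi ⊢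
  exact hi.le

/-- The largest entry is admissible if some entry exceeds `1`; otherwise `1` is admissible. -/
theorem FiniteLevels.nonempty {a : ι → ℝ} (h : FiniteLevels a) (k : ℕ) :
    {t : ℝ | 0 ≤ t ∧ {i | t < a i}.encard ≤ k}.Nonempty := by
  have h1 := h 1 one_pos
  by_cases hne : {i | 1 < a i}.Nonempty
  · obtain ⟨i₀, hi₀, hmax⟩ := Set.exists_max_image _ a h1 hne
    refine ⟨a i₀, zero_le_one.trans hi₀.le, ?_⟩
    have : {i | a i₀ < a i} = ∅ := by
      ext i
      simp only [Set.mem_ofPred_eq, Set.mem_empty_iff_false, iff_false, not_lt]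
      by_contra hc
      exact hc (hmax i (lt_trans hi₀ (not_le.1 hc)))
    rw [this, Set.encard_empty]
    exact zero_le
  · refine ⟨1, zero_le_one, ?_⟩
    rw [Set.not_nonempty_iff_eq_empty.1 hne, Set.encard_empty]
    exact zero_le

theorem lt_rank_iff {a : ι → ℝ} (h : FiniteLevels a) (k : ℕ) {t : ℝ} (ht : 0 ≤ t) :
    t < rank a k ↔ (k : ℕ∞) < {i | t < a i}.encard :=
  lt_rank_iff_of_nonempty (h.nonempty k) ht

theorem encard_setOf_lt (c : ℕ∞) : {k : ℕ | (k : ℕ∞) < c}.encard = c := by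
  induction c using WithTop.recTopCoe with
  | top =>
    have : {k : ℕ | (k : ℕ∞) < ⊤} = Set.univ := by
      ext k
      simp
    exact (congrArg Set.encard this).trans (Set.encard_eq_top Set.infinite_univ)
  | coe n =>
    have : {k : ℕ | (k : ℕ∞) < (n : ℕ∞)} = Finset.range n := by
      ext k
      simp
    refine (congrArg Set.encard this).trans ?_
    rw [Set.encard_coe_eq_coe_finsetCard, Finset.card_range]
    rfl

theorem encard_lt_rank {a : ι → ℝ} (h : FiniteLevels a) {t : ℝ} (ht : 0 ≤ t) :
    {k | t < rank a k}.encard = {i | t < a i}.encard := by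
  rw [← encard_setOf_lt {i | t < a i}.encard]
  congr 1
  ext k
  exact lt_rank_iff h k ht

theorem FiniteLevels.rank {a : ι → ℝ} (h : FiniteLevels a) : FiniteLevels (rank a) := by
  intro t ht
  rw [← Set.encard_lt_top_iff, encard_lt_rank h ht.le, Set.encard_lt_top_iff]
  exact h t ht

theorem rank_rank {a : ι → ℝ} (h : FiniteLevels a) : rank (rank a) = rank a :=
  rank_congr fun _ ht => encard_lt_rank h ht

/-- Below a positive number there is a gap in the values. -/
theorem FiniteLevels.exists_gap {a : ι → ℝ} (ha : FiniteLevels a) {v : ℝ} (hv : 0 < v) :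
    ∃ s, 0 < s ∧ s < v ∧ ∀ r, s ≤ r → ∀ i, r < a i → v ≤ a i := by
  have h1 : {i | v / 2 < a i ∧ a i < v}.Finite := (ha (v / 2) (by positivity)).subset
    fun i hi => hi.1
  by_cases hne : {i | v / 2 < a i ∧ a i < v}.Nonempty
  · obtain ⟨i₀, hi₀, hmax⟩ := Set.exists_max_image _ a h1 hne
    refine ⟨a i₀, by linarith [hi₀.1], hi₀.2, fun r hr i hi => ?_⟩
    by_contra hc
    have := hmax i ⟨by linarith [hi₀.1], not_le.1 hc⟩
    linarith
  · refine ⟨v / 2, by positivity, by linarith, fun r hr i hi => ?_⟩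
    by_contra hc
    exact hne ⟨i, lt_of_le_of_lt hr hi, not_le.1 hc⟩

theorem encard_lt_eq_add {a : ι → ℝ} {s v : ℝ} (hsv : s < v) (hsa : ∀ i, s < a i → v ≤ a i) :
    {i | s < a i}.encard = {i | v < a i}.encard + {i | a i = v}.encard := by
  rw [← Set.encard_union_eq]
  · congr 1
    ext i
    simp only [Set.mem_ofPred_eq, Set.mem_union]
    constructor
    · intro hi
      exact (hsa i hi).lt_or_eq.imp_right Eq.symm
    · rintro (hi | hi) <;> linarith
  · rw [Set.disjoint_left]
    intro i hi hi'
    simp only [Set.mem_ofPred_eq] at hi hi'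
    linarith

/-- The entries equal to a positive number are counted by the levels. -/
theorem encard_eq_of_levels {a : ι → ℝ} {b : κ → ℝ} (ha : FiniteLevels a) (hb : FiniteLevels b)
    (h : ∀ t, 0 ≤ t → {i | t < a i}.encard = {i | t < b i}.encard) {v : ℝ} (hv : 0 < v) :
    {i | a i = v}.encard = {i | b i = v}.encard := by
  obtain ⟨s, hs0, hsv, hs⟩ := ha.exists_gap hv
  obtain ⟨r, hr0, hrv, hr⟩ := hb.exists_gap hv
  -- Between the larger of the two gap points and `v` neither family has entries, so the
  -- multiplicity of `v` is the jump of the level count.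
  have e1 := encard_lt_eq_add (max_lt hsv hrv) (hs _ (le_max_left _ _))
  have e2 := encard_lt_eq_add (max_lt hsv hrv) (hr _ (le_max_right _ _))
  rw [h _ (le_max_of_le_left hs0.le), h v hv.le] at e1
  rw [e2] at e1
  have hfin : {i | v < b i}.encard ≠ ⊤ := (Set.encard_lt_top_iff.2 (hb v hv)).ne
  exact (ENat.add_right_injective_of_ne_top hfin e1).symm

theorem FiniteLevels.finite_eq {a : ι → ℝ} (ha : FiniteLevels a) {v : ℝ} (hv : 0 < v) :
    {i | a i = v}.Finite := by
  refine (ha (v / 2) (half_pos hv)).subset fun i hi => ?_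
  simp only [Set.mem_ofPred_eq] at hi ⊢
  rw [hi]
  exact half_lt_self hv

/-- The positive entries equal to `v`. -/
def positiveFiberEquiv (a : ι → ℝ) (v : {v : ℝ // 0 < v}) :
    {i : {i // 0 < a i} // (⟨a i, i.2⟩ : {v : ℝ // 0 < v}) = v} ≃ {i | a i = v.1} :=
  ⟨fun i => ⟨i.1.1, congrArg Subtype.val i.2⟩,
    fun i => ⟨⟨i.1, (show a i.1 = v.1 from i.2).symm ▸ v.2⟩, Subtype.ext i.2⟩,
    fun _ => rfl, fun _ => rfl⟩

/-- Families with the same levels have the same positive entries with multiplicities. -/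
theorem exists_equiv_of_levels {a : ι → ℝ} {b : κ → ℝ} (ha : FiniteLevels a) (hb : FiniteLevels b)
    (h : ∀ t, 0 ≤ t → {i | t < a i}.encard = {i | t < b i}.encard) :
    ∃ e : {i // 0 < a i} ≃ {j // 0 < b j}, ∀ i, b (e i) = a i := by
  let fa : {i // 0 < a i} → {v : ℝ // 0 < v} := fun i => ⟨a i, i.2⟩
  let fb : {i // 0 < b i} → {v : ℝ // 0 < v} := fun i => ⟨b i, i.2⟩
  have key : ∀ v, Nonempty ({i // fa i = v} ≃ {j // fb j = v}) := by
    intro v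
    have hfa := ha.finite_eq v.2
    have hfb := hb.finite_eq v.2
    have hcard := encard_eq_of_levels ha hb h v.2
    have : Nonempty ({i | a i = v.1} ≃ {i | b i = v.1}) := by
      rw [hfa.encard_eq_coe_toFinset_card, hfb.encard_eq_coe_toFinset_card] at hcard
      have := hfa.fintype
      have := hfb.fintype
      refine ⟨Fintype.equivOfCardEq ?_⟩
      rw [← Set.toFinset_card, ← Set.toFinset_card]
      have h' := Nat.cast_injective hcard
      convert h' <;> ext <;> simp
    exact this.map fun e => (positiveFiberEquiv a v).trans (e.trans (positiveFiberEquiv b v).symm)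
  let e := fun v => (key v).some
  refine ⟨(Equiv.sigmaFiberEquiv fa).symm.trans
    ((Equiv.sigmaCongrRight e).trans (Equiv.sigmaFiberEquiv fb)), fun i => ?_⟩
  exact congrArg Subtype.val (e (fa i) ⟨i, rfl⟩).2

theorem exists_equiv_rank {a : ι → ℝ} (h : FiniteLevels a) :
    ∃ e : {k // 0 < rank a k} ≃ {i // 0 < a i}, ∀ k, a (e k) = rank a k :=
  exists_equiv_of_levels h.rank h fun _ ht => encard_lt_rank h ht

/-- More than `k` entries exceed `t` exactly when all entries over some `(k + 1)`-element set of
indices do, and there are only countably many such sets. -/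
theorem measurableSet_lt_encard [Countable ι] (t : ℝ) (k : ℕ) :
    MeasurableSet {a : ι → ℝ | (k : ℕ∞) < {i | t < a i}.encard} := by
  have : {a : ι → ℝ | (k : ℕ∞) < {i | t < a i}.encard}
      = ⋃ s : Finset ι, ⋃ (_ : s.card = k + 1), ⋂ i ∈ s, {a : ι → ℝ | t < a i} := by
    ext a
    simp only [Set.mem_ofPred_eq, Set.mem_iUnion, Set.mem_iInter, exists_prop]
    constructor
    · intro h
      have h' : ((k + 1 : ℕ) : ℕ∞) ≤ {i | t < a i}.encard := by
        rw [Nat.cast_add, Nat.cast_one]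
        exact Order.add_one_le_of_lt h
      obtain ⟨T, hT, hc⟩ := Set.exists_subset_encard_eq h'
      have hfin : T.Finite := Set.finite_of_encard_eq_coe hc
      refine ⟨hfin.toFinset, ?_, fun i hi => hT (hfin.mem_toFinset.1 hi)⟩
      rw [hfin.encard_eq_coe_toFinset_card] at hc
      exact_mod_cast hc
    · rintro ⟨s, hs, h⟩
      have : (s : Set ι) ⊆ {i | t < a i} := fun i hi => h i hi
      refine lt_of_lt_of_le ?_ (Set.encard_le_encard this)
      rw [Set.encard_coe_eq_coe_finsetCard, hs]
      exact_mod_cast Nat.lt_succ_self k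
  rw [this]
  refine .iUnion fun s => .iUnion fun _ => .biInter s.countable_toSet fun i _ => ?_
  exact measurableSet_lt measurable_const (measurable_pi_apply i)

theorem measurable_rank [Countable ι] : Measurable (rank : (ι → ℝ) → Restaurant) := by
  refine measurable_pi_lambda _ fun k => measurable_of_Ioi fun t => ?_
  by_cases ht : t < 0
  · convert MeasurableSet.univ
    ext a
    simpa using ht.trans_le (rank_nonneg a k)
  have ht : 0 ≤ t := not_lt.1 ht
  -- `E` consists of the families without any admissible threshold; on it the rank is `0` by the
  -- convention for the empty infimum.
  let E : Set (ι → ℝ) := ⋂ n : ℕ, {a | (k : ℕ∞) < {i | (n : ℝ) < a i}.encard}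
  have hE : MeasurableSet E := .iInter fun n => measurableSet_lt_encard _ k
  have : (fun a : ι → ℝ => rank a k) ⁻¹' Set.Ioi t = {a | (k : ℕ∞) < {i | t < a i}.encard} \ E := by
    ext a
    by_cases hne : {t : ℝ | 0 ≤ t ∧ {i | t < a i}.encard ≤ k}.Nonempty
    · have hnE : a ∉ E := by
        obtain ⟨s, hs0, hs⟩ := hne
        obtain ⟨n, hn⟩ := exists_nat_ge s
        intro ha
        have := Set.mem_iInter.1 ha n
        refine absurd this (not_lt.2 (le_trans (Set.encard_le_encard fun i hi => ?_) hs))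
        exact lt_of_le_of_lt hn hi
      simp only [Set.mem_preimage, Set.mem_Ioi, Set.mem_sdiff, hnE, not_false_eq_true, and_true]
      exact lt_rank_iff_of_nonempty hne ht
    · have hE' : a ∈ E := by
        refine Set.mem_iInter.2 fun n => ?_
        by_contra hc
        exact hne ⟨n, Nat.cast_nonneg n, not_lt.1 hc⟩
      have h0 : rank a k = 0 := by
        unfold rank
        rw [Set.not_nonempty_iff_eq_empty.1 hne, Real.sInf_empty]
      simp [hE', h0, ht]
  rw [this]
  exact (measurableSet_lt_encard t k).diff hE

end Rank

end Restaurants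

namespace Restaurants

theorem perm_inv_apply (σ : Equiv.Perm ℕ) (n : ℕ) : σ⁻¹ (σ n) = n := σ.symm_apply_apply n

/-! ### Cylinders of virtual permutations -/

namespace VirtualPerm

theorem seq_injOn_restrict (N : ℕ) (u v : VirtualPerm)
    (h : (fun i : Fin N => u.seq N i) = fun i : Fin N => v.seq N i) : u.seq N = v.seq N := by
  ext i
  by_cases hi : i < N
  · exact congrFun h ⟨i, hi⟩
  · rw [u.fix N i (by omega), v.fix N i (by omega)]

/-- Every function of the `N`-th component is measurable. -/
theorem measurable_of_seq {α : Type*} [MeasurableSpace α] (N : ℕ) (G : Equiv.Perm ℕ → α) :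
    Measurable fun u : VirtualPerm => G (u.seq N) := by
  let R : VirtualPerm → (Fin N → ℕ) := fun u i => u.seq N i
  have hR : Measurable R := measurable_pi_lambda _ fun i => measurable_seq_apply N i
  have hfac : Function.FactorsThrough (fun u : VirtualPerm => G (u.seq N)) R := fun u v h =>
    congrArg G (seq_injOn_restrict N u v h)
  let u₀ : VirtualPerm := Classical.arbitrary _
  have : (fun u : VirtualPerm => G (u.seq N))
      = Function.extend R (fun u : VirtualPerm => G (u.seq N)) (fun _ => G (u₀.seq N)) ∘ R := by
    funext u
    exact (hfac.extend_apply _ u).symm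
  rw [this]
  exact (measurable_of_countable _).comp hR

theorem seq_eq_removeFrom (u : VirtualPerm) (N : ℕ) : ∀ k, u.seq N = removeFrom N k (u.seq (N + k))
  | 0 => rfl
  | k + 1 => by
    rw [removeFrom, show N + (k + 1) = N + k + 1 from rfl, u.compat, ← seq_eq_removeFrom u N k]

theorem seq_eq_of_le {u v : VirtualPerm} {N M : ℕ} (hNM : N ≤ M) (h : u.seq M = v.seq M) :
    u.seq N = v.seq N := by
  obtain ⟨k, rfl⟩ := Nat.exists_eq_add_of_le hNM
  rw [u.seq_eq_removeFrom N k, v.seq_eq_removeFrom N k, h]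

theorem ext_of_le {u v : VirtualPerm} (n : ℕ) (h : ∀ N, n ≤ N → u.seq N = v.seq N) : u = v :=
  VirtualPerm.ext (funext fun N => seq_eq_of_le (le_max_left N n) (h _ (le_max_right N n)))

/-- The set of virtual permutations with a given component. -/
def cylinder (N : ℕ) (σ : Equiv.Perm ℕ) : Set VirtualPerm := {u | u.seq N = σ}

theorem measurableSet_cylinder (N : ℕ) (σ : Equiv.Perm ℕ) : MeasurableSet (cylinder N σ) := by
  have h : Measurable fun u : VirtualPerm => (u.seq N = σ : Prop) :=
    measurable_of_seq N fun τ => (τ = σ : Prop)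
  exact measurableSet_setOfPred.2 h

theorem countable_fixing (N : ℕ) : {σ : Equiv.Perm ℕ | ∀ i, N ≤ i → σ i = i}.Countable := by
  refine Set.MapsTo.countable_of_injOn (f := fun (σ : Equiv.Perm ℕ) (i : Fin N) => σ i)
    (t := Set.univ) (fun _ _ => trivial) ?_ (Set.to_countable _)
  intro σ hσ τ hτ h
  ext i
  by_cases hi : i < N
  · exact congrFun h ⟨i, hi⟩
  · rw [hσ i (by omega), hτ i (by omega)]

/-- Cylinders of levels at least `n` form a generating π-system, because two of them are either
disjoint or nested. Starting from an arbitrary level matters: the action of `S_n × S_n` is a plain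
multiplication only from the level `n` on. -/
theorem measure_ext {μ ν : Measure VirtualPerm} [IsFiniteMeasure μ] (n : ℕ)
    (h : ∀ N, n ≤ N → ∀ σ : Equiv.Perm ℕ, (∀ i, N ≤ i → σ i = i) →
      μ (cylinder N σ) = ν (cylinder N σ)) : μ = ν := by
  let C : Set (Set VirtualPerm) := {s | ∃ N, n ≤ N ∧ ∃ σ : Equiv.Perm ℕ, s = cylinder N σ}
  have hgen : (inferInstance : MeasurableSpace VirtualPerm) = MeasurableSpace.generateFrom C := by
    apply le_antisymm
    · change MeasurableSpace.comap _ _ ≤ _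
      rw [← measurable_iff_comap_le]
      refine @measurable_pi_lambda _ _ _ (MeasurableSpace.generateFrom C) _ _ fun N =>
        @measurable_pi_lambda _ _ _ (MeasurableSpace.generateFrom C) _ _ fun i => ?_
      intro S _
      -- The level `N` may be below `n`, so the `N`-th component is read off from the component of
      -- level `N + n`.
      have : (fun u : VirtualPerm => u.seq N i) ⁻¹' S
          = ⋃ σ ∈ {σ : Equiv.Perm ℕ | (∀ i, N + n ≤ i → σ i = i) ∧ removeFrom N n σ i ∈ S},
              cylinder (N + n) σ := by
        ext u
        simp only [Set.mem_preimage, Set.mem_ofPred_eq, Set.mem_iUnion, exists_prop, cylinder]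
        constructor
        · intro hu
          exact ⟨_, ⟨u.fix _, by rwa [← u.seq_eq_removeFrom]⟩, rfl⟩
        · rintro ⟨σ, ⟨_, h2⟩, rfl⟩
          rwa [← u.seq_eq_removeFrom] at h2
      rw [this]
      refine MeasurableSet.biUnion ((countable_fixing (N + n)).mono fun σ hσ => hσ.1) fun σ _ => ?_
      exact MeasurableSpace.measurableSet_generateFrom ⟨N + n, by omega, σ, rfl⟩
    · refine MeasurableSpace.generateFrom_le ?_
      rintro _ ⟨N, _, σ, rfl⟩
      exact measurableSet_cylinder N σ
  have hpi : IsPiSystem C := by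
    have aux : ∀ N M σ τ, n ≤ M → N ≤ M → (cylinder N σ ∩ cylinder M τ).Nonempty →
        cylinder N σ ∩ cylinder M τ ∈ C := by
      rintro N M σ τ hM hNM ⟨u, hu1, hu2⟩
      refine ⟨M, hM, τ, Set.inter_eq_right.2 fun v hv => ?_⟩
      exact (seq_eq_of_le hNM (hv.trans hu2.symm)).trans hu1
    rintro _ ⟨N, hN, σ, rfl⟩ _ ⟨M, hM, τ, rfl⟩ hne
    rcases le_total N M with hNM | hNM
    · exact aux N M σ τ hM hNM hne
    · rw [Set.inter_comm] at hne ⊢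
      exact aux M N τ σ hN hNM hne
  have heq : ∀ s ∈ C, μ s = ν s := by
    rintro _ ⟨N, hN, σ, rfl⟩
    by_cases hσ : ∀ i, N ≤ i → σ i = i
    · exact h N hN σ hσ
    · have : cylinder N σ = ∅ := by
        ext u
        simp only [cylinder, Set.mem_ofPred_eq, Set.mem_empty_iff_false, iff_false]
        rintro rfl
        exact hσ (u.fix N)
      rw [this, measure_empty, measure_empty]
  refine Measure.ext_of_generateFrom_of_cover_subset hgen hpi
    (T := (fun σ => cylinder n σ) '' {σ : Equiv.Perm ℕ | ∀ i, n ≤ i → σ i = i}) ?_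
    ((countable_fixing n).image _) ?_ (fun s _ => measure_ne_top μ s) heq
  · rintro _ ⟨σ, _, rfl⟩
    exact ⟨n, le_rfl, σ, rfl⟩
  · ext u
    simp only [Set.sUnion_image, Set.mem_iUnion, Set.mem_univ, iff_true]
    exact ⟨u.seq n, u.fix n, rfl⟩

theorem sameCycle_iff_of_le (u : VirtualPerm) {i j N M : ℕ} (hi : i < N) (hj : j < N)
    (hNM : N ≤ M) : (u.seq N).SameCycle i j ↔ (u.seq M).SameCycle i j := by
  induction M, hNM using Nat.le_induction with
  | base => rfl
  | succ M hM ih => rw [ih, ← u.compat M, sameCycle_removePoint (by omega) (by omega)]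

end VirtualPerm

/-! ### The lengths of the tables of a virtual permutation -/

theorem measurable_tableLength (i : ℕ) : Measurable fun u : VirtualPerm => tableLength u i := by
  refine Measurable.limsup fun N => ?_
  exact VirtualPerm.measurable_of_seq N fun σ => ({j | σ.SameCycle i j}.ncard : ℝ) / N

theorem measurable_tableLengths : Measurable tableLengths := by
  classical
  refine measurable_rank.comp (measurable_pi_lambda _ fun i => ?_)
  refine Measurable.ite ?_ (measurable_tableLength i) measurable_const
  exact measurableSet_setOfPred.2 (VirtualPerm.measurable_of_seq (i + 1)
    fun σ => (∀ j < i, ¬ σ.SameCycle i j : Prop))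

/-- The tool by which restaurants are computed: a labeling `f` of the guests by tables replaces the
abstract classes. Each table is listed at its least guest, which `Nat.find` recovers from the label;
labels with nonpositive length may be unoccupied, since they are invisible in the rearrangement. -/
theorem tableLengths_eq_rank {K : Type*} (v : VirtualPerm) (f : ℕ → K) (L : K → ℝ)
    (hf : ∀ i j, ∃ N, i < N ∧ j < N ∧ ((v.seq N).SameCycle i j ↔ f i = f j))
    (hL : ∀ i, tableLength v i = L (f i)) (hs : ∀ k, 0 < L k → ∃ i, f i = k) :
    tableLengths v = rank L := by
  classical
  have hf' : ∀ i j N, i < N → j < N → ((v.seq N).SameCycle i j ↔ f i = f j) := by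
    intro i j N hi hj
    obtain ⟨M, hMi, hMj, hM⟩ := hf i j
    rw [← hM]
    rcases le_total N M with h | h
    · exact v.sameCycle_iff_of_le hi hj h
    · exact (v.sameCycle_iff_of_le hMi hMj h).symm
  have hmin : ∀ i, (∀ j < i, ¬ (v.seq (i + 1)).SameCycle i j) ↔ ∀ j < i, f i ≠ f j := fun i =>
    forall_congr' fun j => forall_congr' fun hj =>
      not_congr (hf' i j (i + 1) (by omega) (by omega))
  unfold tableLengths
  let a : ℕ → ℝ := fun i =>
    if ∀ j < i, ¬ (v.seq (i + 1)).SameCycle i j then tableLength v i else 0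
  have ha : ∀ i, 0 < a i ↔ (∀ j < i, f i ≠ f j) ∧ 0 < L (f i) := by
    intro i
    simp only [a, hmin, hL]
    split_ifs with h
    · exact ⟨fun h' => ⟨h, h'⟩, fun h' => h'.2⟩
    · exact ⟨fun h' => absurd h' (lt_irrefl _), fun h' => absurd h'.1 h⟩
  refine rank_eq_of_equiv (a := a) (Equiv.ofBijective
    (fun i : {i // 0 < a i} => (⟨f i, ((ha i).1 i.2).2⟩ : {k // 0 < L k})) ⟨?_, ?_⟩) ?_
  · rintro ⟨i, hi⟩ ⟨j, hj⟩ h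
    have h' : f i = f j := congrArg Subtype.val h
    refine Subtype.ext ?_
    rcases lt_trichotomy i j with hlt | heq | hlt
    · exact absurd h'.symm (((ha j).1 hj).1 i hlt)
    · exact heq
    · exact absurd h' (((ha i).1 hi).1 j hlt)
  · rintro ⟨k, hk⟩
    have hex := hs k hk
    refine ⟨⟨Nat.find hex, (ha _).2 ⟨fun j hj => ?_, ?_⟩⟩, Subtype.ext (Nat.find_spec hex)⟩
    · rw [Nat.find_spec hex]
      exact fun h => Nat.find_min hex hj h.symm
    · rwa [Nat.find_spec hex]
  · rintro ⟨i, hi⟩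
    change L (f i) = a i
    have : ∀ j < i, ¬ (v.seq (i + 1)).SameCycle i j := (hmin i).2 ((ha i).1 hi).1
    simp only [a, if_pos this, hL]

/-- Two guests of a virtual permutation sit at the same table. -/
def tableSetoid (u : VirtualPerm) : Setoid ℕ where
  r i j := ∃ N, i < N ∧ j < N ∧ (u.seq N).SameCycle i j
  iseqv := by
    refine ⟨fun i => ⟨i + 1, by omega, by omega, .refl _ _⟩, ?_, ?_⟩
    · rintro i j ⟨N, hi, hj, h⟩
      exact ⟨N, hj, hi, h.symm⟩
    · rintro i j k ⟨N, hi, hj, h⟩ ⟨M, hj', hk, h'⟩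
      refine ⟨max N M, lt_max_of_lt_left hi, lt_max_of_lt_right hk, ?_⟩
      exact ((u.sameCycle_iff_of_le hi hj (le_max_left _ _)).1 h).trans
        ((u.sameCycle_iff_of_le hj' hk (le_max_right _ _)).1 h')

theorem tableLength_congr {u : VirtualPerm} {i j N : ℕ} (hi : i < N) (hj : j < N)
    (h : (u.seq N).SameCycle i j) : tableLength u i = tableLength u j := by
  refine Filter.limsup_congr ?_
  filter_upwards [Filter.eventually_ge_atTop N] with M hM
  have h' := (u.sameCycle_iff_of_le hi hj hM).1 h
  congr 3
  ext k
  exact ⟨fun hk => h'.symm.trans hk, fun hk => h'.trans hk⟩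

/-- A renumbering of finitely many guests does not change the tables. -/
theorem tableLengths_conj {u v : VirtualPerm} {n : ℕ} (ρ : Equiv.Perm ℕ)
    (hρ : ∀ i, n ≤ i → ρ i = i) (h : ∀ N, n ≤ N → v.seq N = ρ * u.seq N * ρ⁻¹) :
    tableLengths v = tableLengths u := by
  let K := Quotient (tableSetoid u)
  let L : K → ℝ := Quotient.lift (tableLength u) fun i j ⟨N, hi, hj, hc⟩ =>
    tableLength_congr hi hj hc
  have hu : tableLengths u = rank L := by
    refine tableLengths_eq_rank u (fun i => Quotient.mk (tableSetoid u) i) L (fun i j => ?_)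
      (fun i => rfl) fun k _ => Quotient.exists_rep k
    refine ⟨i + j + 1, by omega, by omega, ⟨fun hc => Quotient.sound ⟨_, by omega, by omega, hc⟩,
      fun hc => ?_⟩⟩
    obtain ⟨N, hi, hj, hN⟩ := Quotient.exact hc
    rcases le_total N (i + j + 1) with hle | hle
    · exact (u.sameCycle_iff_of_le hi hj hle).1 hN
    · exact (u.sameCycle_iff_of_le (by omega) (by omega) hle).2 hN
  have hfix' : ∀ i, n ≤ i → ρ⁻¹ i = i := fun i hi => Equiv.Perm.inv_eq_iff_eq.2 (hρ i hi).symm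
  have hlt : ∀ N, n ≤ N → ∀ i, i < N → ρ⁻¹ i < N := by
    intro N hN i hi
    by_contra hc
    have h1 := hρ (ρ⁻¹ i) (by omega)
    rw [perm_apply_inv] at h1
    omega
  have hsc : ∀ N, n ≤ N → ∀ i j, (v.seq N).SameCycle i j ↔ (u.seq N).SameCycle (ρ⁻¹ i) (ρ⁻¹ j) := by
    intro N hN i j
    rw [h N hN, Equiv.Perm.sameCycle_conj]
  rw [hu]
  -- The guest `i` of `v` inherits the table of the guest `ρ⁻¹ i` of `u`.
  refine tableLengths_eq_rank v (fun i => Quotient.mk (tableSetoid u) (ρ⁻¹ i)) L (fun i j => ?_)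
      (fun i => ?_) fun k _ => ?_
  · let N := n + i + j + 1
    refine ⟨N, by omega, by omega, ?_⟩
    have hi' := hlt N (by omega) i (by omega)
    have hj' := hlt N (by omega) j (by omega)
    rw [hsc N (by omega)]
    refine ⟨fun hc => Quotient.sound ⟨N, hi', hj', hc⟩, fun hc => ?_⟩
    obtain ⟨M, hi, hj, hM⟩ := Quotient.exact hc
    rcases le_total N M with hle | hle
    · exact (u.sameCycle_iff_of_le hi' hj' hle).2 hM
    · exact (u.sameCycle_iff_of_le hi hj hle).1 hM
  · change tableLength v i = tableLength u (ρ⁻¹ i)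
    refine Filter.limsup_congr ?_
    filter_upwards [Filter.eventually_ge_atTop n] with N hN
    have : {j | (v.seq N).SameCycle i j} = ρ '' {j | (u.seq N).SameCycle (ρ⁻¹ i) j} := by
      ext j
      rw [Set.mem_ofPred_eq, hsc N hN]
      constructor
      · intro hj
        exact ⟨ρ⁻¹ j, hj, perm_apply_inv ρ j⟩
      · rintro ⟨k, hk, rfl⟩
        rwa [perm_inv_apply]
    rw [this, Set.ncard_image_of_injective _ ρ.injective]
  · obtain ⟨i, rfl⟩ := Quotient.exists_rep k
    exact ⟨ρ i, by rw [perm_inv_apply]⟩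

end Restaurants

namespace Restaurants

noncomputable section

/-! ### The action and the measure -/

theorem extendPerm_apply_fin {n : ℕ} (h : Equiv.Perm (Fin n)) (i : Fin n) :
    extendPerm h i = h i :=
  Equiv.Perm.viaFintypeEmbedding_apply_image h Fin.valEmbedding i

theorem extendPerm_mul {n : ℕ} (g h : Equiv.Perm (Fin n)) :
    extendPerm (g * h) = extendPerm g * extendPerm h := by
  ext i
  by_cases hi : i < n
  · lift i to Fin n using hi
    rw [Equiv.Perm.mul_apply, extendPerm_apply_fin, extendPerm_apply_fin, extendPerm_apply_fin,
      Equiv.Perm.mul_apply]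
  · rw [Equiv.Perm.mul_apply, extendPerm_fix _ i (by omega), extendPerm_fix _ i (by omega),
      extendPerm_fix _ i (by omega)]

theorem extendPerm_one (n : ℕ) : extendPerm (1 : Equiv.Perm (Fin n)) = 1 := by
  have h := extendPerm_mul (1 : Equiv.Perm (Fin n)) 1
  rw [mul_one] at h
  exact (mul_eq_left.1 h.symm)

theorem extendPerm_inv {n : ℕ} (g : Equiv.Perm (Fin n)) :
    extendPerm g⁻¹ = (extendPerm g)⁻¹ := by
  rw [eq_inv_iff_mul_eq_one, ← extendPerm_mul, inv_mul_cancel, extendPerm_one]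

theorem act_act {n : ℕ} (h₁ h₂ g₁ g₂ : Equiv.Perm (Fin n)) (u : VirtualPerm) :
    act h₁ h₂ (act g₁ g₂ u) = act (g₁ * h₁) (g₂ * h₂) u := by
  refine VirtualPerm.ext_of_le n fun N hN => ?_
  rw [act_seq _ _ _ hN, act_seq _ _ _ hN, act_seq _ _ _ hN, extendPerm_mul, extendPerm_mul,
    mul_inv_rev]
  simp only [mul_assoc]

theorem act_one {n : ℕ} (u : VirtualPerm) : act (1 : Equiv.Perm (Fin n)) 1 u = u := by
  refine VirtualPerm.ext_of_le n fun N hN => ?_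
  rw [act_seq _ _ _ hN, extendPerm_one, inv_one, one_mul, mul_one]

theorem act_congr {n m : ℕ} {h₁ h₂ : Equiv.Perm (Fin n)} {g₁ g₂ : Equiv.Perm (Fin m)}
    (e₁ : extendPerm h₁ = extendPerm g₁) (e₂ : extendPerm h₂ = extendPerm g₂) :
    act h₁ h₂ = act g₁ g₂ := by
  funext u
  refine VirtualPerm.ext_of_le (max n m) fun N hN => ?_
  rw [act_seq _ _ _ (le_of_max_le_left hN), act_seq _ _ _ (le_of_max_le_right hN), e₁, e₂]

theorem measurable_act {n : ℕ} (h₁ h₂ : Equiv.Perm (Fin n)) : Measurable (act h₁ h₂) := by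
  rw [measurable_comap_iff]
  refine measurable_pi_lambda _ fun N => measurable_pi_lambda _ fun i => ?_
  exact VirtualPerm.measurable_of_seq (N + n) fun σ =>
    removeFrom N n ((extendPerm h₁)⁻¹ * σ * extendPerm h₂) i

/-- The action is a measurable bijection. -/
def actEquiv {n : ℕ} (h₁ h₂ : Equiv.Perm (Fin n)) : VirtualPerm ≃ᵐ VirtualPerm where
  toFun := act h₁ h₂
  invFun := act h₁⁻¹ h₂⁻¹
  left_inv u := by rw [act_act, mul_inv_cancel, mul_inv_cancel, act_one]
  right_inv u := by rw [act_act, inv_mul_cancel, inv_mul_cancel, act_one]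
  measurable_toFun := measurable_act h₁ h₂
  measurable_invFun := measurable_act _ _

/-- The increment of the number of cycles under the action. -/
def cycleIncrement {n : ℕ} (h₁ h₂ : Equiv.Perm (Fin n)) (u : VirtualPerm) : ℤ :=
  (cycleCount n ((act h₁ h₂ u).seq n) : ℤ) - cycleCount n (u.seq n)

/-- A guest with a number at least `n` opens a new cycle in `u` exactly when it does so in the
transformed permutation, so both cycle counts grow simultaneously. -/
theorem cycleIncrement_eq {n : ℕ} (h₁ h₂ : Equiv.Perm (Fin n)) (u : VirtualPerm) {N : ℕ}
    (hN : n ≤ N) :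
    cycleIncrement h₁ h₂ u = (cycleCount N ((act h₁ h₂ u).seq N) : ℤ) - cycleCount N (u.seq N) := by
  induction N, hN using Nat.le_induction with
  | base => rfl
  | succ N hN ih =>
    rw [ih, cycleCount_succ (VirtualPerm.fix _ _), cycleCount_succ (VirtualPerm.fix _ _),
      VirtualPerm.compat, VirtualPerm.compat]
    have : (act h₁ h₂ u).seq (N + 1) N = N ↔ u.seq (N + 1) N = N := by
      rw [act_seq _ _ _ (by omega), Equiv.Perm.mul_apply, Equiv.Perm.mul_apply,
        extendPerm_fix _ N hN, Equiv.Perm.inv_eq_iff_eq, extendPerm_fix _ N hN]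
    simp only [this]
    push_cast
    ring

theorem measurable_cycleIncrement {n : ℕ} (h₁ h₂ : Equiv.Perm (Fin n)) :
    Measurable (cycleIncrement h₁ h₂) := by
  have : cycleIncrement h₁ h₂ = fun u : VirtualPerm =>
      (cycleCount n ((extendPerm h₁)⁻¹ * u.seq n * extendPerm h₂) : ℤ) - cycleCount n (u.seq n) := by
    funext u
    rw [cycleIncrement, act_seq _ _ _ le_rfl]
  rw [this]
  exact VirtualPerm.measurable_of_seq n fun σ =>
    (cycleCount n ((extendPerm h₁)⁻¹ * σ * extendPerm h₂) : ℤ) - cycleCount n σ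

/-- The action carries a cylinder of level `N ≥ n` to a cylinder of the same level. Their Ewens
weights have the same denominator, so the ratio is `z` to the difference of the cycle counts, which
does not depend on `N`. -/
theorem comap_act {n : ℕ} (z : PosReal) (h₁ h₂ : Equiv.Perm (Fin n)) :
    (virtualMeasure z).comap (act h₁ h₂)
      = (virtualMeasure z).withDensity
          fun u => ENNReal.ofReal ((z : ℝ) ^ cycleIncrement h₁ h₂ u) := by
  have hz := z.2
  have hcomap : (virtualMeasure z).comap (act h₁ h₂)
      = (virtualMeasure z).map (actEquiv h₁ h₂).symm :=
    ((actEquiv h₁ h₂).map_symm).symm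
  have : IsProbabilityMeasure ((virtualMeasure z).comap (act h₁ h₂)) := by
    rw [hcomap]
    exact Measure.isProbabilityMeasure_map (actEquiv h₁ h₂).symm.measurable.aemeasurable
  refine VirtualPerm.measure_ext n fun N hN σ hσ => ?_
  let σ' := (extendPerm h₁)⁻¹ * σ * extendPerm h₂
  have hσ' : ∀ i, N ≤ i → σ' i = i := by
    intro i hi
    simp only [σ', Equiv.Perm.mul_apply]
    rw [extendPerm_fix _ i (by omega), hσ i hi, extendPerm_inv_fix _ i (by omega)]
  have hpre : act h₁ h₂ '' VirtualPerm.cylinder N σ = VirtualPerm.cylinder N σ' := by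
    ext v
    constructor
    · rintro ⟨u, hu, rfl⟩
      change (act h₁ h₂ u).seq N = σ'
      rw [act_seq _ _ _ hN, show u.seq N = σ from hu]
    · intro hv
      refine ⟨(actEquiv h₁ h₂).symm v, ?_, (actEquiv h₁ h₂).apply_symm_apply v⟩
      change (act h₁⁻¹ h₂⁻¹ v).seq N = σ
      rw [act_seq _ _ _ hN, show v.seq N = σ' from hv, extendPerm_inv, extendPerm_inv]
      simp [σ', mul_assoc]
  rw [Measure.comap_apply (act h₁ h₂) (actEquiv h₁ h₂).injective
    (fun s hs => (actEquiv h₁ h₂).measurableSet_image.2 hs) _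
    (VirtualPerm.measurableSet_cylinder N σ), hpre,
    withDensity_apply _ (VirtualPerm.measurableSet_cylinder N σ)]
  have hconst : ∀ u ∈ VirtualPerm.cylinder N σ,
      ENNReal.ofReal ((z : ℝ) ^ cycleIncrement h₁ h₂ u)
        = ENNReal.ofReal ((z : ℝ) ^ ((cycleCount N σ' : ℤ) - cycleCount N σ)) := by
    intro u hu
    rw [cycleIncrement_eq h₁ h₂ u hN, act_seq _ _ _ hN, show u.seq N = σ from hu]
  rw [setLIntegral_congr_fun (VirtualPerm.measurableSet_cylinder N σ) hconst,
    setLIntegral_const, VirtualPerm.cylinder, VirtualPerm.cylinder,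
    virtualMeasure_cylinder z N σ hσ, virtualMeasure_cylinder z N σ' hσ',
    ← ENNReal.ofReal_mul (by positivity)]
  congr 1
  rw [zpow_sub₀ hz.ne', zpow_natCast, zpow_natCast]
  field_simp

theorem act_quasiInvariant {n : ℕ} (z : PosReal) (h₁ h₂ : Equiv.Perm (Fin n)) :
    (virtualMeasure z).map (act h₁ h₂) ≪ virtualMeasure z := by
  have h : (virtualMeasure z).map (act h₁ h₂) = (virtualMeasure z).comap (act h₁⁻¹ h₂⁻¹) :=
    ((actEquiv h₁ h₂).symm.map_symm)
  rw [h, comap_act]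
  exact withDensity_absolutelyContinuous _ _

theorem radonNikodym_act {n : ℕ} (z : PosReal) (h₁ h₂ : Equiv.Perm (Fin n)) :
    ∀ᵐ u ∂(virtualMeasure z),
      radonNikodym (virtualMeasure z) (act h₁ h₂) u = z ^ cycleIncrement h₁ h₂ u := by
  have hm : Measurable fun u => ENNReal.ofReal ((z : ℝ) ^ cycleIncrement h₁ h₂ u) :=
    ENNReal.measurable_ofReal.comp ((measurable_of_countable fun k : ℤ => (z : ℝ) ^ k).comp
      (measurable_cycleIncrement h₁ h₂))
  have h := Measure.rnDeriv_withDensity (virtualMeasure z) hm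
  rw [← comap_act] at h
  filter_upwards [h] with u hu
  have hz : 0 < (z : ℝ) ^ cycleIncrement h₁ h₂ u := zpow_pos z.2 _
  rw [radonNikodym, hu, toPosReal, dif_pos (by rwa [ENNReal.toReal_ofReal hz.le])]
  exact Subtype.ext (ENNReal.toReal_ofReal hz.le)

theorem measurable_toPosReal : Measurable toPosReal := by
  have hpos : MeasurableSet {x : ENNReal | 0 < x.toReal} :=
    measurableSet_lt measurable_const ENNReal.measurable_toReal
  have h : Measurable fun x : ENNReal => if 0 < x.toReal then x.toReal else 1 :=
    Measurable.ite hpos ENNReal.measurable_toReal measurable_const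
  have h' : ∀ x : ENNReal, 0 < if 0 < x.toReal then x.toReal else 1 := fun x => by
    split_ifs with hx
    · exact hx
    · exact one_pos
  have e : toPosReal = fun x : ENNReal =>
      (⟨if 0 < x.toReal then x.toReal else 1, h' x⟩ : PosReal) := by
    funext x
    unfold toPosReal
    by_cases hx : 0 < x.toReal
    · simp only [hx, dite_true, if_true]
    · simp only [hx, dite_false, if_false]
      rfl
  rw [e]
  exact h.subtype_mk

theorem measurable_radonNikodym {M : Type*} [MeasurableSpace M] (μ : Measure M) (φ : M → M) :
    Measurable (radonNikodym μ φ) :=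
  measurable_toPosReal.comp (Measure.measurable_rnDeriv _ _)

/-! ### Products of polymorphisms concentrated on graphs -/

section Polymorphisms

variable {M N K : Type*} [MeasurableSpace M] [MeasurableSpace N] [MeasurableSpace K]

instance : MeasurableMul₂ PosReal :=
  ⟨Measurable.subtype_mk (by fun_prop)⟩

instance : MeasurableInv PosReal :=
  ⟨Measurable.subtype_mk (by fun_prop)⟩

/-- The conditional measures of a graph are delta measures, so the abstract `condKernel` agrees with
a deterministic kernel outside a `μ`-null set. The absolute continuity hypothesis makes this set
negligible for `p`. -/
theorem comp_ofMap [StandardBorelSpace K] [Nonempty K] (p : Measure (M × N × PosReal))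
    [SFinite p] (μ : Measure N) [IsFiniteMeasure μ] {φ : N → K} {D : N → PosReal}
    (hφ : Measurable φ) (hD : Measurable D) (hp : p.map (fun x => x.2.1) ≪ μ) :
    comp p (ofMap μ φ D) = p.map fun x => (x.1, φ x.2.1, x.2.2 * D x.2.1) := by
  have hm : Measurable fun n => (φ n, D n) := hφ.prodMk hD
  have hpr : Measurable fun x : M × N × PosReal => x.2.1 := measurable_fst.comp measurable_snd
  let κ : Kernel N (K × PosReal) := Kernel.deterministic (fun n => (φ n, D n)) hm
  have h1 : ofMap μ φ D = μ ⊗ₘ κ := (Measure.compProd_deterministic hm).symm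
  have h2 : (ofMap μ φ D).fst = μ := by
    rw [h1, Measure.fst_compProd]
  have h3 : ∀ᵐ n ∂μ, κ n = (ofMap μ φ D).condKernel n := by
    have := eq_condKernel_of_measure_eq_compProd (ρ := ofMap μ φ D) κ (by rw [h2, h1])
    rwa [h2] at this
  have h4 : ∀ᵐ x ∂p, κ x.2.1 = (ofMap μ φ D).condKernel x.2.1 :=
    ae_of_ae_map hpr.aemeasurable (hp h3)
  have h5 : p ⊗ₘ ((ofMap μ φ D).condKernel.comap (fun x : M × N × PosReal => x.2.1) hpr)
      = p ⊗ₘ (Kernel.deterministic (fun x : M × N × PosReal => (φ x.2.1, D x.2.1))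
        (hm.comp hpr)) := by
    refine Measure.compProd_congr ?_
    filter_upwards [h4] with x hx
    rw [Kernel.comap_apply, ← hx, Kernel.deterministic_apply, Kernel.deterministic_apply]
  unfold comp
  rw [h5, Measure.compProd_deterministic, Measure.map_map (by fun_prop) (by fun_prop)]
  rfl

end Polymorphisms

instance (z : PosReal) : SFinite (star (forget z)) := by
  unfold star
  infer_instance

theorem star_forget (z : PosReal) :
    star (forget z) = (virtualMeasure z).map fun u => (tableLengths u, u, 1) := by
  have hT := measurable_tableLengths
  have hm : Measurable fun u : VirtualPerm => (u, tableLengths u, (1 : PosReal)) := by fun_prop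
  have h1 : (forget z).withDensity (fun x => ENNReal.ofReal x.2.2) = forget z := by
    have : (fun x : VirtualPerm × Restaurant × PosReal => ENNReal.ofReal x.2.2)
        =ᵐ[forget z] 1 := by
      unfold forget ofMap
      refine (ae_map_iff hm.aemeasurable ?_).2 (ae_of_all _ fun u => by simp)
      exact measurableSet_eq_fun (by fun_prop) measurable_const
    rw [withDensity_congr_ae this, withDensity_one]
  unfold star
  rw [h1]
  unfold forget ofMap
  rw [Measure.map_map (by fun_prop) hm]
  refine congrArg (fun f => Measure.map f _) (funext fun u => ?_)
  simp

/-- After the star is rewritten as an image of `virtualMeasure z`, both products are compositions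
with graphs. The second one is legitimate by the quasi-invariance of the measure under the action.
-/
theorem chipPolymorphism_eq_map {n : ℕ} (z : PosReal) (h₁ h₂ : Equiv.Perm (Fin n)) :
    chipPolymorphism z h₁ h₂ = (virtualMeasure z).map fun u =>
      (tableLengths u, tableLengths (act h₁ h₂ u), z ^ cycleIncrement h₁ h₂ u) := by
  have hT := measurable_tableLengths
  have hA := measurable_act h₁ h₂
  have hR := measurable_radonNikodym (virtualMeasure z) (act h₁ h₂)
  have hm : Measurable fun u : VirtualPerm => (tableLengths u, u, (1 : PosReal)) := by fun_prop
  have e1 : comp (star (forget z)) (actPolymorphism z h₁ h₂) = (virtualMeasure z).map fun u =>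
      (tableLengths u, act h₁ h₂ u, radonNikodym (virtualMeasure z) (act h₁ h₂) u) := by
    unfold actPolymorphism
    rw [comp_ofMap _ _ hA hR, star_forget, Measure.map_map (by fun_prop) hm]
    · refine congrArg (fun f => Measure.map f _) (funext fun u => ?_)
      simp
    · rw [star_forget, Measure.map_map (by fun_prop) hm]
      exact (Measure.map_id (μ := virtualMeasure z)).absolutelyContinuous
  unfold chipPolymorphism
  rw [e1]
  unfold forget
  rw [comp_ofMap _ _ hT measurable_const, Measure.map_map (by fun_prop) (by fun_prop)]
  · refine Measure.map_congr ?_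
    filter_upwards [radonNikodym_act z h₁ h₂] with u hu
    simp [hu]
  · rw [Measure.map_map (by fun_prop) (by fun_prop)]
    exact act_quasiInvariant z h₁ h₂

/-- For the second marginal, the weight `z ^ cycleIncrement` is the density of the pulled back
measure, so the claim is the change of variables `u ↦ h₁⁻¹ u h₂`. -/
theorem isPolymorphism_chipPolymorphism {n : ℕ} (z : PosReal) (h₁ h₂ : Equiv.Perm (Fin n))
    {P : Measure Restaurant} (hP : (virtualMeasure z).map tableLengths = P) :
    IsPolymorphism P P (chipPolymorphism z h₁ h₂) := by
  have hT := measurable_tableLengths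
  have hA := measurable_act h₁ h₂
  have hz : Measurable fun u => z ^ cycleIncrement h₁ h₂ u :=
    (measurable_of_countable fun k : ℤ => z ^ k).comp (measurable_cycleIncrement h₁ h₂)
  have hm : Measurable fun u => (tableLengths u, tableLengths (act h₁ h₂ u),
      z ^ cycleIncrement h₁ h₂ u) := by fun_prop
  rw [chipPolymorphism_eq_map]
  refine ⟨?_, ?_⟩
  · rw [Measure.map_map (by fun_prop) hm]
    exact hP
  · ext A hA'
    have hs : MeasurableSet ((fun x : Restaurant × Restaurant × PosReal => x.2.1) ⁻¹' A) :=
      (measurable_fst.comp measurable_snd) hA'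
    rw [Measure.map_apply (by fun_prop) hA', withDensity_apply _ hs,
      setLIntegral_map hs (by fun_prop) hm]
    have h1 : ∀ u, ENNReal.ofReal ((z ^ cycleIncrement h₁ h₂ u : PosReal) : ℝ)
        = ENNReal.ofReal ((z : ℝ) ^ cycleIncrement h₁ h₂ u) := fun u => by simp
    have hpre : MeasurableSet ((fun u => tableLengths (act h₁ h₂ u)) ⁻¹' A) :=
      (hT.comp hA) hA'
    change ∫⁻ u in (fun u => tableLengths (act h₁ h₂ u)) ⁻¹' A,
      ENNReal.ofReal ((z ^ cycleIncrement h₁ h₂ u : PosReal) : ℝ) ∂_ = _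
    simp_rw [h1]
    rw [← withDensity_apply _ hpre, ← comap_act]
    have hcomap : (virtualMeasure z).comap (act h₁ h₂)
        = (virtualMeasure z).map (actEquiv h₁ h₂).symm :=
      ((actEquiv h₁ h₂).map_symm).symm
    rw [hcomap, Measure.map_apply (actEquiv h₁ h₂).symm.measurable hpre, ← hP,
      Measure.map_apply hT hA']
    congr 1
    ext u
    change tableLengths (actEquiv h₁ h₂ ((actEquiv h₁ h₂).symm u)) ∈ A ↔ _
    rw [MeasurableEquiv.apply_symm_apply]
    rfl

/-! ### Dependence of the polymorphism on the double coset only -/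

theorem cycleIncrement_congr {n m : ℕ} {h₁ h₂ : Equiv.Perm (Fin n)} {g₁ g₂ : Equiv.Perm (Fin m)}
    (e : act h₁ h₂ = act g₁ g₂) (u : VirtualPerm) :
    cycleIncrement h₁ h₂ u = cycleIncrement g₁ g₂ u := by
  rw [cycleIncrement_eq h₁ h₂ u (le_max_left n m), cycleIncrement_eq g₁ g₂ u (le_max_right n m), e]

theorem chipPolymorphism_congr {n m : ℕ} (z : PosReal) {h₁ h₂ : Equiv.Perm (Fin n)}
    {g₁ g₂ : Equiv.Perm (Fin m)} (e : act h₁ h₂ = act g₁ g₂) :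
    chipPolymorphism z h₁ h₂ = chipPolymorphism z g₁ g₂ := by
  rw [chipPolymorphism_eq_map, chipPolymorphism_eq_map]
  simp only [cycleIncrement_congr e, e]

theorem cycleCount_eq_card {n : ℕ} (σ : Equiv.Perm ℕ) (s : Setoid (Fin n))
    (hs : ∀ i j : Fin n, s i j ↔ σ.SameCycle i j) : cycleCount n σ = Nat.card (Quotient s) := by
  classical
  have hmem : ∀ i : {i // i ∈ (Finset.range n).filter fun i => ∀ j < i, ¬ σ.SameCycle i j},
      i.1 < n := fun i => Finset.mem_range.1 (Finset.mem_filter.1 i.2).1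
  unfold cycleCount
  rw [← Nat.card_eq_finsetCard]
  refine Nat.card_congr (Equiv.ofBijective (fun i => Quotient.mk s ⟨i.1, hmem i⟩) ⟨?_, ?_⟩)
  · intro i j hij
    have h : σ.SameCycle i.1 j.1 := (hs ⟨i.1, hmem i⟩ ⟨j.1, hmem j⟩).1 (Quotient.exact hij)
    refine Subtype.ext ?_
    rcases lt_trichotomy i.1 j.1 with hlt | heq | hlt
    · exact absurd h.symm ((Finset.mem_filter.1 j.2).2 _ hlt)
    · exact heq
    · exact absurd h ((Finset.mem_filter.1 i.2).2 _ hlt)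
  · intro q
    obtain ⟨i, rfl⟩ := Quotient.exists_rep q
    have hex : ∃ m, σ.SameCycle i m := ⟨i, .refl _ _⟩
    have hle : Nat.find hex ≤ i := Nat.find_min' hex (.refl _ _)
    refine ⟨⟨Nat.find hex, Finset.mem_filter.2 ⟨Finset.mem_range.2 (hle.trans_lt i.2), ?_⟩⟩, ?_⟩
    · intro j hj hc
      exact Nat.find_min hex hj ((Nat.find_spec hex).trans hc)
    · exact Quotient.sound ((hs _ _).2 (Nat.find_spec hex).symm)

theorem cycleCount_conj {n : ℕ} (ρ : Equiv.Perm (Fin n)) (σ : Equiv.Perm ℕ) :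
    cycleCount n ((extendPerm ρ)⁻¹ * σ * extendPerm ρ) = cycleCount n σ := by
  let s : Setoid (Fin n) := (Equiv.Perm.SameCycle.setoid σ).comap Fin.val
  rw [cycleCount_eq_card σ s fun _ _ => Iff.rfl,
    cycleCount_eq_card ((extendPerm ρ)⁻¹ * σ * extendPerm ρ) (s.comap ρ)]
  · exact Nat.card_congr (Quotient.congr ρ fun _ _ => Iff.rfl)
  · intro i j
    have h := Equiv.Perm.sameCycle_conj (f := σ) (g := (extendPerm ρ)⁻¹) (x := (i : ℕ)) (y := j)
    rw [inv_inv] at h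
    rw [h, extendPerm_apply_fin, extendPerm_apply_fin]
    rfl

theorem cycleIncrement_act {n : ℕ} (ρ τ h₁ h₂ : Equiv.Perm (Fin n)) (u : VirtualPerm) :
    cycleIncrement (ρ * h₁ * τ) (ρ * h₂ * τ) u = cycleIncrement h₁ h₂ (act ρ ρ u) := by
  have h : ∀ (π : Equiv.Perm (Fin n)) (v : VirtualPerm),
      cycleCount n ((act π π v).seq n) = cycleCount n (v.seq n) := fun π v => by
    rw [act_seq _ _ _ le_rfl, cycleCount_conj]
  rw [cycleIncrement, cycleIncrement, ← act_act τ τ (ρ * h₁) (ρ * h₂), h, h, ← act_act h₁ h₂ ρ ρ]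

theorem tableLengths_act_self {n : ℕ} (ρ : Equiv.Perm (Fin n)) (u : VirtualPerm) :
    tableLengths (act ρ ρ u) = tableLengths u := by
  refine tableLengths_conj (n := n) (extendPerm ρ)⁻¹ (extendPerm_inv_fix ρ) fun N hN => ?_
  rw [act_seq _ _ _ hN, inv_inv]

theorem map_act_self {n : ℕ} (z : PosReal) (ρ : Equiv.Perm (Fin n)) :
    (virtualMeasure z).map (act ρ ρ) = virtualMeasure z := by
  have h : (virtualMeasure z).map (act ρ ρ) = (virtualMeasure z).comap (act ρ⁻¹ ρ⁻¹) :=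
    ((actEquiv ρ ρ).symm.map_symm)
  rw [h, comap_act]
  have h0 : ∀ u, cycleIncrement ρ⁻¹ ρ⁻¹ u = 0 := fun u => by
    rw [cycleIncrement, act_seq _ _ _ le_rfl, cycleCount_conj, sub_self]
  simp only [h0, zpow_zero, ENNReal.ofReal_one]
  exact withDensity_one

/-- The diagonal action is a renumbering of guests: it preserves the measure, the tables and the
numbers of cycles. The factor `ρ` renumbers the guests before the transformation and `τ` renumbers
them afterwards. -/
theorem chipPolymorphism_mul {n : ℕ} (z : PosReal) (ρ τ h₁ h₂ : Equiv.Perm (Fin n)) :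
    chipPolymorphism z (ρ * h₁ * τ) (ρ * h₂ * τ) = chipPolymorphism z h₁ h₂ := by
  have hT := measurable_tableLengths
  have hA := measurable_act h₁ h₂
  have hz : Measurable fun u => z ^ cycleIncrement h₁ h₂ u :=
    (measurable_of_countable fun k : ℤ => z ^ k).comp (measurable_cycleIncrement h₁ h₂)
  rw [chipPolymorphism_eq_map, chipPolymorphism_eq_map]
  conv_rhs => rw [← map_act_self z ρ]
  rw [Measure.map_map (by fun_prop) (measurable_act ρ ρ)]
  refine congrArg (fun f => Measure.map f _) (funext fun u => ?_)
  simp only [Function.comp_apply]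
  rw [cycleIncrement_act, tableLengths_act_self ρ, ← act_act τ τ (ρ * h₁) (ρ * h₂),
    tableLengths_act_self τ, ← act_act h₁ h₂ ρ ρ]

/-- The polymorphism depends only on the chip. -/
theorem chipPolymorphism_reduce {n : ℕ} (z : PosReal) (h₁ h₂ : Equiv.Perm (Fin n))
    (k : Multiset ℕ) (hk : chip h₁ h₂ = k) :
    ∃ g : Equiv.Perm (Fin k.sum), g.cycleType = k ∧
      chipPolymorphism z h₁ h₂ = chipPolymorphism z g⁻¹ 1 := by
  have hsum : k.sum ≤ n := by
    rw [← hk, chip, Equiv.Perm.sum_cycleType]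
    simpa using (h₁⁻¹ * h₂).support.card_le_univ
  have h2 : ∀ a ∈ k, 2 ≤ a := fun a ha => by
    rw [← hk] at ha
    exact Equiv.Perm.two_le_of_mem_cycleType ha
  obtain ⟨g, hg⟩ := (Equiv.Perm.exists_with_cycleType_iff (α := Fin k.sum) (m := k)).2
    ⟨by simp, h2⟩
  refine ⟨g, hg, ?_⟩
  let e : Fin k.sum ↪ Fin n := Fin.castLEEmb hsum
  let g' : Equiv.Perm (Fin n) := g.viaFintypeEmbedding e
  have hg' : g'.cycleType = k := by
    rw [← hg]
    exact Equiv.Perm.cycleType_extendDomain _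
  -- The permutation `h₂ h₁⁻¹` is a conjugate of `h₁⁻¹ h₂`, so it has the cycle type `k` too.
  have hconj : IsConj (h₂ * h₁⁻¹) g' := by
    rw [Equiv.Perm.isConj_iff_cycleType_eq, hg', ← hk, chip]
    rw [← Equiv.Perm.cycleType_conj (σ := h₁⁻¹ * h₂) (τ := h₁)]
    group
  obtain ⟨ρ, hρ⟩ := isConj_iff.1 hconj
  have hext : extendPerm g' = extendPerm g := by
    ext i
    by_cases hi : i < k.sum
    · have e1 : extendPerm g' ((e ⟨i, hi⟩ : Fin n) : ℕ) = (g' (e ⟨i, hi⟩) : ℕ) :=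
        extendPerm_apply_fin g' _
      have e2 : g' (e ⟨i, hi⟩) = e (g ⟨i, hi⟩) :=
        Equiv.Perm.viaFintypeEmbedding_apply_image g e _
      have e3 : extendPerm g ((⟨i, hi⟩ : Fin k.sum) : ℕ) = (g ⟨i, hi⟩ : ℕ) :=
        extendPerm_apply_fin g _
      rw [e2] at e1
      exact e1.trans e3.symm
    · rw [extendPerm_fix g i (by omega)]
      by_cases hin : i < n
      · have e1 : extendPerm g' ((⟨i, hin⟩ : Fin n) : ℕ) = (g' ⟨i, hin⟩ : ℕ) :=
          extendPerm_apply_fin g' _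
        have e2 : g' ⟨i, hin⟩ = ⟨i, hin⟩ := by
          refine Equiv.Perm.viaFintypeEmbedding_apply_notMem_range g e ?_
          rintro ⟨j, hj⟩
          have := congrArg Fin.val hj
          simp only [e, Fin.castLEEmb_apply, Fin.val_castLE] at this
          omega
        rw [e2] at e1
        exact e1
      · exact extendPerm_fix g' i (by omega)
  -- The right factor `(ρ h₂)⁻¹` makes the second component trivial and leaves `ρ h₁ h₂⁻¹ ρ⁻¹ =
  -- g'⁻¹` in the first one.
  rw [← chipPolymorphism_congr z (act_congr (h₁ := g'⁻¹) (h₂ := 1) (g₁ := g⁻¹) (g₂ := 1)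
    (by rw [extendPerm_inv, extendPerm_inv, hext]) (by rw [extendPerm_one, extendPerm_one])),
    ← chipPolymorphism_mul z ρ (ρ * h₂)⁻¹ h₁ h₂, mul_inv_cancel, ← hρ]
  have : (ρ * (h₂ * h₁⁻¹) * ρ⁻¹)⁻¹ = ρ * h₁ * (ρ * h₂)⁻¹ := by group
  rw [this]


/-! ### The Mecke formula -/

/-- Resampling one coordinate does not change a product measure. This isolates one point of a block,
and one block of the process, from the rest. -/
theorem infinitePi_map_update {ι : Type*} {X : ι → Type*} [DecidableEq ι]
    [∀ i, MeasurableSpace (X i)] (P : ∀ i, Measure (X i)) [∀ i, IsProbabilityMeasure (P i)]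
    (i : ι) :
    ((Measure.infinitePi P).prod (P i)).map (fun p => Function.update p.1 i p.2)
      = Measure.infinitePi P := by
  have hm : Measurable fun p : ((j : ι) → X j) × X i => Function.update p.1 i p.2 := by
    refine measurable_pi_lambda _ fun j => ?_
    by_cases hj : j = i
    · subst hj
      simpa using measurable_snd
    · simp only [Function.update_of_ne hj]
      exact (measurable_pi_apply j).comp measurable_fst
  refine Measure.eq_infinitePi P fun s t ht => ?_
  rw [Measure.map_apply hm (MeasurableSet.pi s.countable_toSet fun j _ => ht j)]
  have hpre : (fun p : ((j : ι) → X j) × X i => Function.update p.1 i p.2) ⁻¹' (Set.pi s t)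
      = (Set.pi (s.erase i : Finset ι) t) ×ˢ (if i ∈ s then t i else Set.univ) := by
    ext p
    simp only [Set.mem_preimage, Set.mem_pi, Set.mem_prod, Finset.mem_coe, Finset.mem_erase]
    constructor
    · intro h
      refine ⟨fun j hj => ?_, ?_⟩
      · have := h j hj.2
        rwa [Function.update_of_ne hj.1] at this
      · split_ifs with his
        · have := h i his
          rwa [Function.update_self] at this
        · trivial
    · rintro ⟨h1, h2⟩ j hj
      by_cases hji : j = i
      · subst hji
        rw [Function.update_self]
        rwa [if_pos hj] at h2
      · rw [Function.update_of_ne hji]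
        exact h1 j ⟨hji, hj⟩
  rw [hpre, Measure.prod_prod, Measure.infinitePi_pi _ fun j _ => ht j]
  split_ifs with his
  · rw [mul_comm, Finset.mul_prod_erase s (fun j => P j (t j)) his]
  · rw [measure_univ, mul_one, Finset.erase_eq_of_notMem his]

theorem lintegral_poissonMeasure (r : NNReal) (f : ℕ → ENNReal) :
    ∫⁻ n, f n ∂(poissonMeasure r)
      = ∑' n : ℕ, ENNReal.ofReal (Real.exp (-r) * r ^ n / n.factorial) * f n := by
  simp [poissonMeasure, lintegral_sum_measure, lintegral_smul_measure]

/-- The identity `n p(n) = r p(n - 1)` for the Poisson distribution. -/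
theorem tsum_poisson_shift (r : NNReal) (f : ℕ → ENNReal) :
    ∑' n : ℕ, ENNReal.ofReal (Real.exp (-r) * r ^ n / n.factorial) * (n * f (n - 1))
      = r * ∑' n : ℕ, ENNReal.ofReal (Real.exp (-r) * r ^ n / n.factorial) * f n := by
  rw [tsum_eq_zero_add' ENNReal.summable]
  simp only [Nat.cast_zero, zero_mul, mul_zero, zero_add, Nat.add_sub_cancel]
  rw [← ENNReal.tsum_mul_left]
  refine tsum_congr fun n => ?_
  have h : ENNReal.ofReal (Real.exp (-r) * r ^ (n + 1) / (n + 1).factorial) * ((n + 1 : ℕ) : ENNReal)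
      = r * ENNReal.ofReal (Real.exp (-r) * r ^ n / n.factorial) := by
    rw [← ENNReal.ofReal_natCast, ← ENNReal.ofReal_mul (by positivity), ← ENNReal.ofReal_coe_nnreal,
      ← ENNReal.ofReal_mul (by positivity)]
    congr 1
    rw [Nat.factorial_succ]
    push_cast
    field_simp
    ring
  rw [← mul_assoc, h, mul_assoc]

/-- The enumeration of the natural numbers different from `i`. -/
def skip (i k : ℕ) : ℕ := if k < i then k else k + 1

theorem skip_injective (i : ℕ) : Function.Injective (skip i) := by
  intro k l h
  unfold skip at h
  split_ifs at h <;> omega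

theorem skip_ne (i k : ℕ) : skip i k ≠ i := by
  unfold skip
  split_ifs <;> omega

theorem exists_skip {i j : ℕ} (h : j ≠ i) : ∃ k, skip i k = j := by
  by_cases hj : j < i
  · exact ⟨j, by simp [skip, hj]⟩
  · exact ⟨j - 1, by unfold skip; split_ifs <;> omega⟩

/-- The removal of a point from a block of a configuration. -/
def removeBlock (i : ℕ) (y : ℕ × (ℕ → ℝ)) : ℕ × (ℕ → ℝ) := (y.1 - 1, fun k => y.2 (skip i k))

theorem measurable_removeBlock (i : ℕ) : Measurable (removeBlock i) := by
  refine Measurable.prodMk ((measurable_of_countable fun n : ℕ => n - 1).comp measurable_fst) ?_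
  exact measurable_pi_lambda _ fun k => (measurable_pi_apply _).comp measurable_snd

/-- After the coordinate `i` is resampled it is independent of the others, and these, renumbered by
`skip i`, are again independent with the law `μ`. -/
theorem lintegral_iid_split (μ : Measure ℝ) [IsProbabilityMeasure μ] (i : ℕ)
    (F : ℝ → (ℕ → ℝ) → ENNReal) (hF : Measurable (Function.uncurry F)) :
    ∫⁻ x, F (x i) (fun k => x (skip i k)) ∂(Measure.infinitePi fun _ : ℕ => μ)
      = ∫⁻ a, ∫⁻ x, F a x ∂(Measure.infinitePi fun _ : ℕ => μ) ∂μ := by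
  have hup : Measurable fun p : (ℕ → ℝ) × ℝ => Function.update p.1 i p.2 := by
    refine measurable_pi_lambda _ fun j => ?_
    by_cases hj : j = i
    · subst hj
      simpa using measurable_snd
    · simp only [Function.update_of_ne hj]
      exact (measurable_pi_apply j).comp measurable_fst
  have hsk : Measurable fun x : ℕ → ℝ => fun k => x (skip i k) :=
    measurable_pi_lambda _ fun k => measurable_pi_apply _
  have hm : Measurable fun x : ℕ → ℝ => F (x i) (fun k => x (skip i k)) :=
    hF.comp ((measurable_pi_apply i).prodMk hsk)
  conv_lhs => rw [← infinitePi_map_update (fun _ : ℕ => μ) i]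
  rw [lintegral_map hm hup]
  simp only [Function.update_self, Function.update_of_ne (skip_ne i _)]
  rw [lintegral_prod_symm' (fun p : (ℕ → ℝ) × ℝ => F p.2 fun k => p.1 (skip i k))
    (hF.comp (measurable_snd.prodMk (hsk.comp measurable_fst)))]
  refine lintegral_congr fun a => ?_
  have h := Measure.map_infinitePi_infinitePi_of_inj (P := fun _ : ℕ => μ) (skip_injective i)
  conv_rhs => rw [← h]
  have hFa : Measurable (F a) := hF.comp measurable_prodMk_left
  exact (lintegral_map hFa hsk).symm

/-- The Mecke formula on one block. Given `n` points, all of them contribute equally, and `n p(n) =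
r p(n - 1)` shows that the remaining `n - 1` points again have the Poisson law. The factor `r` turns
the normalized law of a point into the intensity measure. -/
theorem lintegral_blockLaw_tsum (z : PosReal) (b : ℕ) (F : ℝ → ℕ × (ℕ → ℝ) → ENNReal)
    (hF : Measurable (Function.uncurry F)) :
    ∫⁻ y, ∑' i, (if i < y.1 then F (y.2 i) (removeBlock i y) else 0) ∂(blockLaw z b)
      = ∫⁻ x in block b, ∫⁻ y, F x y ∂(blockLaw z b) ∂(intensity z) := by
  set μ := cond (intensity z) (block b) with hμ
  set r := (intensity z (block b)).toNNReal with hr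
  have hr' : (r : ENNReal) = intensity z (block b) :=
    ENNReal.coe_toNNReal (intensity_block_ne_top z b)
  have hmeas : ∀ i, Measurable fun y : ℕ × (ℕ → ℝ) =>
      if i < y.1 then F (y.2 i) (removeBlock i y) else 0 := fun i =>
    Measurable.ite (measurableSet_lt measurable_const measurable_fst)
      (hF.comp (((measurable_pi_apply i).comp measurable_snd).prodMk (measurable_removeBlock i)))
      measurable_const
  let G : ℕ → ENNReal := fun m => ∫⁻ a, ∫⁻ x, F a (m, x) ∂(Measure.infinitePi fun _ : ℕ => μ) ∂μ
  have hFm : ∀ m, Measurable (Function.uncurry fun (a : ℝ) (x : ℕ → ℝ) => F a (m, x)) := fun m =>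
    hF.comp (measurable_fst.prodMk (measurable_const.prodMk measurable_snd))
  rw [lintegral_tsum fun i => (hmeas i).aemeasurable]
  have h1 : ∀ i, ∫⁻ y, (if i < y.1 then F (y.2 i) (removeBlock i y) else 0) ∂(blockLaw z b)
      = ∑' n : ℕ, ENNReal.ofReal (Real.exp (-r) * r ^ n / n.factorial) *
          (if i < n then G (n - 1) else 0) := by
    intro i
    unfold blockLaw
    rw [lintegral_prod _ (hmeas i).aemeasurable, lintegral_poissonMeasure]
    refine tsum_congr fun n => ?_
    congr 1
    split_ifs with hi
    · simp only [removeBlock]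
      exact lintegral_iid_split μ i (fun a x => F a (n - 1, x)) (hFm (n - 1))
    · simp
  simp_rw [h1]
  rw [ENNReal.tsum_comm]
  have h2 : ∀ n : ℕ, ∑' i : ℕ, ENNReal.ofReal (Real.exp (-r) * r ^ n / n.factorial) *
      (if i < n then G (n - 1) else 0)
      = ENNReal.ofReal (Real.exp (-r) * r ^ n / n.factorial) * (n * G (n - 1)) := by
    intro n
    rw [ENNReal.tsum_mul_left]
    congr 1
    rw [tsum_eq_sum (s := Finset.range n) fun i hi => if_neg (by simpa using hi)]
    rw [Finset.sum_congr rfl fun i hi => if_pos (Finset.mem_range.1 hi)]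
    simp
  simp_rw [h2]
  rw [tsum_poisson_shift, ← lintegral_poissonMeasure]
  have hrestr : (intensity z).restrict (block b) = (r : ENNReal) • μ := by
    rw [hμ, ProbabilityTheory.cond, hr', smul_smul, ENNReal.mul_inv_cancel
      (intensity_block_ne_zero z b) (intensity_block_ne_top z b), one_smul]
  rw [hrestr, lintegral_smul_measure, smul_eq_mul]
  congr 1
  unfold blockLaw
  have h3 : ∀ a, ∫⁻ y, F a y ∂((poissonMeasure r).prod (Measure.infinitePi fun _ : ℕ => μ))
      = ∫⁻ m, ∫⁻ x, F a (m, x) ∂(Measure.infinitePi fun _ : ℕ => μ) ∂(poissonMeasure r) := fun a =>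
    lintegral_prod _ (hF.comp measurable_prodMk_left).aemeasurable
  simp_rw [← hr, ← hμ, h3]
  have h4 : Measurable fun p : (ℕ × ℝ) × (ℕ → ℝ) => F p.1.2 (p.1.1, p.2) :=
    hF.comp ((measurable_snd.comp measurable_fst).prodMk
      ((measurable_fst.comp measurable_fst).prodMk measurable_snd))
  exact lintegral_lintegral_swap h4.lintegral_prod_right'.aemeasurable

/-- The removal of a point from a configuration. -/
def removeConfig (p : ℕ × ℕ) (w : ℕ → ℕ × (ℕ → ℝ)) : ℕ → ℕ × (ℕ → ℝ) :=
  Function.update w p.1 (removeBlock p.2 (w p.1))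

theorem measurable_update_pair (b : ℕ) :
    Measurable fun p : (ℕ → ℕ × (ℕ → ℝ)) × (ℕ × (ℕ → ℝ)) => Function.update p.1 b p.2 := by
  refine measurable_pi_lambda _ fun j => ?_
  by_cases hj : j = b
  · subst hj
    simpa using measurable_snd
  · simp only [Function.update_of_ne hj]
    exact (measurable_pi_apply j).comp measurable_fst

theorem measurable_removeConfig (p : ℕ × ℕ) : Measurable (removeConfig p) :=
  (measurable_update_pair p.1).comp (measurable_id.prodMk
    ((measurable_removeBlock p.2).comp (measurable_pi_apply p.1)))

theorem block_pairwise_disjoint : Pairwise (Function.onFun Disjoint block) := by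
  have key : ∀ i j : ℕ, i < j → Disjoint (block i) (block j) := by
    intro i j hij
    rw [Set.disjoint_left]
    intro x hi hj
    have hj' : x ≤ 1 / (j : ℝ) := by
      unfold block at hj
      rw [if_neg (by omega)] at hj
      exact hj.2
    have hj0 : (0 : ℝ) < j := by exact_mod_cast (by omega : 0 < j)
    unfold block at hi
    split_ifs at hi with h
    · have h1 : (1 : ℝ) ≤ j := by exact_mod_cast (by omega : 1 ≤ j)
      have h2 : 1 / (j : ℝ) ≤ 1 := (div_le_one hj0).2 h1
      have hi' : 1 < x := hi
      linarith
    · have h1 : (i : ℝ) + 1 ≤ j := by exact_mod_cast hij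
      have h2 : 1 / (j : ℝ) ≤ 1 / ((i : ℝ) + 1) := one_div_le_one_div_of_le (by positivity) h1
      have := hi.1
      linarith
  intro i j hij
  rcases lt_or_gt_of_ne hij with h | h
  · exact key i j h
  · exact (key j i h).symm

theorem iUnion_block : ⋃ b, block b = Set.Ioi 0 := by
  ext x
  simp only [Set.mem_iUnion, Set.mem_Ioi]
  constructor
  · rintro ⟨b, hb⟩
    obtain ⟨a, ha, hs⟩ := block_subset b
    exact ha.trans (hs hb)
  · intro hx
    by_cases h1 : 1 < x
    · exact ⟨0, by simpa [block] using h1⟩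
    · have hfl : 1 ≤ ⌊1 / x⌋₊ := by
        rw [Nat.one_le_floor_iff]
        rw [le_div_iff₀ hx]
        linarith
      have hpos : (0 : ℝ) < ⌊1 / x⌋₊ := by exact_mod_cast hfl
      refine ⟨⌊1 / x⌋₊, ?_⟩
      unfold block
      rw [if_neg (by omega)]
      refine ⟨?_, ?_⟩
      · rw [div_lt_iff₀ (by positivity)]
        have := Nat.lt_floor_add_one (1 / x)
        rwa [div_lt_iff₀ hx, mul_comm] at this
      · rw [le_div_iff₀ hpos]
        have := Nat.floor_le (show 0 ≤ 1 / x by positivity)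
        rwa [le_div_iff₀ hx, mul_comm] at this

theorem lintegral_intensity (z : PosReal) (f : ℝ → ENNReal) :
    ∑' b, ∫⁻ x in block b, f x ∂(intensity z) = ∫⁻ x, f x ∂(intensity z) := by
  rw [← lintegral_iUnion measurableSet_block block_pairwise_disjoint, iUnion_block]
  congr 1
  rw [intensity, restrict_withDensity measurableSet_Ioi, Measure.restrict_restrict measurableSet_Ioi,
    Set.inter_self]

/-- The Mecke formula for the whole process: the formula of a block is applied with the other blocks
frozen, and the blocks, which partition the half-line, are summed. -/
theorem lintegral_poissonProcess_tsum (z : PosReal) (F : ℝ → (ℕ → ℕ × (ℕ → ℝ)) → ENNReal)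
    (hF : Measurable (Function.uncurry F)) :
    ∫⁻ w, ∑' p : ℕ × ℕ, (if p.2 < (w p.1).1 then F ((w p.1).2 p.2) (removeConfig p w) else 0)
        ∂(poissonProcess z)
      = ∫⁻ x, ∫⁻ w, F x w ∂(poissonProcess z) ∂(intensity z) := by
  have hmeas : ∀ p : ℕ × ℕ, Measurable fun w : ℕ → ℕ × (ℕ → ℝ) =>
      if p.2 < (w p.1).1 then F ((w p.1).2 p.2) (removeConfig p w) else 0 := fun p =>
    Measurable.ite (measurableSet_lt measurable_const (measurable_fst.comp (measurable_pi_apply _)))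
      (hF.comp (((measurable_pi_apply _).comp (measurable_snd.comp (measurable_pi_apply _))).prodMk
        (measurable_removeConfig p))) measurable_const
  have hmb : ∀ b, Measurable fun w : ℕ → ℕ × (ℕ → ℝ) =>
      ∑' i, if i < (w b).1 then F ((w b).2 i) (removeConfig (b, i) w) else 0 := fun b =>
    Measurable.tsum fun i => hmeas (b, i)
  simp_rw [fun w : ℕ → ℕ × (ℕ → ℝ) => ENNReal.tsum_prod (f := fun b i =>
    (if i < (w b).1 then F ((w b).2 i) (removeConfig (b, i) w) else 0))]
  rw [lintegral_tsum fun b => (hmb b).aemeasurable, ← lintegral_intensity]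
  refine tsum_congr fun b => ?_
  have hup := measurable_update_pair b
  conv_lhs => rw [poissonProcess, ← infinitePi_map_update (blockLaw z) b]
  rw [lintegral_map (hmb b) hup, lintegral_prod (fun p : (ℕ → ℕ × (ℕ → ℝ)) × (ℕ × (ℕ → ℝ)) =>
    ∑' i, if i < (Function.update p.1 b p.2 b).1 then
      F ((Function.update p.1 b p.2 b).2 i) (removeConfig (b, i) (Function.update p.1 b p.2)) else 0)
    ((hmb b).comp hup).aemeasurable]
  have hF2 : ∀ w : ℕ → ℕ × (ℕ → ℝ),
      Measurable (Function.uncurry fun (x : ℝ) y => F x (Function.update w b y)) := fun w =>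
    hF.comp (measurable_fst.prodMk (hup.comp (measurable_const.prodMk measurable_snd)))
  have h1 : ∀ w : ℕ → ℕ × (ℕ → ℝ), ∫⁻ y, ∑' i, (if i < (Function.update w b y b).1 then
      F ((Function.update w b y b).2 i) (removeConfig (b, i) (Function.update w b y)) else 0)
        ∂(blockLaw z b)
      = ∫⁻ x in block b, ∫⁻ y, F x (Function.update w b y) ∂(blockLaw z b) ∂(intensity z) := by
    intro w
    rw [← lintegral_blockLaw_tsum z b _ (hF2 w)]
    simp [removeConfig]
  simp_rw [h1]
  have h3 : Measurable fun p : ((ℕ → ℕ × (ℕ → ℝ)) × ℝ) × (ℕ × (ℕ → ℝ)) =>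
      F p.1.2 (Function.update p.1.1 b p.2) :=
    hF.comp ((measurable_snd.comp measurable_fst).prodMk
      (hup.comp ((measurable_fst.comp measurable_fst).prodMk measurable_snd)))
  have : SFinite ((intensity z).restrict (block b)) := by
    unfold intensity
    infer_instance
  rw [lintegral_lintegral_swap h3.lintegral_prod_right'.aemeasurable]
  refine lintegral_congr fun x => ?_
  have hFx : Measurable (F x) := hF.comp measurable_prodMk_left
  rw [← lintegral_prod (fun p : (ℕ → ℕ × (ℕ → ℝ)) × (ℕ × (ℕ → ℝ)) =>
    F x (Function.update p.1 b p.2)) (hFx.comp hup).aemeasurable, ← lintegral_map hFx hup,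
    infinitePi_map_update, poissonProcess]


/-! ### Sums over tuples of distinct points -/

open Classical in
/-- The sum of the products `∏ a (p j) ^ m j` over the tuples of distinct indices `p j`. -/
def distinctSum {α : Type*} : List ℕ → (α → ENNReal) → ENNReal
  | [], _ => 1
  | m :: ms, a => ∑' p, a p ^ m * distinctSum ms (Function.update a p 0)

theorem distinctSum_cons {α : Type*} [DecidableEq α] (m : ℕ) (ms : List ℕ) (a : α → ENNReal) :
    distinctSum (m :: ms) a = ∑' p, a p ^ m * distinctSum ms (Function.update a p 0) := by
  rw [distinctSum]
  refine tsum_congr fun p => ?_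
  congr!

theorem measurable_distinctSum {α : Type*} [Countable α] (ms : List ℕ) :
    Measurable (distinctSum ms : (α → ENNReal) → ENNReal) := by
  classical
  induction ms with
  | nil => exact measurable_const
  | cons m ms ih =>
    refine Measurable.tsum fun p => ((measurable_pi_apply p).pow_const m).mul (ih.comp ?_)
    refine measurable_pi_lambda _ fun q => ?_
    by_cases hq : q = p
    · subst hq
      simp
    · simpa only [Function.update_of_ne hq] using measurable_pi_apply q

/-- Used indices are excluded by setting their entries to zero, and zero entries contribute nothing
only because the exponents are nonzero; with `0 ^ 0 = 1` this would fail. -/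
theorem distinctSum_comp {α β : Type*} {f : β → α} (hf : Function.Injective f) (ms : List ℕ)
    (hms : ∀ m ∈ ms, m ≠ 0) (a : α → ENNReal) (ha : ∀ p, p ∉ Set.range f → a p = 0) :
    distinctSum ms (fun q => a (f q)) = distinctSum ms a := by
  classical
  induction ms generalizing a with
  | nil => rfl
  | cons m ms ih =>
    simp only [List.mem_cons, forall_eq_or_imp] at hms
    simp only [distinctSum]
    have hsupp : Function.support (fun p => a p ^ m * distinctSum ms (Function.update a p 0))
        ⊆ Set.range f := by
      intro p hp
      by_contra hc
      exact hp (by simp [ha p hc, hms.1])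
    rw [← hf.tsum_eq hsupp]
    refine tsum_congr fun q => ?_
    congr 1
    rw [← ih hms.2 (Function.update a (f q) 0)]
    · congr 1
      funext r
      by_cases hr : r = q
      · subst hr
        simp
      · rw [Function.update_of_ne hr, Function.update_of_ne (hf.ne hr)]
    · intro p hp
      by_cases hpq : p = f q
      · exact absurd ⟨q, hpq.symm⟩ hp
      · rw [Function.update_of_ne hpq, ha p hp]

theorem distinctSum_congr_equiv {α β : Type*} {a : α → ℝ} {b : β → ℝ}
    (e : {i // 0 < a i} ≃ {j // 0 < b j}) (he : ∀ i, b (e i) = a i) (ms : List ℕ)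
    (hms : ∀ m ∈ ms, m ≠ 0) :
    distinctSum ms (fun i => ENNReal.ofReal (a i)) = distinctSum ms fun j => ENNReal.ofReal (b j) := by
  rw [← distinctSum_comp (f := fun i : {i // 0 < a i} => i.1) Subtype.val_injective ms hms,
    ← distinctSum_comp (f := fun i : {i // 0 < a i} => (e i).1)
      (Subtype.val_injective.comp e.injective) ms hms (fun j => ENNReal.ofReal (b j))]
  · simp only [he]
  · intro j hj
    refine ENNReal.ofReal_of_nonpos (not_lt.1 fun h => hj ⟨e.symm ⟨j, h⟩, ?_⟩)
    simp
  · intro j hj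
    exact ENNReal.ofReal_of_nonpos (not_lt.1 fun h => hj ⟨⟨j, h⟩, rfl⟩)

theorem distinctSum_smul {α : Type*} (c : ENNReal) (ms : List ℕ) (a : α → ENNReal) :
    distinctSum ms (fun p => c * a p) = c ^ ms.sum * distinctSum ms a := by
  classical
  induction ms generalizing a with
  | nil => simp [distinctSum]
  | cons m ms ih =>
    simp only [distinctSum, List.sum_cons]
    rw [← ENNReal.tsum_mul_left]
    refine tsum_congr fun p => ?_
    have : Function.update (fun q => c * a q) p 0 = fun q => c * Function.update a p 0 q := by
      funext q
      by_cases hq : q = p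
      · subst hq
        simp
      · rw [Function.update_of_ne hq, Function.update_of_ne hq]
    rw [this, ih, mul_pow, pow_add]
    ring

/-! ### Exponential weights -/

/-- The weight `exp (-t s)`; it vanishes at infinity. -/
def expWeight (t : ℝ) (s : ENNReal) : ENNReal :=
  if s = ⊤ then 0 else ENNReal.ofReal (Real.exp (-(t * s.toReal)))

theorem measurable_expWeight (t : ℝ) : Measurable (expWeight t) := by
  unfold expWeight
  exact Measurable.ite (measurableSet_singleton _) measurable_const (by fun_prop)

theorem measurable_expWeight_uncurry : Measurable (Function.uncurry expWeight) := by
  unfold expWeight Function.uncurry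
  refine Measurable.ite ?_ measurable_const (by fun_prop)
  exact measurableSet_eq_fun measurable_snd measurable_const

theorem expWeight_add (t : ℝ) (r s : ENNReal) :
    expWeight t (r + s) = expWeight t r * expWeight t s := by
  unfold expWeight
  by_cases hr : r = ⊤
  · simp [hr]
  by_cases hs : s = ⊤
  · simp [hs]
  rw [if_neg hr, if_neg hs, if_neg (ENNReal.add_ne_top.2 ⟨hr, hs⟩), ENNReal.toReal_add hr hs,
    ← ENNReal.ofReal_mul (Real.exp_nonneg _), ← Real.exp_add]
  congr 2
  ring

theorem expWeight_of_ne_top (t : ℝ) {s : ENNReal} (h : s ≠ ⊤) :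
    expWeight t s = ENNReal.ofReal (Real.exp (-(t * s.toReal))) := if_neg h

theorem expWeight_le_one {t : ℝ} (ht : 0 ≤ t) (s : ENNReal) : expWeight t s ≤ 1 := by
  unfold expWeight
  split_ifs
  · exact zero_le_one
  · rw [← ENNReal.ofReal_one]
    refine ENNReal.ofReal_le_ofReal (Real.exp_le_one_iff.2 ?_)
    have := ENNReal.toReal_nonneg (a := s)
    nlinarith

/-- This is the normalization of the Gamma density with shape `a` and rate `r`. -/
theorem lintegral_rpow_mul_exp {a r : ℝ} (ha : 0 < a) (hr : 0 < r) :
    ∫⁻ x in Set.Ioi (0 : ℝ), ENNReal.ofReal (x ^ (a - 1) * Real.exp (-(r * x)))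
      = ENNReal.ofReal (Real.Gamma a / r ^ a) := by
  have hG := Real.Gamma_pos_of_pos ha
  have hc : (0 : ℝ) < Real.Gamma a / r ^ a := by positivity
  have h := lintegral_gammaPDF_eq_one ha hr
  have h1 : ∫⁻ x in Set.Ioi (0 : ℝ), ENNReal.ofReal (x ^ (a - 1) * Real.exp (-(r * x)))
      = ∫⁻ x in Set.Ioi (0 : ℝ), ENNReal.ofReal (Real.Gamma a / r ^ a) * gammaPDF a r x := by
    refine setLIntegral_congr_fun measurableSet_Ioi fun x hx => ?_
    have hx' : (0 : ℝ) ≤ x := le_of_lt hx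
    rw [gammaPDF_of_nonneg hx', ← ENNReal.ofReal_mul hc.le]
    congr 1
    field_simp
  rw [h1, lintegral_const_mul' _ _ ENNReal.ofReal_ne_top]
  have h2 : ∫⁻ x in Set.Ioi (0 : ℝ), gammaPDF a r x = 1 := by
    have : ∫⁻ x in (Set.Ici (0 : ℝ))ᶜ, gammaPDF a r x = 0 := by
      rw [Set.compl_Ici]
      exact lintegral_gammaPDF_of_nonpos le_rfl
    have h' := lintegral_add_compl (μ := volume) (gammaPDF a r) (measurableSet_Ici (a := (0 : ℝ)))
    rw [this, add_zero, h] at h'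
    rw [setLIntegral_congr (Ioi_ae_eq_Ici (a := (0 : ℝ)) (μ := volume)), h']
  rw [h2, mul_one]

theorem lintegral_intensity_weight (z : PosReal) {t : ℝ} (ht : 0 ≤ t) {m : ℕ} (hm : m ≠ 0) :
    ∫⁻ x, ENNReal.ofReal x ^ m * expWeight t (ENNReal.ofReal x) ∂(intensity z)
      = ENNReal.ofReal (z * (m - 1).factorial / (1 + t) ^ m) := by
  have hz := z.2
  unfold intensity
  have hmeas : Measurable fun x : ℝ => ENNReal.ofReal x ^ m * expWeight t (ENNReal.ofReal x) :=
    (ENNReal.measurable_ofReal.pow_const m).mul ((measurable_expWeight t).comp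
      ENNReal.measurable_ofReal)
  rw [lintegral_withDensity_eq_lintegral_mul _ (by fun_prop) hmeas]
  have h1 : ∫⁻ x in Set.Ioi (0 : ℝ), ((fun x : ℝ => ENNReal.ofReal ((z : ℝ) * x⁻¹ * Real.exp (-x))) *
        fun x : ℝ => ENNReal.ofReal x ^ m * expWeight t (ENNReal.ofReal x)) x
      = ∫⁻ x in Set.Ioi (0 : ℝ), ENNReal.ofReal z *
          ENNReal.ofReal (x ^ ((m : ℝ) - 1) * Real.exp (-((1 + t) * x))) := by
    refine setLIntegral_congr_fun measurableSet_Ioi fun x hx => ?_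
    have hx' : 0 < x := hx
    simp only [Pi.mul_apply]
    rw [expWeight_of_ne_top _ ENNReal.ofReal_ne_top, ENNReal.toReal_ofReal hx'.le,
      ← ENNReal.ofReal_pow hx'.le, ← ENNReal.ofReal_mul (by positivity),
      ← ENNReal.ofReal_mul (by positivity), ← ENNReal.ofReal_mul hz.le]
    congr 1
    rw [Real.rpow_sub_one hx'.ne', Real.rpow_natCast,
      show -((1 + t) * x) = -x + -(t * x) by ring, Real.exp_add]
    field_simp
  rw [h1, lintegral_const_mul' _ _ ENNReal.ofReal_ne_top, lintegral_rpow_mul_exp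
    (by exact_mod_cast Nat.pos_of_ne_zero hm) (by linarith), ← ENNReal.ofReal_mul hz.le]
  congr 1
  obtain ⟨k, rfl⟩ := Nat.exists_eq_succ_of_ne_zero hm
  rw [Real.rpow_natCast, Nat.succ_eq_add_one, Nat.cast_succ, Real.Gamma_nat_eq_factorial,
    Nat.add_sub_cancel]
  ring

/-! ### The correlation functions of the Poisson process -/

/-- The lengths of the points of a configuration. -/
def pointMass (w : ℕ → ℕ × (ℕ → ℝ)) (p : ℕ × ℕ) : ENNReal := ENNReal.ofReal (configPoints w p)

/-- The total length of a configuration. -/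
def totalMass (w : ℕ → ℕ × (ℕ → ℝ)) : ENNReal := ∑' p, pointMass w p

theorem measurable_configPoints (p : ℕ × ℕ) : Measurable fun w => configPoints w p := by
  unfold configPoints
  exact Measurable.ite (measurableSet_lt measurable_const
    (measurable_fst.comp (measurable_pi_apply _)))
    ((measurable_pi_apply _).comp (measurable_snd.comp (measurable_pi_apply _))) measurable_const

theorem measurable_pointMass : Measurable pointMass :=
  measurable_pi_lambda _ fun p => ENNReal.measurable_ofReal.comp (measurable_configPoints p)

theorem measurable_totalMass : Measurable totalMass :=
  Measurable.tsum fun p => (measurable_pi_apply p).comp measurable_pointMass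

/-- The enumeration of the indices different from `p`. -/
def skipPair (p q : ℕ × ℕ) : ℕ × ℕ := if q.1 = p.1 then (q.1, skip p.2 q.2) else q

theorem skipPair_injective (p : ℕ × ℕ) : Function.Injective (skipPair p) := by
  rintro ⟨a, b⟩ ⟨c, d⟩ h
  unfold skipPair at h
  simp only at h
  split_ifs at h with h1 h2 h2
  · simp only [Prod.mk.injEq] at h ⊢
    exact ⟨h.1, skip_injective _ h.2⟩
  · simp only [Prod.mk.injEq] at h
    exact absurd (h.1 ▸ h1) h2
  · simp only [Prod.mk.injEq] at h
    exact absurd (h.1.symm ▸ h2) h1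
  · exact h

theorem range_skipPair (p : ℕ × ℕ) : Set.range (skipPair p) = {p}ᶜ := by
  ext ⟨a, b⟩
  simp only [Set.mem_range, Set.mem_compl_iff, Set.mem_singleton_iff, Prod.exists]
  constructor
  · rintro ⟨c, d, h⟩ rfl
    unfold skipPair at h
    simp only at h
    split_ifs at h with h1
    · exact skip_ne _ _ (congrArg Prod.snd h)
    · exact h1 (congrArg Prod.fst h)
  · intro h
    by_cases ha : a = p.1
    · have hb : b ≠ p.2 := fun hb => h (Prod.ext ha hb)
      obtain ⟨k, hk⟩ := exists_skip hb
      exact ⟨a, k, by simp [skipPair, ha, hk]⟩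
    · exact ⟨a, b, by simp [skipPair, ha]⟩

theorem pointMass_removeConfig {w : ℕ → ℕ × (ℕ → ℝ)} {p : ℕ × ℕ} (hp : p.2 < (w p.1).1)
    (q : ℕ × ℕ) : pointMass (removeConfig p w) q = pointMass w (skipPair p q) := by
  unfold pointMass configPoints removeConfig skipPair
  congr 1
  by_cases hq : q.1 = p.1
  · rw [if_pos hq, hq, Function.update_self]
    simp only [removeBlock]
    have : q.2 < (w p.1).1 - 1 ↔ skip p.2 q.2 < (w p.1).1 := by
      unfold skip
      split_ifs <;> omega
    simp only [this]
  · rw [if_neg hq, Function.update_of_ne hq]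

theorem totalMass_removeConfig {w : ℕ → ℕ × (ℕ → ℝ)} {p : ℕ × ℕ} (hp : p.2 < (w p.1).1) :
    totalMass w = pointMass w p + totalMass (removeConfig p w) := by
  classical
  unfold totalMass
  simp_rw [pointMass_removeConfig hp]
  rw [ENNReal.tsum_eq_add_tsum_ite p]
  congr 1
  rw [← (skipPair_injective p).tsum_eq]
  · refine tsum_congr fun q => ?_
    have : skipPair p q ≠ p := by
      have h : skipPair p q ∈ Set.range (skipPair p) := ⟨q, rfl⟩
      rwa [range_skipPair] at h
    rw [if_neg this]
  · rw [range_skipPair]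
    intro q hq
    rw [Function.mem_support] at hq
    intro hqp
    exact hq (if_pos hqp)

theorem distinctSum_removeConfig {w : ℕ → ℕ × (ℕ → ℝ)} {p : ℕ × ℕ} (hp : p.2 < (w p.1).1)
    (ms : List ℕ) (hms : ∀ m ∈ ms, m ≠ 0) :
    distinctSum ms (pointMass (removeConfig p w))
      = distinctSum ms (Function.update (pointMass w) p 0) := by
  rw [← distinctSum_comp (skipPair_injective p) ms hms (Function.update (pointMass w) p 0)]
  · congr 1
    funext q
    have : skipPair p q ≠ p := by
      have h : skipPair p q ∈ Set.range (skipPair p) := ⟨q, rfl⟩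
      rwa [range_skipPair] at h
    rw [pointMass_removeConfig hp, Function.update_of_ne this]
  · intro q hq
    rw [range_skipPair, Set.notMem_compl_iff, Set.mem_singleton_iff] at hq
    rw [hq, Function.update_self]

/-- The first point is peeled off in the form needed for the Mecke formula: the exponential weight
splits because the total length is that of the point plus that of the remaining configuration. -/
theorem distinctSum_cons_pointMass (w : ℕ → ℕ × (ℕ → ℝ)) (t : ℝ) {m : ℕ} (hm : m ≠ 0) (ms : List ℕ)
    (hms : ∀ m ∈ ms, m ≠ 0) :
    expWeight t (totalMass w) * distinctSum (m :: ms) (pointMass w)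
      = ∑' p : ℕ × ℕ, if p.2 < (w p.1).1 then
          (fun x w => ENNReal.ofReal x ^ m * expWeight t (ENNReal.ofReal x) *
            (expWeight t (totalMass w) * distinctSum ms (pointMass w)))
            ((w p.1).2 p.2) (removeConfig p w) else 0 := by
  rw [distinctSum_cons, ← ENNReal.tsum_mul_left]
  refine tsum_congr fun p => ?_
  split_ifs with hp
  · have hpm : pointMass w p = ENNReal.ofReal ((w p.1).2 p.2) := by
      simp [pointMass, configPoints, hp]
    beta_reduce
    rw [distinctSum_removeConfig hp ms hms, totalMass_removeConfig hp, expWeight_add, hpm]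
    ring
  · have hpm : pointMass w p = 0 := by
      simp [pointMass, configPoints, hp]
    rw [hpm, zero_pow hm, zero_mul, mul_zero]

/-- By the Mecke formula the peeled point is integrated independently of the rest of the
configuration, and its integral is a Gamma integral. -/
theorem lintegral_cons (z : PosReal) {t : ℝ} (ht : 0 ≤ t) {m : ℕ} (hm : m ≠ 0) (ms : List ℕ)
    (hms : ∀ m ∈ ms, m ≠ 0) :
    ∫⁻ w, expWeight t (totalMass w) * distinctSum (m :: ms) (pointMass w) ∂(poissonProcess z)
      = ENNReal.ofReal (z * (m - 1).factorial / (1 + t) ^ m) *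
        ∫⁻ w, expWeight t (totalMass w) * distinctSum ms (pointMass w) ∂(poissonProcess z) := by
  simp_rw [distinctSum_cons_pointMass _ t hm ms hms]
  have hG : Measurable fun w : ℕ → ℕ × (ℕ → ℝ) =>
      expWeight t (totalMass w) * distinctSum ms (pointMass w) :=
    ((measurable_expWeight t).comp measurable_totalMass).mul
      ((measurable_distinctSum ms).comp measurable_pointMass)
  have hH : Measurable fun x : ℝ => ENNReal.ofReal x ^ m * expWeight t (ENNReal.ofReal x) :=
    (ENNReal.measurable_ofReal.pow_const m).mul ((measurable_expWeight t).comp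
      ENNReal.measurable_ofReal)
  rw [lintegral_poissonProcess_tsum z (fun x w => ENNReal.ofReal x ^ m *
    expWeight t (ENNReal.ofReal x) * (expWeight t (totalMass w) * distinctSum ms (pointMass w))) ((hH.comp measurable_fst).mul (hG.comp measurable_snd))]
  simp_rw [lintegral_const_mul _ hG]
  rw [lintegral_mul_const _ hH, lintegral_intensity_weight z ht hm]

theorem lintegral_expWeight_mul_distinctSum (z : PosReal) {t : ℝ} (ht : 0 ≤ t) (ms : List ℕ)
    (hms : ∀ m ∈ ms, m ≠ 0) :
    ∫⁻ w, expWeight t (totalMass w) * distinctSum ms (pointMass w) ∂(poissonProcess z)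
      = (ms.map fun m => ENNReal.ofReal (z * (m - 1).factorial / (1 + t) ^ m)).prod *
        ∫⁻ w, expWeight t (totalMass w) ∂(poissonProcess z) := by
  induction ms with
  | nil => simp [distinctSum]
  | cons m ms ih =>
    simp only [List.mem_cons, forall_eq_or_imp] at hms
    rw [lintegral_cons z ht hms.1 ms hms.2, ih hms.2, List.map_cons, List.prod_cons, mul_assoc]

theorem distinctSum_one {α : Type*} (a : α → ENNReal) : distinctSum [1] a = ∑' p, a p := by
  simp [distinctSum]

/-- The Mecke formula for the indicator of the negative half-line: the expected number of negative
points is zero. -/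
theorem ae_points_pos (z : PosReal) :
    ∀ᵐ w ∂(poissonProcess z), ∀ p, 0 ≤ configPoints w p := by
  have hF : Measurable (Function.uncurry fun (x : ℝ) (_ : ℕ → ℕ × (ℕ → ℝ)) =>
      (Set.Iio (0 : ℝ)).indicator (1 : ℝ → ENNReal) x) :=
    (measurable_one.indicator measurableSet_Iio).comp measurable_fst
  have h := lintegral_poissonProcess_tsum z _ hF
  have h0 : ∫⁻ x, ∫⁻ _, (Set.Iio (0 : ℝ)).indicator (1 : ℝ → ENNReal) x ∂(poissonProcess z)
      ∂(intensity z) = 0 := by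
    simp only [lintegral_const, measure_univ, mul_one]
    rw [lintegral_indicator_one measurableSet_Iio, intensity, withDensity_apply _ measurableSet_Iio,
      Measure.restrict_restrict measurableSet_Iio]
    have : Set.Iio (0 : ℝ) ∩ Set.Ioi 0 = ∅ := by
      ext x
      simp only [Set.mem_inter_iff, Set.mem_Iio, Set.mem_Ioi, Set.mem_empty_iff_false, iff_false]
      exact fun h => lt_asymm h.1 h.2
    simp [this]
  rw [h0, lintegral_eq_zero_iff] at h
  · filter_upwards [h] with w hw p
    rw [Pi.zero_apply, ENNReal.tsum_eq_zero] at hw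
    unfold configPoints
    split_ifs with hp
    · have := hw p
      rw [if_pos hp] at this
      by_contra hc
      simp [Set.indicator_of_mem (show (w p.1).2 p.2 ∈ Set.Iio 0 from not_le.1 hc)] at this
    · exact le_rfl
  · refine Measurable.tsum fun p => Measurable.ite (measurableSet_lt measurable_const
      (measurable_fst.comp (measurable_pi_apply _))) ?_ measurable_const
    exact (measurable_one.indicator measurableSet_Iio).comp ((measurable_pi_apply _).comp
      (measurable_snd.comp (measurable_pi_apply _)))

/-- The expected total length is the integral of `x` against the intensity, which is finite. -/
theorem lintegral_totalMass_lt_top (z : PosReal) :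
    ∀ᵐ w ∂(poissonProcess z), totalMass w ≠ ⊤ := by
  have hF : Measurable (Function.uncurry fun (x : ℝ) (_ : ℕ → ℕ × (ℕ → ℝ)) =>
      ENNReal.ofReal x) := ENNReal.measurable_ofReal.comp measurable_fst
  have h := lintegral_poissonProcess_tsum z _ hF
  have h1 : ∀ w : ℕ → ℕ × (ℕ → ℝ), totalMass w
      = ∑' p : ℕ × ℕ, if p.2 < (w p.1).1 then ENNReal.ofReal ((w p.1).2 p.2) else 0 := fun w =>
    tsum_congr fun p => by
      unfold pointMass configPoints
      split_ifs <;> simp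
  have h2 := lintegral_intensity_weight z le_rfl one_ne_zero
  have h3 : ∀ x : ℝ, expWeight 0 (ENNReal.ofReal x) = 1 := fun x => by
    simp [expWeight_of_ne_top]
  simp only [h3, pow_one, mul_one] at h2
  simp only [lintegral_const, measure_univ, mul_one, h2] at h
  simp_rw [← h1] at h
  have := ae_lt_top measurable_totalMass (h.trans_ne ENNReal.ofReal_ne_top)
  filter_upwards [this] with w hw using hw.ne


/-! ### The Laplace transform of the total length -/

/-- The Laplace transform of the total length. -/
def laplace (z : PosReal) (t : ℝ) : ℝ :=
  (∫⁻ w, expWeight t (totalMass w) ∂(poissonProcess z)).toReal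

theorem laplace_le_one (z : PosReal) {t : ℝ} (ht : 0 ≤ t) :
    ∫⁻ w, expWeight t (totalMass w) ∂(poissonProcess z) ≤ 1 := by
  calc _ ≤ ∫⁻ _, 1 ∂(poissonProcess z) := lintegral_mono fun w => expWeight_le_one ht _
    _ = 1 := by simp

theorem ofReal_laplace (z : PosReal) {t : ℝ} (ht : 0 ≤ t) :
    ENNReal.ofReal (laplace z t) = ∫⁻ w, expWeight t (totalMass w) ∂(poissonProcess z) :=
  ENNReal.ofReal_toReal (ne_top_of_le_ne_top ENNReal.one_ne_top (laplace_le_one z ht))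

theorem measurable_laplace (z : PosReal) : Measurable (laplace z) := by
  have h : Measurable fun p : ℝ × (ℕ → ℕ × (ℕ → ℝ)) => expWeight p.1 (totalMass p.2) :=
    measurable_expWeight_uncurry.comp
      (measurable_fst.prodMk (measurable_totalMass.comp measurable_snd))
  exact h.lintegral_prod_right'.ennreal_toReal

/-- The fundamental theorem of calculus for `exp (-r s)` on `[0, t]`, in an additive form suited to
`ENNReal`. -/
theorem expWeight_add_integral {t : ℝ} (ht : 0 ≤ t) {s : ENNReal} (hs : s ≠ ⊤) :
    expWeight t s + ∫⁻ r in Set.Ioc 0 t, s * expWeight r s = 1 := by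
  obtain ⟨x, rfl⟩ : ∃ x : NNReal, (x : ENNReal) = s := ⟨s.toNNReal, ENNReal.coe_toNNReal hs⟩
  have h1 : ∀ r : ℝ, (x : ENNReal) * expWeight r x = ENNReal.ofReal (x * Real.exp (-(r * x))) := by
    intro r
    rw [expWeight_of_ne_top _ hs, ENNReal.ofReal_mul x.coe_nonneg, ENNReal.ofReal_coe_nnreal,
      ENNReal.coe_toReal]
  simp_rw [h1]
  have hc : Continuous fun r : ℝ => (x : ℝ) * Real.exp (-(r * x)) := by fun_prop
  rw [← ofReal_integral_eq_lintegral_ofReal (hc.integrableOn_Ioc)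
    (ae_of_all _ fun r => by positivity), ← intervalIntegral.integral_of_le ht]
  have h2 : ∫ r in (0 : ℝ)..t, (x : ℝ) * Real.exp (-(r * x)) = 1 - Real.exp (-(t * x)) := by
    have hd : ∀ r ∈ Set.uIcc 0 t, HasDerivAt (fun r : ℝ => -Real.exp (-(r * x)))
        ((x : ℝ) * Real.exp (-(r * x))) r := by
      intro r _
      have := (((hasDerivAt_id r).mul_const (x : ℝ)).neg.exp).neg
      refine this.congr_deriv ?_
      simp only [id_eq, Pi.neg_apply]
      ring
    rw [intervalIntegral.integral_eq_sub_of_hasDerivAt hd (hc.intervalIntegrable _ _)]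
    simp
    ring
  rw [h2, expWeight_of_ne_top _ hs, ENNReal.coe_toReal,
    ← ENNReal.ofReal_add (Real.exp_nonneg _) (sub_nonneg.2 (Real.exp_le_one_iff.2 (by
      have := x.2
      have : (0 : ℝ) ≤ t * x := mul_nonneg ht this
      linarith)))]
  simp

/-- Averaging `expWeight_add_integral` over the process leaves the mean of `S exp (-r S)` for the
total length `S`; the Mecke formula for one point expresses it through the Laplace transform itself.
-/
theorem laplace_integral_equation (z : PosReal) {t : ℝ} (ht : 0 ≤ t) :
    laplace z t = 1 - ∫ r in (0 : ℝ)..t, z / (1 + r) * laplace z r := by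
  have hz := z.2
  have h1 : ∫⁻ w, (expWeight t (totalMass w) + ∫⁻ r in Set.Ioc 0 t, totalMass w *
      expWeight r (totalMass w)) ∂(poissonProcess z) = 1 := by
    rw [lintegral_congr_ae (g := fun _ => 1)]
    · simp
    · filter_upwards [lintegral_totalMass_lt_top z] with w hw
      exact expWeight_add_integral ht hw
  have hm : Measurable fun p : (ℕ → ℕ × (ℕ → ℝ)) × ℝ =>
      totalMass p.1 * expWeight p.2 (totalMass p.1) :=
    (measurable_totalMass.comp measurable_fst).mul (measurable_expWeight_uncurry.comp
      (measurable_snd.prodMk (measurable_totalMass.comp measurable_fst)))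
  have h2 : ∀ r, 0 ≤ r → ∫⁻ w, totalMass w * expWeight r (totalMass w) ∂(poissonProcess z)
      = ENNReal.ofReal (z / (1 + r) * laplace z r) := by
    intro r hr
    have h := lintegral_cons z hr one_ne_zero [] (by simp)
    simp only [distinctSum_one, Nat.sub_self, Nat.factorial_zero, Nat.cast_one, pow_one,
      mul_one] at h
    simp only [distinctSum, mul_one] at h
    rw [ENNReal.ofReal_mul (by positivity), ofReal_laplace z hr, ← h]
    exact lintegral_congr fun w => mul_comm _ _
  have hEt : Measurable fun w => expWeight t (totalMass w) :=
    (measurable_expWeight t).comp measurable_totalMass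
  rw [lintegral_add_left hEt, lintegral_lintegral_swap hm.aemeasurable] at h1
  have h3 : ∫⁻ r in Set.Ioc 0 t, ∫⁻ w, totalMass w * expWeight r (totalMass w) ∂(poissonProcess z)
      = ∫⁻ r in Set.Ioc 0 t, ENNReal.ofReal (z / (1 + r) * laplace z r) :=
    setLIntegral_congr_fun measurableSet_Ioc fun r hr => h2 r hr.1.le
  have hnn : ∀ r, 0 ≤ r → 0 ≤ z / (1 + r) * laplace z r := fun r hr =>
    mul_nonneg (by positivity) ENNReal.toReal_nonneg
  rw [h3] at h1
  have hmeas : Measurable fun r => (z : ℝ) / (1 + r) * laplace z r :=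
    (by fun_prop : Measurable fun r : ℝ => (z : ℝ) / (1 + r)).mul (measurable_laplace z)
  have h4 : ∫ r in (0 : ℝ)..t, z / (1 + r) * laplace z r
      = (∫⁻ r in Set.Ioc 0 t, ENNReal.ofReal (z / (1 + r) * laplace z r)).toReal := by
    rw [intervalIntegral.integral_of_le ht, integral_eq_lintegral_of_nonneg_ae]
    · exact (ae_restrict_mem measurableSet_Ioc).mono fun r hr => hnn r hr.1.le
    · exact hmeas.aestronglyMeasurable
  have h5 := congrArg ENNReal.toReal h1
  have hne : ∀ {a b : ENNReal}, a + b = 1 → a ≠ ⊤ ∧ b ≠ ⊤ := fun {a b} h => by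
    refine ENNReal.add_ne_top.1 ?_
    rw [h]
    exact ENNReal.one_ne_top
  rw [ENNReal.toReal_add (hne h1).1 (hne h1).2, ← h4, ENNReal.toReal_one] at h5
  exact eq_sub_of_add_eq h5

/-- The integral equation first yields continuity and then the one-sided equation `L' = -z L / (1 +
t)`. Hence `(1 + t) ^ z L` has zero right derivative and is constant. -/
theorem laplace_eq (z : PosReal) {t : ℝ} (ht : 0 ≤ t) :
    laplace z t = (1 + t) ^ (-(z : ℝ)) := by
  have hz := z.2
  have hmeas : Measurable fun r => (z : ℝ) / (1 + r) * laplace z r :=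
    (by fun_prop : Measurable fun r : ℝ => (z : ℝ) / (1 + r)).mul (measurable_laplace z)
  have hint : IntegrableOn (fun r => (z : ℝ) / (1 + r) * laplace z r) (Set.Icc 0 t) := by
    refine IntegrableOn.of_bound (by simp) hmeas.aestronglyMeasurable z ?_
    refine (ae_restrict_mem measurableSet_Icc).mono fun r hr => ?_
    have h1 : laplace z r ≤ 1 := by
      have := ENNReal.toReal_mono ENNReal.one_ne_top (laplace_le_one z hr.1)
      rwa [ENNReal.toReal_one] at this
    have h0 : 0 ≤ laplace z r := ENNReal.toReal_nonneg
    have hr0 := hr.1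
    rw [Real.norm_of_nonneg (mul_nonneg (by positivity) h0)]
    have h2 : (z : ℝ) / (1 + r) ≤ z := div_le_self hz.le (by linarith)
    calc _ ≤ (z : ℝ) * 1 := mul_le_mul h2 h1 h0 hz.le
      _ = z := mul_one _
  have hII : IntervalIntegrable (fun r => (z : ℝ) / (1 + r) * laplace z r) volume 0 t :=
    (intervalIntegrable_iff_integrableOn_Icc_of_le ht).2 hint
  have hprim : ContinuousOn (fun x => ∫ r in (0 : ℝ)..x, z / (1 + r) * laplace z r)
      (Set.Icc 0 t) := by
    rw [← Set.uIcc_of_le ht] at hint ⊢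
    exact intervalIntegral.continuousOn_primitive_interval hint
  have hcont : ContinuousOn (laplace z) (Set.Icc 0 t) :=
    (continuousOn_const.sub hprim).congr fun x hx => laplace_integral_equation z hx.1
  have hcont2 : ContinuousOn (fun r => (z : ℝ) / (1 + r) * laplace z r) (Set.Icc 0 t) := by
    refine ContinuousOn.mul (ContinuousOn.div continuousOn_const (by fun_prop) ?_) hcont
    intro x hx
    have := hx.1
    positivity
  have hderiv : ∀ x ∈ Set.Ico 0 t, HasDerivWithinAt (laplace z)
      (-(z / (1 + x) * laplace z x)) (Set.Ici x) x := by
    intro x hx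
    have hsub : Set.Icc x t ⊆ Set.Icc 0 t := Set.Icc_subset_Icc_left hx.1
    have hcw : ContinuousWithinAt (fun r => (z : ℝ) / (1 + r) * laplace z r) (Set.Ioi x) x := by
      have := (hcont2 x ⟨hx.1, hx.2.le⟩).mono hsub
      exact ((this.mono_of_mem_nhdsWithin
        (Icc_mem_nhdsGE hx.2)).mono Set.Ioi_subset_Ici_self)
    have hd := intervalIntegral.integral_hasDerivWithinAt_right
      (hII.mono_set (by
        rw [Set.uIcc_of_le hx.1, Set.uIcc_of_le ht]
        exact Set.Icc_subset_Icc_right hx.2.le))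
      (s := Set.Ici x) (t := Set.Ioi x) hmeas.stronglyMeasurable.stronglyMeasurableAtFilter hcw
    refine ((hd.const_sub 1).congr_of_eventuallyEq ?_ (laplace_integral_equation z hx.1))
    filter_upwards [self_mem_nhdsWithin] with y hy
    exact laplace_integral_equation z (hx.1.trans hy)
  have hconst := constant_of_has_deriv_right_zero (f := fun x => (1 + x) ^ (z : ℝ) * laplace z x)
    (a := 0) (b := t) ?_ ?_ t ⟨ht, le_rfl⟩
  · have h0 : laplace z 0 = 1 := by
      rw [laplace_integral_equation z le_rfl]
      simp
    simp only [add_zero, Real.one_rpow, h0, mul_one] at hconst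
    rw [Real.rpow_neg (by linarith)]
    exact eq_inv_of_mul_eq_one_right hconst
  · refine ContinuousOn.mul (ContinuousOn.rpow_const (by fun_prop) fun x hx => Or.inr hz.le) hcont
  · intro x hx
    have hx0 : (0 : ℝ) < 1 + x := by linarith [hx.1]
    have h1 : HasDerivAt (fun x : ℝ => (1 + x) ^ (z : ℝ)) (1 * z * (1 + x) ^ ((z : ℝ) - 1)) x :=
      ((hasDerivAt_id x).const_add 1).rpow_const (Or.inl hx0.ne')
    refine (h1.hasDerivWithinAt.mul (hderiv x hx)).congr_deriv ?_
    rw [Real.rpow_sub_one hx0.ne']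
    field_simp
    ring

theorem lintegral_expWeight_totalMass (z : PosReal) {t : ℝ} (ht : 0 ≤ t) :
    ∫⁻ w, expWeight t (totalMass w) ∂(poissonProcess z)
      = ENNReal.ofReal ((1 + t) ^ (-(z : ℝ))) := by
  rw [← ofReal_laplace z ht, laplace_eq z ht]

/-- The probability of zero total length is at most the Laplace transform at every `n`, and this
tends to zero. -/
theorem totalMass_ne_zero (z : PosReal) : ∀ᵐ w ∂(poissonProcess z), totalMass w ≠ 0 := by
  have hm : MeasurableSet {w : ℕ → ℕ × (ℕ → ℝ) | totalMass w = 0} :=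
    measurable_totalMass (measurableSet_singleton 0)
  have hle : ∀ n : ℕ, poissonProcess z {w | totalMass w = 0}
      ≤ ENNReal.ofReal ((1 + (n : ℝ)) ^ (-(z : ℝ))) := by
    intro n
    rw [← lintegral_expWeight_totalMass z (Nat.cast_nonneg n), ← lintegral_indicator_one hm]
    refine lintegral_mono fun w => ?_
    by_cases hw : totalMass w = 0
    · rw [Set.indicator_of_mem (show w ∈ {w | totalMass w = 0} from hw), hw]
      simp [expWeight]
    · rw [Set.indicator_of_notMem (show w ∉ {w | totalMass w = 0} from hw)]
      exact zero_le
  have hlim : Filter.Tendsto (fun n : ℕ => ENNReal.ofReal ((1 + (n : ℝ)) ^ (-(z : ℝ))))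
      Filter.atTop (nhds (ENNReal.ofReal 0)) := by
    refine ENNReal.tendsto_ofReal ?_
    refine (tendsto_rpow_neg_atTop z.2).comp ?_
    exact Filter.tendsto_atTop_add_const_left _ _ tendsto_natCast_atTop_atTop
  rw [ENNReal.ofReal_zero] at hlim
  have h0 : poissonProcess z {w | totalMass w = 0} = 0 :=
    le_antisymm (ge_of_tendsto' hlim hle) zero_le
  exact (measure_eq_zero_iff_ae_notMem.1 h0)

/-- A Beta integral: the power of `1 + t` is written as a Gamma integral in `y`, and after the
interchange both remaining integrals are Gamma integrals. The quotient of Gamma values is the rising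
factorial. -/
theorem lintegral_rpow_mul_one_add (z : PosReal) (n : ℕ) :
    ∫⁻ t in Set.Ioi (0 : ℝ), ENNReal.ofReal (t ^ n * (1 + t) ^ (-((z : ℝ) + (n + 1))))
      = ENNReal.ofReal (n.factorial / ∏ i ∈ Finset.range (n + 1), ((z : ℝ) + i)) := by
  have hz := z.2
  set a : ℝ := (z : ℝ) + (n + 1) with ha
  have ha0 : 0 < a := by positivity
  have hGa := Real.Gamma_pos_of_pos ha0
  have hGz := Real.Gamma_pos_of_pos hz
  have hprod : ∀ m : ℕ, Real.Gamma ((z : ℝ) + m)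
      = Real.Gamma z * ∏ i ∈ Finset.range m, ((z : ℝ) + i) := by
    intro m
    induction m with
    | zero => simp
    | succ m ih =>
      rw [Finset.prod_range_succ, ← mul_assoc, ← ih, Nat.cast_succ, ← add_assoc,
        Real.Gamma_add_one (by positivity), mul_comm]
  have hGa' : Real.Gamma a = Real.Gamma z * ∏ i ∈ Finset.range (n + 1), ((z : ℝ) + i) := by
    rw [← hprod (n + 1), ha]
    push_cast
    rfl
  have h1 : ∀ t ∈ Set.Ioi (0 : ℝ), ENNReal.ofReal (t ^ n * (1 + t) ^ (-a))
      = ∫⁻ y in Set.Ioi (0 : ℝ), ENNReal.ofReal ((1 / Real.Gamma a) *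
          (t ^ n * (y ^ (a - 1) * Real.exp (-((1 + t) * y))))) := by
    intro t ht
    have ht' : (0 : ℝ) < t := ht
    have h := lintegral_rpow_mul_exp ha0 (show 0 < 1 + t by linarith)
    have e : ∀ y : ℝ, ENNReal.ofReal ((1 / Real.Gamma a) *
        (t ^ n * (y ^ (a - 1) * Real.exp (-((1 + t) * y)))))
        = ENNReal.ofReal (1 / Real.Gamma a * t ^ n) *
          ENNReal.ofReal (y ^ (a - 1) * Real.exp (-((1 + t) * y))) := fun y => by
      rw [← ENNReal.ofReal_mul (by positivity), mul_assoc]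
    simp_rw [e]
    rw [lintegral_const_mul' _ _ ENNReal.ofReal_ne_top, h, ← ENNReal.ofReal_mul (by positivity)]
    congr 1
    rw [Real.rpow_neg (by linarith)]
    field_simp
  rw [setLIntegral_congr_fun measurableSet_Ioi h1, lintegral_lintegral_swap
    (by fun_prop)]
  have h2 : ∀ y ∈ Set.Ioi (0 : ℝ), ∫⁻ t in Set.Ioi (0 : ℝ), ENNReal.ofReal ((1 / Real.Gamma a) *
          (t ^ n * (y ^ (a - 1) * Real.exp (-((1 + t) * y)))))
      = ENNReal.ofReal (n.factorial / Real.Gamma a) *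
          ENNReal.ofReal (y ^ ((z : ℝ) - 1) * Real.exp (-(1 * y))) := by
    intro y hy
    have hy' : (0 : ℝ) < y := hy
    have h := lintegral_rpow_mul_exp (show (0 : ℝ) < n + 1 by positivity) hy'
    have e : ∀ t : ℝ, ENNReal.ofReal ((1 / Real.Gamma a) *
        (t ^ n * (y ^ (a - 1) * Real.exp (-((1 + t) * y)))))
        = ENNReal.ofReal (1 / Real.Gamma a * (y ^ (a - 1) * Real.exp (-(1 * y)))) *
          ENNReal.ofReal (t ^ ((n : ℝ) + 1 - 1) * Real.exp (-(y * t))) := fun t => by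
      rw [← ENNReal.ofReal_mul (by positivity)]
      congr 1
      rw [add_sub_cancel_right, Real.rpow_natCast,
        show -((1 + t) * y) = -(1 * y) + -(y * t) by ring, Real.exp_add]
      ring
    simp_rw [e]
    rw [lintegral_const_mul' _ _ ENNReal.ofReal_ne_top, h, ← ENNReal.ofReal_mul (by positivity),
      ← ENNReal.ofReal_mul (by positivity), Real.Gamma_nat_eq_factorial]
    congr 1
    rw [show a - 1 = ((z : ℝ) - 1) + ((n : ℝ) + 1) by rw [ha]; ring, Real.rpow_add hy']
    field_simp
  rw [setLIntegral_congr_fun measurableSet_Ioi h2, lintegral_const_mul' _ _ ENNReal.ofReal_ne_top,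
    lintegral_rpow_mul_exp hz one_pos, Real.one_rpow, div_one,
    ← ENNReal.ofReal_mul (by positivity)]
  congr 1
  rw [hGa']
  have : 0 < ∏ i ∈ Finset.range (n + 1), ((z : ℝ) + i) := Finset.prod_pos fun i _ => by positivity
  field_simp


/-! ### The Poisson–Dirichlet distribution -/

theorem hasSum_congr_equiv {α β : Type*} {a : α → ℝ} {b : β → ℝ} (ha : ∀ i, 0 ≤ a i)
    (hb : ∀ i, 0 ≤ b i) (e : {i // 0 < a i} ≃ {j // 0 < b j}) (he : ∀ i, b (e i) = a i) {s : ℝ} :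
    HasSum a s ↔ HasSum b s := by
  have key : ∀ {γ : Type _} {c : γ → ℝ}, (∀ i, 0 ≤ c i) →
      (HasSum (fun i : {i // 0 < c i} => c i) s ↔ HasSum c s) := fun {γ c} hc =>
    hasSum_subtype_iff_of_support_subset (s := {i | 0 < c i}) fun i hi =>
      lt_of_le_of_ne (hc i) (Ne.symm hi)
  -- A local statement lives in one universe, so the copy serves the second index type.
  have key' : ∀ {γ : Type _} {c : γ → ℝ}, (∀ i, 0 ≤ c i) →
      (HasSum (fun i : {i // 0 < c i} => c i) s ↔ HasSum c s) := fun {γ c} hc =>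
    hasSum_subtype_iff_of_support_subset (s := {i | 0 < c i}) fun i hi =>
      lt_of_le_of_ne (hc i) (Ne.symm hi)
  rw [← key ha, ← key' hb, ← e.hasSum_iff]
  have : (fun i : {j // 0 < b j} => b i) ∘ e = fun i : {i // 0 < a i} => a i := funext he
  rw [this]

theorem hasSum_rank {α : Type*} {a : α → ℝ} (ha : ∀ i, 0 ≤ a i) {s : ℝ} (h : HasSum a s) :
    HasSum (rank a) s := by
  obtain ⟨e, he⟩ := exists_equiv_rank (FiniteLevels.of_hasSum h.summable)
  exact (hasSum_congr_equiv (rank_nonneg a) ha e he).2 h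

/-- The normalized lengths of the points of a configuration. -/
def normalizedPoints (w : ℕ → ℕ × (ℕ → ℝ)) (p : ℕ × ℕ) : ℝ :=
  (pointMass w p / totalMass w).toReal

theorem measurable_normalizedPoints : Measurable normalizedPoints :=
  measurable_pi_lambda _ fun p => (((measurable_pi_apply p).comp measurable_pointMass).div
    measurable_totalMass).ennreal_toReal

theorem tsum_configPoints {w : ℕ → ℕ × (ℕ → ℝ)} (h0 : ∀ p, 0 ≤ configPoints w p) :
    ∑' q, configPoints w q = (totalMass w).toReal := by
  have h : ∀ q, configPoints w q = (pointMass w q).toReal := fun q =>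
    (ENNReal.toReal_ofReal (h0 q)).symm
  rw [totalMass, ENNReal.tsum_toReal_eq (f := pointMass w) fun q => ENNReal.ofReal_ne_top]
  exact tsum_congr h

theorem ae_normalizedPoints (z : PosReal) :
    ∀ᵐ w ∂(poissonProcess z),
      (fun p => configPoints w p / ∑' q, configPoints w q) = normalizedPoints w := by
  filter_upwards [ae_points_pos z] with w h0
  funext p
  rw [tsum_configPoints h0, normalizedPoints, ENNReal.toReal_div, pointMass,
    ENNReal.toReal_ofReal (h0 p)]

theorem poissonDirichlet_eq (z : PosReal) :
    poissonDirichlet z = (poissonProcess z).map fun w => rank (normalizedPoints w) := by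
  refine Measure.map_congr ?_
  filter_upwards [ae_normalizedPoints z] with w hw
  rw [hw]

theorem measurable_rank_normalizedPoints :
    Measurable fun w : ℕ → ℕ × (ℕ → ℝ) => rank (normalizedPoints w) :=
  measurable_rank.comp measurable_normalizedPoints

instance (z : PosReal) : IsProbabilityMeasure (poissonDirichlet z) := by
  rw [poissonDirichlet_eq]
  exact Measure.isProbabilityMeasure_map measurable_rank_normalizedPoints.aemeasurable

/-- The restaurants of total length `1`. -/
structure IsNormalized (ℓ : Restaurant) : Prop where
  rank_eq : rank ℓ = ℓ
  nonneg : ∀ ν, 0 ≤ ℓ ν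
  hasSum : HasSum ℓ 1

theorem hasSum_normalizedPoints {w : ℕ → ℕ × (ℕ → ℝ)} (h0 : totalMass w ≠ 0)
    (h1 : totalMass w ≠ ⊤) : HasSum (normalizedPoints w) 1 := by
  have h : ∑' p, pointMass w p / totalMass w = 1 := by
    simp_rw [div_eq_mul_inv]
    rw [ENNReal.tsum_mul_right]
    exact ENNReal.mul_inv_cancel h0 h1
  have hne : ∑' p, pointMass w p / totalMass w ≠ ⊤ := by
    rw [h]
    exact ENNReal.one_ne_top
  have := ENNReal.hasSum_toReal hne
  rwa [← ENNReal.tsum_toReal_eq (fun p => ENNReal.ne_top_of_tsum_ne_top hne p), h,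
    ENNReal.toReal_one] at this

theorem ae_isNormalized (z : PosReal) : ∀ᵐ ℓ ∂(poissonDirichlet z), IsNormalized ℓ := by
  -- For measurability the summation condition is replaced by an equality of `ENNReal` sums.
  have hset : {ℓ : Restaurant | IsNormalized ℓ}
      = {ℓ | rank ℓ = ℓ} ∩ {ℓ | (∀ ν, 0 ≤ ℓ ν) ∧ ∑' ν, ENNReal.ofReal (ℓ ν) = 1} := by
    ext ℓ
    constructor
    · rintro ⟨h1, h2, h3⟩
      refine ⟨h1, h2, ?_⟩
      rw [← ENNReal.ofReal_tsum_of_nonneg h2 h3.summable, h3.tsum_eq, ENNReal.ofReal_one]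
    · rintro ⟨h1, h2, h3⟩
      refine ⟨h1, h2, ?_⟩
      have hne : ∑' ν, ENNReal.ofReal (ℓ ν) ≠ ⊤ := by
        rw [h3]
        exact ENNReal.one_ne_top
      have := ENNReal.hasSum_toReal hne
      simp only [ENNReal.toReal_ofReal (h2 _)] at this
      have h4 : ∑' ν, ℓ ν = 1 := by
        have h5 := ENNReal.ofReal_tsum_of_nonneg h2 this.summable
        rw [h3] at h5
        have h6 := congrArg ENNReal.toReal h5
        rwa [ENNReal.toReal_ofReal (tsum_nonneg h2), ENNReal.toReal_one] at h6
      rwa [h4] at this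
  have hm : MeasurableSet {ℓ : Restaurant | IsNormalized ℓ} := by
    rw [hset]
    refine (measurableSet_eq_fun measurable_rank measurable_id).inter
      (MeasurableSet.inter (s₁ := {ℓ : Restaurant | ∀ ν, 0 ≤ ℓ ν}) ?_ ?_)
    · have : {ℓ : Restaurant | ∀ ν, 0 ≤ ℓ ν} = ⋂ ν, {ℓ : Restaurant | 0 ≤ ℓ ν} := by
        ext ℓ
        simp
      rw [this]
      exact .iInter fun ν => measurableSet_le measurable_const (measurable_pi_apply ν)
    · exact measurableSet_eq_fun (Measurable.tsum fun ν =>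
        ENNReal.measurable_ofReal.comp (measurable_pi_apply ν)) measurable_const
  rw [poissonDirichlet_eq, ae_map_iff measurable_rank_normalizedPoints.aemeasurable hm]
  filter_upwards [totalMass_ne_zero z, lintegral_totalMass_lt_top z] with w h0 h1
  have h := hasSum_normalizedPoints h0 h1
  exact ⟨rank_rank (FiniteLevels.of_hasSum h.summable), rank_nonneg _,
    hasSum_rank (fun _ => ENNReal.toReal_nonneg) h⟩

/-- A Gamma integral. It trades the division by the total length, which couples all points, for
exponential weights, which factor over the points. -/
theorem inv_pow_eq_lintegral {s : ENNReal} (h0 : s ≠ 0) (h1 : s ≠ ⊤) (n : ℕ) :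
    s⁻¹ ^ (n + 1) = ∫⁻ t in Set.Ioi (0 : ℝ),
      ENNReal.ofReal (t ^ n / n.factorial) * expWeight t s := by
  have hx : 0 < s.toReal := ENNReal.toReal_pos h0 h1
  have h := lintegral_rpow_mul_exp (show (0 : ℝ) < n + 1 by positivity) hx
  have e : ∫⁻ t in Set.Ioi (0 : ℝ), ENNReal.ofReal (t ^ n / n.factorial) * expWeight t s
      = ∫⁻ t in Set.Ioi (0 : ℝ), ENNReal.ofReal (1 / n.factorial) *
        ENNReal.ofReal (t ^ ((n : ℝ) + 1 - 1) * Real.exp (-(s.toReal * t))) := by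
    refine setLIntegral_congr_fun measurableSet_Ioi fun t ht => ?_
    have ht' : (0 : ℝ) < t := ht
    rw [expWeight_of_ne_top _ h1, ← ENNReal.ofReal_mul (by positivity),
      ← ENNReal.ofReal_mul (by positivity), add_sub_cancel_right, Real.rpow_natCast, mul_comm t]
    congr 1
    ring
  rw [e, lintegral_const_mul' _ _ ENNReal.ofReal_ne_top, h, ← ENNReal.ofReal_mul (by positivity),
    Real.Gamma_nat_eq_factorial]
  have hs : s⁻¹ = ENNReal.ofReal (s.toReal)⁻¹ := by
    rw [ENNReal.ofReal_inv_of_pos hx, ENNReal.ofReal_toReal h1]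
  rw [hs, ← ENNReal.ofReal_pow (by positivity)]
  congr 1
  have : (n.factorial : ℝ) ≠ 0 := by positivity
  rw [show (n : ℝ) + 1 = ((n + 1 : ℕ) : ℝ) by push_cast; rfl, Real.rpow_natCast,
    inv_pow]
  field_simp

theorem prod_map_ofReal (z : PosReal) {t : ℝ} (ht : 0 ≤ t) (ms : List ℕ) :
    (ms.map fun m => ENNReal.ofReal (z * (m - 1).factorial / (1 + t) ^ m)).prod
      = ENNReal.ofReal ((ms.map fun m => (z : ℝ) * (m - 1).factorial).prod *
          (1 + t) ^ (-(ms.sum : ℝ))) := by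
  have hz := z.2
  induction ms with
  | nil => simp
  | cons m ms ih =>
    rw [List.map_cons, List.prod_cons, ih, ← ENNReal.ofReal_mul (by positivity)]
    congr 1
    rw [List.map_cons, List.prod_cons, List.sum_cons, Nat.cast_add, neg_add,
      Real.rpow_add (by positivity), Real.rpow_neg (by positivity) (m : ℝ), Real.rpow_natCast]
    field_simp

/-- The correlation functions of the Poisson–Dirichlet distribution. -/
theorem lintegral_distinctSum_poissonDirichlet (z : PosReal) (ms : List ℕ)
    (hms : ∀ m ∈ ms, m ≠ 0) :
    ∫⁻ ℓ, distinctSum ms (fun ν => ENNReal.ofReal (ℓ ν)) ∂(poissonDirichlet z)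
      = ENNReal.ofReal ((ms.map fun m => (z : ℝ) * (m - 1).factorial).prod /
          ∏ i ∈ Finset.range ms.sum, ((z : ℝ) + i)) := by
  have hz := z.2
  rcases ms with _ | ⟨m, ms⟩
  · simp [distinctSum]
  obtain ⟨n, hn⟩ : ∃ n, (m :: ms).sum = n + 1 := by
    refine ⟨(m :: ms).sum - 1, ?_⟩
    have : m ≠ 0 := hms m (by simp)
    rw [List.sum_cons]
    omega
  generalize hL : m :: ms = L at *
  have hD : Measurable fun ℓ : Restaurant => distinctSum L (fun ν => ENNReal.ofReal (ℓ ν)) :=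
    (measurable_distinctSum L).comp (measurable_pi_lambda _ fun ν =>
      ENNReal.measurable_ofReal.comp (measurable_pi_apply ν))
  rw [poissonDirichlet_eq, lintegral_map hD measurable_rank_normalizedPoints]
  have h1 : ∀ᵐ w ∂(poissonProcess z),
      distinctSum L (fun ν => ENNReal.ofReal (rank (normalizedPoints w) ν))
      = ∫⁻ t in Set.Ioi (0 : ℝ), ENNReal.ofReal (t ^ n / n.factorial) *
          (expWeight t (totalMass w) * distinctSum L (pointMass w)) := by
    filter_upwards [totalMass_ne_zero z, lintegral_totalMass_lt_top z] with w h0 h1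
    have h := hasSum_normalizedPoints h0 h1
    obtain ⟨e, he⟩ := exists_equiv_rank (FiniteLevels.of_hasSum h.summable)
    rw [distinctSum_congr_equiv e he L hms]
    have h2 : (fun p => ENNReal.ofReal (normalizedPoints w p))
        = fun p => (totalMass w)⁻¹ * pointMass w p := by
      funext p
      rw [normalizedPoints, ENNReal.ofReal_toReal, div_eq_mul_inv, mul_comm]
      exact (ENNReal.div_lt_top ENNReal.ofReal_ne_top h0).ne
    -- The sum is homogeneous of degree `n + 1`, so the normalization is the factor `S⁻¹ ^ (n + 1)`
    -- for the total length `S`.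
    rw [h2, distinctSum_smul, hn, inv_pow_eq_lintegral h0 h1, ← lintegral_mul_const]
    · simp_rw [mul_assoc]
    · exact (by fun_prop : Measurable fun t : ℝ => ENNReal.ofReal (t ^ n / n.factorial)).mul
        (measurable_expWeight_uncurry.comp (measurable_id.prodMk measurable_const))
  have hG : Measurable fun p : ℝ × (ℕ → ℕ × (ℕ → ℝ)) =>
      expWeight p.1 (totalMass p.2) * distinctSum L (pointMass p.2) :=
    (measurable_expWeight_uncurry.comp
      (measurable_fst.prodMk (measurable_totalMass.comp measurable_snd))).mul
      ((measurable_distinctSum L).comp (measurable_pointMass.comp measurable_snd))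
  have hH : Measurable fun p : (ℕ → ℕ × (ℕ → ℝ)) × ℝ => ENNReal.ofReal (p.2 ^ n / n.factorial) *
      (expWeight p.2 (totalMass p.1) * distinctSum L (pointMass p.1)) :=
    (by fun_prop : Measurable fun p : (ℕ → ℕ × (ℕ → ℝ)) × ℝ =>
      ENNReal.ofReal (p.2 ^ n / n.factorial)).mul (hG.comp measurable_swap)
  rw [lintegral_congr_ae h1, lintegral_lintegral_swap hH.aemeasurable]
  set C : ℝ := (L.map fun m => (z : ℝ) * (m - 1).factorial).prod with hC
  have hC0 : 0 ≤ C := by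
    refine List.prod_nonneg fun x hx => ?_
    obtain ⟨m, _, rfl⟩ := List.mem_map.1 hx
    positivity
  have h2 : ∀ t ∈ Set.Ioi (0 : ℝ), ∫⁻ w, ENNReal.ofReal (t ^ n / n.factorial) *
          (expWeight t (totalMass w) * distinctSum L (pointMass w)) ∂(poissonProcess z)
      = ENNReal.ofReal (C / n.factorial) *
        ENNReal.ofReal (t ^ n * (1 + t) ^ (-((z : ℝ) + (n + 1)))) := by
    intro t ht
    have ht' : (0 : ℝ) < t := ht
    rw [lintegral_const_mul' _ _ ENNReal.ofReal_ne_top,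
      lintegral_expWeight_mul_distinctSum z ht'.le L hms, prod_map_ofReal z ht'.le,
      lintegral_expWeight_totalMass z ht'.le, hn, ← ENNReal.ofReal_mul (by positivity),
      ← ENNReal.ofReal_mul (by positivity), ← ENNReal.ofReal_mul (by positivity)]
    congr 1
    rw [neg_add, Real.rpow_add (by positivity), ← hC]
    push_cast
    ring
  rw [setLIntegral_congr_fun measurableSet_Ioi h2, lintegral_const_mul' _ _ ENNReal.ofReal_ne_top,
    lintegral_rpow_mul_one_add, ← ENNReal.ofReal_mul (by positivity), hn]
  congr 1
  have : 0 < ∏ i ∈ Finset.range (n + 1), ((z : ℝ) + i) := Finset.prod_pos fun i _ => by positivity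
  field_simp


/-! ### Arcs of the circle -/

/-- The length in `(0, 1]` of the arc from `a` to `b`. -/
def arc (a b : UnitAddCircle) : ℝ := (AddCircle.equivIoc 1 0 (b - a) : ℝ)

theorem arc_pos (a b : UnitAddCircle) : 0 < arc a b := (AddCircle.equivIoc 1 0 (b - a)).2.1

theorem arc_le_one (a b : UnitAddCircle) : arc a b ≤ 1 := by
  have := (AddCircle.equivIoc 1 0 (b - a)).2.2
  exact this.trans_eq (zero_add 1)

theorem coe_arc (a b : UnitAddCircle) : (arc a b : UnitAddCircle) = b - a :=
  (AddCircle.equivIoc 1 0).symm_apply_apply (b - a)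

theorem arc_eq_of_coe {a b : UnitAddCircle} {r : ℝ} (h0 : 0 < r) (h1 : r ≤ 1)
    (h : (r : UnitAddCircle) = b - a) : arc a b = r := by
  have hr : r ∈ Set.Ioc (0 : ℝ) (0 + 1) := ⟨h0, by rwa [zero_add]⟩
  have : AddCircle.equivIoc 1 0 (b - a) = ⟨r, hr⟩ := by
    rw [← h]
    exact (AddCircle.equivIoc 1 0).apply_symm_apply ⟨r, hr⟩
  exact congrArg Subtype.val this

theorem coe_one_circle : ((1 : ℝ) : UnitAddCircle) = 0 := AddCircle.coe_period 1

/-- A full turn, not zero: a guest alone at a table is its own successor after going around the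
whole circle. -/
theorem arc_self (a : UnitAddCircle) : arc a a = 1 :=
  arc_eq_of_coe one_pos le_rfl (by rw [coe_one_circle, sub_self])

theorem arc_right_injective (a : UnitAddCircle) : Function.Injective (arc a) := by
  intro b c h
  have h1 := coe_arc a b
  rw [h, coe_arc] at h1
  exact (sub_left_injective h1).symm

theorem arc_lt_one {a b : UnitAddCircle} (h : a ≠ b) : arc a b < 1 := by
  refine lt_of_le_of_ne (arc_le_one a b) fun h1 => h ?_
  rw [← arc_self a] at h1
  exact (arc_right_injective a h1).symm

/-- Both sides agree modulo `1` and every arc lies in `(0, 1]`, so at most one full turn can be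
gained. -/
theorem arc_add (a b c : UnitAddCircle) :
    arc a b + arc b c = arc a c ∨ arc a b + arc b c = arc a c + 1 := by
  have hab := arc_pos a b
  have hbc := arc_pos b c
  have hab' := arc_le_one a b
  have hbc' := arc_le_one b c
  have hc : ((arc a b + arc b c : ℝ) : UnitAddCircle) = c - a := by
    rw [AddCircle.coe_add, coe_arc, coe_arc]
    abel
  rcases le_or_gt (arc a b + arc b c) 1 with h | h
  · exact Or.inl (arc_eq_of_coe (by linarith) h hc).symm
  · right
    have := arc_eq_of_coe (a := a) (b := c) (r := arc a b + arc b c - 1) (by linarith) (by linarith)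
      (by rw [AddCircle.coe_sub, hc, coe_one_circle, sub_zero])
    linarith

theorem arc_add_symm {a b : UnitAddCircle} (h : a ≠ b) : arc a b + arc b a = 1 := by
  have h1 := arc_lt_one h
  have h2 := arc_le_one b a
  rcases arc_add a b a with h3 | h3 <;> rw [arc_self] at h3 <;> linarith

theorem measurable_arc : Measurable fun p : UnitAddCircle × UnitAddCircle => arc p.1 p.2 := by
  have h : Measurable fun x : UnitAddCircle => (AddCircle.equivIoc 1 0 x : ℝ) :=
    measurable_subtype_coe.comp (AddCircle.measurableEquivIoc 1 0).measurable
  exact h.comp (measurable_snd.sub measurable_fst)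

/-! ### Cyclic orders of the guests at the tables -/

section Successor

variable {ι T : Type*}

/-- The guests of a finite set `s` sit at the tables `ν` at the points `θ` of circles, and `σ` sends
each of them to the next one at the same table. -/
structure IsSuccessor (s : Finset ι) (ν : ι → T) (θ : ι → UnitAddCircle) (σ : Equiv.Perm ι) :
    Prop where
  mem : ∀ i ∈ s, σ i ∈ s
  table : ∀ i ∈ s, ν (σ i) = ν i
  le : ∀ i ∈ s, ∀ k ∈ s, ν k = ν i → arc (θ i) (θ (σ i)) ≤ arc (θ i) (θ k)

variable {s : Finset ι} {ν : ι → T} {θ : ι → UnitAddCircle} {σ : Equiv.Perm ι}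

theorem IsSuccessor.apply_eq {τ : Equiv.Perm ι} (h : IsSuccessor s ν θ σ)
    (h' : IsSuccessor s ν θ τ) (hθ : Set.InjOn θ s) {i : ι} (hi : i ∈ s) : σ i = τ i := by
  have h1 := h.le i hi (τ i) (h'.mem i hi) (h'.table i hi)
  have h2 := h'.le i hi (σ i) (h.mem i hi) (h.table i hi)
  exact hθ (h.mem i hi) (h'.mem i hi) (arc_right_injective _ (le_antisymm h1 h2))

theorem sum_perm_eq {β : Finset ι} (hβ : ∀ i ∈ β, σ i ∈ β) (f : ι → ℝ) :
    ∑ i ∈ β, f (σ i) = ∑ i ∈ β, f i := by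
  classical
  refine Finset.sum_nbij σ hβ σ.injective.injOn ?_ fun _ _ => rfl
  exact Finset.surjOn_of_injOn_of_card_le σ hβ σ.injective.injOn le_rfl

/-- The arcs between successive guests cover each table exactly once. -/
theorem IsSuccessor.sum_arc [DecidableEq T] (h : IsSuccessor s ν θ σ) (hθ : Set.InjOn θ s)
    {i : ι} (hi : i ∈ s) : ∑ j ∈ s with ν j = ν i, arc (θ j) (θ (σ j)) = 1 := by
  classical
  set β := s.filter fun j => ν j = ν i with hβ
  have hmem : ∀ j, j ∈ β ↔ j ∈ s ∧ ν j = ν i := fun j => by simp [hβ]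
  have hinv : ∀ j ∈ β, σ j ∈ β := fun j hj => by
    rw [hmem] at hj ⊢
    exact ⟨h.mem j hj.1, (h.table j hj.1).trans hj.2⟩
  -- Seen from `i`, passing from `j` to its successor never goes beyond `i`; only the first step is
  -- corrected by `1`, since `arc (θ i) (θ i) = 1`. Summation over the table telescopes.
  have key : ∀ j ∈ β, arc (θ i) (θ (σ j))
      = arc (θ i) (θ j) + arc (θ j) (θ (σ j)) - if j = i then 1 else 0 := by
    intro j hj
    rw [hmem] at hj
    split_ifs with hji
    · rw [hji, arc_self]
      ring
    · have hne : θ i ≠ θ j := fun hc => hji (hθ hj.1 hi hc.symm)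
      have h1 := h.le j hj.1 i hi hj.2.symm
      have h2 := arc_add_symm hne
      have h3 := arc_pos (θ i) (θ (σ j))
      rcases arc_add (θ i) (θ j) (θ (σ j)) with h4 | h4 <;> linarith
  have h1 := sum_perm_eq hinv fun j => arc (θ i) (θ j)
  rw [Finset.sum_congr rfl key, Finset.sum_sub_distrib, Finset.sum_add_distrib,
    Finset.sum_ite_eq' β i, if_pos ((hmem i).2 ⟨hi, rfl⟩)] at h1
  linarith

/-- Converse of `IsSuccessor.sum_arc`. The number `d j` records whether the arc from `j` to `σ j`
carries one beyond `i`; it is `0` or `1`, equals `1` at `i`, and the total is `1`, so no other arc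
passes `i`. If the guest nearest to `i` were reached from some `j ≠ i`, then `j` would be nearer
still. -/
theorem isSuccessor_of_sum_arc [DecidableEq T] (hσ : ∀ i ∈ s, σ i ∈ s) (hν : ∀ i ∈ s, ν (σ i) = ν i)
    (hsum : ∀ i ∈ s, ∑ j ∈ s with ν j = ν i, arc (θ j) (θ (σ j)) = 1) : IsSuccessor s ν θ σ := by
  classical
  refine ⟨hσ, hν, fun i hi k hk hki => ?_⟩
  set β := s.filter fun j => ν j = ν i with hβ
  have hmem : ∀ j, j ∈ β ↔ j ∈ s ∧ ν j = ν i := fun j => by simp [hβ]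
  have hinv : ∀ j ∈ β, σ j ∈ β := fun j hj => by
    rw [hmem] at hj ⊢
    exact ⟨hσ j hj.1, (hν j hj.1).trans hj.2⟩
  let d : ι → ℝ := fun j => arc (θ i) (θ j) + arc (θ j) (θ (σ j)) - arc (θ i) (θ (σ j))
  have hd : ∀ j, d j = 0 ∨ d j = 1 := fun j => by
    rcases arc_add (θ i) (θ j) (θ (σ j)) with h4 | h4
    · left
      simp only [d]
      linarith
    · right
      simp only [d]
      linarith
  have hdi : d i = 1 := by simp [d, arc_self]
  have hdsum : ∑ j ∈ β, d j = 1 := by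
    have h1 := sum_perm_eq hinv fun j => arc (θ i) (θ j)
    simp only [d]
    rw [Finset.sum_sub_distrib, Finset.sum_add_distrib, h1, hsum i hi]
    ring
  have hiβ : i ∈ β := (hmem i).2 ⟨hi, rfl⟩
  have hd0 : ∀ j ∈ β, j ≠ i → d j = 0 := by
    intro j hj hji
    have h1 : ∑ l ∈ β.erase i, d l = 0 := by
      have := Finset.add_sum_erase β d hiβ
      rw [hdsum, hdi] at this
      linarith
    refine (Finset.sum_eq_zero_iff_of_nonneg fun l _ => ?_).1 h1 j (Finset.mem_erase.2 ⟨hji, hj⟩)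
    rcases hd l with h | h <;> rw [h]
    exact zero_le_one
  obtain ⟨m, hm, hmin⟩ := Finset.exists_min_image β (fun j => arc (θ i) (θ j)) ⟨i, hiβ⟩
  obtain ⟨j, hj, hjm⟩ := Finset.surjOn_of_injOn_of_card_le σ hinv σ.injective.injOn le_rfl hm
  have hji : j = i := by
    by_contra hji
    have h1 := hd0 j hj hji
    simp only [d] at h1
    rw [hjm] at h1
    have h2 := hmin j hj
    have h3 := arc_pos (θ j) (θ m)
    linarith
  rw [← hji, hjm, hji]
  exact hmin k ((hmem k).2 ⟨hk, hki⟩)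

theorem IsSuccessor.pow_mem (h : IsSuccessor s ν θ σ) {i : ι} (hi : i ∈ s) (k : ℕ) :
    (σ ^ k) i ∈ s ∧ ν ((σ ^ k) i) = ν i := by
  induction k with
  | zero => exact ⟨hi, rfl⟩
  | succ k ih =>
    rw [pow_succ', Equiv.Perm.mul_apply]
    exact ⟨h.mem _ ih.1, (h.table _ ih.1).trans ih.2⟩

/-- A function invariant under `σ` is constant on the cycles. -/
theorem eq_of_sameCycle {α : Type*} {F : ι → α} (hσ : ∀ i ∈ s, σ i ∈ s)
    (hF : ∀ i ∈ s, F (σ i) = F i) {i j : ι} (hi : i ∈ s) (hj : j ∈ s) (h : σ.SameCycle i j) :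
    F i = F j := by
  have hpow : ∀ (k : ℕ) i, i ∈ s → (σ ^ k) i ∈ s ∧ F ((σ ^ k) i) = F i := by
    intro k i hi
    induction k with
    | zero => exact ⟨hi, rfl⟩
    | succ k ih =>
      rw [pow_succ', Equiv.Perm.mul_apply]
      exact ⟨hσ _ ih.1, (hF _ ih.1).trans ih.2⟩
  obtain ⟨k, hk⟩ := h
  obtain ⟨m, rfl | rfl⟩ := k.eq_nat_or_neg
  · rw [← hk, zpow_natCast, (hpow m i hi).2]
  · have : (σ ^ m) j = i := by
      rw [← hk, ← zpow_natCast, ← Equiv.Perm.mul_apply, ← zpow_add]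
      simp
    rw [← this, (hpow m j hj).2]

/-- If `j` sits at the table of `i` outside its cycle, choose the guest `k` of the cycle with the
shortest arc to `j`. The successor of `k` comes before `j`, hence is closer to it, a contradiction.
-/
theorem IsSuccessor.sameCycle_iff (h : IsSuccessor s ν θ σ) (hθ : Set.InjOn θ s) {i j : ι}
    (hi : i ∈ s) (hj : j ∈ s) : σ.SameCycle i j ↔ ν i = ν j := by
  classical
  refine ⟨eq_of_sameCycle h.mem h.table hi hj, fun hij => ?_⟩
  by_contra hc
  obtain ⟨k, hk, hmin⟩ := Finset.exists_min_image (s.filter fun k => σ.SameCycle i k)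
    (fun k => arc (θ k) (θ j)) ⟨i, Finset.mem_filter.2 ⟨hi, .refl _ _⟩⟩
  rw [Finset.mem_filter] at hk
  have hkν : ν i = ν k := eq_of_sameCycle h.mem h.table hi hk.1 hk.2
  have hk' : σ.SameCycle i (σ k) := hk.2.trans ⟨1, by simp⟩
  have h1 := h.le k hk.1 j hj (hij.symm.trans hkν)
  have hne : arc (θ k) (θ (σ k)) ≠ arc (θ k) (θ j) := fun he => by
    have := hθ (h.mem k hk.1) hj (arc_right_injective _ he)
    exact hc (this ▸ hk')
  have h2 := lt_of_le_of_ne h1 hne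
  have h3 := hmin (σ k) (Finset.mem_filter.2 ⟨h.mem k hk.1, hk'⟩)
  have h4 := arc_pos (θ k) (θ (σ k))
  have h5 := arc_le_one (θ (σ k)) (θ j)
  rcases arc_add (θ k) (θ (σ k)) (θ j) with h6 | h6 <;> linarith

/-- A new guest is put right after the nearest guest at the same table. -/
theorem IsSuccessor.seat [DecidableEq ι] (h : IsSuccessor s ν θ σ) {N c : ι} (hN : N ∉ s)
    (hσN : σ N = N) (hθ : Set.InjOn θ (insert N s : Finset ι)) (hc : c ∈ insert N s)
    (hcν : ν c = ν N)
    (hmin : ∀ k ∈ insert N s, ν k = ν N → arc (θ c) (θ N) ≤ arc (θ k) (θ N)) :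
    IsSuccessor (insert N s) ν θ (σ * Equiv.swap N c) := by
  have hNs : N ∈ insert N s := Finset.mem_insert_self _ _
  have hsub : ∀ {i}, i ∈ s → i ∈ insert N s := fun hi => Finset.mem_insert_of_mem hi
  have hθ' : ∀ {i j}, i ∈ insert N s → j ∈ insert N s → θ i = θ j → i = j := fun hi hj he =>
    hθ hi hj he
  by_cases hcN : c = N
  · subst hcN
    have hσ : σ * Equiv.swap c c = σ := by rw [Equiv.swap_self]; rfl
    -- The distance of a guest from itself is `1`, the maximum, so the new guest is its own nearest
    -- one only when the table is otherwise empty.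
    have halone : ∀ k ∈ insert c s, ν k = ν c → k = c := by
      intro k hk hkν
      by_contra hne
      have h1 := hmin k hk hkν
      rw [arc_self] at h1
      exact absurd (arc_lt_one fun he => hne (hθ' hk hNs he)) (not_lt.2 h1)
    rw [hσ]
    refine ⟨fun i hi => ?_, fun i hi => ?_, fun i hi k hk hkν => ?_⟩
    · rcases Finset.mem_insert.1 hi with rfl | hi
      · rwa [hσN]
      · exact hsub (h.mem i hi)
    · rcases Finset.mem_insert.1 hi with rfl | hi
      · rw [hσN]
      · exact h.table i hi
    · rcases Finset.mem_insert.1 hi with rfl | his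
      · rw [hσN, halone k hk hkν]
      · rcases Finset.mem_insert.1 hk with rfl | hks
        · exact absurd (halone i hi hkν.symm ▸ his) hN
        · exact h.le i his k hks hkν
  have hcs : c ∈ s := (Finset.mem_insert.1 hc).resolve_left hcN
  have e1 : (σ * Equiv.swap N c) N = σ c := by simp
  have e2 : (σ * Equiv.swap N c) c = N := by simp [hσN]
  have e3 : ∀ i, i ≠ N → i ≠ c → (σ * Equiv.swap N c) i = σ i := fun i h1 h2 => by
    rw [Equiv.Perm.mul_apply, Equiv.swap_apply_of_ne_of_ne h1 h2]
  -- A guest strictly between `c` and `N` would be closer to `N` than `c`.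
  have hcle : ∀ k ∈ insert N s, ν k = ν N → arc (θ c) (θ N) ≤ arc (θ c) (θ k) := by
    intro k hk hkν
    by_contra hlt
    have h1 := hmin k hk hkν
    have h2 := arc_pos (θ c) (θ k)
    have h3 := arc_le_one (θ k) (θ N)
    rcases arc_add (θ c) (θ k) (θ N) with h4 | h4 <;> linarith
  have hNk : ∀ k ∈ s, ν k = ν N → arc (θ N) (θ k) = arc (θ c) (θ k) - arc (θ c) (θ N) := by
    intro k hk hkν
    have h1 := hcle k (hsub hk) hkν
    have hne : arc (θ c) (θ N) ≠ arc (θ c) (θ k) := fun he => by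
      have := hθ' hNs (hsub hk) (arc_right_injective _ he)
      exact hN (this ▸ hk)
    have h2 := lt_of_le_of_ne h1 hne
    have h3 := arc_le_one (θ N) (θ k)
    rcases arc_add (θ c) (θ N) (θ k) with h4 | h4 <;> linarith
  refine ⟨fun i hi => ?_, fun i hi => ?_, fun i hi k hk hkν => ?_⟩
  · by_cases hiN : i = N
    · rw [hiN, e1]
      exact hsub (h.mem c hcs)
    by_cases hic : i = c
    · rw [hic, e2]
      exact hNs
    rw [e3 i hiN hic]
    exact hsub (h.mem i ((Finset.mem_insert.1 hi).resolve_left hiN))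
  · by_cases hiN : i = N
    · rw [hiN, e1, h.table c hcs, hcν]
    by_cases hic : i = c
    · rw [hic, e2, hcν]
    rw [e3 i hiN hic]
    exact h.table i ((Finset.mem_insert.1 hi).resolve_left hiN)
  · by_cases hiN : i = N
    · subst hiN
      rw [e1]
      rcases Finset.mem_insert.1 hk with rfl | hks
      · rw [arc_self]
        exact arc_le_one _ _
      · rw [hNk k hks hkν, hNk (σ c) (h.mem c hcs) ((h.table c hcs).trans hcν)]
        have := h.le c hcs k hks (hkν.trans hcν.symm)
        linarith
    by_cases hic : i = c
    · subst hic
      rw [e2]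
      exact hcle k hk (hkν.trans hcν)
    have his := (Finset.mem_insert.1 hi).resolve_left hiN
    rw [e3 i hiN hic]
    rcases Finset.mem_insert.1 hk with rfl | hks
    · by_contra hlt
      have h1 := h.le i his c hcs (hcν.trans hkν)
      have h2 := hmin i hi hkν.symm
      have h3 := arc_lt_one fun he => hic (hθ' hi hc he)
      have h4 := arc_pos (θ c) (θ k)
      rcases arc_add (θ i) (θ c) (θ k) with h5 | h5 <;> linarith
    · exact h.le i his k hks hkν

/-! ### Cutting the tables at some guests -/

variable {s₀ : Finset ι} {σ₀ g : Equiv.Perm ι}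

theorem IsSuccessor.arc_le_of_label (h₀ : IsSuccessor s₀ ν θ σ₀) {p k : ι} (hp : p ∈ s₀)
    (hk : k ∈ s₀) (hν : ν k = ν p) : ¬ arc (θ p) (θ k) < arc (θ p) (θ (σ₀ p)) :=
  not_lt.2 (h₀.le p hp k hk hν)

/-- The required `p` is the last guest of `s₀` before `j`; if its successor also came before `j`, it
would be nearer. -/
theorem IsSuccessor.exists_label (h₀ : IsSuccessor s₀ ν θ σ₀) {j : ι}
    (hθ : ∀ k ∈ s₀, θ k ≠ θ j) (hj : ∃ p ∈ s₀, ν p = ν j) :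
    ∃ p ∈ s₀, ν j = ν p ∧ arc (θ p) (θ j) < arc (θ p) (θ (σ₀ p)) := by
  classical
  obtain ⟨q, hq, hqν⟩ := hj
  obtain ⟨p, hp, hmin⟩ := Finset.exists_min_image (s₀.filter fun k => ν k = ν j)
    (fun k => arc (θ k) (θ j)) ⟨q, Finset.mem_filter.2 ⟨hq, hqν⟩⟩
  rw [Finset.mem_filter] at hp
  refine ⟨p, hp.1, hp.2.symm, ?_⟩
  by_contra hlt
  have h1 := hmin (σ₀ p) (Finset.mem_filter.2 ⟨h₀.mem p hp.1, (h₀.table p hp.1).trans hp.2⟩)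
  have hne : arc (θ p) (θ (σ₀ p)) ≠ arc (θ p) (θ j) := fun he =>
    hθ _ (h₀.mem p hp.1) (arc_right_injective _ he)
  have h2 := lt_of_le_of_ne (not_lt.1 hlt) hne
  have h3 := arc_pos (θ p) (θ (σ₀ p))
  have h4 := arc_le_one (θ (σ₀ p)) (θ j)
  rcases arc_add (θ p) (θ (σ₀ p)) (θ j) with h5 | h5 <;> linarith

/-- The arc starting at `p` ends no later than at `q` and vice versa, so the two arcs cannot share a
point. -/
theorem IsSuccessor.label_unique (h₀ : IsSuccessor s₀ ν θ σ₀) (hθ : Set.InjOn θ s₀) {p q j : ι}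
    (hp : p ∈ s₀) (hq : q ∈ s₀) (hpν : ν j = ν p) (hqν : ν j = ν q)
    (hpj : arc (θ p) (θ j) < arc (θ p) (θ (σ₀ p)))
    (hqj : arc (θ q) (θ j) < arc (θ q) (θ (σ₀ q))) : p = q := by
  by_contra hne
  have h1 := h₀.le p hp q hq (hqν.symm.trans hpν)
  have h2 := h₀.le q hq p hp (hpν.symm.trans hqν)
  have h3 := arc_add_symm fun he => hne (hθ hp hq he)
  have h4 := arc_pos (θ p) (θ j)
  have h5 := arc_pos (θ q) (θ j)
  rcases arc_add (θ p) (θ q) (θ j) with h6 | h6 <;> linarith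

/-- After the multiplication by `g`, the guests on the arc following `p` stay in the cycle of `p`. -/
theorem IsSuccessor.sameCycle_label (h : IsSuccessor s ν θ σ) (h₀ : IsSuccessor s₀ ν θ σ₀)
    (hss : s₀ ⊆ s) (hθ : Set.InjOn θ s) (hg : ∀ i, i ∉ s₀ → g i = i) {p j : ι} (hp : p ∈ s₀)
    (hj : j ∈ s) (hν : ν j = ν p) (hlt : arc (θ p) (θ j) < arc (θ p) (θ (σ₀ p))) :
    (g * σ).SameCycle p j := by
  classical
  by_contra hc
  -- Take the first violating guest `k` on the arc. It is outside `s₀`, so `g` fixes it and its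
  -- `σ`-predecessor precedes it in the cycle of `g σ` too; this predecessor is `p` or lies earlier
  -- on the arc.
  obtain ⟨k, hk, hmin⟩ := Finset.exists_min_image (s.filter fun k => ν k = ν p ∧
    arc (θ p) (θ k) < arc (θ p) (θ (σ₀ p)) ∧ ¬ (g * σ).SameCycle p k)
    (fun k => arc (θ p) (θ k)) ⟨j, Finset.mem_filter.2 ⟨hj, hν, hlt, hc⟩⟩
  obtain ⟨hks, hkν, hklt, hkc⟩ := Finset.mem_filter.1 hk
  have hk₀ : k ∉ s₀ := fun hk₀ => h₀.arc_le_of_label hp hk₀ hkν hklt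
  obtain ⟨l, hl, hlk⟩ := Finset.surjOn_of_injOn_of_card_le σ h.mem σ.injective.injOn le_rfl hks
  have hl : l ∈ s := hl
  have hstep : (g * σ) l = k := by rw [Equiv.Perm.mul_apply, hlk, hg k hk₀]
  have hlν : ν l = ν p := by rw [← h.table l hl, hlk, hkν]
  by_cases hlp : l = p
  · exact hkc ⟨1, by rw [zpow_one, ← hlp, hstep]⟩
  have h1 := h.le l hl p (hss hp) hlν.symm
  rw [hlk] at h1
  have h2 := arc_add_symm fun he : θ p = θ l => hlp (hθ hl (hss hp) he.symm)
  have h3 := arc_pos (θ l) (θ k)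
  have h4 := arc_pos (θ p) (θ k)
  have h5 : arc (θ p) (θ l) < arc (θ p) (θ k) := by
    rcases arc_add (θ p) (θ l) (θ k) with h6 | h6 <;> linarith
  by_cases hlc : (g * σ).SameCycle p l
  · exact hkc (hlc.trans ⟨1, by rw [zpow_one, hstep]⟩)
  · have := hmin l (Finset.mem_filter.2 ⟨hl, hlν, h5.trans hklt, hlc⟩)
    linarith

/-- The tables without guests from `s₀` do not change after the multiplication by `g`. -/
theorem IsSuccessor.sameCycle_of_untouched (h : IsSuccessor s ν θ σ) (hθ : Set.InjOn θ s)
    (hg : ∀ i, i ∉ s₀ → g i = i) {i j : ι} (hi : i ∈ s) (hj : j ∈ s) (hν : ν i = ν j)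
    (hun : ∀ p ∈ s₀, ν p ≠ ν i) : (g * σ).SameCycle i j := by
  have hpow : ∀ (k : ℕ) i, i ∈ s → (∀ p ∈ s₀, ν p ≠ ν i) → ((g * σ) ^ k) i = (σ ^ k) i := by
    intro k i hi hun
    induction k with
    | zero => rfl
    | succ k ih =>
      rw [pow_succ', Equiv.Perm.mul_apply, ih, pow_succ' σ, Equiv.Perm.mul_apply,
        Equiv.Perm.mul_apply]
      refine hg _ fun hc => hun _ hc ?_
      have := h.pow_mem hi k
      rw [h.table _ this.1, this.2]
  obtain ⟨k, hk⟩ := (h.sameCycle_iff hθ hi hj).2 hν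
  obtain ⟨m, rfl | rfl⟩ := k.eq_nat_or_neg
  · rw [zpow_natCast] at hk
    exact ⟨m, by rw [zpow_natCast, hpow m i hi hun, hk]⟩
  · have hk' : (σ ^ m) j = i := by
      rw [← hk, ← zpow_natCast, ← Equiv.Perm.mul_apply, ← zpow_add]
      simp
    refine Equiv.Perm.SameCycle.symm ⟨m, ?_⟩
    rw [zpow_natCast, hpow m j hj (fun p hp => hν ▸ hun p hp), hk']

open Classical in
/-- The table of a guest, if it has no guests from `s₀`. -/
def untouchedTable (s₀ : Finset ι) (ν : ι → T) (i : ι) : Option T :=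
  if ∃ p ∈ s₀, ν p = ν i then none else some (ν i)

/-- The permutation `g` can mix only tables with guests from `s₀`. Once these are identified as
`none`, the table is invariant under `g σ`. -/
theorem IsSuccessor.untouchedTable_eq (h : IsSuccessor s ν θ σ) (hss : s₀ ⊆ s)
    (hg : ∀ i, i ∉ s₀ → g i = i) (hgs : ∀ i ∈ s₀, g i ∈ s₀) {i j : ι} (hi : i ∈ s) (hj : j ∈ s)
    (hc : (g * σ).SameCycle i j) : untouchedTable s₀ ν i = untouchedTable s₀ ν j := by
  refine eq_of_sameCycle (s := s) (F := untouchedTable s₀ ν) (fun i hi => ?_) (fun i hi => ?_)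
    hi hj hc
  · rw [Equiv.Perm.mul_apply]
    by_cases h0 : σ i ∈ s₀
    · exact hss (hgs _ h0)
    · rw [hg _ h0]
      exact h.mem i hi
  · rw [Equiv.Perm.mul_apply]
    by_cases h0 : σ i ∈ s₀
    · unfold untouchedTable
      rw [if_pos ⟨g (σ i), hgs _ h0, rfl⟩, if_pos ⟨σ i, h0, h.table i hi⟩]
    · unfold untouchedTable
      rw [hg _ h0, h.table i hi]

end Successor


/-! ### Densities of sets of natural numbers -/

open Classical in
/-- The set `S` of natural numbers has the asymptotic frequency `d`. -/
def HasDensity (S : Set ℕ) (d : ℝ) : Prop :=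
  Filter.Tendsto (fun N : ℕ => (∑ k ∈ Finset.range N, if k ∈ S then (1 : ℝ) else 0) / N)
    Filter.atTop (nhds d)

theorem hasDensity_empty : HasDensity ∅ 0 := by
  simp [HasDensity]

open Classical in
-- The guests below `n` change the numerators by a bounded amount and do not affect the limit.
theorem HasDensity.of_sum {κ : Type*} {s : Finset κ} {A : κ → Set ℕ} {d : κ → ℝ} {S : Set ℕ}
    (hA : ∀ p ∈ s, HasDensity (A p) (d p)) (n : ℕ)
    (h : ∀ k, n ≤ k → (if k ∈ S then (1 : ℝ) else 0) = ∑ p ∈ s, if k ∈ A p then 1 else 0) :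
    HasDensity S (∑ p ∈ s, d p) := by
  have h1 := tendsto_finsetSum s hA
  have h2 : Filter.Tendsto (fun N : ℕ => (∑ k ∈ Finset.range n,
      ((if k ∈ S then (1 : ℝ) else 0) - ∑ p ∈ s, if k ∈ A p then 1 else 0)) / (N : ℝ))
      Filter.atTop (nhds 0) :=
    tendsto_const_nhds.div_atTop tendsto_natCast_atTop_atTop
  have h3 := h1.add h2
  rw [add_zero] at h3
  refine h3.congr' ?_
  filter_upwards [Filter.eventually_ge_atTop n] with N hN
  rw [← Finset.sum_div, ← add_div, Finset.sum_comm]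
  congr 1
  rw [← Finset.sum_range_add_sum_Ico _ hN, ← Finset.sum_range_add_sum_Ico (fun k =>
    if k ∈ S then (1 : ℝ) else 0) hN, Finset.sum_sub_distrib]
  have : ∑ k ∈ Finset.Ico n N, (if k ∈ S then (1 : ℝ) else 0)
      = ∑ k ∈ Finset.Ico n N, ∑ p ∈ s, if k ∈ A p then 1 else 0 :=
    Finset.sum_congr rfl fun k hk => h k (Finset.mem_Ico.1 hk).1
  rw [this]
  ring

theorem HasDensity.union {A B : Set ℕ} {a b : ℝ} (hA : HasDensity A a) (hB : HasDensity B b)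
    (h : Disjoint A B) : HasDensity (A ∪ B) (a + b) := by
  classical
  refine (Filter.Tendsto.add hA hB).congr fun N => ?_
  rw [← add_div, ← Finset.sum_add_distrib]
  congr 1
  refine Finset.sum_congr rfl fun k _ => ?_
  by_cases h1 : k ∈ A
  · have h2 : k ∉ B := Set.disjoint_left.1 h h1
    simp [h1, h2]
  · simp [h1]

theorem HasDensity.diff {A B : Set ℕ} {a b : ℝ} (hA : HasDensity A a) (hB : HasDensity B b)
    (h : B ⊆ A) : HasDensity (A \ B) (a - b) := by
  classical
  refine (Filter.Tendsto.sub hA hB).congr fun N => ?_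
  rw [← sub_div, ← Finset.sum_sub_distrib]
  congr 1
  refine Finset.sum_congr rfl fun k _ => ?_
  by_cases h1 : k ∈ B
  · simp [h1, h h1]
  · simp [h1]

theorem HasDensity.squeeze {S : Set ℕ} {d : ℝ}
    (h : ∀ ε > 0, ∃ A B : Set ℕ, ∃ a b : ℝ, A ⊆ S ∧ S ⊆ B ∧ HasDensity A a ∧ HasDensity B b ∧
      d - ε < a ∧ b < d + ε) : HasDensity S d := by
  classical
  have mono : ∀ {A B : Set ℕ}, A ⊆ B → ∀ N : ℕ,
      (∑ k ∈ Finset.range N, if k ∈ A then (1 : ℝ) else 0) / N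
        ≤ (∑ k ∈ Finset.range N, if k ∈ B then (1 : ℝ) else 0) / N := by
    intro A B hAB N
    gcongr with k _
    split_ifs with h1 h2
    · exact le_rfl
    · exact absurd (hAB h1) h2
    · exact zero_le_one
    · exact le_rfl
  rw [HasDensity, Metric.tendsto_atTop']
  intro ε hε
  obtain ⟨A, B, a, b, hA, hB, ha, hb, hda, hdb⟩ := h ε hε
  have h1 := ha.eventually (lt_mem_nhds hda)
  have h2 := hb.eventually (gt_mem_nhds hdb)
  obtain ⟨N, hN⟩ := Filter.eventually_atTop.1 (h1.and h2)
  refine ⟨N, fun M hM => ?_⟩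
  have h3 := hN M hM.le
  rw [Real.dist_eq, abs_lt]
  constructor
  · have := mono hA M
    linarith [h3.1]
  · have := mono hB M
    linarith [h3.2]

theorem HasDensity.nonempty {S : Set ℕ} {d : ℝ} (h : HasDensity S d) (hd : 0 < d) : S.Nonempty := by
  by_contra hS
  rw [Set.not_nonempty_iff_eq_empty] at hS
  subst hS
  have := tendsto_nhds_unique h hasDensity_empty
  exact hd.ne' this

/-- For large `N` the cycle of `i` consists of the guests below `N` with the label of `i`, so the
upper limit defining the length is an honest limit. -/
theorem HasDensity.tableLength_eq {K : Type*} {v : VirtualPerm} {f : ℕ → K} {n : ℕ}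
    (hf : ∀ i j N, n ≤ N → i < N → j < N → ((v.seq N).SameCycle i j ↔ f i = f j)) {i : ℕ} {d : ℝ}
    (h : HasDensity {k | f k = f i} d) : tableLength v i = d := by
  classical
  refine Filter.Tendsto.limsup_eq (h.congr' ?_)
  filter_upwards [Filter.eventually_ge_atTop n, Filter.eventually_gt_atTop i] with N hN hi
  congr 1
  have : {j | (v.seq N).SameCycle i j}
      = ((Finset.range N).filter fun k => f k = f i : Finset ℕ) := by
    ext j
    simp only [Set.mem_ofPred_eq, Finset.coe_filter, Finset.mem_range]
    constructor
    · intro hc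
      have hj : j < N := by
        by_contra hj
        obtain ⟨k, hk⟩ := hc.symm
        have h1 : ((v.seq N) ^ k) j = j := Function.IsFixedPt.perm_zpow (v.fix N j (not_lt.1 hj)) k
        omega
      exact ⟨hj, ((hf i j N hN hi hj).1 hc).symm⟩
    · rintro ⟨hj, he⟩
      exact (hf i j N hN hi hj).2 he.symm
  rw [this, Set.ncard_coe_finset, Finset.card_filter]
  push_cast
  rfl

/-! ### Virtual permutations from tables and points of circles -/

/-- The distance from the guest `j` to the guest `n` at the same table (`2` at different tables). -/
def seatDistance (x : ℕ → ℕ × UnitAddCircle) (n j : ℕ) : ℝ :=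
  if (x j).1 = (x n).1 then arc (x j).2 (x n).2 else 2

open Classical in
theorem nearest_nonempty (x : ℕ → ℕ × UnitAddCircle) (n : ℕ) :
    (Finset.univ.filter fun j : Fin (n + 1) =>
      ∀ i : Fin (n + 1), seatDistance x n j ≤ seatDistance x n i).Nonempty := by
  obtain ⟨j, -, hj⟩ := Finset.exists_min_image Finset.univ
    (fun j : Fin (n + 1) => seatDistance x n j) Finset.univ_nonempty
  exact ⟨j, Finset.mem_filter.2 ⟨Finset.mem_univ _, fun i => hj i (Finset.mem_univ _)⟩⟩

open Classical in
/-- The guest after which the guest `n` is put. -/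
def nearest (x : ℕ → ℕ × UnitAddCircle) (n : ℕ) : Fin (n + 1) :=
  (Finset.univ.filter fun j : Fin (n + 1) =>
    ∀ i : Fin (n + 1), seatDistance x n j ≤ seatDistance x n i).min' (nearest_nonempty x n)

theorem nearest_le (x : ℕ → ℕ × UnitAddCircle) (n : ℕ) (i : Fin (n + 1)) :
    seatDistance x n (nearest x n) ≤ seatDistance x n i := by
  classical
  have := Finset.min'_mem _ (nearest_nonempty x n)
  exact (Finset.mem_filter.1 this).2 i

/-- The virtual permutation formed by guests at points of circles. -/
def arrange (x : ℕ → ℕ × UnitAddCircle) : VirtualPerm := seating (nearest x)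

theorem measurable_seatDistance (n j : ℕ) :
    Measurable fun x : ℕ → ℕ × UnitAddCircle => seatDistance x n j := by
  refine Measurable.ite ?_ ?_ measurable_const
  · exact measurableSet_eq_fun (measurable_fst.comp (measurable_pi_apply j))
      (measurable_fst.comp (measurable_pi_apply n))
  · exact measurable_arc.comp ((measurable_snd.comp (measurable_pi_apply j)).prodMk
      (measurable_snd.comp (measurable_pi_apply n)))

/-- Since the least of the nearest guests is chosen, each fiber is a finite Boolean combination of
comparisons of distances. -/
theorem measurable_arrange : Measurable arrange := by
  classical
  refine measurable_seating.comp (measurable_pi_lambda _ fun n => ?_)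
  refine measurable_to_countable' fun j => ?_
  have hP : ∀ j : Fin (n + 1), MeasurableSet {x : ℕ → ℕ × UnitAddCircle |
      ∀ i : Fin (n + 1), seatDistance x n j ≤ seatDistance x n i} := fun j => by
    simp only [Set.ofPred_forall]
    exact .iInter fun i => measurableSet_le (measurable_seatDistance n j) (measurable_seatDistance n i)
  have : (fun x => nearest x n) ⁻¹' {j} = {x | ∀ i : Fin (n + 1),
      seatDistance x n j ≤ seatDistance x n i} ∩ ⋂ l : Fin (n + 1), ⋂ (_ : l < j),
        {x | ∀ i : Fin (n + 1), seatDistance x n l ≤ seatDistance x n i}ᶜ := by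
    ext x
    simp only [Set.mem_preimage, Set.mem_singleton_iff, Set.mem_inter_iff, Set.mem_iInter,
      Set.mem_compl_iff, Set.mem_ofPred_eq, nearest]
    rw [Finset.min'_eq_iff]
    simp only [Finset.mem_filter, Finset.mem_univ, true_and]
    refine and_congr_right fun _ => forall_congr' fun l => ?_
    constructor
    · intro h h1 h2
      exact absurd (h h2) (not_le.2 h1)
    · intro h h1
      by_contra h2
      exact h (not_le.1 h2) h1
  rw [this]
  exact (hP j).inter (.iInter fun l => .iInter fun _ => (hP l).compl)

theorem isSuccessor_arrange {x : ℕ → ℕ × UnitAddCircle}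
    (hθ : Function.Injective fun i => (x i).2) (N : ℕ) :
    IsSuccessor (Finset.range N) (fun i => (x i).1) (fun i => (x i).2) ((arrange x).seq N) := by
  classical
  induction N with
  | zero => exact ⟨by simp, by simp, by simp⟩
  | succ N ih =>
    rw [Finset.range_add_one]
    set c : ℕ := (nearest x N).val with hc
    -- The guest itself is available at distance `1`, so a guest of another table, at distance `2`,
    -- is never chosen.
    have hself : seatDistance x N N = 1 := by
      rw [seatDistance, if_pos rfl, arc_self]
    have hcν : (x c).1 = (x N).1 := by
      by_contra hne
      have h1 := nearest_le x N (Fin.last N)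
      rw [Fin.val_last, hself, ← hc, seatDistance, if_neg hne] at h1
      norm_num at h1
    refine ih.seat (by simp) ((arrange x).fix N N le_rfl) hθ.injOn ?_ hcν ?_
    · rw [← Finset.range_add_one, Finset.mem_range]
      exact (nearest x N).2
    · intro k hk hkν
      rw [← Finset.range_add_one, Finset.mem_range] at hk
      have h1 := nearest_le x N ⟨k, hk⟩
      rwa [← hc, seatDistance, if_pos hcν, seatDistance, if_pos hkν] at h1

/-! ### Frequencies of the guests on arcs -/

/-- The properties of typical guests of the restaurant `ℓ`. -/
structure IsTypical (ℓ : Restaurant) (x : ℕ → ℕ × UnitAddCircle) : Prop where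
  inj : Function.Injective fun i => (x i).2
  pos : ∀ i, 0 < ℓ (x i).1
  dens : ∀ a, ∀ q : ℚ, 0 ≤ q → q ≤ 1 → HasDensity {k | (x k).1 = a ∧ arc 0 (x k).2 ≤ q} (ℓ a * q)

variable {ℓ : Restaurant} {x : ℕ → ℕ × UnitAddCircle}

/-- The strong law can be imposed only for countably many arcs at once; monotonicity extends it from
rational endpoints to all real ones. -/
theorem IsTypical.density_le (h : IsTypical ℓ x) (hℓ : ∀ a, 0 ≤ ℓ a) (a : ℕ) {t : ℝ} (h0 : 0 ≤ t)
    (h1 : t ≤ 1) : HasDensity {k | (x k).1 = a ∧ arc 0 (x k).2 ≤ t} (ℓ a * t) := by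
  refine HasDensity.squeeze fun ε hε => ?_
  have hδ : 0 < ε / (ℓ a + 1) := div_pos hε (by linarith [hℓ a])
  have hlow : ∃ q : ℚ, 0 ≤ q ∧ (q : ℝ) ≤ t ∧ t - ε / (ℓ a + 1) ≤ q := by
    rcases h0.eq_or_lt with rfl | h0
    · exact ⟨0, le_rfl, by simp, by rw [Rat.cast_zero]; linarith⟩
    · obtain ⟨q, hq1, hq2⟩ := exists_rat_btwn (max_lt h0 (sub_lt_self t hδ))
      rw [max_lt_iff] at hq1
      exact ⟨q, by exact_mod_cast hq1.1.le, hq2.le, hq1.2.le⟩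
  have hup : ∃ q : ℚ, q ≤ 1 ∧ t ≤ (q : ℝ) ∧ q ≤ t + ε / (ℓ a + 1) := by
    rcases h1.eq_or_lt with rfl | h1
    · exact ⟨1, le_rfl, by simp, by rw [Rat.cast_one]; linarith⟩
    · obtain ⟨q, hq1, hq2⟩ := exists_rat_btwn (lt_min h1 (lt_add_of_pos_right t hδ))
      rw [lt_min_iff] at hq2
      exact ⟨q, by exact_mod_cast hq2.1.le, hq1.le, hq2.2.le⟩
  obtain ⟨q, hq0, hq1, hq2⟩ := hlow
  obtain ⟨r, hr0, hr1, hr2⟩ := hup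
  have hb : ℓ a * (ε / (ℓ a + 1)) < ε := by
    have := hℓ a
    rw [← mul_div_assoc, div_lt_iff₀ (by linarith)]
    nlinarith
  refine ⟨_, _, _, _, ?_, ?_, h.dens a q hq0 (by exact_mod_cast hq1.trans h1),
    h.dens a r (by exact_mod_cast h0.trans hr1) hr0, ?_, ?_⟩
  · exact fun k hk => ⟨hk.1, hk.2.trans hq1⟩
  · exact fun k hk => ⟨hk.1, hk.2.trans hr1⟩
  · nlinarith [hℓ a, mul_le_mul_of_nonneg_left hq2 (hℓ a)]
  · nlinarith [hℓ a, mul_le_mul_of_nonneg_left hr2 (hℓ a)]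

theorem IsTypical.density_lt (h : IsTypical ℓ x) (hℓ : ∀ a, 0 ≤ ℓ a) (a : ℕ) {t : ℝ} (h0 : 0 ≤ t)
    (h1 : t ≤ 1) : HasDensity {k | (x k).1 = a ∧ arc 0 (x k).2 < t} (ℓ a * t) := by
  rcases h0.eq_or_lt with rfl | h0
  · have : {k | (x k).1 = a ∧ arc 0 (x k).2 < 0} = ∅ := by
      ext k
      simpa using fun _ => (arc_pos _ _).le
    rw [this, mul_zero]
    exact hasDensity_empty
  refine HasDensity.squeeze fun ε hε => ?_
  have hδ : 0 < ε / (ℓ a + 1) := div_pos hε (by linarith [hℓ a])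
  obtain ⟨s, hs1, hs2⟩ := exists_between (max_lt h0 (sub_lt_self t hδ))
  rw [max_lt_iff] at hs1
  have hb : ℓ a * (ε / (ℓ a + 1)) < ε := by
    have := hℓ a
    rw [← mul_div_assoc, div_lt_iff₀ (by linarith)]
    nlinarith
  refine ⟨_, _, _, _, ?_, ?_, h.density_le hℓ a hs1.1.le (hs2.le.trans h1),
    h.density_le hℓ a h0.le h1, ?_, by linarith⟩
  · exact fun k hk => ⟨hk.1, hk.2.trans_lt hs2⟩
  · exact fun k hk => ⟨hk.1, hk.2.le⟩
  · nlinarith [hℓ a, mul_le_mul_of_nonneg_left hs1.2.le (hℓ a)]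

theorem IsTypical.density_table (h : IsTypical ℓ x) (a : ℕ) :
    HasDensity {k | (x k).1 = a} (ℓ a) := by
  have h1 := h.dens a 1 zero_le_one le_rfl
  rw [Rat.cast_one, mul_one] at h1
  convert h1 using 3
  simp [arc_le_one]

/-- The frequency of the guests on the arc from `b` to `c` of the circle number `a`. -/
theorem IsTypical.density_arc (h : IsTypical ℓ x) (hℓ : ∀ a, 0 ≤ ℓ a) (a : ℕ)
    (b c : UnitAddCircle) :
    HasDensity {k | (x k).1 = a ∧ arc b (x k).2 < arc b c} (ℓ a * arc b c) := by
  have b0 := arc_pos 0 b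
  have b1 := arc_le_one 0 b
  have c0 := arc_pos 0 c
  have c1 := arc_le_one 0 c
  -- The arc from `b` to `c` is expressed through arcs issuing from the base point `0`; whether it
  -- crosses `0` decides between a difference of two such arcs and a disjoint union.
  have key : ∀ y, (arc 0 b < arc 0 y ∧ arc b y = arc 0 y - arc 0 b) ∨
      (arc 0 y ≤ arc 0 b ∧ arc b y = arc 0 y - arc 0 b + 1) := by
    intro y
    have h1 := arc_pos b y
    have h2 := arc_le_one b y
    have h3 := arc_pos 0 y
    rcases arc_add 0 b y with h4 | h4
    · exact Or.inl ⟨by linarith, by linarith⟩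
    · exact Or.inr ⟨by linarith, by linarith⟩
  rcases key c with ⟨hc, hcb⟩ | ⟨hc, hcb⟩
  · have h1 := (h.density_lt hℓ a c0.le c1).diff (h.density_le hℓ a b0.le b1)
      fun k hk => ⟨hk.1, hk.2.trans_lt hc⟩
    convert h1 using 1
    · ext k
      simp only [Set.mem_ofPred_eq, Set.mem_sdiff, not_and, not_le]
      refine ⟨fun ⟨h2, h3⟩ => ?_, fun ⟨⟨h2, h3⟩, h4⟩ => ⟨h2, ?_⟩⟩
      · have := arc_pos 0 (x k).2
        rcases key (x k).2 with ⟨h4, h5⟩ | ⟨h4, h5⟩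
        · exact ⟨⟨h2, by linarith⟩, fun _ => h4⟩
        · linarith
      · have := h4 h2
        rcases key (x k).2 with ⟨h4, h5⟩ | ⟨h4, h5⟩ <;> linarith
    · rw [hcb]
      ring
  · have h1 := ((h.density_table a).diff (h.density_le hℓ a b0.le b1)
      fun k hk => hk.1).union (h.density_lt hℓ a c0.le c1) ?_
    · convert h1 using 1
      · ext k
        simp only [Set.mem_ofPred_eq, Set.mem_sdiff, not_and, not_le, Set.mem_union]
        refine ⟨fun ⟨h2, h3⟩ => ?_, ?_⟩
        · rcases key (x k).2 with ⟨h4, h5⟩ | ⟨h4, h5⟩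
          · exact Or.inl ⟨h2, fun _ => h4⟩
          · exact Or.inr ⟨h2, by linarith⟩
        · have h6 := arc_le_one 0 (x k).2
          rintro (⟨h2, h3⟩ | ⟨h2, h3⟩)
          · have := h3 h2
            refine ⟨h2, ?_⟩
            rcases key (x k).2 with ⟨h4, h5⟩ | ⟨h4, h5⟩ <;> linarith
          · refine ⟨h2, ?_⟩
            rcases key (x k).2 with ⟨h4, h5⟩ | ⟨h4, h5⟩ <;> linarith
      · rw [hcb]
        ring
    · rw [Set.disjoint_left]
      rintro k ⟨h2, h3⟩ ⟨h4, h5⟩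
      exact h3 ⟨h4, h5.le.trans hc⟩


/-! ### Finite permutations -/

theorem exists_extendPerm {n : ℕ} {π : Equiv.Perm ℕ} (h : ∀ i, n ≤ i → π i = i) :
    ∃ σ : Equiv.Perm (Fin n), extendPerm σ = π := by
  have hlt : ∀ i : Fin n, π i < n := fun i => by
    by_contra hc
    have := π.injective (h _ (not_lt.1 hc))
    omega
  have hinj : Function.Injective fun i : Fin n => (⟨π i, hlt i⟩ : Fin n) := fun i j hij =>
    Fin.ext (π.injective (Fin.mk.inj hij))
  refine ⟨Equiv.ofBijective _ (Finite.injective_iff_bijective.1 hinj), ?_⟩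
  ext i
  by_cases hi : i < n
  · lift i to Fin n using hi
    rw [extendPerm_apply_fin]
    rfl
  · rw [extendPerm_fix _ i (not_lt.1 hi), h i (not_lt.1 hi)]

theorem extendPerm_injective (n : ℕ) : Function.Injective (extendPerm : Equiv.Perm (Fin n) → _) := by
  intro σ τ h
  ext i
  rw [← extendPerm_apply_fin, ← extendPerm_apply_fin, h]

theorem extendPerm_sameCycle {n : ℕ} {σ : Equiv.Perm (Fin n)} {i j : Fin n} :
    (extendPerm σ).SameCycle i j ↔ σ.SameCycle i j := by
  refine exists_congr fun k => ?_
  have : extendPerm σ ^ k = extendPerm (σ ^ k) :=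
    (map_zpow (MonoidHom.mk' extendPerm extendPerm_mul) σ k).symm
  rw [this, extendPerm_apply_fin, Fin.ext_iff]

theorem Vertex.mk_eq_iff {n : ℕ} {p q : Equiv.Perm (Fin n)} {i j : Fin n} :
    Vertex.mk p q i = Vertex.mk p q j ↔ (p⁻¹ * q).SameCycle i j := Quotient.eq

theorem Vertex.mk_one_eq_iff {n : ℕ} {q : Equiv.Perm (Fin n)} {i j : Fin n} :
    Vertex.mk 1 q i = Vertex.mk 1 q j ↔ q.SameCycle i j := by
  rw [Vertex.mk_eq_iff, inv_one, one_mul]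

theorem Vertex.exists_mk {n : ℕ} {p q : Equiv.Perm (Fin n)} (v : Vertex p q) :
    ∃ i, Vertex.mk p q i = v := Quotient.exists_rep v

theorem cycleCount_extendPerm {n : ℕ} (σ : Equiv.Perm (Fin n)) :
    cycleCount n (extendPerm σ) = Nat.card (Vertex 1 σ) := by
  refine cycleCount_eq_card _ _ fun i j => ?_
  rw [extendPerm_sameCycle, ← Vertex.mk_one_eq_iff]
  exact Quotient.eq.symm

theorem act_inv_seq {n : ℕ} (g : Equiv.Perm (Fin n)) (u : VirtualPerm) {N : ℕ} (hN : n ≤ N) :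
    (act g⁻¹ 1 u).seq N = extendPerm g * u.seq N := by
  rw [act_seq _ _ _ hN, extendPerm_one, mul_one, extendPerm_inv, inv_inv]

theorem cycleIncrement_inv {n : ℕ} (g σ : Equiv.Perm (Fin n)) {u : VirtualPerm}
    (h : u.seq n = extendPerm σ) : cycleIncrement g⁻¹ 1 u
      = (Nat.card (Vertex 1 (g * σ)) : ℤ) - Nat.card (Vertex 1 σ) := by
  rw [cycleIncrement, act_inv_seq g u le_rfl, h, ← extendPerm_mul, cycleCount_extendPerm,
    cycleCount_extendPerm]

/-! ### Restaurants of typical guests -/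

open Classical in
/-- The lengths of the new tables: the arc from `p` to `σ p` is attached to the cycle of `p` under
`g σ`. -/
def cutLengths {n : ℕ} (g σ : Equiv.Perm (Fin n)) (L : Fin n → ℝ) (d : Fin n → ℝ)
    (γ : Vertex 1 (g * σ)) : ℝ :=
  ∑ p with Vertex.mk 1 (g * σ) p = γ, L p * d p

variable {ℓ : Restaurant} {x : ℕ → ℕ × UnitAddCircle}

theorem IsTypical.tableLengths_arrange (hx : IsTypical ℓ x) (hℓ : IsNormalized ℓ) :
    tableLengths (arrange x) = ℓ := by
  have hf : ∀ i j N, 0 ≤ N → i < N → j < N →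
      (((arrange x).seq N).SameCycle i j ↔ (x i).1 = (x j).1) := fun i j N _ hi hj =>
    (isSuccessor_arrange hx.inj N).sameCycle_iff hx.inj.injOn (Finset.mem_range.2 hi)
      (Finset.mem_range.2 hj)
  rw [tableLengths_eq_rank (arrange x) (fun i => (x i).1) ℓ, hℓ.rank_eq]
  · exact fun i j => ⟨i + j + 1, by omega, by omega, hf i j _ (by omega) (by omega) (by omega)⟩
  · exact fun i => HasDensity.tableLength_eq hf (hx.density_table _)
  · exact fun k hk => (hx.density_table k).nonempty hk

/-- A guest `j` at a table without the first `n` guests keeps its table. Otherwise it is labeled by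
the cycle under `g σ` of the guest `p < n` on whose arc it lies, with `p = j` when `j < n`. These
labels describe the new tables, and the frequency of a new table is the sum of the frequencies of
its arcs. -/
theorem IsTypical.tableLengths_act (hx : IsTypical ℓ x) (hℓ : IsNormalized ℓ) {n : ℕ}
    (g σ : Equiv.Perm (Fin n)) (hσ : (arrange x).seq n = extendPerm σ) (τ : Fin n → Table ℓ)
    (hτ : ∀ i, (τ i).1 = (x i).1) :
    tableLengths (act g⁻¹ 1 (arrange x)) = replaceTables ℓ (Set.range τ)
      (cutLengths g σ (fun p => ℓ (τ p)) fun p => arc (x p).2 (x (σ p)).2) := by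
  classical
  set ν : ℕ → ℕ := fun i => (x i).1 with hν
  set θ : ℕ → UnitAddCircle := fun i => (x i).2 with hθ
  have hS := isSuccessor_arrange hx.inj
  have hgfix : ∀ i, i ∉ Finset.range n → extendPerm g i = i := fun i hi =>
    extendPerm_fix g i (by simpa using hi)
  have hgs : ∀ i ∈ Finset.range n, extendPerm g i ∈ Finset.range n := by
    intro i hi
    lift i to Fin n using Finset.mem_range.1 hi
    rw [extendPerm_apply_fin]
    simp
  have hσn : ∀ p : Fin n, (arrange x).seq n p = σ p := fun p => by rw [hσ, extendPerm_apply_fin]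
  let inArc : Fin n → ℕ → Prop := fun p j => ν j = ν p ∧ arc (θ p) (θ j) < arc (θ p) (θ (σ p))
  have hlabel : ∀ j, (∃ p : Fin n, ν p = ν j) → ∃ p : Fin n, (j < n → (p : ℕ) = j) ∧
      (n ≤ j → inArc p j) := by
    intro j hj
    by_cases hjn : j < n
    · exact ⟨⟨j, hjn⟩, fun _ => rfl, fun h => absurd hjn (not_lt.2 h)⟩
    · obtain ⟨p, hp⟩ := hj
      obtain ⟨q, hq, hq1, hq2⟩ := (hS n).exists_label (j := j)
        (fun k hk he => hjn (hx.inj he ▸ Finset.mem_range.1 hk))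
        ⟨p, Finset.mem_range.2 p.2, hp⟩
      lift q to Fin n using Finset.mem_range.1 hq
      rw [hσn] at hq2
      exact ⟨q, fun h => absurd h hjn, fun _ => ⟨hq1, hq2⟩⟩
  have hinl : ∀ j, (¬ ∃ p : Fin n, ν p = ν j) → (⟨ν j, hx.pos j⟩ : Table ℓ) ∉ Set.range τ := by
    rintro j hj ⟨p, hp⟩
    exact hj ⟨p, by rw [hν]; exact (hτ p).symm.trans (congrArg Subtype.val hp)⟩
  let f : ℕ → {t : Table ℓ // t ∉ Set.range τ} ⊕ Vertex 1 (g * σ) := fun j =>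
    if h : ∃ p : Fin n, ν p = ν j then .inr (Vertex.mk 1 (g * σ) (hlabel j h).choose)
    else .inl ⟨⟨ν j, hx.pos j⟩, hinl j h⟩
  have f_touched : ∀ j, (∃ p : Fin n, ν p = ν j) → ∃ p : Fin n, f j = .inr (Vertex.mk 1 (g * σ) p) ∧
      (j < n → (p : ℕ) = j) ∧ (n ≤ j → inArc p j) := fun j hj =>
    ⟨(hlabel j hj).choose, dif_pos hj, (hlabel j hj).choose_spec⟩
  have f_untouched : ∀ j (hj : ¬ ∃ p : Fin n, ν p = ν j),
      f j = .inl ⟨⟨ν j, hx.pos j⟩, hinl j hj⟩ := fun j hj => dif_neg hj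
  have hf : ∀ i j N, n ≤ N → i < N → j < N →
      (((act g⁻¹ 1 (arrange x)).seq N).SameCycle i j ↔ f i = f j) := by
    intro i j N hN hi hj
    have hss : Finset.range n ⊆ Finset.range N := Finset.range_subset_range.2 hN
    have hi' := Finset.mem_range.2 hi
    have hj' := Finset.mem_range.2 hj
    have hlab : ∀ (p : Fin n) k, k < N → (k < n → (p : ℕ) = k) → (n ≤ k → inArc p k) →
        ((act g⁻¹ 1 (arrange x)).seq N).SameCycle p k := by
      intro p k hk h1 h2
      rcases lt_or_ge k n with h3 | h3
      · rw [h1 h3]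
      · rw [act_inv_seq g _ hN]
        refine (hS N).sameCycle_label (hS n) hss hx.inj.injOn hgfix (Finset.mem_range.2 p.2)
          (Finset.mem_range.2 hk) (h2 h3).1 ?_
        rw [hσn]
        exact (h2 h3).2
    have hpq : ∀ p q : Fin n, ((act g⁻¹ 1 (arrange x)).seq N).SameCycle p q ↔
        Vertex.mk 1 (g * σ) p = Vertex.mk 1 (g * σ) q := by
      intro p q
      rw [← VirtualPerm.sameCycle_iff_of_le _ p.2 q.2 hN, act_inv_seq g _ le_rfl, hσ,
        ← extendPerm_mul, extendPerm_sameCycle, Vertex.mk_one_eq_iff]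
    by_cases h1 : ∃ p : Fin n, ν p = ν i <;> by_cases h2 : ∃ p : Fin n, ν p = ν j
    · obtain ⟨p, hp, hp1, hp2⟩ := f_touched i h1
      obtain ⟨q, hq, hq1, hq2⟩ := f_touched j h2
      have hpi := hlab p i hi hp1 hp2
      have hqj := hlab q j hj hq1 hq2
      rw [hp, hq, Sum.inr.injEq, ← hpq]
      exact ⟨fun h => hpi.trans (h.trans hqj.symm), fun h => hpi.symm.trans (h.trans hqj)⟩
    · obtain ⟨p, hp, -⟩ := f_touched i h1
      rw [hp, f_untouched j h2]
      refine iff_of_false (fun hc => ?_) (by simp)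
      rw [act_inv_seq g _ hN] at hc
      have := (hS N).untouchedTable_eq hss hgfix hgs hi' hj' hc
      obtain ⟨p, hp⟩ := h1
      unfold untouchedTable at this
      rw [if_pos ⟨p, Finset.mem_range.2 p.2, hp⟩, if_neg] at this
      · cases this
      · rintro ⟨q, hq, hq'⟩
        exact h2 ⟨⟨q, Finset.mem_range.1 hq⟩, hq'⟩
    · obtain ⟨p, hp, -⟩ := f_touched j h2
      rw [hp, f_untouched i h1]
      refine iff_of_false (fun hc => ?_) (by simp)
      rw [act_inv_seq g _ hN] at hc
      have := ((hS N).untouchedTable_eq hss hgfix hgs hi' hj' hc).symm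
      obtain ⟨p, hp⟩ := h2
      unfold untouchedTable at this
      rw [if_pos ⟨p, Finset.mem_range.2 p.2, hp⟩, if_neg] at this
      · cases this
      · rintro ⟨q, hq, hq'⟩
        exact h1 ⟨⟨q, Finset.mem_range.1 hq⟩, hq'⟩
    · rw [f_untouched i h1, f_untouched j h2, Sum.inl.injEq, Subtype.mk.injEq, Subtype.mk.injEq,
        act_inv_seq g _ hN]
      constructor
      · intro hc
        have := (hS N).untouchedTable_eq hss hgfix hgs hi' hj' hc
        unfold untouchedTable at this
        rw [if_neg, if_neg] at this
        · exact Option.some.inj this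
        · rintro ⟨q, hq, hq'⟩
          exact h2 ⟨⟨q, Finset.mem_range.1 hq⟩, hq'⟩
        · rintro ⟨q, hq, hq'⟩
          exact h1 ⟨⟨q, Finset.mem_range.1 hq⟩, hq'⟩
      · intro hc
        exact (hS N).sameCycle_of_untouched hx.inj.injOn hgfix hi' hj' hc fun p hp hpi =>
          h1 ⟨⟨p, Finset.mem_range.1 hp⟩, hpi⟩
  set d := cutLengths g σ (fun p => ℓ (τ p)) fun p => arc (x p).2 (x (σ p)).2 with hd
  have hdens : ∀ i, HasDensity {k | f k = f i}
      (Sum.elim (fun t : {t : Table ℓ // t ∉ Set.range τ} => ℓ t.1) d (f i)) := by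
    intro i
    by_cases h1 : ∃ p : Fin n, ν p = ν i
    · obtain ⟨p, hp, -⟩ := f_touched i h1
      rw [hp, Sum.elim_inr, hd, cutLengths]
      -- The decomposition into arcs is needed only for guests from `n` on; the first `n` guests are
      -- labeled separately and have density zero.
      refine HasDensity.of_sum (A := fun q => {k | inArc q k}) (fun q _ => ?_) n fun k hk => ?_
      · have := hx.density_arc hℓ.nonneg (ν q) (θ q) (θ (σ q))
        rw [show ℓ (τ q) = ℓ (ν q) from congrArg ℓ (hτ q)]
        exact this
      · have huniq : ∀ q q' : Fin n, inArc q k → inArc q' k → q = q' := by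
          intro q q' h2 h3
          refine Fin.ext ((hS n).label_unique hx.inj.injOn (Finset.mem_range.2 q.2)
            (Finset.mem_range.2 q'.2) h2.1 h3.1 ?_ ?_)
          · rw [hσn]
            exact h2.2
          · rw [hσn]
            exact h3.2
        by_cases h2 : ∃ q : Fin n, ν q = ν k
        · obtain ⟨q, hq, -, hq2⟩ := f_touched k h2
          have h3 : ∀ q', k ∈ {k | inArc q' k} ↔ q' = q := fun q' =>
            ⟨fun h => huniq _ _ h (hq2 hk), fun h => h ▸ hq2 hk⟩
          simp only [h3, Set.mem_ofPred_eq, hq, Sum.inr.injEq]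
          rw [Finset.sum_ite_eq']
          simp
        · rw [if_neg, Finset.sum_eq_zero]
          · exact fun q _ => if_neg fun hc => h2 ⟨q, hc.1.symm⟩
          · rw [Set.mem_ofPred_eq, f_untouched k h2]
            simp
    · rw [f_untouched i h1, Sum.elim_inl]
      have h2 : {k | f k = .inl ⟨⟨ν i, hx.pos i⟩, hinl i h1⟩} = {k | ν k = ν i} := by
        ext k
        simp only [Set.mem_ofPred_eq]
        by_cases h3 : ∃ p : Fin n, ν p = ν k
        · obtain ⟨p, hp, -⟩ := f_touched k h3
          rw [hp]
          refine iff_of_false (by simp) fun hc => h1 ?_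
          rwa [hc] at h3
        · rw [f_untouched k h3]
          simp
      rw [h2]
      exact hx.density_table (ν i)
  unfold replaceTables
  refine tableLengths_eq_rank _ f _ (fun i j => ⟨n + i + j + 1, by omega, by omega,
    hf i j _ (by omega) (by omega) (by omega)⟩) (fun i => HasDensity.tableLength_eq hf (hdens i)) ?_
  rintro (t | γ) ht
  · rw [Sum.elim_inl] at ht
    obtain ⟨i, hi⟩ := (hx.density_table t.1).nonempty ht
    refine ⟨i, ?_⟩
    have hi : ν i = t.1.1 := hi
    have h1 : ¬ ∃ p : Fin n, ν p = ν i := by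
      rintro ⟨p, hp⟩
      exact t.2 ⟨p, Subtype.ext ((hτ p).trans (hp.trans hi))⟩
    rw [f_untouched i h1]
    exact congrArg _ (Subtype.ext (Subtype.ext hi))
  · obtain ⟨p, rfl⟩ := Vertex.exists_mk γ
    obtain ⟨q, hq, hq1, -⟩ := f_touched p ⟨p, rfl⟩
    exact ⟨p, by rw [hq, Fin.ext (hq1 p.2)]⟩


/-! ### Random guests -/

instance isProbabilityMeasure_circle : IsProbabilityMeasure (volume : Measure UnitAddCircle) :=
  ⟨UnitAddCircle.measure_univ⟩

theorem map_arc_zero :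
    (volume : Measure UnitAddCircle).map (arc 0) = volume.restrict (Set.Ioc 0 1) := by
  have h : arc 0 = Subtype.val ∘ AddCircle.equivIoc (1 : ℝ) 0 := by
    ext y
    simp [arc]
  have hm : Measurable (AddCircle.equivIoc (1 : ℝ) 0) :=
    (AddCircle.measurableEquivIoc 1 0).measurable
  rw [h, ← Measure.map_map measurable_subtype_coe hm,
    (AddCircle.measurePreserving_equivIoc 1).map_eq, map_comap_subtype_coe measurableSet_Ioc,
    zero_add]

theorem measurable_arc_zero : Measurable (arc 0) :=
  measurable_arc.comp (measurable_const.prodMk measurable_id)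

theorem volume_arc_le {t : ℝ} (h1 : t ≤ 1) :
    (volume : Measure UnitAddCircle) {y | arc 0 y ≤ t} = ENNReal.ofReal t := by
  have h : {y | arc 0 y ≤ t} = arc 0 ⁻¹' Set.Iic t := rfl
  rw [h, ← Measure.map_apply measurable_arc_zero measurableSet_Iic, map_arc_zero,
    Measure.restrict_apply measurableSet_Iic]
  have : Set.Iic t ∩ Set.Ioc 0 1 = Set.Ioc 0 t := by
    ext r
    simp only [Set.mem_inter_iff, Set.mem_Iic, Set.mem_Ioc]
    constructor
    · rintro ⟨h2, h3, -⟩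
      exact ⟨h3, h2⟩
    · rintro ⟨h2, h3⟩
      exact ⟨h3, h2, h3.trans h1⟩
  rw [this, Real.volume_Ioc, sub_zero]

theorem volume_singleton_circle (y : UnitAddCircle) : volume {y} = 0 := by
  have h : {y} = arc 0 ⁻¹' {arc 0 y} := by
    ext w
    simp [(arc_right_injective 0).eq_iff]
  rw [h, ← Measure.map_apply measurable_arc_zero (measurableSet_singleton _), map_arc_zero]
  simp

open Classical in
/-- The choice of a table with the probabilities `ℓ`. -/
def tableLaw (ℓ : Restaurant) : Measure ℕ :=
  if ∑' ν, ENNReal.ofReal (ℓ ν) = 1 then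
    Measure.sum fun ν => ENNReal.ofReal (ℓ ν) • Measure.dirac ν
  -- The default value makes `guests` a Markov kernel on all restaurants, including those that are
  -- not normalized.
  else Measure.dirac 0

instance (ℓ : Restaurant) : IsProbabilityMeasure (tableLaw ℓ) := by
  unfold tableLaw
  split_ifs with h
  · exact ⟨by simp [Measure.sum_apply, h]⟩
  · infer_instance

theorem IsNormalized.tsum_ofReal {ℓ : Restaurant} (h : IsNormalized ℓ) :
    ∑' ν, ENNReal.ofReal (ℓ ν) = 1 := by
  rw [← ENNReal.ofReal_tsum_of_nonneg h.nonneg h.hasSum.summable, h.hasSum.tsum_eq,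
    ENNReal.ofReal_one]

theorem tableLaw_singleton {ℓ : Restaurant} (h : IsNormalized ℓ) (ν : ℕ) :
    tableLaw ℓ {ν} = ENNReal.ofReal (ℓ ν) := by
  rw [tableLaw, if_pos h.tsum_ofReal, Measure.sum_apply _ (measurableSet_singleton _),
    tsum_eq_single ν]
  · simp
  · intro κ hκ
    simp [hκ]

theorem measurable_tableLaw : Measurable tableLaw := by
  classical
  have hm : ∀ ν, Measurable fun ℓ : Restaurant => ENNReal.ofReal (ℓ ν) := fun ν =>
    (measurable_pi_apply ν).ennreal_ofReal
  refine Measurable.ite (measurableSet_eq_fun (Measurable.tsum hm) measurable_const) ?_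
    measurable_const
  refine Measure.measurable_of_measurable_coe _ fun s hs => ?_
  simp only [Measure.sum_apply _ hs, Measure.smul_apply, smul_eq_mul]
  exact Measurable.tsum fun ν => (hm ν).mul_const _

/-- The table of a guest and a uniformly distributed point of the circle. -/
def guestLaw (ℓ : Restaurant) : Measure (ℕ × UnitAddCircle) := (tableLaw ℓ).prod volume

instance (ℓ : Restaurant) : IsProbabilityMeasure (guestLaw ℓ) := by
  unfold guestLaw
  infer_instance

theorem measurable_guestLaw {s : Set (ℕ × UnitAddCircle)} (hs : MeasurableSet s) :
    Measurable fun ℓ => guestLaw ℓ s := by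
  have : ∀ ℓ, guestLaw ℓ s = ∫⁻ ν, volume (Prod.mk ν ⁻¹' s) ∂(tableLaw ℓ) := fun ℓ =>
    Measure.prod_apply hs
  simp only [this]
  exact (Measure.measurable_lintegral (measurable_measure_prodMk_left hs)).comp measurable_tableLaw

/-- Independent guests of the restaurant `ℓ`. -/
def guests : Kernel Restaurant (ℕ → ℕ × UnitAddCircle) where
  toFun ℓ := Measure.infinitePi fun _ => guestLaw ℓ
  measurable' := by
    refine Measurable.measure_of_isPiSystem_of_isProbabilityMeasure
      generateFrom_squareCylinders.symm
      (isPiSystem_squareCylinders (fun _ => MeasurableSpace.isPiSystem_measurableSet)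
        fun _ => MeasurableSet.univ (α := ℕ × UnitAddCircle)) ?_
    rintro _ ⟨s, t, ht, rfl⟩
    have ht' : ∀ i, MeasurableSet (t i) := fun i => ht i (Set.mem_univ i)
    simp only [Measure.infinitePi_pi _ fun i _ => ht' i]
    exact Finset.measurable_prod _ fun i _ => measurable_guestLaw (ht' i)

instance : IsMarkovKernel guests :=
  ⟨fun _ => inferInstanceAs (IsProbabilityMeasure (Measure.infinitePi _))⟩

/-- The strong law of large numbers for independent guests. -/
theorem ae_hasDensity {α : Type*} [MeasurableSpace α] (μ : Measure α) [IsProbabilityMeasure μ]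
    {A : Set α} (hA : MeasurableSet A) :
    ∀ᵐ x ∂(Measure.infinitePi fun _ : ℕ => μ), HasDensity {k | x k ∈ A} (μ.real A) := by
  classical
  let F : α → ℝ := A.indicator 1
  have hF : Measurable F := measurable_one.indicator hA
  have hint : Integrable F μ := (integrable_const 1).indicator hA
  have hmp : ∀ i, MeasurePreserving (Function.eval i) (Measure.infinitePi fun _ : ℕ => μ) μ :=
    fun i => measurePreserving_eval_infinitePi (fun _ : ℕ => μ) i
  have h := strong_law_ae_real (μ := Measure.infinitePi fun _ : ℕ => μ)
    (fun i x => F (x i)) ((hmp 0).integrable_comp_of_integrable hint)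
    (fun i j hij => (iIndepFun_infinitePi (X := fun _ => F) fun _ => hF).indepFun hij)
    (fun i => ⟨(hF.comp (measurable_pi_apply i)).aemeasurable,
      (hF.comp (measurable_pi_apply 0)).aemeasurable, by
        change Measure.map (F ∘ fun x : ℕ → α => x i) _ = Measure.map (F ∘ fun x : ℕ → α => x 0) _
        rw [← Measure.map_map hF (measurable_pi_apply i), ← Measure.map_map hF
          (measurable_pi_apply 0)]
        exact congrArg _ ((hmp i).map_eq.trans (hmp 0).map_eq.symm)⟩)
  have hint' : ∫ x, F (x 0) ∂(Measure.infinitePi fun _ : ℕ => μ) = μ.real A := by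
    have h1 := integral_map (hmp 0).measurable.aemeasurable
      (hF.aestronglyMeasurable (μ := (Measure.infinitePi fun _ : ℕ => μ).map (Function.eval 0)))
    rw [(hmp 0).map_eq, integral_indicator_one hA] at h1
    exact h1.symm
  rw [hint'] at h
  filter_upwards [h] with x hx
  refine hx.congr fun N => ?_
  congr 1

/-- Points of different guests are independent without atoms, hence distinct; tables of length zero
are never chosen; the frequencies come from the strong law for countably many rectangles. -/
theorem ae_isTypical {ℓ : Restaurant} (h : IsNormalized ℓ) : ∀ᵐ x ∂(guests ℓ), IsTypical ℓ x := by
  have hmp : ∀ i, MeasurePreserving (Function.eval i) (guests ℓ) (guestLaw ℓ) := fun i =>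
    measurePreserving_eval_infinitePi (fun _ : ℕ => guestLaw ℓ) i
  have hsnd : MeasurePreserving Prod.snd (guestLaw ℓ) volume := measurePreserving_snd
  have h1 : ∀ᵐ x ∂(guests ℓ), ∀ i j, i ≠ j → (x i).2 ≠ (x j).2 := by
    simp only [ae_all_iff]
    intro i j hij
    have hind : IndepFun (fun x : ℕ → ℕ × UnitAddCircle => (x i).2) (fun x => (x j).2)
        (guests ℓ) :=
      (iIndepFun_infinitePi (P := fun _ : ℕ => guestLaw ℓ) (X := fun _ => Prod.snd)
        fun _ => measurable_snd).indepFun hij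
    have hmi : ∀ i, Measurable fun x : ℕ → ℕ × UnitAddCircle => (x i).2 := fun i =>
      measurable_snd.comp (measurable_pi_apply i)
    have hlaw : ∀ i, (guests ℓ).map (fun x => (x i).2) = volume := fun i =>
      (hsnd.comp (hmp i)).map_eq
    rw [indepFun_iff_map_prod_eq_prod_map_map (hmi i).aemeasurable (hmi j).aemeasurable, hlaw,
      hlaw] at hind
    have h2 : ∀ᵐ p ∂((volume : Measure UnitAddCircle).prod volume), p.1 ≠ p.2 := by
      rw [ae_iff, Measure.prod_apply (by measurability)]
      simp only [not_not]
      have : ∀ y : UnitAddCircle, Prod.mk y ⁻¹' {p : UnitAddCircle × UnitAddCircle | p.1 = p.2}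
          = {y} := fun y => by
        ext z
        simp [eq_comm]
      simp [this, volume_singleton_circle]
    rw [← hind] at h2
    exact ae_of_ae_map ((hmi i).prodMk (hmi j)).aemeasurable h2
  have h2 : ∀ᵐ x ∂(guests ℓ), ∀ i, 0 < ℓ (x i).1 := by
    rw [ae_all_iff]
    intro i
    have h3 : ∀ᵐ ν ∂(tableLaw ℓ), 0 < ℓ ν := by
      rw [ae_iff_of_countable]
      intro ν hν
      rw [tableLaw_singleton h] at hν
      exact ENNReal.ofReal_pos.1 (pos_iff_ne_zero.2 hν)
    exact ((measurePreserving_fst (μ := tableLaw ℓ)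
      (ν := (volume : Measure UnitAddCircle))).comp (hmp i)).quasiMeasurePreserving.ae h3
  have h3 : ∀ᵐ x ∂(guests ℓ), ∀ (a : ℕ) (q : ℚ), 0 ≤ q → q ≤ 1 →
      HasDensity {k | (x k).1 = a ∧ arc 0 (x k).2 ≤ q} (ℓ a * q) := by
    simp only [ae_all_iff]
    intro a q hq0 hq1
    have hm : MeasurableSet {y : UnitAddCircle | arc 0 y ≤ q} :=
      measurableSet_le measurable_arc_zero measurable_const
    have h4 := ae_hasDensity (guestLaw ℓ) (A := {a} ×ˢ {y | arc 0 y ≤ q})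
      ((measurableSet_singleton a).prod hm)
    have h5 : (guestLaw ℓ).real ({a} ×ˢ {y | arc 0 y ≤ q}) = ℓ a * q := by
      rw [Measure.real, guestLaw, Measure.prod_prod, tableLaw_singleton h,
        volume_arc_le (by exact_mod_cast hq1), ENNReal.toReal_mul,
        ENNReal.toReal_ofReal (h.nonneg a), ENNReal.toReal_ofReal (by exact_mod_cast hq0)]
    rw [h5] at h4
    exact h4
  filter_upwards [h1, h2, h3] with x hx1 hx2 hx3
  refine ⟨fun i j hij => ?_, hx2, hx3⟩
  by_contra hne
  exact hx1 i j hne hij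


/-! ### Products of densities -/

/-- Tonelli's theorem, by induction on the finite index type. -/
theorem lintegral_prod_volume {ι : Type*} [Fintype ι] (f : ι → ℝ → ENNReal)
    (hf : ∀ i, Measurable (f i)) :
    ∫⁻ x : ι → ℝ, ∏ i, f i (x i) = ∏ i, ∫⁻ t, f i t := by
  revert f
  refine Fintype.induction_empty_option (P := fun (ι : Type _) _ => ∀ f : ι → ℝ → ENNReal,
    (∀ i, Measurable (f i)) → ∫⁻ x : ι → ℝ, ∏ i, f i (x i) = ∏ i, ∫⁻ t, f i t) ?_ ?_ ?_ ι
  · intro α β _ e ih f hf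
    let _ : Fintype α := Fintype.ofEquiv β e.symm
    have h := (volume_measurePreserving_piCongrLeft (fun _ : β => ℝ) e).lintegral_comp
      (f := fun x => ∏ i, f i (x i)) (by fun_prop)
    rw [← h, ← e.prod_comp, ← ih (fun i => f (e i)) fun i => hf _]
    refine lintegral_congr fun x => ?_
    rw [← e.prod_comp]
    simp [MeasurableEquiv.piCongrLeft, Equiv.piCongrLeft_apply_apply]
  · intro f _
    rw [volume_pi, Measure.pi_of_empty]
    simp
  · intro α _ ih f hf
    have h := Measure.pi_map_piOptionEquivProd (fun _ : Option α => (volume : Measure ℝ))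
    rw [volume_pi, ← h, lintegral_map (by fun_prop) (by fun_prop), Fintype.prod_option,
      ← ih (fun i => f (some i)) fun i => hf _]
    have h2 : ∀ p : (α → ℝ) × ℝ, ∏ i, f i
        ((MeasurableEquiv.piOptionEquivProd fun _ : Option α => ℝ).symm p i)
          = (∏ i, f (some i) (p.1 i)) * f none p.2 := fun p => by
      rw [Fintype.prod_option, mul_comm]
      rfl
    simp only [h2]
    have h3 : Measurable fun x : α → ℝ => ∏ i, f (some i) (x i) := by fun_prop
    rw [lintegral_prod_mul h3.aemeasurable (hf none).aemeasurable, mul_comm]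
    rfl

theorem pi_withDensity {ι : Type*} [Fintype ι] (f : ι → ℝ → ENNReal)
    (hf : ∀ i, Measurable (f i)) [∀ i, SigmaFinite ((volume : Measure ℝ).withDensity (f i))] :
    Measure.pi (fun i => (volume : Measure ℝ).withDensity (f i))
      = (volume : Measure (ι → ℝ)).withDensity fun x => ∏ i, f i (x i) := by
  refine Measure.pi_eq fun s hs => ?_
  rw [withDensity_apply _ (MeasurableSet.univ_pi hs), ← lintegral_indicator
    (MeasurableSet.univ_pi hs)]
  have h : ∀ x : ι → ℝ, (Set.univ.pi s).indicator (fun x => ∏ i, f i (x i)) x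
      = ∏ i, (s i).indicator (f i) (x i) := by
    intro x
    by_cases hx : x ∈ Set.univ.pi s
    · rw [Set.indicator_of_mem hx]
      exact Finset.prod_congr rfl fun i _ => (Set.indicator_of_mem (hx i (Set.mem_univ i)) _).symm
    · rw [Set.indicator_of_notMem hx]
      simp only [Set.mem_univ_pi, not_forall] at hx
      obtain ⟨i, hi⟩ := hx
      exact (Finset.prod_eq_zero (Finset.mem_univ i) (Set.indicator_of_notMem hi _)).symm
  simp only [h]
  rw [lintegral_prod_volume _ fun i => (hf i).indicator (hs i)]
  exact Finset.prod_congr rfl fun i _ => by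
    rw [withDensity_apply _ (hs i), lintegral_indicator (hs i)]

/-! ### Gamma distributions -/

/-- The density of the Gamma distribution. -/
def gammaDensity (a x : ℝ) : ENNReal :=
  (Set.Ioi 0).indicator (fun x => ENNReal.ofReal (x ^ (a - 1) * Real.exp (-x) / Real.Gamma a)) x

open Classical in
/-- The Gamma distribution, concentrated at zero if the parameter vanishes. -/
def gammaLaw (a : ℝ) : Measure ℝ :=
  if 0 < a then volume.withDensity (gammaDensity a) else Measure.dirac 0

theorem measurable_gammaDensity (a : ℝ) : Measurable (gammaDensity a) :=
  Measurable.indicator (by fun_prop) measurableSet_Ioi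

theorem lintegral_gammaDensity {a : ℝ} (ha : 0 < a) : ∫⁻ x, gammaDensity a x = 1 := by
  have hG := Real.Gamma_pos_of_pos ha
  unfold gammaDensity
  rw [lintegral_indicator measurableSet_Ioi]
  have h := lintegral_rpow_mul_exp ha one_pos
  have h2 : ∀ x : ℝ, ENNReal.ofReal (x ^ (a - 1) * Real.exp (-x) / Real.Gamma a)
      = ENNReal.ofReal (x ^ (a - 1) * Real.exp (-(1 * x))) * ENNReal.ofReal (Real.Gamma a)⁻¹ :=
    fun x => by rw [← ENNReal.ofReal_mul' (by positivity), one_mul, div_eq_mul_inv]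
  simp only [h2]
  rw [lintegral_mul_const _ (by fun_prop), h, ← ENNReal.ofReal_mul (by positivity), Real.one_rpow,
    div_one, mul_inv_cancel₀ hG.ne', ENNReal.ofReal_one]

instance (a : ℝ) : IsProbabilityMeasure (gammaLaw a) := by
  unfold gammaLaw
  split_ifs with h
  · exact ⟨by rw [withDensity_apply _ .univ, Measure.restrict_univ, lintegral_gammaDensity h]⟩
  · infer_instance

/-! ### Coordinates on a simplex -/

section Simplex

variable {ι : Type*} {m : ι → ℝ} {r : ι}

open Classical in
/-- The point of `ι → ℝ` with the coordinate `t` at `r`, and `y` at the other `i` with `m i > 0`. -/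
def simplexPoint (m : ι → ℝ) (r : ι) (y : {i : ι // 0 < m i ∧ i ≠ r} → ℝ) (t : ℝ) (i : ι) : ℝ :=
  if i = r then t else if hi : 0 < m i ∧ i ≠ r then y ⟨i, hi⟩ else 0

theorem measurable_simplexPoint (m : ι → ℝ) (r : ι) :
    Measurable fun p : ({i : ι // 0 < m i ∧ i ≠ r} → ℝ) × ℝ => simplexPoint m r p.1 p.2 := by
  refine measurable_pi_lambda _ fun i => ?_
  unfold simplexPoint
  split_ifs
  · exact measurable_snd
  · exact (measurable_pi_apply _).comp measurable_fst
  · exact measurable_const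

theorem simplexPoint_self (y : {i : ι // 0 < m i ∧ i ≠ r} → ℝ) (t : ℝ) :
    simplexPoint m r y t r = t := if_pos rfl

theorem simplexPoint_coe (y : {i : ι // 0 < m i ∧ i ≠ r} → ℝ) (t : ℝ)
    (j : {i : ι // 0 < m i ∧ i ≠ r}) : simplexPoint m r y t j = y j := by
  unfold simplexPoint
  rw [if_neg j.2.2, dif_pos j.2]

theorem simplexPoint_zero (y : {i : ι // 0 < m i ∧ i ≠ r} → ℝ) (t : ℝ) {i : ι} (hi : i ≠ r)
    (hm : ¬ 0 < m i) : simplexPoint m r y t i = 0 := by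
  unfold simplexPoint
  rw [if_neg hi, dif_neg fun h => hm h.1]

theorem simplexPoint_smul (s : ℝ) (y : {i : ι // 0 < m i ∧ i ≠ r} → ℝ) (t : ℝ) :
    simplexPoint m r (s • y) (s * t) = s • simplexPoint m r y t := by
  ext i
  rw [Pi.smul_apply]
  unfold simplexPoint
  split_ifs <;> simp

variable [Fintype ι]

open Classical in
theorem prod_eq_mul_prod_subtype {M : Type*} [CommMonoid M] (f : ι → M)
    (hf : ∀ i, i ≠ r → ¬ 0 < m i → f i = 1) :
    ∏ i, f i = f r * ∏ j : {i : ι // 0 < m i ∧ i ≠ r}, f j := by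
  rw [← Finset.mul_prod_erase Finset.univ f (Finset.mem_univ r)]
  congr 1
  rw [← Finset.prod_filter_of_ne (p := fun i => 0 < m i)]
  · refine Finset.prod_subtype _ (fun i => ?_) _
    simp [and_comm]
  · intro i hi hne
    by_contra hc
    exact hne (hf i (Finset.ne_of_mem_erase hi) hc)

open Classical in
theorem sum_eq_add_sum_subtype (f : ι → ℝ) (hf : ∀ i, i ≠ r → ¬ 0 < m i → f i = 0) :
    ∑ i, f i = f r + ∑ j : {i : ι // 0 < m i ∧ i ≠ r}, f j :=
  prod_eq_mul_prod_subtype (M := Multiplicative ℝ) f hf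

open Classical in
theorem sum_simplexPoint (y : {i : ι // 0 < m i ∧ i ≠ r} → ℝ) (t : ℝ) :
    ∑ i, simplexPoint m r y t i = t + ∑ j, y j := by
  rw [sum_eq_add_sum_subtype (m := m) (r := r) _ fun i hi hm => simplexPoint_zero y t hi hm,
    simplexPoint_self]
  simp only [simplexPoint_coe]

open Classical in
-- Coordinates with vanishing parameter are concentrated at zero, so the product lives on the
-- coordinate face parametrized by `simplexPoint`, where it is again a product.
theorem pi_gammaLaw_eq_map (m : ι → ℝ) (r : ι) :
    Measure.pi (fun i => gammaLaw (m i)) =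
      ((Measure.pi fun j : {i : ι // 0 < m i ∧ i ≠ r} => gammaLaw (m j)).prod
        (gammaLaw (m r))).map fun p => simplexPoint m r p.1 p.2 := by
  refine Measure.pi_eq fun s hs => ?_
  rw [Measure.map_apply (measurable_simplexPoint m r) (MeasurableSet.univ_pi hs)]
  have hzero : ∀ i, ¬ 0 < m i → gammaLaw (m i) = Measure.dirac 0 := fun i hi => if_neg hi
  by_cases h0 : ∀ i, i ≠ r → ¬ 0 < m i → (0 : ℝ) ∈ s i
  · have hpre : (fun p : ({i : ι // 0 < m i ∧ i ≠ r} → ℝ) × ℝ => simplexPoint m r p.1 p.2) ⁻¹'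
        Set.univ.pi s = (Set.univ.pi fun j : {i : ι // 0 < m i ∧ i ≠ r} => s j) ×ˢ s r := by
      ext p
      simp only [Set.mem_preimage, Set.mem_univ_pi, Set.mem_prod]
      constructor
      · intro h
        refine ⟨fun j => ?_, ?_⟩
        · rw [← simplexPoint_coe p.1 p.2 j]
          exact h j
        · have := h r
          rwa [simplexPoint_self] at this
      · rintro ⟨h1, h2⟩ i
        by_cases hi : i = r
        · rw [hi, simplexPoint_self]
          exact h2
        by_cases hm : 0 < m i
        · have := simplexPoint_coe p.1 p.2 ⟨i, hm, hi⟩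
          rw [this]
          exact h1 ⟨i, hm, hi⟩
        · rw [simplexPoint_zero _ _ hi hm]
          exact h0 i hi hm
    rw [hpre, Measure.prod_prod, Measure.pi_pi, mul_comm,
      prod_eq_mul_prod_subtype (m := m) (r := r)]
    intro i hi hm
    rw [hzero i hm, Measure.dirac_apply' _ (hs i), Set.indicator_of_mem (h0 i hi hm), Pi.one_apply]
  · push Not at h0
    obtain ⟨i, hi, hm, h0⟩ := h0
    have hpre : (fun p : ({i : ι // 0 < m i ∧ i ≠ r} → ℝ) × ℝ => simplexPoint m r p.1 p.2) ⁻¹'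
        Set.univ.pi s = ∅ := by
      ext p
      simp only [Set.mem_preimage, Set.mem_univ_pi, Set.mem_empty_iff_false, iff_false]
      intro h
      have := h i
      rw [simplexPoint_zero _ _ hi (not_lt.2 hm)] at this
      exact h0 this
    rw [hpre, measure_empty]
    refine (Finset.prod_eq_zero (Finset.mem_univ i) ?_).symm
    rw [hzero i (not_lt.2 hm), Measure.dirac_apply' _ (hs i), Set.indicator_of_notMem h0]

open Classical in
/-- The density of the Dirichlet distribution. -/
def dirichletDensity (m : ι → ℝ) (r : ι) (ℓ : ℝ) (y : {i : ι // 0 < m i ∧ i ≠ r} → ℝ) : ENNReal :=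
  ENNReal.ofReal (Real.Gamma (∑ i, m i) / (∏ i with 0 < m i, Real.Gamma (m i))
    * ℓ ^ (1 - ∑ i, m i) * (∏ j, y j ^ (m j - 1)) * (ℓ - ∑ j, y j) ^ (m r - 1))

open Classical in
theorem measurable_dirichletDensity (m : ι → ℝ) (r : ι) (ℓ : ℝ) :
    Measurable (dirichletDensity m r ℓ) := by
  unfold dirichletDensity
  fun_prop

/-- The open simplex. -/
def openSimplex (κ : Type*) [Fintype κ] (ℓ : ℝ) : Set (κ → ℝ) := {y | (∀ j, 0 < y j) ∧ ∑ j, y j < ℓ}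

theorem measurableSet_openSimplex (κ : Type*) [Fintype κ] (ℓ : ℝ) :
    MeasurableSet (openSimplex κ ℓ) := by
  unfold openSimplex
  rw [Set.ofPred_and, Set.ofPred_forall]
  exact (MeasurableSet.iInter fun j => measurableSet_lt measurable_const
    (measurable_pi_apply j)).inter (measurableSet_lt (by fun_prop) measurable_const)

open Classical in
theorem lintegral_dirichlet (h : ∃ i, 0 < m i) (ℓ : ℝ) {F : (ι → ℝ) → ENNReal}
    (hF : Measurable F) : ∫⁻ x, F x ∂(dirichlet m ℓ) =
      ∫⁻ y in openSimplex {i : ι // 0 < m i ∧ i ≠ h.choose} ℓ, dirichletDensity m h.choose ℓ y *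
        F (simplexPoint m h.choose y (ℓ - ∑ j, y j)) := by
  have hm : Measurable fun y : {i : ι // 0 < m i ∧ i ≠ h.choose} → ℝ =>
      simplexPoint m h.choose y (ℓ - ∑ j, y j) :=
    (measurable_simplexPoint m h.choose).comp (measurable_id.prodMk (by fun_prop))
  have hd : dirichlet m ℓ = ((volume.restrict (openSimplex _ ℓ)).withDensity
      (dirichletDensity m h.choose ℓ)).map fun y => simplexPoint m h.choose y (ℓ - ∑ j, y j) := by
    unfold dirichlet
    rw [dif_pos h]
    rfl
  rw [hd, lintegral_map hF hm]
  exact lintegral_withDensity_eq_lintegral_mul _ (measurable_dirichletDensity _ _ _) (hF.comp hm)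

end Simplex


/-! ### Gamma variables in polar coordinates and Dirichlet distributions -/

section Simplex

variable {ι : Type*} [Fintype ι] {m : ι → ℝ}

open Classical in
-- The joint density of independent Gamma variables, with the last coordinate replaced by the sum
-- `s`. The exponentials multiply to `exp (-s)` and the powers of `s` cancel; outside the open
-- simplex both sides vanish.
theorem gammaDensity_mul_prod (hm : ∀ i, 0 ≤ m i) {r : ι} (hr : 0 < m r) {s : ℝ} (hs : 0 < s)
    (y : {i : ι // 0 < m i ∧ i ≠ r} → ℝ) :
    (∏ j : {i : ι // 0 < m i ∧ i ≠ r}, gammaDensity (m j) (y j)) *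
        gammaDensity (m r) (s - ∑ j, y j) =
      gammaDensity (∑ i, m i) s *
        (openSimplex {i : ι // 0 < m i ∧ i ≠ r} s).indicator (dirichletDensity m r s) y := by
  have hM : 0 < ∑ i, m i := lt_of_lt_of_le hr
    (Finset.single_le_sum (fun i _ => hm i) (Finset.mem_univ r))
  by_cases hy : y ∈ openSimplex {i : ι // 0 < m i ∧ i ≠ r} s
  · rw [Set.indicator_of_mem hy, dirichletDensity]
    obtain ⟨hy0, hys⟩ := hy
    have ht : 0 < s - ∑ j, y j := by linarith
    have hΓ : ∏ i with 0 < m i, Real.Gamma (m i)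
        = Real.Gamma (m r) * ∏ j : {i : ι // 0 < m i ∧ i ≠ r}, Real.Gamma (m j) := by
      rw [Finset.prod_filter, prod_eq_mul_prod_subtype (m := m) (r := r), if_pos hr]
      · congr 1
        exact Finset.prod_congr rfl fun j _ => if_pos j.2.1
      · exact fun i _ h => if_neg h
    have hΓM := Real.Gamma_pos_of_pos hM
    have hΓr := Real.Gamma_pos_of_pos hr
    have hΓp : 0 < ∏ j : {i : ι // 0 < m i ∧ i ≠ r}, Real.Gamma (m j) :=
      Finset.prod_pos fun j _ => Real.Gamma_pos_of_pos j.2.1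
    have hg : ∀ {a x : ℝ}, 0 < x → gammaDensity a x
        = ENNReal.ofReal (x ^ (a - 1) * Real.exp (-x) / Real.Gamma a) := fun hx =>
      Set.indicator_of_mem (Set.mem_Ioi.2 hx) _
    rw [hg ht, hg hs, Finset.prod_congr rfl fun j _ => hg (hy0 j),
      ← ENNReal.ofReal_prod_of_nonneg, ← ENNReal.ofReal_mul, ← ENNReal.ofReal_mul]
    · congr 1
      rw [hΓ, Finset.prod_div_distrib, Finset.prod_mul_distrib, ← Real.exp_sum,
        Finset.sum_neg_distrib]
      have he : Real.exp (-s) = Real.exp (-∑ j, y j) * Real.exp (-(s - ∑ j, y j)) := by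
        rw [← Real.exp_add]
        congr 1
        ring
      have hp : s ^ (∑ i, m i - 1) * s ^ (1 - ∑ i, m i) = 1 := by
        rw [← Real.rpow_add hs, sub_add_sub_cancel', sub_self, Real.rpow_zero]
      rw [he]
      field_simp
      linear_combination -(∏ j : {i : ι // 0 < m i ∧ i ≠ r}, y j ^ (m j.1 - 1)) * hp
    · positivity
    · exact Finset.prod_nonneg fun j _ => div_nonneg (mul_nonneg
        (Real.rpow_nonneg (hy0 j).le _) (Real.exp_pos _).le) (Real.Gamma_pos_of_pos j.2.1).le
    · exact fun j _ => div_nonneg (mul_nonneg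
        (Real.rpow_nonneg (hy0 j).le _) (Real.exp_pos _).le) (Real.Gamma_pos_of_pos j.2.1).le
  · rw [Set.indicator_of_notMem hy, mul_zero]
    by_cases h0 : ∀ j, 0 < y j
    · have : ¬ ∑ j, y j < s := fun h => hy ⟨h0, h⟩
      have h2 : gammaDensity (m r) (s - ∑ j, y j) = 0 :=
        Set.indicator_of_notMem (by simpa using not_lt.1 this) _
      rw [h2, mul_zero]
    · push Not at h0
      obtain ⟨j, hj⟩ := h0
      rw [Finset.prod_eq_zero (Finset.mem_univ j), zero_mul]
      exact Set.indicator_of_notMem (by simpa using hj) _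

/-- Independent Gamma distributed coordinates in the polar coordinates. -/
theorem lintegral_pi_gammaLaw (hm : ∀ i, 0 ≤ m i) (h : ∃ i, 0 < m i) {F : (ι → ℝ) → ENNReal}
    (hF : Measurable F) : ∫⁻ x, F x ∂(Measure.pi fun i => gammaLaw (m i)) =
      ∫⁻ s, gammaDensity (∑ i, m i) s * ∫⁻ x, F x ∂(dirichlet m s) := by
  classical
  set r := h.choose with hr
  have hmr : 0 < m r := h.choose_spec
  set κ := {i : ι // 0 < m i ∧ i ≠ r}
  have hmp : ∀ i, 0 < m i → gammaLaw (m i) = volume.withDensity (gammaDensity (m i)) := fun i hi =>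
    if_pos hi
  have hsf : ∀ j : κ, IsProbabilityMeasure (volume.withDensity (gammaDensity (m j))) := fun j => by
    rw [← hmp j j.2.1]
    infer_instance
  have hgm := measurable_gammaDensity
  have hsp := measurable_simplexPoint m r
  have hpi : (Measure.pi fun j : κ => gammaLaw (m j))
      = volume.withDensity fun y : κ → ℝ => ∏ j : κ, gammaDensity (m j) (y j) := by
    have : (fun j : κ => gammaLaw (m j)) = fun j : κ => volume.withDensity (gammaDensity (m j)) :=
      funext fun j => hmp j j.2.1
    rw [this, pi_withDensity _ fun j => hgm _]
  have hm1 : Measurable fun y : κ → ℝ => ∏ j : κ, gammaDensity (m j) (y j) :=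
    Finset.measurable_prod _ fun j _ => (hgm _).comp (measurable_pi_apply j)
  have hm2 : Measurable fun p : (κ → ℝ) × ℝ => (∏ j : κ, gammaDensity (m j) (p.1 j)) *
      gammaDensity (m r) p.2 * F (simplexPoint m r p.1 p.2) :=
    ((hm1.comp measurable_fst).mul ((hgm _).comp measurable_snd)).mul (hF.comp hsp)
  have e1 : ∫⁻ x, F x ∂(Measure.pi fun i => gammaLaw (m i)) = ∫⁻ y : κ → ℝ, ∫⁻ t : ℝ,
      (∏ j : κ, gammaDensity (m j) (y j)) * gammaDensity (m r) t * F (simplexPoint m r y t) := by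
    have hw : Measurable fun z : (κ → ℝ) × ℝ => (∏ j : κ, gammaDensity (m j) (z.1 j)) *
        gammaDensity (m r) z.2 := (hm1.comp measurable_fst).mul ((hgm _).comp measurable_snd)
    have hF' : Measurable fun p : (κ → ℝ) × ℝ => F (simplexPoint m r p.1 p.2) := hF.comp hsp
    rw [pi_gammaLaw_eq_map m r, lintegral_map hF hsp, hpi, hmp r hmr, prod_withDensity hm1 (hgm _)]
    refine (lintegral_withDensity_eq_lintegral_mul _ hw hF').trans ?_
    exact lintegral_prod _ hm2.aemeasurable
  -- The translation by `∑ j, y j` replaces the coordinate at `r` by the sum of all coordinates.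
  have e2 : ∀ y : κ → ℝ, ∫⁻ t : ℝ, (∏ j : κ, gammaDensity (m j) (y j)) * gammaDensity (m r) t *
      F (simplexPoint m r y t) = ∫⁻ s : ℝ, (∏ j : κ, gammaDensity (m j) (y j)) *
        gammaDensity (m r) (s - ∑ j, y j) * F (simplexPoint m r y (s - ∑ j, y j)) := fun y =>
    (lintegral_sub_right_eq_self (fun t => (∏ j : κ, gammaDensity (m j) (y j)) *
      gammaDensity (m r) t * F (simplexPoint m r y t)) (∑ j, y j)).symm
  rw [e1]
  simp only [e2]
  rw [lintegral_lintegral_swap]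
  · refine lintegral_congr fun s => ?_
    by_cases hs : 0 < s
    · rw [lintegral_dirichlet h s hF, ← lintegral_indicator (measurableSet_openSimplex _ _),
        ← lintegral_const_mul']
      · refine lintegral_congr fun y => ?_
        rw [gammaDensity_mul_prod hm hmr hs]
        by_cases hy : y ∈ openSimplex κ s
        · rw [Set.indicator_of_mem hy, Set.indicator_of_mem hy, mul_assoc]
        · rw [Set.indicator_of_notMem hy, Set.indicator_of_notMem hy, mul_zero, zero_mul]
      · unfold gammaDensity
        rw [Set.indicator_of_mem (Set.mem_Ioi.2 hs)]
        exact ENNReal.ofReal_ne_top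
    · have h0 : gammaDensity (∑ i, m i) s = 0 := Set.indicator_of_notMem (by simpa using hs) _
      rw [h0, zero_mul]
      refine lintegral_eq_zero_of_ae_eq_zero (Filter.Eventually.of_forall fun y => ?_)
      suffices h1 : (∏ j : κ, gammaDensity (m j) (y j)) * gammaDensity (m r) (s - ∑ j, y j) = 0 by
        simp [h1]
      by_cases h1 : ∀ j, 0 < y j
      · have : 0 ≤ ∑ j, y j := Finset.sum_nonneg fun j _ => (h1 j).le
        have h2 : gammaDensity (m r) (s - ∑ j, y j) = 0 := by
          refine Set.indicator_of_notMem ?_ _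
          simp only [Set.mem_Ioi, not_lt]
          linarith
        rw [h2, mul_zero]
      · push Not at h1
        obtain ⟨j, hj⟩ := h1
        rw [Finset.prod_eq_zero (Finset.mem_univ j), zero_mul]
        exact Set.indicator_of_notMem (by simpa using hj) _
  · have : Measurable fun p : (κ → ℝ) × ℝ => (p.1, p.2 - ∑ j, p.1 j) := by fun_prop
    exact (hm2.comp this).aemeasurable

theorem lintegral_eq_lintegral_smul {κ : Type*} [Fintype κ] {s : ℝ} (hs : 0 < s)
    {G : (κ → ℝ) → ENNReal} (hG : Measurable G) :
    ∫⁻ y, G y = ENNReal.ofReal (s ^ Fintype.card κ) * ∫⁻ y, G (s • y) := by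
  have h := Measure.map_addHaar_smul (volume : Measure (κ → ℝ)) hs.ne'
  have h2 : ∫⁻ y, G (s • y) = ENNReal.ofReal ((s ^ Fintype.card κ)⁻¹) * ∫⁻ y, G y := by
    rw [← lintegral_map hG (measurable_const_smul s), h, lintegral_smul_measure,
      Module.finrank_fintype_fun_eq_card, abs_of_pos (by positivity)]
    rfl
  rw [h2, ← mul_assoc, ← ENNReal.ofReal_mul (by positivity), mul_inv_cancel₀ (by positivity),
    ENNReal.ofReal_one, one_mul]

/-- Under the substitution `y ↦ s y` the Jacobian and the powers of `s` in the density cancel. -/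
theorem dirichlet_eq_map_smul (hm : ∀ i, 0 ≤ m i) {s : ℝ} (hs : 0 < s) :
    dirichlet m s = (dirichlet m 1).map fun x => s • x := by
  classical
  by_cases h : ∃ i, 0 < m i
  swap
  · rw [dirichlet, dif_neg h, dirichlet, dif_neg h, Measure.map_zero]
  have hsm : Measurable fun x : ι → ℝ => s • x := measurable_const_smul s
  refine Measure.ext_of_lintegral _ fun F hF => ?_
  rw [lintegral_map hF hsm, lintegral_dirichlet h s hF, lintegral_dirichlet h 1 (F := fun x => F (s • x)) (hF.comp hsm)]
  set r := h.choose with hr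
  have hmr : 0 < m r := h.choose_spec
  set κ := {i : ι // 0 < m i ∧ i ≠ r}
  rw [← lintegral_indicator (measurableSet_openSimplex _ _),
    ← lintegral_indicator (measurableSet_openSimplex _ _), lintegral_eq_lintegral_smul hs,
    ← lintegral_const_mul' _ _ ENNReal.ofReal_ne_top]
  · refine lintegral_congr fun y => ?_
    have hsum : ∑ j, (s • y) j = s * ∑ j, y j := by
      simp [Finset.mul_sum]
    have hmem : s • y ∈ openSimplex κ s ↔ y ∈ openSimplex κ 1 := by
      unfold openSimplex
      rw [Set.mem_ofPred_eq, Set.mem_ofPred_eq, hsum]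
      refine and_congr (forall_congr' fun j => ?_) ?_
      · rw [Pi.smul_apply, smul_eq_mul, mul_pos_iff_of_pos_left hs]
      · exact mul_lt_iff_lt_one_right hs
    by_cases hy : y ∈ openSimplex κ 1
    · rw [Set.indicator_of_mem hy, Set.indicator_of_mem (hmem.2 hy), ← mul_assoc]
      have hpt : simplexPoint m r (s • y) (s - ∑ j, (s • y) j)
          = s • simplexPoint m r y (1 - ∑ j, y j) := by
        rw [← simplexPoint_smul, hsum, mul_sub, mul_one]
      rw [hpt]
      congr 1
      unfold dirichletDensity
      rw [← ENNReal.ofReal_mul (by positivity), hsum]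
      congr 1
      have h1 : ∏ j : κ, (s • y) j ^ (m j - 1) = s ^ (∑ i, m i - m r) / s ^ Fintype.card κ *
          ∏ j : κ, y j ^ (m j - 1) := by
        have h2 : ∀ j : κ, (s • y) j ^ (m j.1 - 1) = s ^ (m j.1 - 1) * y j ^ (m j.1 - 1) :=
          fun j => Real.mul_rpow hs.le (hy.1 j).le
        rw [Finset.prod_congr rfl fun j _ => h2 j, Finset.prod_mul_distrib,
          ← Real.rpow_sum_of_pos hs, Finset.sum_sub_distrib]
        congr 1
        rw [Real.rpow_sub hs]
        congr 1
        · congr 1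
          rw [sum_eq_add_sum_subtype (m := m) (r := r) m fun i _ hi =>
            le_antisymm (not_lt.1 hi) (hm i)]
          ring
        · simp
      have h3 : (s - s * ∑ j, y j) ^ (m r - 1) = s ^ (m r - 1) * (1 - ∑ j, y j) ^ (m r - 1) := by
        rw [← Real.mul_rpow hs.le (by linarith [hy.2]), mul_sub, mul_one]
      have h4 : s ^ (1 - ∑ i, m i) * s ^ (∑ i, m i - m r) * s ^ (m r - 1) = 1 := by
        rw [← Real.rpow_add hs, ← Real.rpow_add hs]
        ring_nf
        exact Real.rpow_zero s
      rw [h1, h3, Real.one_rpow]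
      have h5 : s ^ Fintype.card κ * (s ^ (∑ i, m i - m r) / s ^ Fintype.card κ)
          = s ^ (∑ i, m i - m r) := mul_div_cancel₀ _ (by positivity)
      linear_combination Real.Gamma (∑ i, m i) / (∏ i with 0 < m i, Real.Gamma (m i)) *
        (∏ j : κ, y j ^ (m j.1 - 1)) * (1 - ∑ j, y j) ^ (m r - 1) *
        (s ^ (1 - ∑ i, m i) * s ^ (m r - 1) * h5 + h4)
    · rw [Set.indicator_of_notMem hy, Set.indicator_of_notMem (fun hc => hy (hmem.1 hc)), mul_zero]
  · exact Measurable.indicator ((measurable_dirichletDensity _ _ _).mul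
      (hF.comp ((measurable_simplexPoint m r).comp (measurable_id.prodMk (by fun_prop)))))
      (measurableSet_openSimplex _ _)

theorem ae_sum_dirichlet (m : ι → ℝ) (s : ℝ) : ∀ᵐ x ∂(dirichlet m s), ∑ i, x i = s := by
  classical
  by_cases h : ∃ i, 0 < m i
  swap
  · rw [dirichlet, dif_neg h]
    simp
  have hm : MeasurableSet {x : ι → ℝ | ∑ i, x i = s} :=
    measurableSet_eq_fun (by fun_prop) measurable_const
  rw [ae_iff, ← lintegral_indicator_one, lintegral_dirichlet h s]
  · refine lintegral_eq_zero_of_ae_eq_zero (Filter.Eventually.of_forall fun y => ?_)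
    have h1 : {x : ι → ℝ | ¬ ∑ i, x i = s}.indicator (1 : (ι → ℝ) → ENNReal)
        (simplexPoint m h.choose y (s - ∑ j, y j)) = 0 := by
      rw [Set.indicator_of_notMem]
      rw [Set.mem_ofPred_eq, not_not, sum_simplexPoint, sub_add_cancel]
    exact mul_eq_zero_of_right _ h1
  · exact measurable_one.indicator hm.compl
  · exact hm.compl

/-- No Dirichlet integral is computed: by scaling the mass does not depend on the total length, and
the polar decomposition of a product of probability measures forces it to be `1`. -/
theorem isProbabilityMeasure_dirichlet (hm : ∀ i, 0 ≤ m i) (h : ∃ i, 0 < m i) {s : ℝ}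
    (hs : 0 < s) : IsProbabilityMeasure (dirichlet m s) := by
  have hmass : ∀ t, 0 < t → dirichlet m t Set.univ = dirichlet m 1 Set.univ := fun t ht => by
    rw [dirichlet_eq_map_smul hm ht, Measure.map_apply (measurable_const_smul t) .univ,
      Set.preimage_univ]
  have hM : 0 < ∑ i, m i := Finset.sum_pos' (fun i _ => hm i) (by simpa using h)
  have h1 := lintegral_pi_gammaLaw hm h (F := fun _ => 1) measurable_const
  have h2 : ∀ t, gammaDensity (∑ i, m i) t * ∫⁻ _, 1 ∂(dirichlet m t)
      = gammaDensity (∑ i, m i) t * dirichlet m 1 Set.univ := fun t => by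
    rw [lintegral_one]
    by_cases ht : 0 < t
    · rw [hmass t ht]
    · have h0 : gammaDensity (∑ i, m i) t = 0 := Set.indicator_of_notMem (by simpa using ht) _
      rw [h0, zero_mul, zero_mul]
  simp only [h2] at h1
  rw [lintegral_one, measure_univ, lintegral_mul_const _ (measurable_gammaDensity _),
    lintegral_gammaDensity hM, one_mul] at h1
  exact ⟨by rw [hmass s hs, ← h1]⟩

/-- The sum of independent Gamma distributed variables. -/
theorem map_sum_pi_gammaLaw (hm : ∀ i, 0 ≤ m i) :
    (Measure.pi fun i => gammaLaw (m i)).map (fun x => ∑ i, x i) = gammaLaw (∑ i, m i) := by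
  have hsum : Measurable fun x : ι → ℝ => ∑ i, x i := by fun_prop
  by_cases h : ∃ i, 0 < m i
  · have hM : 0 < ∑ i, m i := Finset.sum_pos' (fun i _ => hm i) (by simpa using h)
    refine Measure.ext_of_lintegral _ fun F hF => ?_
    rw [lintegral_map hF hsum, lintegral_pi_gammaLaw hm h (F := fun x => F (∑ i, x i)) (hF.comp hsum), gammaLaw, if_pos hM,
      lintegral_withDensity_eq_lintegral_mul _ (measurable_gammaDensity _) hF]
    refine lintegral_congr fun s => ?_
    rw [Pi.mul_apply]
    by_cases hs : 0 < s
    · have := isProbabilityMeasure_dirichlet hm h hs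
      have h1 : ∫⁻ x, F (∑ i, x i) ∂(dirichlet m s) = ∫⁻ _, F s ∂(dirichlet m s) :=
        lintegral_congr_ae ((ae_sum_dirichlet m s).mono fun x hx => congrArg F hx)
      rw [h1, lintegral_const, measure_univ, mul_one]
    · have h0 : gammaDensity (∑ i, m i) s = 0 := Set.indicator_of_notMem (by simpa using hs) _
      rw [h0, zero_mul, zero_mul]
  · push Not at h
    have h0 : ∀ i, m i = 0 := fun i => le_antisymm (h i) (hm i)
    have h1 : (fun i => gammaLaw (m i)) = fun _ => Measure.dirac 0 := by
      ext1 i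
      rw [h0 i, gammaLaw, if_neg (lt_irrefl _)]
    rw [h1, Finset.sum_eq_zero fun i _ => h0 i, gammaLaw, if_neg (lt_irrefl _),
      ← Measure.infinitePi_eq_pi, Measure.infinitePi_dirac, Measure.map_dirac' hsum]
    simp

/-- Dirichlet distributions and Gamma distributions. -/
theorem dirichlet_one_eq_map (hm : ∀ i, 0 ≤ m i) (h : ∃ i, 0 < m i) :
    dirichlet m 1 = (Measure.pi fun i => gammaLaw (m i)).map fun x => (∑ i, x i)⁻¹ • x := by
  have hM : 0 < ∑ i, m i := Finset.sum_pos' (fun i _ => hm i) (by simpa using h)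
  have hnorm : Measurable fun x : ι → ℝ => (∑ i, x i)⁻¹ • x := by fun_prop
  refine Measure.ext_of_lintegral _ fun F hF => ?_
  rw [lintegral_map hF hnorm, lintegral_pi_gammaLaw hm h (F := fun x => F ((∑ i, x i)⁻¹ • x)) (hF.comp hnorm)]
  have h2 : ∀ s, gammaDensity (∑ i, m i) s * ∫⁻ x, F ((∑ i, x i)⁻¹ • x) ∂(dirichlet m s)
      = gammaDensity (∑ i, m i) s * ∫⁻ x, F x ∂(dirichlet m 1) := by
    intro s
    by_cases hs : 0 < s
    · congr 1
      rw [dirichlet_eq_map_smul hm hs, lintegral_map (f := fun x => F ((∑ i, x i)⁻¹ • x)) (hF.comp hnorm)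
        (measurable_const_smul s)]
      refine lintegral_congr_ae ((ae_sum_dirichlet m 1).mono fun x hx => ?_)
      have : ∑ i, (s • x) i = s := by
        simp only [Pi.smul_apply, smul_eq_mul]
        rw [← Finset.mul_sum, hx, mul_one]
      change F ((∑ i, (s • x) i)⁻¹ • s • x) = F x
      rw [this, smul_smul, inv_mul_cancel₀ hs.ne', one_smul]
    · have h0 : gammaDensity (∑ i, m i) s = 0 := Set.indicator_of_notMem (by simpa using hs) _
      rw [h0, zero_mul, zero_mul]
  simp only [h2]
  rw [lintegral_mul_const _ (measurable_gammaDensity _), lintegral_gammaDensity hM, one_mul]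

end Simplex

/-! ### Families of independent variables split into blocks -/

theorem map_pi_blocks {ι κ X : Type*} [Fintype ι] [Fintype κ] [MeasurableSpace X] (q : ι → κ)
    [∀ k, Fintype {i // q i = k}] (μ : ι → Measure X) [∀ i, IsProbabilityMeasure (μ i)] :
    (Measure.pi μ).map (fun x k (j : {i // q i = k}) => x j)
      = Measure.pi fun k => Measure.pi fun j : {i // q i = k} => μ j := by
  have h1 := Measure.infinitePi_map_piCurry (ι := κ) (κ := fun k => {i // q i = k})
    (X := fun _ _ => X) fun k j => μ j
  have hinj : Function.Injective fun p : (k : κ) × {i // q i = k} => (p.2 : ι) := by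
    rintro ⟨k, i, rfl⟩ ⟨k', i', rfl⟩ h
    cases h
    rfl
  have h2 := Measure.map_infinitePi_infinitePi_of_inj (P := μ) hinj
  rw [← h2, Measure.map_map (by fun_prop) (by fun_prop)] at h1
  simp only [Measure.infinitePi_eq_pi] at h1
  exact h1

theorem map_pi_subtype {ι X : Type*} [Fintype ι] [MeasurableSpace X] (p : ι → Prop)
    [Fintype {i // p i}] (μ : ι → Measure X) [∀ i, IsProbabilityMeasure (μ i)] :
    (Measure.pi μ).map (fun x (j : {i // p i}) => x j)
      = Measure.pi fun j : {i // p i} => μ j := by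
  have h := Measure.map_infinitePi_infinitePi_of_inj (P := μ)
    (Subtype.val_injective (p := p))
  simpa only [Measure.infinitePi_eq_pi] using h

open Classical in
/-- The aggregation property of Dirichlet distributions. -/
theorem map_dirichlet_one {κ ι : Type*} [Fintype κ] [Nonempty κ] [Fintype ι] (q : κ → ι) :
    (dirichlet (fun _ : κ => (1 : ℝ)) 1).map (fun x γ => ∑ i with q i = γ, x i)
      = dirichlet (fun γ => (Nat.card {i // q i = γ} : ℝ)) 1 := by
  have hpos : ∃ γ, 0 < (Nat.card {i // q i = γ} : ℝ) := by
    obtain ⟨i⟩ := ‹Nonempty κ›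
    refine ⟨q i, ?_⟩
    have : Nonempty {j // q j = q i} := ⟨⟨i, rfl⟩⟩
    exact_mod_cast Nat.card_pos
  have hagg : Measurable fun (x : κ → ℝ) γ => ∑ i with q i = γ, x i := by fun_prop
  rw [dirichlet_one_eq_map (fun _ => zero_le_one) (by simp),
    dirichlet_one_eq_map (fun γ => Nat.cast_nonneg _) hpos]
  -- Sums over disjoint blocks of independent Gamma variables are independent Gamma variables with
  -- added parameters. Normalization commutes with taking block sums.
  have h1 : (Measure.pi fun γ => gammaLaw (Nat.card {i // q i = γ} : ℝ))
      = (Measure.pi fun _ : κ => gammaLaw 1).map (fun x γ => ∑ i with q i = γ, x i) := by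
    have h2 := map_pi_blocks q fun _ : κ => gammaLaw 1
    have h3 : (fun (x : κ → ℝ) γ => ∑ i with q i = γ, x i) = (fun y γ => ∑ j, y γ j) ∘
        fun x γ (j : {i // q i = γ}) => x j := by
      ext x γ
      exact Finset.sum_subtype _ (by simp) _
    have h5 : ∀ γ, (Measure.pi fun _ : {i // q i = γ} => gammaLaw 1).map (fun y => ∑ j, y j)
        = gammaLaw (Nat.card {i // q i = γ} : ℝ) := by
      intro γ
      rw [map_sum_pi_gammaLaw (m := fun _ : {i // q i = γ} => (1 : ℝ)) fun _ => zero_le_one]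
      simp
    have hms : ∀ γ, Measurable fun y : {i // q i = γ} → ℝ => ∑ j, y j := fun γ => by fun_prop
    have hsf : ∀ γ, SigmaFinite ((Measure.pi fun _ : {i // q i = γ} => gammaLaw 1).map
        (fun y => ∑ j, y j)) := fun γ => by
      rw [h5]
      infer_instance
    have h4 := Measure.pi_map_pi
      (μ := fun γ => Measure.pi fun _ : {i // q i = γ} => gammaLaw 1)
      (f := fun γ y => ∑ j, y j) fun γ => (hms γ).aemeasurable
    simp only [h5] at h4
    rw [h3, ← Measure.map_map (by fun_prop) (by fun_prop), h2, h4]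
  rw [h1, Measure.map_map hagg (by fun_prop), Measure.map_map (by fun_prop) hagg]
  congr 1
  ext x γ
  simp only [Function.comp_apply, Pi.smul_apply, smul_eq_mul]
  rw [← Finset.mul_sum]
  congr 2
  exact (Finset.sum_fiberwise Finset.univ q x).symm


theorem pi_smul_measure {ι : Type*} [Fintype ι] {X : ι → Type*} [∀ i, MeasurableSpace (X i)]
    (c : ι → ENNReal) (hc : ∀ i, c i ≠ ⊤) (ν : ∀ i, Measure (X i)) [∀ i, IsFiniteMeasure (ν i)] :
    Measure.pi (fun i => c i • ν i) = (∏ i, c i) • Measure.pi ν := by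
  have : ∀ i, IsFiniteMeasure (c i • ν i) := fun i => (ν i).smul_finite (hc i)
  refine Measure.pi_eq fun s _ => ?_
  rw [Measure.smul_apply, Measure.pi_pi, smul_eq_mul, ← Finset.prod_mul_distrib]
  rfl

/-! ### Arcs of a circle: all lengths but one are free, the last one closes the circle -/

section CloseUp

variable {κ : Type*} [Fintype κ]

open Classical in
/-- The replacement of the coordinate `r` by the number making the sum equal to `1`. -/
def closeUp (r : κ) (y : κ → ℝ) : κ → ℝ :=
  simplexPoint (fun _ : κ => (1 : ℝ)) r (fun j => y j)
    (1 - ∑ j : {i : κ // 0 < (1 : ℝ) ∧ i ≠ r}, y j)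

open Classical in
/-- The set of `y` for which the sum of the coordinates different from `r` is less than `1`. -/
def closable (r : κ) : Set (κ → ℝ) := {y | ∑ j : {i : κ // 0 < (1 : ℝ) ∧ i ≠ r}, y j < 1}

theorem measurable_closeUp (r : κ) : Measurable (closeUp r) :=
  (measurable_simplexPoint _ r).comp
    (Measurable.prodMk (measurable_pi_lambda _ fun j => measurable_pi_apply _) (by fun_prop))

theorem measurableSet_closable (r : κ) : MeasurableSet (closable r) :=
  measurableSet_lt (by fun_prop) measurable_const

/-- The law of the lengths of the arcs into which a circle is cut by random points. -/
theorem map_closeUp (h : ∃ i : κ, 0 < (fun _ : κ => (1 : ℝ)) i) :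
    ((Measure.pi fun _ : κ => (volume : Measure ℝ).restrict (Set.Ioc 0 1)).restrict
      (closable h.choose)).map (closeUp h.choose) =
      ENNReal.ofReal (1 / ((Fintype.card κ - 1).factorial : ℝ)) • dirichlet (fun _ => 1) 1 := by
  classical
  set r := h.choose with hr
  have hu : IsProbabilityMeasure ((volume : Measure ℝ).restrict (Set.Ioc 0 1)) := ⟨by simp⟩
  have hcard : 0 < Fintype.card κ := Fintype.card_pos_iff.2 ⟨r⟩
  let P : κ → Prop := fun i => 0 < (1 : ℝ) ∧ i ≠ r
  refine Measure.ext_of_lintegral _ fun F hF => ?_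
  let G : ({i // P i} → ℝ) → ENNReal := fun y =>
    F (simplexPoint (fun _ : κ => (1 : ℝ)) r y (1 - ∑ j, y j))
  have hG : Measurable G := hF.comp ((measurable_simplexPoint _ r).comp
    (measurable_id.prodMk (by fun_prop)))
  let D : Set ({i // P i} → ℝ) := {y | ∑ j, y j < 1}
  have hD : MeasurableSet D := measurableSet_lt (by fun_prop) measurable_const
  have hres : Measurable fun (x : κ → ℝ) (j : {i // P i}) => x j := by fun_prop
  have e1 : ∫⁻ y, F y ∂(((Measure.pi fun _ : κ =>
      (volume : Measure ℝ).restrict (Set.Ioc 0 1)).restrict (closable r)).map (closeUp r))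
        = ∫⁻ y in openSimplex {i // P i} 1, G y := by
    rw [lintegral_map hF (measurable_closeUp r), ← lintegral_indicator (measurableSet_closable r)]
    have e2 : ∀ y, (closable r).indicator (fun y => F (closeUp r y)) y
        = D.indicator G (fun j => y j) := fun y => rfl
    simp only [e2]
    rw [← lintegral_map (f := D.indicator G) (hG.indicator hD) hres, map_pi_subtype P,
      lintegral_indicator hD, ← Measure.restrict_pi_pi,
      Measure.restrict_restrict hD]
    -- The open simplex is the part of the cube where the sum is less than `1`, so the law on it is
    -- Lebesgue measure.
    have e3 : ∀ y, y ∈ openSimplex {i // P i} 1 ↔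
        y ∈ D ∩ Set.univ.pi fun _ => Set.Ioc (0 : ℝ) 1 := by
      intro y
      constructor
      · rintro ⟨h1, h2⟩
        refine ⟨h2, fun j _ => ⟨h1 j, ?_⟩⟩
        exact (Finset.single_le_sum (f := y) (fun i _ => (h1 i).le) (Finset.mem_univ j)).trans h2.le
      · rintro ⟨h1, h2⟩
        exact ⟨fun j => (h2 j (Set.mem_univ j)).1, h1⟩
    rw [← Set.ext e3]
    rfl
  -- With unit parameters the Dirichlet density is constant; its value is the source of the factor
  -- `1 / (card - 1)!`.
  have e4 : ∀ y, dirichletDensity (fun _ : κ => (1 : ℝ)) r 1 y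
      = ENNReal.ofReal ((Fintype.card κ - 1).factorial : ℝ) := by
    intro y
    unfold dirichletDensity
    congr 1
    have : Real.Gamma (Fintype.card κ : ℝ) = ((Fintype.card κ - 1).factorial : ℝ) := by
      rw [← Real.Gamma_nat_eq_factorial, ← Nat.cast_add_one, Nat.sub_add_cancel hcard]
    simp [this]
  have e5 : ∫⁻ y, F y ∂(dirichlet (fun _ : κ => (1 : ℝ)) 1) = ∫⁻ y in openSimplex {i // P i} 1,
      ENNReal.ofReal ((Fintype.card κ - 1).factorial : ℝ) * G y :=
    (lintegral_dirichlet h 1 hF).trans (lintegral_congr fun y => congrArg (· * G y) (e4 y))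
  rw [e1, lintegral_smul_measure, e5, lintegral_const_mul _ hG, smul_eq_mul, ← mul_assoc,
    ← ENNReal.ofReal_mul (by positivity), one_div_mul_cancel (by positivity), ENNReal.ofReal_one,
    one_mul]

theorem closeUp_of_ne {r i : κ} (hi : i ≠ r) (y : κ → ℝ) : closeUp r y i = y i :=
  simplexPoint_coe (m := fun _ : κ => (1 : ℝ)) _ _ ⟨i, one_pos, hi⟩

open Classical in
theorem sum_sub_apply (r : κ) (y : κ → ℝ) :
    ∑ i, y i - y r = ∑ j : {i : κ // 0 < (1 : ℝ) ∧ i ≠ r}, y j := by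
  rw [sum_eq_add_sum_subtype (m := fun _ : κ => (1 : ℝ)) (r := r) y
    fun i _ h => absurd one_pos h, add_sub_cancel_left]

theorem closeUp_self (r : κ) (y : κ → ℝ) : closeUp r y r = 1 - (∑ i, y i - y r) := by
  rw [sum_sub_apply]
  exact simplexPoint_self _ _

theorem mem_closable_iff {r : κ} {y : κ → ℝ} : y ∈ closable r ↔ ∑ i, y i - y r < 1 := by
  rw [sum_sub_apply]
  rfl

theorem sum_sub_congr {M : Type*} [AddCommGroup M] {r : κ} {f g : κ → M}
    (h : ∀ i, i ≠ r → f i = g i) : ∑ i, f i - f r = ∑ i, g i - g r := by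
  have h1 : ∑ i, (f i - g i) = f r - g r :=
    Finset.sum_eq_single r (fun i _ hi => by rw [h i hi, sub_self]) (by simp)
  rw [Finset.sum_sub_distrib, sub_eq_sub_iff_add_eq_add] at h1
  rw [sub_eq_sub_iff_add_eq_add, h1, add_comm]

end CloseUp

/-! ### Arcs between random points of circles -/

variable {n : ℕ}

/-- The guests on the cycle `β` of `σ`. -/
abbrev Block (σ : Equiv.Perm (Fin n)) (β : Vertex 1 σ) : Type := {i : Fin n // Vertex.mk 1 σ i = β}

theorem Block.nonempty (σ : Equiv.Perm (Fin n)) (β : Vertex 1 σ) :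
    ∃ i : Block σ β, 0 < (fun _ : Block σ β => (1 : ℝ)) i := by
  obtain ⟨i, hi⟩ := β.exists_mk
  exact ⟨⟨i, hi⟩, one_pos⟩

/-- A guest on the cycle `β`. -/
def blockRoot (σ : Equiv.Perm (Fin n)) (β : Vertex 1 σ) : Block σ β := (Block.nonempty σ β).choose

instance (σ : Equiv.Perm (Fin n)) (β : Vertex 1 σ) : Fintype (Block σ β) := Fintype.ofFinite _

theorem Vertex.mk_apply (σ : Equiv.Perm (Fin n)) (i : Fin n) :
    Vertex.mk 1 σ (σ i) = Vertex.mk 1 σ i :=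
  Vertex.mk_one_eq_iff.2 (Equiv.Perm.sameCycle_apply_left.2 (.refl _ _))

theorem sum_block_apply {M : Type*} [AddCommMonoid M] (σ : Equiv.Perm (Fin n)) (β : Vertex 1 σ)
    (f : Fin n → M) : ∑ i : Block σ β, f (σ i) = ∑ i : Block σ β, f i :=
  Equiv.sum_comp (σ.subtypePerm (p := fun i => Vertex.mk 1 σ i = β)
    fun i => by rw [Vertex.mk_apply]) fun i : Block σ β => f i

/-- The differences of the positions of successive guests, and the positions of the roots. -/
def differences (σ : Equiv.Perm (Fin n)) : (Fin n → UnitAddCircle) →+ (Fin n → UnitAddCircle) where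
  toFun θ i := if i = blockRoot σ (Vertex.mk 1 σ i) then θ i else θ (σ i) - θ i
  map_zero' := by ext i; simp
  map_add' θ η := by
    ext i
    simp only [Pi.add_apply]
    split_ifs
    · rfl
    · abel

theorem differences_apply_root (σ : Equiv.Perm (Fin n)) (θ : Fin n → UnitAddCircle) {i : Fin n}
    (h : i = blockRoot σ (Vertex.mk 1 σ i)) : differences σ θ i = θ i := if_pos h

theorem differences_apply (σ : Equiv.Perm (Fin n)) (θ : Fin n → UnitAddCircle) {i : Fin n}
    (h : i ≠ blockRoot σ (Vertex.mk 1 σ i)) : differences σ θ i = θ (σ i) - θ i := if_neg h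

/-- Start with the prescribed position of the root of each cycle and subtract the prescribed
differences along the way to it; `K i` is the number of steps from `i` to the root. -/
theorem differences_surjective (σ : Equiv.Perm (Fin n)) : Function.Surjective (differences σ) := by
  classical
  intro y
  let r : Fin n → Fin n := fun i => blockRoot σ (Vertex.mk 1 σ i)
  have hr : ∀ i, Vertex.mk 1 σ (r i) = Vertex.mk 1 σ i := fun i =>
    (blockRoot σ (Vertex.mk 1 σ i)).2
  have hrσ : ∀ i, r (σ i) = r i := fun i =>
    congrArg (fun β => (blockRoot σ β : Fin n)) (Vertex.mk_apply σ i)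
  have hex : ∀ i, ∃ k : ℕ, (σ ^ k) i = r i := fun i => by
    obtain ⟨k, -, hk⟩ := (Vertex.mk_one_eq_iff.1 (hr i).symm).exists_pow_eq'
    exact ⟨k, hk⟩
  let K : Fin n → ℕ := fun i => Nat.find (hex i)
  have hK : ∀ i, i ≠ r i → K i = K (σ i) + 1 := by
    intro i hi
    refine (Nat.find_eq_iff (hex i)).2 ⟨?_, ?_⟩
    · have := Nat.find_spec (hex (σ i))
      rw [pow_succ, Equiv.Perm.mul_apply, this, hrσ]
    · rintro (_ | k) hk hc
      · exact hi hc
      · refine Nat.find_min (hex (σ i)) (Nat.lt_of_succ_lt_succ hk) ?_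
        rw [hrσ, ← hc, pow_succ, Equiv.Perm.mul_apply]
  have hK0 : ∀ i, i = r i → K i = 0 := fun i hi => (Nat.find_eq_zero (hex i)).2 hi
  refine ⟨fun i => y (r i) - ∑ k ∈ Finset.range (K i), y ((σ ^ k) i), ?_⟩
  ext1 i
  by_cases hi : i = r i
  · rw [differences_apply_root σ _ hi, hK0 i hi, Finset.range_zero, Finset.sum_empty, sub_zero, ← hi]
  · rw [differences_apply σ _ hi, hK i hi, Finset.sum_range_succ', hrσ]
    simp only [pow_succ, Equiv.Perm.mul_apply, pow_zero, Equiv.Perm.one_apply]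
    abel

/-- A continuous surjective homomorphism of compact groups carries normalized Haar measure to
normalized Haar measure. So the differences are independent and uniform. -/
theorem measurePreserving_differences (σ : Equiv.Perm (Fin n)) :
    MeasurePreserving (differences σ) volume volume := by
  refine AddMonoidHom.measurePreserving (f := differences σ) ?_ (differences_surjective σ) rfl
  refine continuous_pi fun i => ?_
  by_cases hi : i = blockRoot σ (Vertex.mk 1 σ i)
  · simp only [differences_apply_root σ _ hi]
    exact continuous_apply i
  · simp only [differences_apply σ _ hi]
    exact (continuous_apply _).sub (continuous_apply _)

theorem arc_eq_arc_zero (a b : UnitAddCircle) : arc a b = arc 0 (b - a) := by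
  unfold arc
  rw [sub_zero]

/-- The lengths of the arcs between successive guests. -/
def arcs (σ : Equiv.Perm (Fin n)) (θ : Fin n → UnitAddCircle) (i : Fin n) : ℝ :=
  arc (θ i) (θ (σ i))

theorem measurable_arcs (σ : Equiv.Perm (Fin n)) : Measurable (arcs σ) :=
  measurable_pi_lambda _ fun i => measurable_arc.comp
    (f := fun θ : Fin n → UnitAddCircle => (θ i, θ (σ i)))
    ((measurable_pi_apply i).prodMk (measurable_pi_apply (σ i)))

/-- The event that the arcs between successive guests cover each circle exactly once. -/
def coversOnce (σ : Equiv.Perm (Fin n)) : Set (Fin n → UnitAddCircle) :=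
  {θ | ∀ β, ∑ i : Block σ β, arcs σ θ i = 1}

theorem measurableSet_coversOnce (σ : Equiv.Perm (Fin n)) : MeasurableSet (coversOnce σ) := by
  unfold coversOnce
  rw [Set.ofPred_forall]
  refine .iInter fun β => measurableSet_eq_fun ?_ measurable_const
  exact Finset.measurable_sum _ fun i _ => (measurable_pi_apply i.1).comp (measurable_arcs σ)

theorem arcs_eq_arc_differences {σ : Equiv.Perm (Fin n)} {β : Vertex 1 σ}
    (θ : Fin n → UnitAddCircle) {i : Block σ β} (hi : i ≠ blockRoot σ β) :
    arcs σ θ i = arc 0 (differences σ θ i) := by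
  obtain ⟨i, rfl⟩ := i
  rw [differences_apply σ θ fun h => hi (Subtype.ext h), arcs, arc_eq_arc_zero]

theorem sum_arcs_sub {σ : Equiv.Perm (Fin n)} {β : Vertex 1 σ} (θ : Fin n → UnitAddCircle) :
    ∑ i : Block σ β, arcs σ θ i - arcs σ θ (blockRoot σ β) =
      ∑ i : Block σ β, arc 0 (differences σ θ i) - arc 0 (differences σ θ (blockRoot σ β)) :=
  sum_sub_congr (f := fun i : Block σ β => arcs σ θ i) fun _ hi => arcs_eq_arc_differences θ hi

/-- Around a cycle the differences add up to zero on the circle, so the arc at the root is congruent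
modulo `1` to `1` minus the sum of the others. When that sum is less than `1`, both numbers lie in
`(0, 1]` and coincide. The event is thereby expressed through independent differences. -/
theorem sum_arcs_eq_one_iff {σ : Equiv.Perm (Fin n)} {β : Vertex 1 σ}
    (θ : Fin n → UnitAddCircle) : ∑ i : Block σ β, arcs σ θ i = 1 ↔
      (fun i : Block σ β => arc 0 (differences σ θ i)) ∈ closable (blockRoot σ β) := by
  rw [mem_closable_iff, ← sum_arcs_sub]
  have h0 : 0 < arcs σ θ (blockRoot σ β) := arc_pos _ _
  constructor
  · intro h
    linarith
  · intro h
    have h1 : ∀ x : ℝ, x = ∑ i : Block σ β, arcs σ θ i - arcs σ θ (blockRoot σ β) →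
        (x : UnitAddCircle) = -(θ (σ (blockRoot σ β)) - θ (blockRoot σ β)) := by
      rintro x rfl
      have hsum : ∀ f : Block σ β → ℝ, ((∑ i, f i : ℝ) : UnitAddCircle) = ∑ i, (f i : UnitAddCircle) :=
        fun f => map_sum (QuotientAddGroup.mk' (AddSubgroup.zmultiples (1 : ℝ))) f _
      have h2 : ∀ i, (arcs σ θ i : UnitAddCircle) = θ (σ i) - θ i := fun i => coe_arc _ _
      rw [AddCircle.coe_sub, hsum]
      simp only [h2]
      rw [Finset.sum_sub_distrib, sum_block_apply, sub_self, zero_sub]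
    have h2 : 0 ≤ ∑ i : Block σ β, arcs σ θ i - arcs σ θ (blockRoot σ β) := by
      rw [sub_nonneg]
      exact Finset.single_le_sum (f := fun i : Block σ β => arcs σ θ i) (fun i _ => (arc_pos _ _).le)
        (Finset.mem_univ (blockRoot σ β))
    have h3 : arcs σ θ (blockRoot σ β)
        = 1 - (∑ i : Block σ β, arcs σ θ i - arcs σ θ (blockRoot σ β)) := by
      refine arc_eq_of_coe (by linarith) (by linarith) ?_
      rw [AddCircle.coe_sub, h1 _ rfl, coe_one_circle]
      abel
    linarith

theorem closeUp_arc_differences {σ : Equiv.Perm (Fin n)} {β : Vertex 1 σ}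
    (θ : Fin n → UnitAddCircle) (h : ∑ i : Block σ β, arcs σ θ i = 1) :
    closeUp (blockRoot σ β) (fun i : Block σ β => arc 0 (differences σ θ i))
      = fun i : Block σ β => arcs σ θ i := by
  ext i
  by_cases hi : i = blockRoot σ β
  · rw [hi, closeUp_self, ← sum_arcs_sub, h, sub_sub_cancel]
  · rw [arcs_eq_arc_differences θ hi, closeUp_of_ne hi]

/-- The law of the arcs between successive guests. -/
theorem lintegral_arcs (σ : Equiv.Perm (Fin n)) {F : ((β : Vertex 1 σ) → Block σ β → ℝ) → ENNReal}
    (hF : Measurable F) :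
    ∫⁻ θ in coversOnce σ, F (fun _ i => arcs σ θ i) =
      ENNReal.ofReal (∏ β : Vertex 1 σ, 1 / ((β.order - 1).factorial : ℝ)) *
        ∫⁻ y, F y ∂(Measure.pi fun β : Vertex 1 σ => dirichlet (fun _ : Block σ β => (1 : ℝ)) 1) := by
  classical
  have hu : IsProbabilityMeasure ((volume : Measure ℝ).restrict (Set.Ioc 0 1)) := ⟨by simp⟩
  let C : ((β : Vertex 1 σ) → Block σ β → ℝ) → (β : Vertex 1 σ) → Block σ β → ℝ :=
    fun y β => closeUp (blockRoot σ β) (y β)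
  have hC : Measurable C := measurable_pi_lambda _ fun β =>
    (measurable_closeUp _).comp (measurable_pi_apply β)
  let D : Set ((β : Vertex 1 σ) → Block σ β → ℝ) := Set.univ.pi fun β => closable (blockRoot σ β)
  have hD : MeasurableSet D := MeasurableSet.univ_pi fun β => measurableSet_closable _
  let A : (Fin n → UnitAddCircle) → (β : Vertex 1 σ) → Block σ β → ℝ := fun θ β i => arc 0 (θ i)
  have hA : Measurable A := by
    refine measurable_pi_lambda _ fun β => measurable_pi_lambda _ fun i => ?_
    exact measurable_arc_zero.comp (measurable_pi_apply i.1)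
  have hFC : Measurable fun y => F (C y) := hF.comp hC
  have hlaw : (volume : Measure (Fin n → UnitAddCircle)).map A = Measure.pi fun β : Vertex 1 σ =>
      Measure.pi fun _ : Block σ β => (volume : Measure ℝ).restrict (Set.Ioc 0 1) := by
    have hsf : SigmaFinite ((volume : Measure UnitAddCircle).map (arc 0)) := by
      rw [map_arc_zero]
      infer_instance
    have h1 := Measure.pi_map_pi (μ := fun _ : Fin n => (volume : Measure UnitAddCircle))
      (f := fun _ => arc 0) fun _ => measurable_arc_zero.aemeasurable
    simp only [map_arc_zero] at h1
    have h2 := map_pi_blocks (Vertex.mk 1 σ)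
      fun _ : Fin n => (volume : Measure ℝ).restrict (Set.Ioc 0 1)
    have h3 : Measurable fun (x : Fin n → UnitAddCircle) i => arc 0 (x i) :=
      measurable_pi_lambda _ fun i => measurable_arc_zero.comp (measurable_pi_apply i)
    rw [← h1, Measure.map_map (by fun_prop) h3] at h2
    exact h2
  -- Both the event and the arcs are functions of the differences, whose law is a product over the
  -- cycles.
  have e1 : ∀ θ, (coversOnce σ).indicator (fun θ => F fun β i => arcs σ θ i) θ
      = D.indicator (fun y => F (C y)) (A (differences σ θ)) := by
    intro θ
    have hiff : θ ∈ coversOnce σ ↔ A (differences σ θ) ∈ D := by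
      simp only [D, Set.mem_univ_pi]
      exact forall_congr' fun β => sum_arcs_eq_one_iff θ
    by_cases hθ : θ ∈ coversOnce σ
    · rw [Set.indicator_of_mem hθ, Set.indicator_of_mem (hiff.1 hθ)]
      congr 1
      ext1 β
      exact (closeUp_arc_differences θ (hθ β)).symm
    · rw [Set.indicator_of_notMem hθ, Set.indicator_of_notMem fun hc => hθ (hiff.2 hc)]
  rw [← lintegral_indicator (measurableSet_coversOnce σ)]
  simp only [e1]
  have hFD : Measurable (D.indicator fun y => F (C y)) := hFC.indicator hD
  rw [(measurePreserving_differences σ).lintegral_comp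
    (f := fun θ => D.indicator (fun y => F (C y)) (A θ)) (hFD.comp hA),
    ← lintegral_map (f := D.indicator fun y => F (C y)) hFD hA, hlaw, lintegral_indicator hD,
    ← lintegral_map hF hC, Measure.restrict_pi_pi]
  have hcl : ∀ β : Vertex 1 σ, ((Measure.pi fun _ : Block σ β =>
      (volume : Measure ℝ).restrict (Set.Ioc 0 1)).restrict (closable (blockRoot σ β))).map
        (closeUp (blockRoot σ β)) = ENNReal.ofReal (1 / ((β.order - 1).factorial : ℝ)) •
          dirichlet (fun _ : Block σ β => (1 : ℝ)) 1 := by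
    intro β
    have h1 := map_closeUp (Block.nonempty σ β)
    have h2 : Fintype.card (Block σ β) = β.order := Nat.card_eq_fintype_card.symm
    rw [h2] at h1
    exact h1
  have hp : ∀ β : Vertex 1 σ, IsProbabilityMeasure (dirichlet (fun _ : Block σ β => (1 : ℝ)) 1) :=
    fun β => isProbabilityMeasure_dirichlet (fun _ => zero_le_one) (Block.nonempty σ β) one_pos
  have hfin : ∀ β : Vertex 1 σ, IsFiniteMeasure (ENNReal.ofReal (1 / ((β.order - 1).factorial : ℝ)) •
      dirichlet (fun _ : Block σ β => (1 : ℝ)) 1) := fun β =>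
    Measure.smul_finite _ ENNReal.ofReal_ne_top
  have hsf : ∀ β : Vertex 1 σ, SigmaFinite (((Measure.pi fun _ : Block σ β =>
      (volume : Measure ℝ).restrict (Set.Ioc 0 1)).restrict (closable (blockRoot σ β))).map
        (closeUp (blockRoot σ β))) := fun β => by
    rw [hcl]
    infer_instance
  rw [Measure.pi_map_pi (f := fun β => closeUp (blockRoot σ β))
    fun β => (measurable_closeUp _).aemeasurable]
  simp only [hcl]
  rw [pi_smul_measure _ fun β => ENNReal.ofReal_ne_top, lintegral_smul_measure, smul_eq_mul,
    ← ENNReal.ofReal_prod_of_nonneg fun β _ => by positivity]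


/-! ### The law of the tables after cutting and regluing -/

variable {n : ℕ} {ℓ : Restaurant} {x : ℕ → ℕ × UnitAddCircle}

theorem measurable_replaceTables {ι : Type*} [Countable ι] (ℓ : Restaurant) (B : Set (Table ℓ)) :
    Measurable fun y : ι → ℝ => replaceTables ℓ B y := by
  unfold replaceTables
  refine measurable_rank.comp (measurable_pi_lambda _ fun i => ?_)
  cases i with
  | inl i => exact measurable_const
  | inr i => exact measurable_pi_apply i

theorem measurable_cutLengths (g σ : Equiv.Perm (Fin n)) (L : Fin n → ℝ) :
    Measurable fun d => cutLengths g σ L d := by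
  unfold cutLengths
  fun_prop

/-- The number of guests on the cycle `β` of `σ` and on the cycle `γ` of `g σ`. -/
def commonGuests (g σ : Equiv.Perm (Fin n)) (β : Vertex 1 σ) (γ : Vertex 1 (g * σ)) : ℕ :=
  Nat.card {w : Fin n // Vertex.mk 1 σ w = β ∧ Vertex.mk 1 (g * σ) w = γ}

theorem exists_commonGuests_pos (g σ : Equiv.Perm (Fin n)) (β : Vertex 1 σ) :
    ∃ γ, 0 < (commonGuests g σ β γ : ℝ) := by
  obtain ⟨i, rfl⟩ := β.exists_mk
  refine ⟨Vertex.mk 1 (g * σ) i, ?_⟩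
  have : Nonempty {w : Fin n // Vertex.mk 1 σ w = Vertex.mk 1 σ i ∧
    Vertex.mk 1 (g * σ) w = Vertex.mk 1 (g * σ) i} := ⟨⟨i, rfl, rfl⟩⟩
  exact_mod_cast Nat.card_pos

/-- The law of the lengths of the new tables. -/
def cutLaw (g σ : Equiv.Perm (Fin n)) (L : Vertex 1 σ → ℝ) : Measure (Vertex 1 (g * σ) → ℝ) :=
  convolution fun β => dirichlet (fun γ => (commonGuests g σ β γ : ℝ)) (L β)

theorem isProbabilityMeasure_cutLaw (g σ : Equiv.Perm (Fin n)) {L : Vertex 1 σ → ℝ}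
    (hL : ∀ β, 0 < L β) : IsProbabilityMeasure (cutLaw g σ L) := by
  have : ∀ β, IsProbabilityMeasure (dirichlet (fun γ => (commonGuests g σ β γ : ℝ)) (L β)) :=
    fun β => isProbabilityMeasure_dirichlet (fun _ => Nat.cast_nonneg _)
      (exists_commonGuests_pos g σ β) (hL β)
  exact Measure.isProbabilityMeasure_map (by fun_prop)

/-- New lengths are sums, over the old circles `β`, of rescaled arcs grouped by the cycles of `g σ`.
Aggregation of the flat Dirichlet law gives the parameters `commonGuests`, and independence of the
circles gives the convolution. -/
theorem lintegral_cutLengths (g σ : Equiv.Perm (Fin n)) {L : Vertex 1 σ → ℝ} (hL : ∀ β, 0 < L β)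
    {F : (Vertex 1 (g * σ) → ℝ) → ENNReal} (hF : Measurable F) :
    ∫⁻ θ in coversOnce σ, F (cutLengths g σ (fun p => L (Vertex.mk 1 σ p)) (arcs σ θ)) =
      ENNReal.ofReal (∏ β : Vertex 1 σ, 1 / ((β.order - 1).factorial : ℝ)) *
        ∫⁻ y, F y ∂(cutLaw g σ L) := by
  classical
  let f : (β : Vertex 1 σ) → (Block σ β → ℝ) → Vertex 1 (g * σ) → ℝ := fun β y γ =>
    L β * ∑ i with Vertex.mk 1 (g * σ) i.1 = γ, y i
  have hf : ∀ β, Measurable (f β) := fun β => by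
    simp only [f]
    fun_prop
  have hsum : ∀ d : Fin n → ℝ, cutLengths g σ (fun p => L (Vertex.mk 1 σ p)) d
      = ∑ β, f β fun i => d i := by
    intro d
    ext γ
    rw [cutLengths, Finset.sum_apply, Finset.sum_filter, ← Fintype.sum_fiberwise (Vertex.mk 1 σ)]
    refine Finset.sum_congr rfl fun β _ => ?_
    simp only [f]
    rw [Finset.mul_sum, Finset.sum_filter]
    refine Finset.sum_congr (by congr!) fun i _ => ?_
    rw [i.2]
  have hlaw : ∀ β, (dirichlet (fun _ : Block σ β => (1 : ℝ)) 1).map (f β)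
      = dirichlet (fun γ => (commonGuests g σ β γ : ℝ)) (L β) := by
    intro β
    have : Nonempty (Block σ β) := ⟨blockRoot σ β⟩
    have h1 := map_dirichlet_one fun i : Block σ β => Vertex.mk 1 (g * σ) i.1
    have h2 : ∀ γ, Nat.card {i : Block σ β // Vertex.mk 1 (g * σ) i.1 = γ}
        = commonGuests g σ β γ := fun γ => Nat.card_congr
      (Equiv.subtypeSubtypeEquivSubtypeInter (fun i => Vertex.mk 1 σ i = β)
        fun i => Vertex.mk 1 (g * σ) i = γ)
    simp only [h2] at h1
    rw [dirichlet_eq_map_smul (fun _ => Nat.cast_nonneg _) (hL β), ← h1,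
      Measure.map_map (measurable_const_smul _) (by fun_prop)]
    rfl
  have hp : ∀ β : Vertex 1 σ, IsProbabilityMeasure (dirichlet (fun _ : Block σ β => (1 : ℝ)) 1) :=
    fun β => isProbabilityMeasure_dirichlet (fun _ => zero_le_one) (Block.nonempty σ β) one_pos
  have hp' : ∀ β : Vertex 1 σ, IsProbabilityMeasure
      ((dirichlet (fun _ : Block σ β => (1 : ℝ)) 1).map (f β)) := fun β =>
    Measure.isProbabilityMeasure_map (hf β).aemeasurable
  have hmap := Measure.pi_map_pi (μ := fun β => dirichlet (fun _ : Block σ β => (1 : ℝ)) 1)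
    (f := f) fun β => (hf β).aemeasurable
  simp only [hlaw] at hmap
  have hfm : Measurable fun (y : (β : Vertex 1 σ) → Block σ β → ℝ) β => f β (y β) :=
    measurable_pi_lambda _ fun β => (hf β).comp (measurable_pi_apply β)
  have hsm : Measurable fun y : Vertex 1 σ → Vertex 1 (g * σ) → ℝ => ∑ β, y β := by fun_prop
  simp only [hsum]
  rw [lintegral_arcs σ (F := fun y => F (∑ β, f β (y β))) (hF.comp (hsm.comp hfm)), cutLaw,
    convolution, ← hmap, Measure.map_map hsm hfm, lintegral_map hF (hsm.comp hfm)]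
  rfl

/-- Integrals of functions of the first `n` guests. -/
theorem lintegral_guests (hℓ : IsNormalized ℓ) (H : (Fin n → ℕ) → (Fin n → UnitAddCircle) → ENNReal)
    (hH : ∀ τ, Measurable (H τ)) :
    ∫⁻ x, H (fun i => (x i).1) (fun i => (x i).2) ∂(guests ℓ) =
      ∑' τ : Fin n → ℕ, (∏ i, ENNReal.ofReal (ℓ (τ i))) * ∫⁻ θ, H τ θ := by
  have hHm : Measurable fun p : (Fin n → ℕ) × (Fin n → UnitAddCircle) => H p.1 p.2 :=
    measurable_from_prod_countable_right hH
  have h1 := Measure.map_infinitePi_infinitePi_of_inj (P := fun _ : ℕ => guestLaw ℓ)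
    (f := fun i : Fin n => (i : ℕ)) Fin.val_injective
  rw [Measure.infinitePi_eq_pi (ι := Fin n)] at h1
  have h2 := (measurePreserving_arrowProdEquivProdArrow ℕ UnitAddCircle (Fin n)
    (fun _ => tableLaw ℓ) fun _ => volume).map_eq
  have hm : Measurable fun (x : ℕ → ℕ × UnitAddCircle) (i : Fin n) => x i := by fun_prop
  have e : ∫⁻ x, H (fun i => (x i).1) (fun i => (x i).2) ∂(guests ℓ) = ∫⁻ p, H p.1 p.2
      ∂((Measure.pi fun _ : Fin n => tableLaw ℓ).prod
        (Measure.pi fun _ : Fin n => (volume : Measure UnitAddCircle))) := by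
    rw [← h2, lintegral_map hHm (MeasurableEquiv.measurable _)]
    have h3 : (Measure.pi fun _ : Fin n => (tableLaw ℓ).prod (volume : Measure UnitAddCircle))
        = (guests ℓ).map fun x (i : Fin n) => x i := h1.symm
    rw [h3]
    exact (lintegral_map (hHm.comp
      (MeasurableEquiv.arrowProdEquivProdArrow ℕ UnitAddCircle (Fin n)).measurable) hm).symm
  rw [e, lintegral_prod _ hHm.aemeasurable, lintegral_countable']
  refine tsum_congr fun τ => ?_
  rw [mul_comm, ← Set.univ_pi_singleton, Measure.pi_pi]
  simp only [tableLaw_singleton hℓ]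
  rfl

/-- The table of a guest determines its cycle, and conversely. -/
def Compatible {T : Type*} (σ : Equiv.Perm (Fin n)) (τ : Fin n → T) : Prop :=
  ∀ i j, σ.SameCycle i j ↔ τ i = τ j

theorem prod_eq_pow_natCard {α : Type*} {_ : Fintype α} {f : α → ℝ} {a : ℝ} (h : ∀ i, f i = a) :
    ∏ i, f i = a ^ Nat.card α := by
  simp [h, Nat.card_eq_fintype_card]

/-- The successor permutation is unique, and it is recognized by its arcs covering each circle once
(`IsSuccessor.sum_arc`, `isSuccessor_of_sum_arc`). This separates the event into a condition on the
tables and one on the positions. -/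
theorem IsTypical.seq_eq_iff (hx : IsTypical ℓ x) (σ : Equiv.Perm (Fin n)) :
    (arrange x).seq n = extendPerm σ ↔
      Compatible σ (fun i : Fin n => (x i).1) ∧ (fun i : Fin n => (x i).2) ∈ coversOnce σ := by
  classical
  have hS := isSuccessor_arrange hx.inj n
  have hblock : ∀ (τ : Equiv.Perm (Fin n)), Compatible τ (fun i : Fin n => (x i).1) → ∀ i : Fin n,
      ∑ j ∈ Finset.range n with (x j).1 = (x i).1, arc (x j).2 (x (extendPerm τ j)).2
        = ∑ j : Block τ (Vertex.mk 1 τ i), arcs τ (fun i : Fin n => (x i).2) j := by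
    intro τ hτ i
    rw [Finset.sum_filter, Finset.sum_range]
    rw [← Finset.sum_subtype (Finset.univ.filter fun j => Vertex.mk 1 τ j = Vertex.mk 1 τ i)
      (by simp) (arcs τ fun i : Fin n => (x i).2), Finset.sum_filter]
    refine Finset.sum_congr rfl fun j _ => ?_
    simp only [Vertex.mk_one_eq_iff, hτ j i, arcs, extendPerm_apply_fin]
  constructor
  · intro h
    have hc : Compatible σ (fun i : Fin n => (x i).1) := fun i j => by
      rw [← extendPerm_sameCycle, ← h]
      exact hS.sameCycle_iff hx.inj.injOn (Finset.mem_range.2 i.2) (Finset.mem_range.2 j.2)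
    refine ⟨hc, fun β => ?_⟩
    obtain ⟨i, rfl⟩ := β.exists_mk
    rw [← hblock σ hc i, ← h]
    exact hS.sum_arc hx.inj.injOn (Finset.mem_range.2 i.2)
  · rintro ⟨hc, hθ⟩
    have hσ : IsSuccessor (Finset.range n) (fun i => (x i).1) (fun i => (x i).2) (extendPerm σ) := by
      refine isSuccessor_of_sum_arc (fun i hi => ?_) (fun i hi => ?_) fun i hi => ?_
      · lift i to Fin n using Finset.mem_range.1 hi
        rw [extendPerm_apply_fin]
        simp
      · lift i to Fin n using Finset.mem_range.1 hi
        rw [extendPerm_apply_fin]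
        exact (hc _ _).1 (Equiv.Perm.sameCycle_apply_left.2 (.refl _ _))
      · lift i to Fin n using Finset.mem_range.1 hi
        rw [hblock σ hc i]
        exact hθ _
    ext i
    by_cases hi : i < n
    · exact hS.apply_eq hσ hx.inj.injOn (Finset.mem_range.2 hi)
    · rw [(arrange x).fix n i (not_lt.1 hi), extendPerm_fix _ i (not_lt.1 hi)]

/-- The distribution of the new restaurant on the event that the first `n` guests form the
permutation `σ`. -/
theorem lintegral_guests_seq_eq (hℓ : IsNormalized ℓ) (g σ : Equiv.Perm (Fin n))
    {F : Restaurant → ENNReal} (hF : Measurable F) :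
    ∫⁻ x in {x | (arrange x).seq n = extendPerm σ},
        F (tableLengths (act g⁻¹ 1 (arrange x))) ∂(guests ℓ) =
      ∑' ω : Vertex 1 σ ↪ Table ℓ,
        ENNReal.ofReal (∏ β, (ℓ (ω β) ^ β.order / ((β.order - 1).factorial : ℝ))) *
          ∫⁻ y, F (replaceTables ℓ (Set.range ω) y) ∂(cutLaw g σ fun β => ℓ (ω β)) := by
  classical
  let B : (Fin n → ℕ) → Set (Table ℓ) := fun τ => {t | ∃ i, τ i = t.1}
  let H : (Fin n → ℕ) → (Fin n → UnitAddCircle) → ENNReal := fun τ θ =>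
    if Compatible σ τ then (coversOnce σ).indicator
      (fun θ => F (replaceTables ℓ (B τ) (cutLengths g σ (fun p => ℓ (τ p)) (arcs σ θ)))) θ else 0
  have hHm : ∀ τ, Measurable (H τ) := by
    intro τ
    simp only [H]
    split_ifs
    · exact (hF.comp ((measurable_replaceTables ℓ (B τ)).comp ((measurable_cutLengths g σ _).comp
        (measurable_arcs σ)))).indicator (measurableSet_coversOnce σ)
    · exact measurable_const
  have hE : MeasurableSet {x : ℕ → ℕ × UnitAddCircle | (arrange x).seq n = extendPerm σ} :=
    measurable_arrange (VirtualPerm.measurableSet_cylinder n (extendPerm σ))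
  rw [← lintegral_indicator hE]
  have e1 : ∫⁻ x, {x | (arrange x).seq n = extendPerm σ}.indicator
      (fun x => F (tableLengths (act g⁻¹ 1 (arrange x)))) x ∂(guests ℓ)
        = ∫⁻ x, H (fun i => (x i).1) (fun i => (x i).2) ∂(guests ℓ) := by
    refine lintegral_congr_ae ((ae_isTypical hℓ).mono fun x hx => ?_)
    have hiff := hx.seq_eq_iff σ
    simp only [H]
    by_cases hσ : (arrange x).seq n = extendPerm σ
    · obtain ⟨h1, h2⟩ := hiff.1 hσ
      rw [Set.indicator_of_mem (by exact hσ), if_pos h1, Set.indicator_of_mem h2]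
      rw [hx.tableLengths_act hℓ g σ hσ (fun i => ⟨(x i).1, hx.pos i⟩) fun _ => rfl]
      congr 2
      ext t
      simp [B, Subtype.ext_iff]
    · rw [Set.indicator_of_notMem (by exact hσ)]
      split_ifs with h1
      · rw [Set.indicator_of_notMem fun h2 => hσ (hiff.2 ⟨h1, h2⟩)]
      · rfl
  rw [e1, lintegral_guests hℓ H hHm]
  let j : (Vertex 1 σ ↪ Table ℓ) → Fin n → ℕ := fun ω i => (ω (Vertex.mk 1 σ i)).1
  have hj : Function.Injective j := by
    intro ω ω' h
    ext β
    obtain ⟨i, rfl⟩ := β.exists_mk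
    exact congrFun h i
  have hcomp : ∀ ω, Compatible σ (j ω) := fun ω a b => by
    simp only [j]
    rw [Subtype.val_inj, ω.injective.eq_iff, Vertex.mk_one_eq_iff]
  -- The table assignments with nonzero contribution are those constant on the cycles of `σ`,
  -- distinct on different cycles and with positive lengths, that is, those given by embeddings `ω`.
  rw [← hj.tsum_eq]
  · refine tsum_congr fun ω => ?_
    have hB : B (j ω) = Set.range ω := by
      ext t
      constructor
      · rintro ⟨i, hi⟩
        exact ⟨_, Subtype.ext hi⟩
      · rintro ⟨β, rfl⟩
        obtain ⟨i, rfl⟩ := β.exists_mk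
        exact ⟨i, rfl⟩
    have hprod : ∏ i, ENNReal.ofReal (ℓ (j ω i)) = ENNReal.ofReal (∏ β, ℓ (ω β) ^ β.order) := by
      rw [← ENNReal.ofReal_prod_of_nonneg fun i _ => (ω (Vertex.mk 1 σ i)).2.le,
        ← Fintype.prod_fiberwise (Vertex.mk 1 σ)]
      congr 1
      refine Finset.prod_congr rfl fun β _ => ?_
      have hβ : ∀ i : {i // Vertex.mk 1 σ i = β}, ℓ (j ω i) = ℓ (ω β) := fun i => by
        simp only [j, i.2]
      exact prod_eq_pow_natCard hβ
    have hmain := lintegral_cutLengths g σ (L := fun β => ℓ (ω β)) (fun β => (ω β).2)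
      (F := fun y => F (replaceTables ℓ (Set.range ω) y))
      (hF.comp (measurable_replaceTables ℓ (Set.range ω)))
    simp only [H, if_pos (hcomp ω), hB]
    rw [lintegral_indicator (measurableSet_coversOnce σ), hprod]
    refine (congrArg _ hmain).trans ?_
    rw [← mul_assoc, ← ENNReal.ofReal_mul (Finset.prod_nonneg fun β _ => pow_nonneg (ω β).2.le _),
      ← Finset.prod_mul_distrib]
    simp only [mul_one_div]
  · intro τ hτ
    rw [Function.mem_support] at hτ
    have h1 : ∀ i, 0 < ℓ (τ i) := fun i => by
      by_contra hc
      refine hτ (mul_eq_zero_of_left (Finset.prod_eq_zero (Finset.mem_univ i) ?_) _)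
      exact ENNReal.ofReal_eq_zero.2 (not_lt.1 hc)
    have h2 : Compatible σ τ := by
      by_contra hc
      refine hτ (mul_eq_zero_of_right _ ?_)
      simp only [H, if_neg hc, lintegral_zero]
    refine ⟨⟨fun β => Quotient.lift (fun i => (⟨τ i, h1 i⟩ : Table ℓ)) (fun a b hab => ?_) β, ?_⟩, rfl⟩
    · have hab' : Vertex.mk 1 σ a = Vertex.mk 1 σ b := Quotient.sound hab
      exact Subtype.ext ((h2 a b).1 (Vertex.mk_one_eq_iff.1 hab'))
    · intro β β' h
      obtain ⟨a, rfl⟩ := β.exists_mk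
      obtain ⟨b, rfl⟩ := β'.exists_mk
      exact Vertex.mk_one_eq_iff.2 ((h2 a b).2 (congrArg Subtype.val h))


/-! ### The law of the arranged guests -/

open Classical in
-- In the recursion a repeated index meets an entry already set to zero, so only injective tuples
-- survive.
theorem distinctSum_ofFn {α : Type*} {r : ℕ} (m : Fin r → ℕ) (hm : ∀ i, m i ≠ 0) (a : α → ENNReal) :
    distinctSum (List.ofFn m) a =
      ∑' f : Fin r → α, if Function.Injective f then ∏ i, a (f i) ^ m i else 0 := by
  induction r generalizing a with
  | zero =>
    rw [tsum_eq_single default fun f hf => (hf (Subsingleton.elim _ _)).elim,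
      if_pos (Function.injective_of_subsingleton _)]
    simp [distinctSum]
  | succ r ih =>
    rw [List.ofFn_succ, distinctSum_cons,
      ← (Fin.consEquiv fun _ : Fin (r + 1) => α).tsum_eq, ENNReal.tsum_prod']
    refine tsum_congr fun p => ?_
    rw [ih _ fun i => hm _, ← ENNReal.tsum_mul_left]
    refine tsum_congr fun f => ?_
    simp only [Fin.consEquiv, Equiv.coe_fn_mk, Fin.cons_injective_iff, Fin.prod_univ_succ,
      Fin.cons_zero, Fin.cons_succ]
    by_cases hf : Function.Injective f
    · by_cases hp : p ∈ Set.range f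
      · obtain ⟨i, rfl⟩ := hp
        rw [if_pos hf, if_neg fun h => h.1 ⟨i, rfl⟩,
          Finset.prod_eq_zero (Finset.mem_univ i) (by simp [hm]), mul_zero]
      · rw [if_pos hf, if_pos ⟨hp, hf⟩]
        congr 1
        refine Finset.prod_congr rfl fun i _ => ?_
        rw [Function.update_of_ne fun h => hp ⟨i, h⟩]
    · rw [if_neg hf, if_neg fun h => hf h.2, mul_zero]

theorem tsum_embedding_table {ι : Type*} [Fintype ι] {m : ι → ℕ} (hm : ∀ i, m i ≠ 0)
    (ℓ : Restaurant) :
    ∑' ω : ι ↪ Table ℓ, ∏ i, ENNReal.ofReal (ℓ (ω i)) ^ m i =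
      distinctSum (List.ofFn fun i => m ((Fintype.equivFin ι).symm i))
        fun ν => ENNReal.ofReal (ℓ ν) := by
  classical
  set e := Fintype.equivFin ι
  rw [distinctSum_ofFn _ fun i => hm _]
  let j : (ι ↪ Table ℓ) → Fin (Fintype.card ι) → ℕ := fun ω i => (ω (e.symm i)).1
  have hinj : ∀ ω, Function.Injective (j ω) := fun ω =>
    Subtype.val_injective.comp (ω.injective.comp e.symm.injective)
  have hj : Function.Injective j := fun ω ω' h => by
    ext i
    simpa [j] using congrFun h (e i)
  rw [← hj.tsum_eq]
  · refine tsum_congr fun ω => ?_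
    rw [if_pos (hinj ω)]
    exact (e.symm.prod_comp fun i => ENNReal.ofReal (ℓ (ω i)) ^ m i).symm
  · intro f hf
    rw [Function.mem_support] at hf
    have h1 : Function.Injective f := by
      by_contra hc
      exact hf (if_neg hc)
    rw [if_pos h1] at hf
    have h2 : ∀ i, 0 < ℓ (f i) := fun i => by
      by_contra hc
      refine hf (Finset.prod_eq_zero (Finset.mem_univ i) ?_)
      rw [ENNReal.ofReal_eq_zero.2 (not_lt.1 hc), zero_pow (hm _)]
    refine ⟨⟨fun i => ⟨f (e i), h2 _⟩, fun i i' h => e.injective (h1 (congrArg Subtype.val h))⟩, ?_⟩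
    ext i
    exact congrArg f (e.apply_symm_apply i)

theorem Vertex.order_ne_zero {n : ℕ} {p q : Equiv.Perm (Fin n)} (v : Vertex p q) : v.order ≠ 0 := by
  obtain ⟨i, rfl⟩ := v.exists_mk
  have : Nonempty {w : Fin n // Vertex.mk p q w = Vertex.mk p q i} := ⟨⟨i, rfl⟩⟩
  exact Nat.card_pos.ne'

theorem Vertex.sum_order {n : ℕ} (p q : Equiv.Perm (Fin n)) : ∑ v : Vertex p q, v.order = n := by
  classical
  have h := Fintype.card_congr (Equiv.sigmaFiberEquiv (Vertex.mk p q))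
  rw [Fintype.card_sigma, Fintype.card_fin] at h
  exact (Finset.sum_congr rfl fun v _ => Nat.card_eq_fintype_card).trans h

/-- The case `g = 1` and `F = 1` of `lintegral_guests_seq_eq`: all measures of new lengths have mass
one. -/
theorem guests_seq_eq {ℓ : Restaurant} (hℓ : IsNormalized ℓ) {n : ℕ} (σ : Equiv.Perm (Fin n)) :
    guests ℓ {x | (arrange x).seq n = extendPerm σ} =
      ENNReal.ofReal (∏ β : Vertex 1 σ, 1 / ((β.order - 1).factorial : ℝ)) *
        distinctSum (List.ofFn fun i => ((Fintype.equivFin (Vertex 1 σ)).symm i).order)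
          fun ν => ENNReal.ofReal (ℓ ν) := by
  have h := lintegral_guests_seq_eq hℓ 1 σ (F := fun _ => 1) measurable_const
  rw [setLIntegral_one] at h
  rw [h, ← tsum_embedding_table fun β => β.order_ne_zero, ← ENNReal.tsum_mul_left]
  refine tsum_congr fun ω => ?_
  have := isProbabilityMeasure_cutLaw 1 σ (L := fun β => ℓ (ω β)) fun β => (ω β).2
  rw [lintegral_one, measure_univ, mul_one]
  have hp : ∀ β : Vertex 1 σ, 0 ≤ ℓ (ω β) := fun β => (ω β).2.le
  simp only [← ENNReal.ofReal_pow (hp _)]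
  rw [← ENNReal.ofReal_prod_of_nonneg fun β _ => pow_nonneg (hp β) _, ← ENNReal.ofReal_mul
    (Finset.prod_nonneg fun β _ => by positivity), ← Finset.prod_mul_distrib]
  congr 1
  exact Finset.prod_congr rfl fun β _ => by rw [one_div, mul_comm, div_eq_mul_inv]

theorem measurable_arrange_snd :
    Measurable fun p : Restaurant × (ℕ → ℕ × UnitAddCircle) => arrange p.2 :=
  measurable_arrange.comp measurable_snd

/-- Random guests of a Poisson–Dirichlet restaurant form a random virtual permutation. -/
theorem map_arrange (z : PosReal) :
    (poissonDirichlet z ⊗ₘ guests).map (fun p => arrange p.2) = virtualMeasure z := by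
  have hm := measurable_arrange_snd
  have hz := z.2
  have : IsProbabilityMeasure ((poissonDirichlet z ⊗ₘ guests).map fun p => arrange p.2) :=
    Measure.isProbabilityMeasure_map hm.aemeasurable
  refine VirtualPerm.measure_ext 0 fun n _ π hπ => ?_
  obtain ⟨σ, rfl⟩ := exists_extendPerm hπ
  have hc := VirtualPerm.measurableSet_cylinder n (extendPerm σ)
  rw [Measure.map_apply hm hc, Measure.compProd_apply (hm hc)]
  have e : ∫⁻ ℓ, guests ℓ (Prod.mk ℓ ⁻¹' ((fun p => arrange p.2) ⁻¹'
      VirtualPerm.cylinder n (extendPerm σ))) ∂poissonDirichlet z = ∫⁻ ℓ,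
      ENNReal.ofReal (∏ β : Vertex 1 σ, 1 / ((β.order - 1).factorial : ℝ)) *
        distinctSum (List.ofFn fun i => ((Fintype.equivFin (Vertex 1 σ)).symm i).order)
          (fun ν => ENNReal.ofReal (ℓ ν)) ∂poissonDirichlet z :=
    lintegral_congr_ae ((ae_isNormalized z).mono fun ℓ hℓ => guests_seq_eq hℓ σ)
  refine e.trans ?_
  -- The factorials from the correlation functions cancel those from the arcs, and one factor `z`
  -- per cycle remains: the Ewens weight.
  rw [lintegral_const_mul' _ _ ENNReal.ofReal_ne_top, lintegral_distinctSum_poissonDirichlet]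
  · rw [VirtualPerm.cylinder, virtualMeasure_cylinder z n _ hπ, cycleCount_extendPerm,
      ← ENNReal.ofReal_mul (Finset.prod_nonneg fun β _ => by positivity)]
    have hsum : (List.ofFn fun i => ((Fintype.equivFin (Vertex 1 σ)).symm i).order).sum = n := by
      rw [List.sum_ofFn, (Fintype.equivFin (Vertex 1 σ)).symm.sum_comp fun β => β.order,
        Vertex.sum_order]
    have hprod : ((List.ofFn fun i => ((Fintype.equivFin (Vertex 1 σ)).symm i).order).map
        fun m => (z : ℝ) * (m - 1).factorial).prod
          = ∏ β : Vertex 1 σ, (z : ℝ) * (β.order - 1).factorial := by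
      rw [List.map_ofFn, List.prod_ofFn]
      exact (Fintype.equivFin (Vertex 1 σ)).symm.prod_comp
        fun β => (z : ℝ) * (β.order - 1).factorial
    rw [hsum, hprod, mul_div_assoc', ← Finset.prod_mul_distrib]
    congr 2
    rw [Nat.card_eq_fintype_card, ← Finset.card_univ, ← Finset.prod_const]
    refine Finset.prod_congr rfl fun β _ => ?_
    field_simp
  · simp only [List.mem_ofFn]
    rintro _ ⟨i, rfl⟩
    exact Vertex.order_ne_zero _

theorem ae_tableLengths_arrange (z : PosReal) :
    ∀ᵐ p ∂(poissonDirichlet z ⊗ₘ guests), tableLengths (arrange p.2) = p.1 := by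
  refine Measure.ae_compProd_of_ae_ae (measurableSet_eq_fun
    (measurable_tableLengths.comp (measurable_arrange.comp measurable_snd)) measurable_fst) ?_
  filter_upwards [ae_isNormalized z] with ℓ hℓ
  filter_upwards [ae_isTypical hℓ] with x hx
  exact hx.tableLengths_arrange hℓ

theorem map_tableLengths (z : PosReal) :
    (virtualMeasure z).map tableLengths = poissonDirichlet z := by
  rw [← map_arrange, Measure.map_map measurable_tableLengths measurable_arrange_snd]
  exact (Measure.map_congr (ae_tableLengths_arrange z)).trans (Measure.fst_compProd _ _)

/-! ### The spreaded images as a kernel -/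

theorem measurable_zpow_cycleIncrement (z : PosReal) {n : ℕ} (h₁ h₂ : Equiv.Perm (Fin n)) :
    Measurable fun u => z ^ cycleIncrement h₁ h₂ u :=
  (measurable_of_countable fun m : ℤ => z ^ m).comp (measurable_cycleIncrement h₁ h₂)

/-- The result of the transformation `u ↦ g u` on arranged guests. -/
def regroup (z : PosReal) {n : ℕ} (g : Equiv.Perm (Fin n)) (x : ℕ → ℕ × UnitAddCircle) :
    Restaurant × PosReal :=
  (tableLengths (act g⁻¹ 1 (arrange x)), z ^ cycleIncrement g⁻¹ 1 (arrange x))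

theorem measurable_regroup (z : PosReal) {n : ℕ} (g : Equiv.Perm (Fin n)) :
    Measurable (regroup z g) :=
  (measurable_tableLengths.comp ((measurable_act _ _).comp measurable_arrange)).prodMk
    ((measurable_zpow_cycleIncrement z _ _).comp measurable_arrange)

/-- In the description by random guests the first coordinate is almost surely the restaurant `ℓ`
itself, so the image measure is already disintegrated over `ℓ`. -/
theorem chipPolymorphism_eq_compProd (z : PosReal) {n : ℕ} (g : Equiv.Perm (Fin n)) :
    chipPolymorphism z g⁻¹ 1 = poissonDirichlet z ⊗ₘ guests.map (regroup z g) := by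
  have hu : Measurable fun u : VirtualPerm =>
      (tableLengths u, tableLengths (act g⁻¹ 1 u), z ^ cycleIncrement g⁻¹ 1 u) :=
    measurable_tableLengths.prodMk ((measurable_tableLengths.comp (measurable_act _ _)).prodMk
      (measurable_zpow_cycleIncrement z _ _))
  rw [chipPolymorphism_eq_map, ← map_arrange, Measure.map_map hu
    measurable_arrange_snd, Measure.compProd_map (measurable_regroup z g)]
  refine Measure.map_congr ((ae_tableLengths_arrange z).mono fun p hp => ?_)
  simp only [Function.comp_apply, hp]
  rfl


/-! ### Relabeling -/

theorem map_pi_reindex {ι κ X : Type*} [Fintype ι] [Fintype κ] [MeasurableSpace X] (e : ι ≃ κ)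
    (μ : κ → Measure X) [∀ k, SigmaFinite (μ k)] :
    (Measure.pi μ).map (fun x i => x (e i)) = Measure.pi fun i => μ (e i) := by
  have hm : Measurable fun (x : κ → X) i => x (e i) := by fun_prop
  rw [← Measure.pi_map_piCongrLeft e μ, Measure.map_map hm (MeasurableEquiv.measurable _)]
  have : (fun (x : κ → X) i => x (e i)) ∘ MeasurableEquiv.piCongrLeft (fun _ => X) e = id := by
    ext x i
    exact MeasurableEquiv.piCongrLeft_apply_apply (β := fun _ => X) e x i
  rw [this, Measure.map_id]

/-- The definition depends on a chosen index, which a bijection need not respect; the description by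
normalized Gamma variables is free of choices. -/
theorem map_dirichlet_reindex {ι κ : Type*} [Fintype ι] [Fintype κ] (e : ι ≃ κ) {m : κ → ℝ}
    (hm : ∀ k, 0 ≤ m k) (h : ∃ k, 0 < m k) {s : ℝ} (hs : 0 < s) :
    (dirichlet m s).map (fun x i => x (e i)) = dirichlet (fun i => m (e i)) s := by
  have h' : ∃ i, 0 < m (e i) := by
    obtain ⟨k, hk⟩ := h
    exact ⟨e.symm k, by simpa using hk⟩
  have h1 : Measurable fun (x : κ → ℝ) i => x (e i) := by fun_prop
  rw [dirichlet_eq_map_smul hm hs, dirichlet_eq_map_smul (fun i => hm (e i)) hs,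
    dirichlet_one_eq_map hm h, dirichlet_one_eq_map (fun i => hm (e i)) h',
    ← map_pi_reindex e fun k => gammaLaw (m k)]
  rw [Measure.map_map (by fun_prop) (by fun_prop), Measure.map_map (by fun_prop) (by fun_prop),
    Measure.map_map (by fun_prop) (by fun_prop), Measure.map_map (by fun_prop) (by fun_prop)]
  congr 1
  ext x i
  simp [e.sum_comp]

theorem map_convolution_reindex {ι ι' κ κ' : Type*} [Fintype ι] [Fintype ι'] [Fintype κ]
    [Fintype κ'] (e : κ' ≃ κ) (f : ι' ≃ ι) (Λ : κ → Measure (ι → ℝ))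
    [∀ k, IsProbabilityMeasure (Λ k)] :
    (convolution Λ).map (fun y i => y (f i)) =
      convolution fun k => (Λ (e k)).map fun y i => y (f i) := by
  have hf : Measurable fun (y : ι → ℝ) i => y (f i) := by fun_prop
  have : ∀ k, IsProbabilityMeasure ((Λ (e k)).map fun y i => y (f i)) := fun k =>
    Measure.isProbabilityMeasure_map hf.aemeasurable
  have h1 := Measure.pi_map_pi (μ := fun k => Λ (e k)) (f := fun _ (y : ι → ℝ) i => y (f i))
    fun _ => hf.aemeasurable
  rw [convolution, convolution, ← h1, ← map_pi_reindex e Λ, Measure.map_map (by fun_prop)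
    (by fun_prop), Measure.map_map (by fun_prop) (by fun_prop), Measure.map_map (by fun_prop)
    (by fun_prop)]
  congr 1
  ext y i
  simp only [Function.comp_apply, Finset.sum_apply]
  exact (e.sum_comp fun k => y k (f i)).symm

theorem replaceTables_reindex {ι κ : Type*} (e : ι ≃ κ) (ℓ : Restaurant) (B : Set (Table ℓ))
    (y : κ → ℝ) : replaceTables ℓ B (fun i => y (e i)) = replaceTables ℓ B y := by
  classical
  unfold replaceTables
  rw [← rank_comp_equiv (Equiv.sumCongr (Equiv.refl {ν : Table ℓ // ν ∉ B}) e)]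
  congr 1
  ext (i | i) <;> rfl

variable {n : ℕ} {p q p' q' s t : Equiv.Perm (Fin n)}

theorem sameCycle_relabel (hp : t * p = p' * s) (hq : t * q = q' * s) (i j : Fin n) :
    (p⁻¹ * q).SameCycle i j ↔ (p'⁻¹ * q').SameCycle (s i) (s j) := by
  have : p'⁻¹ * q' = s * (p⁻¹ * q) * s⁻¹ := by
    rw [eq_mul_inv_iff_mul_eq, mul_assoc, ← hq, ← mul_assoc, ← mul_assoc]
    congr 1
    rw [inv_mul_eq_iff_eq_mul, ← mul_assoc, ← hp, mul_assoc, mul_inv_cancel, mul_one]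
  rw [this, Equiv.Perm.sameCycle_conj]
  simp

/-- The bijection of vertices induced by a relabeling of triangles. -/
def Vertex.congr (hp : t * p = p' * s) (hq : t * q = q' * s) : Vertex p q ≃ Vertex p' q' :=
  Quotient.congr s (sameCycle_relabel hp hq)

theorem Vertex.congr_mk (hp : t * p = p' * s) (hq : t * q = q' * s) (w : Fin n) :
    Vertex.congr hp hq (Vertex.mk p q w) = Vertex.mk p' q' (s w) := rfl

theorem Vertex.order_congr (hp : t * p = p' * s) (hq : t * q = q' * s) (v : Vertex p q) :
    (Vertex.congr hp hq v).order = v.order := by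
  refine (Nat.card_congr (s.subtypeEquiv fun w => ?_)).symm
  rw [← Vertex.congr_mk hp hq, (Vertex.congr hp hq).apply_eq_iff_eq]

/-- The orders of the vertices are the lengths of cycles. -/
theorem Vertex.map_order_eq_cycleType (h : ∀ w, (p⁻¹ * q) w ≠ w) :
    (Finset.univ.val.map fun v : Vertex p q => v.order) = (p⁻¹ * q).cycleType := by
  set π := p⁻¹ * q
  have hmem : ∀ w, π.cycleOf w ∈ π.cycleFactorsFinset := fun w =>
    Equiv.Perm.cycleOf_mem_cycleFactorsFinset_iff.2 (Equiv.Perm.mem_support.2 (h w))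
  let f : Vertex p q → π.cycleFactorsFinset := fun v =>
    Quotient.lift (fun w => (⟨π.cycleOf w, hmem w⟩ : π.cycleFactorsFinset))
      (fun i j hij => Subtype.ext (Equiv.Perm.SameCycle.cycleOf_eq hij)) v
  have hf : Function.Bijective f := by
    constructor
    · intro v v' hv
      obtain ⟨i, rfl⟩ := v.exists_mk
      obtain ⟨j, rfl⟩ := v'.exists_mk
      have : π.cycleOf i = π.cycleOf j := congrArg Subtype.val hv
      exact Vertex.mk_eq_iff.2 ((Equiv.Perm.sameCycle_iff_cycleOf_eq_of_mem_support
        (Equiv.Perm.mem_support.2 (h i)) (Equiv.Perm.mem_support.2 (h j))).2 this)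
    · rintro ⟨c, hc⟩
      obtain ⟨w, hw⟩ := (Equiv.Perm.mem_cycleFactorsFinset_iff.1 hc).1.nonempty_support
      exact ⟨Vertex.mk p q w, Subtype.ext (Equiv.Perm.cycle_is_cycleOf hw hc).symm⟩
  have horder : ∀ v, v.order = (f v).1.support.card := by
    intro v
    obtain ⟨i, rfl⟩ := v.exists_mk
    rw [Vertex.order, ← Fintype.card_coe, ← Nat.card_eq_fintype_card]
    refine Nat.card_congr (Equiv.subtypeEquivRight fun w => ?_)
    rw [Vertex.mk_eq_iff, Equiv.Perm.sameCycle_comm]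
    exact (Equiv.Perm.mem_support_cycleOf_iff' (h i)).symm
  rw [Equiv.Perm.cycleType_def]
  simp only [horder]
  have h1 := Multiset.map_univ_val_equiv (Equiv.ofBijective f hf)
  have h2 := congrArg (Multiset.map fun c : π.cycleFactorsFinset => c.1.support.card) h1
  rw [Multiset.map_map] at h2
  refine h2.trans ?_
  rw [Finset.univ_eq_attach, Finset.attach_val]
  exact Multiset.attach_map_val' _ fun c : Equiv.Perm (Fin n) => c.support.card


/-! ### Framed surfaces of seated guests -/

namespace FramedSurface

variable {k : Multiset ℕ} {ℓ : Restaurant}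

/-- The summand of a framed surface without the symmetry factor. -/
def cutting (z : PosReal) (F : FramedSurface k ℓ) : Measure (Restaurant × PosReal) :=
  ENNReal.ofReal (∏ β : F.S.VertexB, (ℓ (F.ω β) ^ β.order / ((β.order - 1).factorial : ℝ))) •
    ((convolution fun β : F.S.VertexB =>
        dirichlet (fun γ : F.S.VertexC => (F.S.edges β γ : ℝ)) (ℓ (F.ω β))).map
      (replaceTables ℓ (Set.range F.ω))).prod
    (Measure.dirac (z ^ ((Nat.card F.S.VertexC : ℤ) - (Nat.card F.S.VertexB : ℤ))))

theorem summand_eq (z : PosReal) (F : FramedSurface k ℓ) :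
    summand z F = ENNReal.ofReal (1 / (Nat.card F.S.AutB : ℝ)) • F.cutting z := by
  rw [summand, cutting, smul_smul, ENNReal.ofReal_mul (by positivity)]

/-- The relabelings of triangles transforming one framed surface to another. -/
def Iso (F G : FramedSurface k ℓ) : Type :=
  {p : Equiv.Perm (Fin k.sum) × Equiv.Perm (Fin k.sum) //
    p.2 * F.S.a = G.S.a * p.1 ∧ p.2 * F.S.b = G.S.b * p.1 ∧ p.2 * F.S.c = G.S.c * p.1 ∧
      ∀ w, G.ω (Vertex.mk G.S.a G.S.c (p.1 w)) = F.ω (Vertex.mk F.S.a F.S.c w)}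

theorem equiv_iff {F G : FramedSurface k ℓ} : F ≈ G ↔ Nonempty (Iso F G) := by
  constructor
  · rintro ⟨s, t, h⟩
    exact ⟨⟨(s, t), h⟩⟩
  · rintro ⟨⟨p, h⟩⟩
    exact ⟨p.1, p.2, h⟩

theorem exists_edges_pos (F : FramedSurface k ℓ) (β : F.S.VertexB) :
    ∃ γ, 0 < (F.S.edges β γ : ℝ) := by
  obtain ⟨i, rfl⟩ := β.exists_mk
  refine ⟨Vertex.mk F.S.a F.S.b i, ?_⟩
  have : Nonempty {w : Fin k.sum // Vertex.mk F.S.a F.S.c w = Vertex.mk F.S.a F.S.c i ∧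
    Vertex.mk F.S.a F.S.b w = Vertex.mk F.S.a F.S.b i} := ⟨⟨i, rfl, rfl⟩⟩
  exact_mod_cast Nat.card_pos

/-- A relabeling induces bijections of vertices preserving orders, numbers of edges and framings;
the decreasing rearrangement forgets the names of the `C`-vertices. -/
theorem cutting_eq (z : PosReal) {F G : FramedSurface k ℓ} (h : F ≈ G) :
    F.cutting z = G.cutting z := by
  obtain ⟨s, t, ha, hb, hc, hω⟩ := h
  let eB : F.S.VertexB ≃ G.S.VertexB := Vertex.congr ha hc
  let eC : F.S.VertexC ≃ G.S.VertexC := Vertex.congr ha hb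
  have hωB : ∀ β, F.ω β = G.ω (eB β) := fun β => by
    obtain ⟨w, rfl⟩ := β.exists_mk
    exact (hω w).symm
  have horder : ∀ β, (eB β).order = β.order := fun β => Vertex.order_congr ha hc β
  have hedges : ∀ β γ, F.S.edges β γ = G.S.edges (eB β) (eC γ) := fun β γ =>
    Nat.card_congr (s.subtypeEquiv fun w => by
      rw [← Vertex.congr_mk ha hc, ← Vertex.congr_mk ha hb]
      simp only [eB, eC, (Vertex.congr ha hc).apply_eq_iff_eq,
        (Vertex.congr ha hb).apply_eq_iff_eq])
  have hprod : ∏ β : F.S.VertexB, (ℓ (F.ω β) ^ β.order / ((β.order - 1).factorial : ℝ)) =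
      ∏ β : G.S.VertexB, (ℓ (G.ω β) ^ β.order / ((β.order - 1).factorial : ℝ)) := by
    rw [← eB.prod_comp]
    exact Finset.prod_congr rfl fun β _ => by rw [horder, hωB]
  have hrange : Set.range F.ω = Set.range G.ω := by
    rw [← eB.surjective.range_comp]
    exact congrArg Set.range (funext hωB)
  have hpos : ∀ β, 0 < ℓ (G.ω β) := fun β => (G.ω β).2
  have hprob : ∀ β, IsProbabilityMeasure
      (dirichlet (fun γ : G.S.VertexC => (G.S.edges β γ : ℝ)) (ℓ (G.ω β))) := fun β =>
    isProbabilityMeasure_dirichlet (fun _ => Nat.cast_nonneg _) (G.exists_edges_pos β) (hpos β)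
  have hconv : (convolution fun β : F.S.VertexB =>
      dirichlet (fun γ : F.S.VertexC => (F.S.edges β γ : ℝ)) (ℓ (F.ω β))) =
        (convolution fun β : G.S.VertexB =>
          dirichlet (fun γ : G.S.VertexC => (G.S.edges β γ : ℝ)) (ℓ (G.ω β))).map
            fun y γ => y (eC γ) := by
    rw [map_convolution_reindex eB eC]
    congr 1
    ext1 β
    rw [map_dirichlet_reindex eC (fun _ => Nat.cast_nonneg _) (G.exists_edges_pos _) (hpos _),
      hωB]
    simp only [hedges]
  rw [cutting, cutting, hprod, hconv, hrange, Measure.map_map (measurable_replaceTables _ _)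
    (by fun_prop), Nat.card_congr eB, Nat.card_congr eC]
  have hrep : replaceTables ℓ (Set.range G.ω) ∘ (fun (y : G.S.VertexC → ℝ) γ => y (eC γ)) =
      replaceTables ℓ (Set.range G.ω) := funext fun y => replaceTables_reindex eC ℓ _ y
  rw [hrep]

/-- The isomorphisms of isomorphic framed surfaces form a torsor over the automorphisms. -/
def isoEquivAutB {F G : FramedSurface k ℓ} (f : Iso F G) : Iso F G ≃ G.S.AutB where
  toFun p := ⟨(p.1.1 * f.1.1⁻¹, p.1.2 * f.1.2⁻¹), by
    obtain ⟨⟨s, t⟩, ha, hb, hc, hω⟩ := f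
    obtain ⟨⟨s', t'⟩, ha', hb', hc', hω'⟩ := p
    have key : ∀ {x y : Equiv.Perm (Fin k.sum)}, t * x = y * s → t' * x = y * s' →
        t' * t⁻¹ * y = y * (s' * s⁻¹) := fun h h' => by
      rw [← mul_assoc, ← h', eq_mul_inv_iff_mul_eq, mul_assoc, ← h]
      group
    -- As the framing is injective, preserving it is the same as fixing all `B`-vertices.
    refine ⟨key ha ha', key hb hb', key hc hc', fun w => G.ω.injective ?_⟩
    have h1 := hω' (s⁻¹ w)
    rw [← hω] at h1
    simpa using h1⟩
  invFun q := ⟨(q.1.1 * f.1.1, q.1.2 * f.1.2), by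
    obtain ⟨⟨s, t⟩, ha, hb, hc, hω⟩ := f
    obtain ⟨⟨s', t'⟩, ha', hb', hc', hω'⟩ := q
    have key : ∀ {x y : Equiv.Perm (Fin k.sum)}, t * x = y * s → t' * y = y * s' →
        t' * t * x = y * (s' * s) := fun h h' => by
      rw [mul_assoc, h, ← mul_assoc, h', mul_assoc]
    refine ⟨key ha ha', key hb hb', key hc hc', fun w => ?_⟩
    rw [← hω]
    exact congrArg G.ω (hω' (s w))⟩
  left_inv p := Subtype.ext (Prod.ext (inv_mul_cancel_right _ _) (inv_mul_cancel_right _ _))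
  right_inv q := Subtype.ext (Prod.ext (mul_inv_cancel_right _ _) (mul_inv_cancel_right _ _))

variable {g : Equiv.Perm (Fin k.sum)}

theorem apply_ne_of_cycleType (hg : g.cycleType = k) (w : Fin k.sum) : g w ≠ w := by
  have h : g.support.card = Fintype.card (Fin k.sum) := by
    rw [← Equiv.Perm.sum_cycleType, hg, Fintype.card_fin]
  have := Finset.mem_univ w
  rw [← (Finset.card_eq_iff_eq_univ _).1 h] at this
  exact Equiv.Perm.mem_support.1 this

/-- The framed surface of a permutation `σ` whose cycles are seated at the tables `ω`. -/
def ofSeating (hg : g.cycleType = k) (x : (σ : Equiv.Perm (Fin k.sum)) × (Vertex 1 σ ↪ Table ℓ)) :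
    FramedSurface k ℓ where
  -- The `B`-vertices are the cycles of `σ` (old tables), the `C`-vertices those of `g σ` (new
  -- tables), and the `A`-vertices those of `σ⁻¹ g⁻¹ σ`, which has the cycle type of `g`.
  S := ⟨1, g * x.1, x.1⟩
  order_eq := by
    have h : ((g * x.1)⁻¹ * x.1).cycleType = k := by
      rw [mul_inv_rev, mul_assoc]
      refine Eq.trans ?_ ((Equiv.Perm.cycleType_inv g).trans hg)
      rw [← Equiv.Perm.cycleType_conj (σ := g⁻¹) (τ := x.1⁻¹), inv_inv, mul_assoc]
    exact (Vertex.map_order_eq_cycleType (apply_ne_of_cycleType h)).trans h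
  ω := x.2

/-- The permutation on the left is conjugate to the inverse of `b⁻¹ c`, whose cycles are the
`A`-vertices. All orders are at least `2`, so there are no fixed points and the list of orders is
the cycle type. -/
theorem isConj_of_framedSurface (hg : g.cycleType = k) (G : FramedSurface k ℓ) :
    IsConj (G.S.a⁻¹ * (G.S.b * G.S.c⁻¹) * G.S.a) g := by
  have hge : ∀ v : G.S.VertexA, 2 ≤ v.order := fun v => by
    have : v.order ∈ g.cycleType :=
      (hg.trans G.order_eq.symm).symm ▸ Multiset.mem_map_of_mem _ (Finset.mem_univ_val v)
    exact Equiv.Perm.two_le_of_mem_cycleType this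
  have hfix : ∀ w, (G.S.b⁻¹ * G.S.c) w ≠ w := fun w hw => by
    have h1 := hge (Vertex.mk G.S.b G.S.c w)
    have : Subsingleton {w' : Fin k.sum // Vertex.mk G.S.b G.S.c w' = Vertex.mk G.S.b G.S.c w} := by
      refine ⟨fun i j => Subtype.ext ?_⟩
      have key : ∀ i : {w' : Fin k.sum // Vertex.mk G.S.b G.S.c w' = Vertex.mk G.S.b G.S.c w},
          i.1 = w := fun i => by
        obtain ⟨m, hm⟩ := (Vertex.mk_eq_iff.1 i.2).symm
        rw [← hm]
        exact Function.IsFixedPt.perm_zpow hw m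
      rw [key i, key j]
    have h2 : (Vertex.mk G.S.b G.S.c w).order ≤ 1 := Finite.card_le_one_iff_subsingleton.2 this
    omega
  rw [Equiv.Perm.isConj_iff_cycleType_eq, hg]
  have h1 : (G.S.b⁻¹ * G.S.c).cycleType = k :=
    (Vertex.map_order_eq_cycleType hfix).symm.trans G.order_eq
  have h2 := Equiv.Perm.cycleType_conj (σ := G.S.b * G.S.c⁻¹) (τ := G.S.a⁻¹)
  rw [inv_inv] at h2
  have h3 := Equiv.Perm.cycleType_conj (σ := (G.S.b⁻¹ * G.S.c)⁻¹) (τ := G.S.b)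
  rw [Equiv.Perm.cycleType_inv, h1] at h3
  refine h2.trans (Eq.trans ?_ h3)
  congr 1
  group

/-- The labelings of a framed surface. -/
def isoOfSeatingEquiv (hg : g.cycleType = k) (G : FramedSurface k ℓ) :
    ((x : (σ : Equiv.Perm (Fin k.sum)) × (Vertex 1 σ ↪ Table ℓ)) × Iso (ofSeating hg x) G) ≃
      {s : Equiv.Perm (Fin k.sum) // G.S.a⁻¹ * (G.S.b * G.S.c⁻¹) * G.S.a * s = s * g} :=
  Equiv.ofBijective (fun p => ⟨p.2.1.1, by
    obtain ⟨x, ⟨s, t⟩, ha, hb, hc, hω⟩ := p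
    simp only [ofSeating] at ha hb hc ⊢
    rw [mul_one] at ha
    subst ha
    have h1 : G.S.c⁻¹ * G.S.a * s = s * x.1⁻¹ := by
      rw [eq_mul_inv_iff_mul_eq, mul_assoc, mul_assoc, ← mul_assoc G.S.a, hc, inv_mul_cancel_left]
    have h2 : G.S.a⁻¹ * G.S.b * s = s * (g * x.1) := by
      rw [mul_assoc, ← hb]
      group
    calc G.S.a⁻¹ * (G.S.b * G.S.c⁻¹) * G.S.a * s
        = G.S.a⁻¹ * G.S.b * (G.S.c⁻¹ * G.S.a * s) := by group
      _ = G.S.a⁻¹ * G.S.b * s * x.1⁻¹ := by rw [h1, ← mul_assoc]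
      _ = s * g := by rw [h2]; group⟩) (by
    constructor
    · rintro ⟨⟨σ, ω⟩, ⟨s, t⟩, ha, hb, hc, hω⟩ ⟨⟨σ', ω'⟩, ⟨s', t'⟩, ha', hb', hc', hω'⟩ h
      have hs : s = s' := congrArg Subtype.val h
      simp only [ofSeating, mul_one] at ha hc hω ha' hc' hω'
      subst hs
      obtain rfl : t = t' := ha.trans ha'.symm
      obtain rfl : σ = σ' := mul_left_cancel (hc.trans hc'.symm)
      obtain rfl : ω = ω' := by
        ext β
        obtain ⟨w, rfl⟩ := β.exists_mk
        exact congrArg Subtype.val ((hω w).symm.trans (hω' w))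
      rfl
    · rintro ⟨s, hs⟩
      -- The relabeling `s` of white triangles determines everything: `t = a s` from the color `a`,
      -- `σ` from the color `c`, and `ω` by transport. The color `b` then gives the equation
      -- satisfied by `s`.
      let σ := s⁻¹ * G.S.a⁻¹ * G.S.c * s
      have ha : G.S.a * s * 1 = G.S.a * s := mul_one _
      have hc : G.S.a * s * σ = G.S.c * s := by
        simp only [σ]
        group
      have hb : G.S.a * s * (g * σ) = G.S.b * s := by
        rw [mul_assoc, ← mul_assoc s, ← hs]
        simp only [σ]
        group
      refine ⟨⟨⟨σ, (Vertex.congr ha hc).toEmbedding.trans G.ω⟩, ⟨(s, G.S.a * s), ha, hb, hc, ?_⟩⟩,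
        rfl⟩
      exact fun w => rfl)

end FramedSurface


/-! ### The sum over framed surfaces -/

open FramedSurface

/-- On the event that the first guests form `σ` the Radon–Nikodym derivative is constant, so only
the law of the new restaurant is needed, tested on a section of `s`. -/
theorem guests_regroup_seq_eq (z : PosReal) {k : Multiset ℕ} {ℓ : Restaurant} (hℓ : IsNormalized ℓ)
    {g : Equiv.Perm (Fin k.sum)} (hg : g.cycleType = k) (σ : Equiv.Perm (Fin k.sum))
    {s : Set (Restaurant × PosReal)} (hs : MeasurableSet s) :
    guests ℓ (regroup z g ⁻¹' s ∩ {x | (arrange x).seq k.sum = extendPerm σ}) =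
      ∑' ω : Vertex 1 σ ↪ Table ℓ, (ofSeating hg ⟨σ, ω⟩).cutting z s := by
  set c : PosReal := z ^ ((Nat.card (Vertex 1 (g * σ)) : ℤ) - Nat.card (Vertex 1 σ))
  have hc : Measurable fun R : Restaurant => (R, c) := by fun_prop
  have hE : MeasurableSet {x | (arrange x).seq k.sum = extendPerm σ} :=
    measurable_arrange (VirtualPerm.measurableSet_cylinder k.sum (extendPerm σ))
  have h := lintegral_guests_seq_eq hℓ g σ (F := ((fun R : Restaurant => (R, c)) ⁻¹' s).indicator 1)
    (measurable_one.indicator (hc hs))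
  have e : ∫⁻ x in {x | (arrange x).seq k.sum = extendPerm σ},
      ((fun R : Restaurant => (R, c)) ⁻¹' s).indicator 1 (tableLengths (act g⁻¹ 1 (arrange x)))
        ∂(guests ℓ) = ∫⁻ x in {x | (arrange x).seq k.sum = extendPerm σ},
          (regroup z g ⁻¹' s).indicator 1 x ∂(guests ℓ) := by
    refine setLIntegral_congr_fun hE fun x hx => ?_
    have : regroup z g x = (tableLengths (act g⁻¹ 1 (arrange x)), c) := by
      rw [regroup, cycleIncrement_inv g σ hx]
    by_cases hx' : (tableLengths (act g⁻¹ 1 (arrange x)), c) ∈ s <;>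
      simp [Set.indicator, this, hx']
  rw [e, lintegral_indicator_one (measurable_regroup z g hs),
    Measure.restrict_apply (measurable_regroup z g hs)] at h
  rw [h]
  refine tsum_congr fun ω => ?_
  have := isProbabilityMeasure_cutLaw g σ (L := fun β => ℓ (ω β)) fun β => (ω β).2
  rw [← lintegral_map (measurable_one.indicator (hc hs)) (measurable_replaceTables ℓ (Set.range ω)),
    lintegral_indicator_one (hc hs)]
  have hcut : (ofSeating hg ⟨σ, ω⟩).cutting z =
      ENNReal.ofReal (∏ β, (ℓ (ω β) ^ β.order / ((β.order - 1).factorial : ℝ))) •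
        ((cutLaw g σ fun β => ℓ (ω β)).map (replaceTables ℓ (Set.range ω))).prod
          (Measure.dirac c) := rfl
  rw [hcut, Measure.smul_apply, smul_eq_mul, Measure.prod_dirac, Measure.map_apply hc hs]

/-- The distribution of the regrouped guests is a sum over framed surfaces. -/
theorem map_regroup_guests (z : PosReal) {k : Multiset ℕ} {ℓ : Restaurant} (hℓ : IsNormalized ℓ)
    {g : Equiv.Perm (Fin k.sum)} (hg : g.cycleType = k) :
    (guests.map (regroup z g)) ℓ =
      Measure.sum fun x : (σ : Equiv.Perm (Fin k.sum)) × (Vertex 1 σ ↪ Table ℓ) =>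
        (ofSeating hg x).cutting z := by
  ext s hs
  rw [Kernel.map_apply' _ (measurable_regroup z g) _ hs, Measure.sum_apply _ hs,
    ENNReal.tsum_sigma',
    ← (tsum_congr fun σ => guests_regroup_seq_eq z hℓ hg σ hs)]
  have hU : (⋃ σ : Equiv.Perm (Fin k.sum), regroup z g ⁻¹' s ∩
      {x | (arrange x).seq k.sum = extendPerm σ}) = regroup z g ⁻¹' s := by
    rw [← Set.inter_iUnion]
    refine Set.inter_eq_left.2 fun x _ => ?_
    obtain ⟨σ, hσ⟩ := exists_extendPerm ((arrange x).fix k.sum)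
    exact Set.mem_iUnion.2 ⟨σ, hσ.symm⟩
  nth_rewrite 1 [← hU]
  refine measure_iUnion ?_ fun σ => (measurable_regroup z g hs).inter
    (measurable_arrange (VirtualPerm.measurableSet_cylinder k.sum (extendPerm σ)))
  intro σ τ hne
  refine Set.disjoint_left.2 fun x h1 h2 => hne (extendPerm_injective _ ?_)
  exact h1.2.symm.trans h2.2

variable {k : Multiset ℕ} {ℓ : Restaurant} {g : Equiv.Perm (Fin k.sum)}

instance (S : LabeledSurface k.sum) : Finite S.AutB := by
  unfold LabeledSurface.AutB
  infer_instance

instance (S : LabeledSurface k.sum) : Nonempty S.AutB :=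
  ⟨⟨(1, 1), by simp, by simp, by simp, fun _ => rfl⟩⟩

/-- The centralizer acts on the labelings of a framed surface. -/
theorem card_labelings (hg : g.cycleType = k) (G : FramedSurface k ℓ) :
    Nat.card {s : Equiv.Perm (Fin k.sum) // G.S.a⁻¹ * (G.S.b * G.S.c⁻¹) * G.S.a * s = s * g} =
      k.prod * ∏ m ∈ k.toFinset, (k.count m).factorial := by
  have hcard := Equiv.Perm.nat_card_centralizer g
  have hcount : k.prod * ∏ m ∈ k.toFinset, (k.count m).factorial =
      g.cycleType.prod * ∏ m ∈ g.cycleType.toFinset, (g.cycleType.count m).factorial := by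
    rw [hg]
  have hsum : Fintype.card (Fin k.sum) - g.cycleType.sum = 0 := by
    rw [hg, Fintype.card_fin, Nat.sub_self]
  rw [hsum, Nat.factorial_zero, one_mul, ← hcount] at hcard
  rw [← hcard]
  obtain ⟨r, hr⟩ := isConj_iff.1 (isConj_of_framedSurface hg G)
  -- Left multiplication by a conjugating element `r` identifies the solutions with the centralizer
  -- of `g`.
  refine Nat.card_congr ((Equiv.mulLeft r).subtypeEquiv fun s => ?_)
  rw [mul_inv_eq_iff_eq_mul] at hr
  rw [Subgroup.mem_centralizer_singleton_iff, Equiv.coe_mulLeft, ← mul_assoc g, ← hr, mul_assoc r s,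
    mul_assoc r _ s, mul_right_inj, eq_comm]

/-- Each isomorphism class of framed surfaces arises from finitely many seatings. -/
theorem card_seatings (hg : g.cycleType = k) (G : FramedSurface k ℓ) :
    Finite {x : (σ : Equiv.Perm (Fin k.sum)) × (Vertex 1 σ ↪ Table ℓ) // ofSeating hg x ≈ G} ∧
      Nat.card {x : (σ : Equiv.Perm (Fin k.sum)) × (Vertex 1 σ ↪ Table ℓ) // ofSeating hg x ≈ G} *
        Nat.card G.S.AutB = k.prod * ∏ m ∈ k.toFinset, (k.count m).factorial := by
  -- A chosen isomorphism for each seating identifies its isomorphisms to `G` with `AutB`; all such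
  -- isomorphisms together are the labelings counted by `card_labelings`.
  let e1 : {x : (σ : Equiv.Perm (Fin k.sum)) × (Vertex 1 σ ↪ Table ℓ) // ofSeating hg x ≈ G} ×
      G.S.AutB ≃ ((x : (σ : Equiv.Perm (Fin k.sum)) × (Vertex 1 σ ↪ Table ℓ)) ×
        Iso (ofSeating hg x) G) :=
    { toFun := fun p => ⟨p.1.1, (isoEquivAutB (equiv_iff.1 p.1.2).some).symm p.2⟩
      invFun := fun p => (⟨p.1, equiv_iff.2 ⟨p.2⟩⟩, isoEquivAutB (equiv_iff.1
        (equiv_iff.2 ⟨p.2⟩)).some p.2)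
      left_inv := fun p => Prod.ext rfl (Equiv.apply_symm_apply _ _)
      right_inv := fun p => Sigma.ext rfl (heq_of_eq (Equiv.symm_apply_apply _ _)) }
  let e := e1.trans (isoOfSeatingEquiv hg G)
  refine ⟨?_, ?_⟩
  · have := Finite.of_equiv _ e.symm
    exact Finite.prod_left G.S.AutB
  · rw [← Nat.card_prod, Nat.card_congr e, card_labelings hg G]

/-- The seatings are grouped by the isomorphism class of their surface. The term is constant on a
class, and by `card_seatings` the size of the class is the prefactor divided by the order of `AutB`.
-/
theorem spreadedImage_eq_sum (z : PosReal) (hg : g.cycleType = k) :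
    spreadedImage z k ℓ =
      Measure.sum fun x : (σ : Equiv.Perm (Fin k.sum)) × (Vertex 1 σ ↪ Table ℓ) =>
        (ofSeating hg x).cutting z := by
  ext s hs
  let f : (σ : Equiv.Perm (Fin k.sum)) × (Vertex 1 σ ↪ Table ℓ) →
      Quotient (FramedSurface.setoid k ℓ) := fun x => Quotient.mk _ (ofSeating hg x)
  rw [spreadedImage, Measure.smul_apply, Measure.sum_apply _ hs, Measure.sum_apply _ hs,
    ← (Equiv.sigmaFiberEquiv f).tsum_eq, ENNReal.tsum_sigma', smul_eq_mul, ← ENNReal.tsum_mul_left]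
  refine tsum_congr fun q => ?_
  have hequiv : ∀ x, f x = q ↔ ofSeating hg x ≈ q.out := fun x => by
    refine Iff.trans ?_ Quotient.eq
    rw [Quotient.out_eq]
  have hx : ∀ x : {x // f x = q}, (ofSeating hg x.1).cutting z s = q.out.cutting z s := fun x => by
    rw [cutting_eq z ((hequiv x.1).1 x.2)]
  obtain ⟨hfin, hcard⟩ := card_seatings hg q.out
  have hfin' : Finite {x // f x = q} := Finite.of_equiv _ (Equiv.subtypeEquivRight hequiv).symm
  refine Eq.trans ?_ (tsum_congr hx).symm
  rw [← Nat.card_congr (Equiv.subtypeEquivRight hequiv)] at hcard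
  rw [ENNReal.tsum_const, ENat.card_eq_coe_natCard, ← hcard, summand_eq, Measure.smul_apply,
    smul_eq_mul, ← mul_assoc]
  congr 1
  have hpos : (0 : ℝ) < Nat.card q.out.S.AutB := by exact_mod_cast Nat.card_pos
  rw [one_div, ENNReal.ofReal_inv_of_pos hpos, ENNReal.ofReal_natCast, Nat.cast_mul, mul_assoc,
    ENNReal.mul_inv_cancel (by exact_mod_cast hpos.ne') (ENNReal.natCast_ne_top _), mul_one]
  simp

end

end Restaurants

theorem mainTheorem2 (z : Restaurants.PosReal) (k : Multiset ℕ) {n : ℕ}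
    (h₁ h₂ : Equiv.Perm (Fin n)) (hk : Restaurants.chip h₁ h₂ = k) :
    Restaurants.IsPolymorphism (Restaurants.poissonDirichlet z) (Restaurants.poissonDirichlet z)
        (Restaurants.chipPolymorphism z h₁ h₂) ∧
      Restaurants.IsSpreadedImage (Restaurants.poissonDirichlet z)
        (Restaurants.chipPolymorphism z h₁ h₂) (Restaurants.spreadedImage z k) := by
  refine ⟨Restaurants.isPolymorphism_chipPolymorphism z h₁ h₂ (Restaurants.map_tableLengths z), ?_⟩
  obtain ⟨g, hg, hchip⟩ := Restaurants.chipPolymorphism_reduce z h₁ h₂ k hk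
  have hm := Restaurants.measurable_regroup z g
  -- The conditional measures are the laws of regrouped random guests.
  refine ⟨Restaurants.guests.map (Restaurants.regroup z g),
    ProbabilityTheory.Kernel.IsMarkovKernel.map _ hm,
    hchip.trans (Restaurants.chipPolymorphism_eq_compProd z g), ?_⟩
  filter_upwards [Restaurants.ae_isNormalized z] with ℓ hℓ
  rw [Restaurants.spreadedImage_eq_sum z hg, Restaurants.map_regroup_guests z hℓ hg]
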